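/- **Setting.** Let $\mathbb M$ be a mark space with probability law $\lambda^{m}$, $\mathbb S=\mathbb R^2\times\mathbb M$, $\mu=\lambda^2\otimes\lambda^m$ ($\lambda^2$ = Lebesgue measure); write $x^m=(x,m)$. A configuration $\varphi$ is a subset of $\mathbb S$ with finitely many points above each bounded set; the space of configurations carries the $\sigma$-algebra generated by the counts of points in measurable sets above bounded regions, and $\varphi_\Lambda$ is the set of points of $\varphi$ above $\Lambda\subset\mathbb R^2$. Let $v=(v_1,\dots,v_p)$ be statistics of finite configurations, $v(\psi|\varphi)=v(\psi\cup\varphi)-v(\varphi)$ (for infinite $\varphi$, the limit along the restrictions of $\varphi$ to growing discs), and $V(\psi|\varphi;\theta)=\theta^Tv(\psi|\varphi)$, with $V(\psi|\varphi;\theta)=+\infty$ if the model has a hard core which $\psi\cup\varphi$ violates. For bounded Borel $\Lambda$ let $Q_\Lambda$ be the Poisson process on $\Lambda\times\mathbb M$ with intensity $\mu$, $Z_\Lambda(\varphi)=\int e^{-V(\psi|\varphi_{\Lambda^c};\theta)}Q_\Lambda(d\psi)$, $R_\Lambda=\{0<Z_\Lambda<\infty\}$, $\Omega=\bigcap_\Lambda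 R_\Lambda$, $\Omega_f$ the set of finite elements of $\Omega$, and $$\Pi_\Lambda(\varphi,F)=1_{R_\Lambda}(\varphi)\,Z_\Lambda(\varphi)^{-1}\int e^{-V(\psi|\varphi_{\Lambda^c};\theta)}1_F(\psi\cup\varphi_{\Lambda^c})\,Q_\Lambda(d\psi).$$ A stationary Gibbs measure $P_\theta$ is a translation invariant probability measure on configurations with $P_\theta(F|\mathcal F_{\Lambda^c})=\Pi_\Lambda(\cdot,F)$ a.s. for all bounded Borel $\Lambda$ and all events $F$, where $\mathcal F_{\Lambda^c}$ is generated by $\varphi\mapsto\varphi_{\Lambda^c}$. Put $$(\mathbf{LPL}^{(1)}_\Lambda(\varphi;\theta))_j=\int_{\Lambda\times\mathbb M}v_j(x^m|\varphi)e^{-V(x^m|\varphi;\theta)}\mu(dx^m)-\sum_{x^m\in\varphi_\Lambda}v_j(x^m|\varphi\setminus x^m),$$ and let $\Delta_i(d)$, $i\in\mathbb Z^2$, be the closed square of side $d$ centred at $d\,i$, $|i|=\max(|i_1|,|i_2|)$. **Assumptions.** For a set $\Theta\subset\mathbb R^p$ and $D\ge0$: * [Mod]: there is $K\ge0$ with $V(0^m|\varphi;\theta)\ge-K$;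 $V(0^m|\varphi;\theta)=V(0^m|\varphi_{\mathcal B(0,D)};\theta)$; and for each $j$ there are $\kappa_j\ge0$, $k_j\in\mathbb N$ with $v_j(0^m|\varphi)\le\kappa_j|\varphi_{\mathcal B(0,D)}|^{k_j}$; all this for all $\theta\in\Theta$, $m\in\mathbb M$, $\varphi\in\Omega_f$. * [Ident] (for $\theta^*$ and $P_{\theta^*}$): there are $\ell\ge p$ and disjoint events $B_i=A^m_i\times A_i$, $1\le i\le\ell$, with $A_i^m\subset\mathbb M$, $A_i\subset\Omega$ measurable, $(\lambda^m\otimes P_{\theta^*})(B_i)>0$, such that for all $(m_i,\varphi_i)\in B_i$ the $(\ell,p)$ matrix $(v_j(0^{m_i}|\varphi_i))_{i,j}$ is injective. * [SDP] (for $\theta^*$, $P_{\theta^*}$ and $D$): for some $\overline D>0$, with $\overline\Lambda=\bigcup_{|i|\le\lceil D/\overline D\rceil}\Delta_i(\overline D)$, there are $\ell\ge p$ and disjoint events $A_0,\dots,A_\ell$ contained in $\overline\Omega=\{\varphi\in\Omega:\varphi_{\Delta_i(\overline D)}=\emptyset,\ 1\le|i|\le2\lceil D/\overline D\rceil\}$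 with $P_{\theta^*}(A_i)>0$, such that for all $(\varphi_0,\dots,\varphi_\ell)\in A_0\times\dots\times A_\ell$ the $(\ell,p)$ matrix with rows $\mathbf{LPL}^{(1)}_{\overline\Lambda}(\varphi_i;\theta^*)-\mathbf{LPL}^{(1)}_{\overline\Lambda}(\varphi_0;\theta^*)$, $1\le i\le\ell$, is injective. **Theorem.** For each of the following models the statistics are translation invariant, and for every compact $\Theta$ contained in the stated set of parameters there is $D\ge0$ such that [Mod] holds on $\Theta$ with $D$, and for every $\theta^*\in\Theta$ and every stationary Gibbs measure $P_{\theta^*}$, [Ident] and [SDP] (with this $D$) hold. (These are the hypotheses of the theorems on strong consistency and asymptotic normality of the maximum pseudolikelihood estimator, which therefore apply to these models.) 1. *Overlap area* ($R>0$, no marks): $v_1(\varphi)=|\varphi|$, $v_2(\varphi)=\sum_{\{x,y\}\subset\varphi}|\mathcal B(x,R/2)\cap\mathcal B(y,R/2)|$; $\theta\in\mathbb R\times\mathbb R^+$. 2. *Multi-Strauss*: uniform marks in $\{1,\dots,M\}$, $M\ge1$; for $m_1\le m_2$ radii $0\le D_1^{m_1,m_2}<\dots<D^{m_1,m_2}_{p^{m_1,m_2}}$,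 $p^{m_1,m_2}\ge1$. The statistics are the number of points with each mark $m$, and for $m_1\le m_2$, $2\le i\le p^{m_1,m_2}$, the number of pairs $\{x_1^{m_1},x_2^{m_2}\}\subset\varphi$ with $\|x_1-x_2\|\in[D_{i-1}^{m_1,m_2},D_i^{m_1,m_2}]$. Hard core: two points with marks $m_1\le m_2$ must be at a distance at least $D_1^{m_1,m_2}$. Parameters: $\theta_1^{m,m}\in\mathbb R$; $\theta_i^{m_1,m_2}\in\mathbb R$ if $D_1^{m_1,m_2}$, $D_1^{m_1,m_1}$ and $D_1^{m_2,m_2}$ are all positive, and $\theta_i^{m_1,m_2}\ge0$ otherwise. 3. *$k$-nearest-neighbour multi-Strauss* ($k\ge1$): as in 2, but without hard core, and counting only the pairs one of whose points is among the $k$ nearest neighbours in $\varphi$ of the other ($w$ is among the $k$ nearest neighbours of $z$ if the closed disc centred at $z$ of radius $\|w-z\|$ contains at most $k$ points of $\varphi$ besides $z$); all parameters real. 4. *Strauss disc* ($M_{\max}>0$, marks uniform on $[0,M_{\max}]$): $v_1(\varphi)=|\varphi|$, $v_2(\varphi)$ the number of pairs $\{x_1^{m_1},x_2^{m_2}\}\subset\varphi$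 with $\|x_1-x_2\|\le m_1+m_2$; $\theta\in\mathbb R\times\mathbb R^+$. 5. *Geyer's triplet process* ($R>0$, no marks): $v_1(\varphi)=|\varphi|$, $v_2$, $v_3$ the numbers of pairs and of triples of points of $\varphi$ with pairwise distances at most $R$; $\theta\in\mathbb R^2\times(0,\infty)$. 6. *Area interaction* ($R>0$, no marks): $v_1(\varphi)=|\varphi|$, $v_2(\varphi)=|\bigcup_{x\in\varphi}\mathcal B(x,R)|$; $\theta\in\mathbb R^2$. -/

import Mathlib

open MeasureTheory Filter Topology Set
open scoped ENNReal

noncomputable section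

namespace MarkedGibbs

/-- The plane with its Euclidean norm and Lebesgue measure. -/
abbrev Plane := EuclideanSpace ℝ (Fin 2)

/-- A configuration of marked points: a set of marked points with finitely many points above
every bounded region of the plane. -/
@[ext]
structure Config (𝕄 : Type) where
  pts : Set (Plane × 𝕄)
  finite_ball : ∀ r : ℝ, {z ∈ pts | z.1 ∈ Metric.closedBall (0 : Plane) r}.Finite

namespace Config

variable {𝕄 : Type}

/-- The σ-algebra generated by the counts of points in measurable sets above bounded regions. -/
instance [MeasurableSpace 𝕄] : MeasurableSpace (Config 𝕄) :=
  MeasurableSpace.generateFrom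
    {s | ∃ F : Set (Plane × 𝕄), MeasurableSet F ∧ Bornology.IsBounded (Prod.fst '' F) ∧
      ∃ n : ℕ, s = {φ : Config 𝕄 | (φ.pts ∩ F).encard = n}}

/-- The points of `φ` above the closed disc of radius `r` centred at the origin. -/
def inBall (φ : Config 𝕄) (r : ℝ) : Finset (Plane × 𝕄) := (φ.finite_ball r).toFinset

/-- The configuration `φ_Λ` of the points of `φ` above `Λ`. -/
def restrict (φ : Config 𝕄) (Λ : Set Plane) : Config 𝕄 where
  pts := {z ∈ φ.pts | z.1 ∈ Λ}
  finite_ball r := (φ.finite_ball r).subset fun _ hz => ⟨hz.1.1, hz.2⟩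

/-- The configuration `φ` without the marked point `z`. -/
def erase (φ : Config 𝕄) (z : Plane × 𝕄) : Config 𝕄 where
  pts := φ.pts \ {z}
  finite_ball r := (φ.finite_ball r).subset fun _ hz => ⟨hz.1.1, hz.2⟩

/-- The configuration `ψ ∪ φ`, for a finite `ψ`. -/
def addPts (ψ : Finset (Plane × 𝕄)) (φ : Config 𝕄) : Config 𝕄 where
  pts := ↑ψ ∪ φ.pts
  finite_ball r := (ψ.finite_toSet.union (φ.finite_ball r)).subset fun _ hz =>
    hz.1.elim Or.inl fun h => Or.inr ⟨h, hz.2⟩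

/-- The configuration `φ` translated by `x`. -/
def translate (x : Plane) (φ : Config 𝕄) : Config 𝕄 where
  pts := (fun z : Plane × 𝕄 => (z.1 + x, z.2)) '' φ.pts
  finite_ball r := by
    refine ((φ.finite_ball (r + ‖x‖)).image fun z : Plane × 𝕄 => (z.1 + x, z.2)).subset ?_
    rintro _ ⟨⟨z, hz, rfl⟩, h⟩
    refine ⟨z, ⟨hz, ?_⟩, rfl⟩
    simp only [Metric.mem_closedBall, dist_zero_right] at h ⊢
    calc ‖z.1‖ = ‖(z.1 + x) - x‖ := by simp
      _ ≤ ‖z.1 + x‖ + ‖x‖ := norm_sub_le _ _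
      _ ≤ r + ‖x‖ := by gcongr

end Config

/-- The data of an exponential family of energies of marked configurations: the law of the marks,
the vector `v` of sufficient statistics of finite configurations, and the set of (possibly
infinite) configurations which do not violate the hard core. -/
structure Model (𝕄 : Type) [MeasurableSpace 𝕄] (ι : Type) where
  markLaw : Measure 𝕄
  stat : Finset (Plane × 𝕄) → ι → ℝ
  hardCore : Set (Set (Plane × 𝕄))

namespace Model

variable {𝕄 : Type} [MeasurableSpace 𝕄] {ι : Type} [Fintype ι] (X : Model 𝕄 ι)

/-- The measure `μ = λ² ⊗ λᵐ` on marked points. -/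
def mu : Measure (Plane × 𝕄) := (volume : Measure Plane).prod X.markLaw

open Classical in
/-- `v(ψ | φ) = v(ψ ∪ φ) - v(φ)`; for an infinite `φ` it is the limit of these differences along
the restrictions of `φ` to growing discs. For a finite `φ` the sequence is eventually constant,
equal to `v(ψ ∪ φ) - v(φ)`. -/
def localStat (ψ : Finset (Plane × 𝕄)) (φ : Config 𝕄) (j : ι) : ℝ :=
  limUnder atTop fun n : ℕ => X.stat (ψ ∪ φ.inBall n) j - X.stat (φ.inBall n) j

open Classical in
/-- The local energy `V(ψ | φ; θ) = θᵀ v(ψ | φ)`, equal to `+∞` if `ψ ∪ φ` violates the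
hard core. -/
def localEnergy (θ : ι → ℝ) (ψ : Finset (Plane × 𝕄)) (φ : Config 𝕄) : EReal :=
  if (φ.addPts ψ).pts ∈ X.hardCore then ((∑ j, θ j * X.localStat ψ φ j : ℝ) : EReal) else ⊤

/-- `exp (-V(ψ | φ; θ))`. -/
def weight (θ : ι → ℝ) (ψ : Finset (Plane × 𝕄)) (φ : Config 𝕄) : ℝ≥0∞ :=
  EReal.exp (-X.localEnergy θ ψ φ)

open Classical in
/-- `∫ f(ψ) Q_Λ(dψ)` for the Poisson process `Q_Λ` on `Λ × 𝕄` with intensity measure `μ`. -/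
def poissonIntegral (Λ : Set Plane) (f : Finset (Plane × 𝕄) → ℝ≥0∞) : ℝ≥0∞ :=
  EReal.exp (-(X.mu (Λ ×ˢ univ) : EReal)) *
    ∑' n : ℕ, ((n.factorial : ℝ≥0∞))⁻¹ *
      ∫⁻ x : Fin n → Plane × 𝕄, f (Finset.univ.image x)
        ∂(Measure.pi fun _ => X.mu.restrict (Λ ×ˢ univ))

/-- The partition function `Z_Λ(φ)`. -/
def partition (θ : ι → ℝ) (Λ : Set Plane) (φ : Config 𝕄) : ℝ≥0∞ :=
  X.poissonIntegral Λ fun ψ => X.weight θ ψ (φ.restrict Λᶜ)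

/-- The set `R_Λ` of configurations with `0 < Z_Λ(φ) < ∞`. -/
def goodSet (θ : ι → ℝ) (Λ : Set Plane) : Set (Config 𝕄) :=
  {φ | 0 < X.partition θ Λ φ ∧ X.partition θ Λ φ < ∞}

open Classical in
/-- The local specification `Π_Λ(φ, F)`. -/
def spec (θ : ι → ℝ) (Λ : Set Plane) (φ : Config 𝕄) (F : Set (Config 𝕄)) : ℝ≥0∞ :=
  if φ ∈ X.goodSet θ Λ then
    (X.partition θ Λ φ)⁻¹ * X.poissonIntegral Λ fun ψ =>
      X.weight θ ψ (φ.restrict Λᶜ) * F.indicator 1 ((φ.restrict Λᶜ).addPts ψ)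
  else 0

/-- The set `Ω` of admissible configurations. -/
def admissible (θ : ι → ℝ) : Set (Config 𝕄) :=
  {φ | ∀ Λ : Set Plane, MeasurableSet Λ → Bornology.IsBounded Λ → φ ∈ X.goodSet θ Λ}

/-- The set `Ω_f` of finite admissible configurations. -/
def finiteAdmissible (θ : ι → ℝ) : Set (Config 𝕄) :=
  {φ | φ.pts.Finite ∧ φ ∈ X.admissible θ}

/-- `P` is (the law of) a stationary Gibbs point process for the energy with parameter `θ`: it is
translation invariant and satisfies the Dobrushin-Lanford-Ruelle equations. -/
structure IsStationaryGibbs (θ : ι → ℝ) (P : Measure (Config 𝕄)) : Prop where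
  isProbabilityMeasure : IsProbabilityMeasure P
  stationary : ∀ (x : Plane) (F : Set (Config 𝕄)), MeasurableSet F →
    P (Config.translate x ⁻¹' F) = P F
  dlr : ∀ Λ : Set Plane, MeasurableSet Λ → Bornology.IsBounded Λ →
    ∀ F : Set (Config 𝕄), MeasurableSet F →
      P[F.indicator (fun _ => (1 : ℝ)) |
          MeasurableSpace.comap (fun φ : Config 𝕄 => φ.restrict Λᶜ) inferInstance]
        =ᵐ[P] fun φ => (X.spec θ Λ φ F).toReal

open Classical in
/-- The energy is invariant by translation. -/
def TranslationInvariant : Prop :=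
  (∀ (x : Plane) (φ : Finset (Plane × 𝕄)),
    X.stat (φ.image fun z => (z.1 + x, z.2)) = X.stat φ) ∧
  ∀ (x : Plane) (φ : Config 𝕄), (φ.translate x).pts ∈ X.hardCore ↔ φ.pts ∈ X.hardCore

/-- The assumption [Mod] for the parameter set `Θ`, with interaction range `D`: stability and
locality of the local energy, and the integrability condition. -/
def Mod (Θ : Set (ι → ℝ)) (D : ℝ) : Prop :=
  0 ≤ D ∧
  (∃ K : ℝ, 0 ≤ K ∧ ∀ θ ∈ Θ, ∀ m : 𝕄, ∀ φ ∈ X.finiteAdmissible θ,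
    ((-K : ℝ) : EReal) ≤ X.localEnergy θ {(0, m)} φ) ∧
  (∀ θ ∈ Θ, ∀ m : 𝕄, ∀ φ ∈ X.finiteAdmissible θ,
    X.localEnergy θ {(0, m)} φ
      = X.localEnergy θ {(0, m)} (φ.restrict (Metric.closedBall 0 D))) ∧
  (∀ j : ι, ∃ (κ : ℝ) (k : ℕ), 0 ≤ κ ∧ ∀ θ ∈ Θ, ∀ m : 𝕄, ∀ φ ∈ X.finiteAdmissible θ,
    X.localStat {(0, m)} φ j ≤ κ * ((φ.inBall D).card : ℝ) ^ k)

/-- The identifiability assumption [Ident]. -/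
def Ident (θ : ι → ℝ) (P : Measure (Config 𝕄)) : Prop :=
  ∃ l : ℕ, Fintype.card ι ≤ l ∧
    ∃ (Am : Fin l → Set 𝕄) (A : Fin l → Set (Config 𝕄)),
      (∀ i, MeasurableSet (Am i)) ∧
      (∀ i, MeasurableSet (A i) ∧ A i ⊆ X.admissible θ) ∧
      Pairwise (fun i i' => Disjoint (Am i ×ˢ A i) (Am i' ×ˢ A i')) ∧
      (∀ i, 0 < (X.markLaw.prod P) (Am i ×ˢ A i)) ∧
      ∀ (m : Fin l → 𝕄) (φ : Fin l → Config 𝕄), (∀ i, m i ∈ Am i ∧ φ i ∈ A i) →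
        Function.Injective
          (Matrix.of fun i j => X.localStat {((0 : Plane), m i)} (φ i) j).mulVec

/-- The component `j` of the gradient with respect to `θ` of the log-pseudolikelihood
of `φ` on `Λ`. -/
def gradLPL (θ : ι → ℝ) (Λ : Set Plane) (φ : Config 𝕄) (j : ι) : ℝ :=
  (∫ z in Λ ×ˢ univ, X.localStat {z} φ j * (X.weight θ {z} φ).toReal ∂X.mu) -
    ∑ᶠ z ∈ (φ.restrict Λ).pts, X.localStat {z} (φ.erase z) j

end Model

/-- The square `Δ_i(d)` of side `d` centred at `d i`. -/
def cell (d : ℝ) (i : Fin 2 → ℤ) : Set Plane :=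
  {z | ∀ j, d * ((i j : ℝ) - 1 / 2) ≤ z j ∧ z j ≤ d * ((i j : ℝ) + 1 / 2)}

/-- The union of the squares `Δ_i(d)` with `|i| ≤ ρ`. -/
def cells (d : ℝ) (ρ : ℕ) : Set Plane :=
  ⋃ i ∈ {i : Fin 2 → ℤ | ∀ j, |i j| ≤ (ρ : ℤ)}, cell d i

namespace Model

variable {𝕄 : Type} [MeasurableSpace 𝕄] {ι : Type} [Fintype ι] (X : Model 𝕄 ι)

/-- The set of the admissible configurations without point in the squares `Δ_i(d)`,
`1 ≤ |i| ≤ 2 ⌈D / d⌉`. -/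
def surroundedByVoid (θ : ι → ℝ) (D d : ℝ) : Set (Config 𝕄) :=
  {φ | φ ∈ X.admissible θ ∧ ∀ i : Fin 2 → ℤ, i ≠ 0 →
    (∀ j, |i j| ≤ ((2 * ⌈D / d⌉₊ : ℕ) : ℤ)) → (φ.restrict (cell d i)).pts = ∅}

/-- The assumption [SDP], for the interaction range `D`. -/
def SDP (θ : ι → ℝ) (P : Measure (Config 𝕄)) (D : ℝ) : Prop :=
  ∃ d : ℝ, 0 < d ∧ ∃ l : ℕ, Fintype.card ι ≤ l ∧
    ∃ A : Fin (l + 1) → Set (Config 𝕄),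
      (∀ i, MeasurableSet (A i) ∧ A i ⊆ X.surroundedByVoid θ D d) ∧
      Pairwise (fun i i' => Disjoint (A i) (A i')) ∧
      (∀ i, 0 < P (A i)) ∧
      ∀ φ : Fin (l + 1) → Config 𝕄, (∀ i, φ i ∈ A i) →
        Function.Injective
          (Matrix.of fun (i : Fin l) (j : ι) =>
            X.gradLPL θ (cells d ⌈D / d⌉₊) (φ i.succ) j
              - X.gradLPL θ (cells d ⌈D / d⌉₊) (φ 0) j).mulVec

/-- The energy is invariant by translation and, for every compact set `Θ` of parameters in
`params`, [Mod] holds on `Θ` with some range `D`, and [Ident] and [SDP] (with the same `D`) hold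
for every true parameter `θ` in `Θ` and every stationary Gibbs measure with parameter `θ`. -/
def SatisfiesAssumptions (params : Set (ι → ℝ)) : Prop :=
  X.TranslationInvariant ∧
  ∀ Θ : Set (ι → ℝ), IsCompact Θ → Θ ⊆ params →
    ∃ D : ℝ, X.Mod Θ D ∧
      ∀ θ ∈ Θ, ∀ P : Measure (Config 𝕄), X.IsStationaryGibbs θ P →
        X.Ident θ P ∧ X.SDP θ P D

end Model

/-! ### The models -/

/-- Overlap area process (no marks): the number of points, and the sum over the pairs of points of
the area of the intersection of the discs of radius `R / 2` centred at them. -/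
def overlapArea (R : ℝ) : Model Unit (Fin 2) where
  markLaw := Measure.dirac ()
  stat φ := ![(φ.card : ℝ),
    ∑ s ∈ φ.powersetCard 2, (volume (⋂ z ∈ s, Metric.closedBall z.1 (R / 2))).toReal]
  hardCore := univ

/-- The distance bands of a multi-Strauss process with marks in `Fin M`: for each pair of marks
`m₁ ≤ m₂` (the values at `m₁ > m₂` are not used) radii
`0 ≤ D_1 < ... < D_p`, indexed from `0`, with `p = num m₁ m₂ + 1`. -/
structure Bands (M : ℕ) where
  num : Fin M → Fin M → ℕ
  rad : ∀ m₁ m₂, Fin (num m₁ m₂ + 1) → ℝ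
  nonneg : ∀ m₁ m₂, 0 ≤ rad m₁ m₂ 0
  strictMono : ∀ m₁ m₂, StrictMono (rad m₁ m₂)

/-- The indices of the parameters: one for each mark, and one for each band of each pair of marks
`m₁ ≤ m₂`. -/
abbrev Bands.Idx {M : ℕ} (b : Bands M) : Type :=
  Fin M ⊕ (Σ q : {q : Fin M × Fin M // q.1 ≤ q.2}, Fin (b.num q.1.1 q.1.2))

open Classical in
/-- The statistics of a multi-Strauss process on a graph `edge`: the number of points with each
mark, and the numbers of edges `{x₁^{m₁}, x₂^{m₂}}` with `‖x₁ - x₂‖` in each band. -/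
def multiStraussStat {M : ℕ} (b : Bands M)
    (edge : Finset (Plane × Fin M) → Plane × Fin M → Plane × Fin M → Prop)
    (φ : Finset (Plane × Fin M)) : b.Idx → ℝ
  | Sum.inl m => ((φ.filter fun z => z.2 = m).card : ℝ)
  | Sum.inr ⟨q, i⟩ => (((φ.powersetCard 2).filter fun s =>
      ∃ z₁ z₂ : Plane × Fin M, s = {z₁, z₂} ∧ z₁.2 = q.1.1 ∧ z₂.2 = q.1.2 ∧ edge φ z₁ z₂ ∧
        dist z₁.1 z₂.1 ∈ Set.Icc (b.rad q.1.1 q.1.2 i.castSucc) (b.rad q.1.1 q.1.2 i.succ)).card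
          : ℝ)

/-- Multi-Strauss marked process: complete graph, uniform marks; two points with marks
`m₁ ≤ m₂` cannot be at a distance less than the least radius `D_1` of their marks. -/
def multiStrauss {M : ℕ} (b : Bands M) : Model (Fin M) b.Idx where
  markLaw := ProbabilityTheory.uniformOn univ
  stat := multiStraussStat b fun _ _ _ => True
  hardCore := {φ | ∀ z₁ ∈ φ, ∀ z₂ ∈ φ, z₁ ≠ z₂ → z₁.2 ≤ z₂.2 →
    b.rad z₁.2 z₂.2 0 ≤ dist z₁.1 z₂.1}

/-- The parameters of the multi-Strauss process: the coefficient of a pair of marks may be negative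
only under the hard core assumption. -/
def multiStraussParams {M : ℕ} (b : Bands M) : Set (b.Idx → ℝ) :=
  {θ | ∀ (q : {q : Fin M × Fin M // q.1 ≤ q.2}) (i : Fin (b.num q.1.1 q.1.2)),
    (b.rad q.1.1 q.1.2 0 = 0 ∨ b.rad q.1.1 q.1.1 0 = 0 ∨ b.rad q.1.2 q.1.2 0 = 0) →
      0 ≤ θ (Sum.inr ⟨q, i⟩)}

open Classical in
/-- `w` is one of the `k` nearest neighbours of `z` in `φ`: the closed disc centred at `z` with `w`
on its boundary has at most `k` points of `φ` besides `z` (so that, in the case of ties, no more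
than `k` points are selected). -/
def IsNeighbour {𝕄 : Type} (k : ℕ) (φ : Finset (Plane × 𝕄)) (z w : Plane × 𝕄) : Prop :=
  (φ.filter fun u => u ≠ z ∧ dist z.1 u.1 ≤ dist z.1 w.1).card ≤ k

/-- `k`-nearest-neighbour multi-Strauss marked process: the complete graph is replaced by the
graph of the pairs one of whose points is among the `k` nearest neighbours of the other; there is
no hard core. -/
def knnMultiStrauss {M : ℕ} (k : ℕ) (b : Bands M) : Model (Fin M) b.Idx where
  markLaw := ProbabilityTheory.uniformOn univ
  stat := multiStraussStat b fun φ z₁ z₂ => IsNeighbour k φ z₁ z₂ ∨ IsNeighbour k φ z₂ z₁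
  hardCore := univ

open Classical in
/-- Strauss type disc process: marks uniform on `[0, Mmax]`; the number of points, and the
number of pairs of points at a distance at most the sum of their marks. -/
def straussDisc (Mmax : ℝ) : Model (Set.Icc (0 : ℝ) Mmax) (Fin 2) where
  markLaw := (ENNReal.ofReal Mmax)⁻¹ • Measure.comap Subtype.val (volume : Measure ℝ)
  stat φ := ![(φ.card : ℝ),
    (((φ.powersetCard 2).filter fun s =>
      ∀ z₁ ∈ s, ∀ z₂ ∈ s, z₁ ≠ z₂ → dist z₁.1 z₂.1 ≤ (z₁.2 : ℝ) + (z₂.2 : ℝ)).card : ℝ)]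
  hardCore := univ

open Classical in
/-- The number of subsets of `φ` with `n` points whose pairwise distances are at most `R`. -/
def closeSubsets (R : ℝ) (n : ℕ) (φ : Finset (Plane × Unit)) : ℕ :=
  ((φ.powersetCard n).filter fun s => ∀ z₁ ∈ s, ∀ z₂ ∈ s, dist z₁.1 z₂.1 ≤ R).card

/-- Geyer's triplet process (no marks): the numbers of points, of pairs of points at a distance at
most `R`, and of triangles with edges of length at most `R`. -/
def geyerTriplet (R : ℝ) : Model Unit (Fin 3) where
  markLaw := Measure.dirac ()
  stat φ := ![(φ.card : ℝ), (closeSubsets R 2 φ : ℝ), (closeSubsets R 3 φ : ℝ)]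
  hardCore := univ

/-- Area-interaction process (no marks): the number of points, and the area of the union of the
discs of radius `R` centred at them. -/
def areaInteraction (R : ℝ) : Model Unit (Fin 2) where
  markLaw := Measure.dirac ()
  stat φ := ![(φ.card : ℝ), (volume (⋃ z ∈ φ, Metric.closedBall z.1 R)).toReal]
  hardCore := univ

end MarkedGibbs

end

/-! All six models are instances of one abstract class, `Model.IsTame`: increments of the statistics
grow polynomially in the number of points and have finite range `D`; the hard core is a condition on
pairs at distance at most `D`; the energy of an added point is bounded below uniformly on `Θ`; and
the statistics are continuous in the points at generic tuples. Generic means that positions are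
distinct, no distance is critical (a value where a count may jump) and no point is equidistant from
two others. Generic tuples form an open set, and almost every point can be added to one of them. For
a tame model [Mod] is immediate (`mod`).

The two other assumptions ask for events of positive probability on which a matrix is injective. The
DLR equations show that under every stationary Gibbs measure any allowed generic pattern, placed
farther than `D` from the boundary of a window, is approximated with positive probability by what is
seen in the window (`exists_event`): the specification is positive there because the pattern does
not interact with the outside. Linear independence is an open condition
(`exists_nhds_linearIndependent`), so it is enough to find finitely many patterns with independent
rows. Thus [Ident] and [SDP] become deterministic: no nonzero `v` annihilates all the increments,
respectively all the innovations `innov`, of generic finite configurations (`ident`, `sdp`,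
`satisfiesAssumptions_of`). For increments, configurations of a few points settle this.

For innovations, annihilation is a balance equation (`sum_death_eq`): the sum along `v` of the
decrements caused by removing each point equals the integral of the births along `v` in excess of
those of the empty configuration. It is contradicted in four ways. (a) Growth: with `n` mutually
interacting points in a small disc, deaths grow one power of `n` faster than births (overlap area,
Strauss discs, Geyer). (b) Discontinuity: along a suitable family of configurations the integral of
the births is continuous while the deaths jump (`tendsto_sum_death`). This happens when two points
merge for the area interaction, and when the distance of a pair crosses the outer radius of a band
for the multi-Strauss models; with nearest neighbours, `k` auxiliary points hide the pair until one
of them is removed. (c) Slow growth: if births along `v` are bounded, so are the deaths of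
configurations in a disc, and removing a point of least decrement repeatedly shows that the
statistic along `v` grows at most logarithmically (`slope_nonpos`); this kills the coefficients of
point counts when points can accumulate. (d) A maximum principle when a hard core prevents
accumulation (`false_of_stat_ge`): at a maximizer with as few points as possible, every death is
positive and births inside the disc are nonpositive, so the number of points is at most of the order
of the boundary, whereas a sparse lattice shows that the maximum is of the order of the area. -/

noncomputable section

set_option linter.unusedSectionVars false

namespace MarkedGibbs

open scoped Classical

/-! ### Generic configurations -/

section Generic

variable {𝕄 κ : Type}

/-- A set of marked points is generic, for critical distances `c k m m'` depending on the marks,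
if its points have distinct positions which are at no critical distance, and no point is
equidistant from two others. -/
structure IsGeneric (c : κ → 𝕄 → 𝕄 → ℝ) (s : Set (Plane × 𝕄)) : Prop where
  fst_ne : ∀ z ∈ s, ∀ w ∈ s, z ≠ w → z.1 ≠ w.1
  dist_ne : ∀ z ∈ s, ∀ w ∈ s, z ≠ w → ∀ k, dist z.1 w.1 ≠ c k z.2 w.2
  no_tie : ∀ z ∈ s, ∀ w ∈ s, ∀ u ∈ s, z ≠ w → z ≠ u → w ≠ u → dist z.1 w.1 ≠ dist z.1 u.1

lemma IsGeneric.mono {c : κ → 𝕄 → 𝕄 → ℝ} {s t : Set (Plane × 𝕄)} (ht : IsGeneric c t)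
    (h : s ⊆ t) : IsGeneric c s where
  fst_ne z hz w hw := ht.fst_ne z (h hz) w (h hw)
  dist_ne z hz w hw := ht.dist_ne z (h hz) w (h hw)
  no_tie z hz w hw u hu := ht.no_tie z (h hz) w (h hw) u (h hu)

lemma isGeneric_empty (c : κ → 𝕄 → 𝕄 → ℝ) : IsGeneric c ∅ where
  fst_ne _ h := h.elim
  dist_ne _ h := h.elim
  no_tie _ h := h.elim

/-- The injective enumerations of generic sets. -/
def genericTuples (c : κ → 𝕄 → 𝕄 → ℝ) (n : ℕ) : Set (Fin n → Plane × 𝕄) :=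
  {x | Function.Injective x ∧ IsGeneric c (range x)}

lemma mem_genericTuples_iff {c : κ → 𝕄 → 𝕄 → ℝ} {n : ℕ} {x : Fin n → Plane × 𝕄} :
    x ∈ genericTuples c n ↔
      (∀ i j, i ≠ j → (x i).1 ≠ (x j).1) ∧
      (∀ i j, i ≠ j → ∀ k, dist (x i).1 (x j).1 ≠ c k (x i).2 (x j).2) ∧
      ∀ i j l, i ≠ j → i ≠ l → j ≠ l → dist (x i).1 (x j).1 ≠ dist (x i).1 (x l).1 := by
  constructor
  · rintro ⟨hi, hg⟩
    exact ⟨fun i j h => hg.fst_ne _ ⟨i, rfl⟩ _ ⟨j, rfl⟩ (hi.ne h),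
      fun i j h => hg.dist_ne _ ⟨i, rfl⟩ _ ⟨j, rfl⟩ (hi.ne h),
      fun i j l h h' h'' => hg.no_tie _ ⟨i, rfl⟩ _ ⟨j, rfl⟩ _ ⟨l, rfl⟩ (hi.ne h) (hi.ne h')
        (hi.ne h'')⟩
  · rintro ⟨h1, h2, h3⟩
    refine ⟨fun i j h => by_contra fun hij => h1 i j hij (by rw [h]), ⟨?_, ?_, ?_⟩⟩
    · rintro _ ⟨i, rfl⟩ _ ⟨j, rfl⟩ h
      exact h1 i j fun e => h (by rw [e])
    · rintro _ ⟨i, rfl⟩ _ ⟨j, rfl⟩ h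
      exact h2 i j fun e => h (by rw [e])
    · rintro _ ⟨i, rfl⟩ _ ⟨j, rfl⟩ _ ⟨l, rfl⟩ h h' h''
      exact h3 i j l (fun e => h (by rw [e])) (fun e => h' (by rw [e])) fun e => h'' (by rw [e])

variable [TopologicalSpace 𝕄]

/-- Openness turns continuity on the set of generic tuples into continuity at each of them. It is
the reason for having finitely many critical distances, continuous in the marks. -/
lemma isOpen_genericTuples [Finite κ] {c : κ → 𝕄 → 𝕄 → ℝ} [T2Space 𝕄]
    (hc : ∀ k, Continuous fun p : 𝕄 × 𝕄 => c k p.1 p.2) (n : ℕ) :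
    IsOpen (genericTuples c n) := by
  have : genericTuples c n =
      {x | ∀ i j, i ≠ j → (x i).1 ≠ (x j).1} ∩
      ({x | ∀ i j, i ≠ j → ∀ k, dist (x i).1 (x j).1 ≠ c k (x i).2 (x j).2} ∩
      {x | ∀ i j l, i ≠ j → i ≠ l → j ≠ l → dist (x i).1 (x j).1 ≠ dist (x i).1 (x l).1}) := by
    ext x
    exact mem_genericTuples_iff
  rw [this]
  refine IsOpen.inter ?_ (IsOpen.inter ?_ ?_)
  · simp only [ofPred_forall]
    exact isOpen_iInter_of_finite fun i => isOpen_iInter_of_finite fun j =>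
      isOpen_iInter_of_finite fun _ => isOpen_ne_fun (by fun_prop) (by fun_prop)
  · simp only [ofPred_forall]
    refine isOpen_iInter_of_finite fun i => isOpen_iInter_of_finite fun j =>
      isOpen_iInter_of_finite fun _ => isOpen_iInter_of_finite fun k =>
        isOpen_ne_fun (by fun_prop) ?_
    exact (hc k).comp (by fun_prop : Continuous fun x : Fin n → Plane × 𝕄 => ((x i).2, (x j).2))
  · simp only [ofPred_forall]
    exact isOpen_iInter_of_finite fun i => isOpen_iInter_of_finite fun j =>
      isOpen_iInter_of_finite fun l => isOpen_iInter_of_finite fun _ =>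
      isOpen_iInter_of_finite fun _ => isOpen_iInter_of_finite fun _ =>
      isOpen_ne_fun (by fun_prop) (by fun_prop)

variable [MeasurableSpace 𝕄] [BorelSpace 𝕄] [SecondCountableTopology 𝕄]

/-- For each mark the exceptional positions form a sphere, which is null; Fubini over the marks
concludes. -/
lemma ae_dist_ne (ν : Measure 𝕄) [SFinite ν] (w : Plane) {f : 𝕄 → ℝ} (hf : Continuous f) :
    ∀ᵐ z ∂((volume : Measure Plane).prod ν), dist z.1 w ≠ f z.2 := by
  have hm : MeasurableSet {z : Plane × 𝕄 | dist z.1 w = f z.2} :=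
    (isClosed_eq (by fun_prop) (by fun_prop)).measurableSet
  rw [ae_iff]
  simp only [ne_eq, not_not]
  rw [Measure.prod_apply_symm hm]
  refine (lintegral_congr fun m => ?_).trans lintegral_zero
  exact Measure.addHaar_sphere (volume : Measure Plane) w (f m)

/-- The exceptional positions form the perpendicular bisector, a proper affine subspace since it
misses `w`. -/
lemma ae_dist_ne_dist (ν : Measure 𝕄) [SFinite ν] {w u : Plane} (h : w ≠ u) :
    ∀ᵐ z ∂((volume : Measure Plane).prod ν), dist z.1 w ≠ dist z.1 u := by
  have h0 : ∀ᵐ x ∂(volume : Measure Plane), dist x w ≠ dist x u := by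
    rw [ae_iff]
    simp only [ne_eq, not_not]
    have := Measure.addHaar_affineSubspace (volume : Measure Plane)
      (AffineSubspace.perpBisector w u) (by
        intro ht
        have : w ∈ AffineSubspace.perpBisector w u := ht ▸ AffineSubspace.mem_top _ _ _
        rw [AffineSubspace.mem_perpBisector_iff_dist_eq, dist_self] at this
        exact h (dist_eq_zero.1 this.symm))
    convert this using 2
    ext x
    exact AffineSubspace.mem_perpBisector_iff_dist_eq.symm
  exact Measure.quasiMeasurePreserving_fst.ae h0

/-- The new point has to avoid finitely many null sets. Ties have two shapes: the apex of the
isosceles triple is an old point (a sphere, `h4`) or the new one (a bisector, `h5`). Both orders of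
the marks are treated because `c` is not assumed symmetric. -/
lemma IsGeneric.ae_insert [Finite κ] {c : κ → 𝕄 → 𝕄 → ℝ}
    (hc : ∀ k, Continuous fun p : 𝕄 × 𝕄 => c k p.1 p.2) (ν : Measure 𝕄) [SFinite ν]
    {φ : Finset (Plane × 𝕄)} (hφ : IsGeneric c (φ : Set (Plane × 𝕄))) :
    ∀ᵐ z ∂((volume : Measure Plane).prod ν),
      z ∉ φ ∧ IsGeneric c (insert z (φ : Set (Plane × 𝕄))) := by
  have h1 : ∀ᵐ z ∂((volume : Measure Plane).prod ν), ∀ w ∈ φ, dist z.1 w.1 ≠ 0 :=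
    (ae_ball_iff φ.countable_toSet).2 fun w _ => ae_dist_ne ν w.1 (f := fun _ => 0) (by fun_prop)
  have h2 : ∀ᵐ z ∂((volume : Measure Plane).prod ν), ∀ w ∈ φ, ∀ k,
      dist z.1 w.1 ≠ c k z.2 w.2 :=
    (ae_ball_iff φ.countable_toSet).2 fun w _ => ae_all_iff.2 fun k =>
      ae_dist_ne ν w.1 ((hc k).comp (by fun_prop : Continuous fun m : 𝕄 => (m, w.2)))
  have h3 : ∀ᵐ z ∂((volume : Measure Plane).prod ν), ∀ w ∈ φ, ∀ k,
      dist z.1 w.1 ≠ c k w.2 z.2 :=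
    (ae_ball_iff φ.countable_toSet).2 fun w _ => ae_all_iff.2 fun k =>
      ae_dist_ne ν w.1 ((hc k).comp (by fun_prop : Continuous fun m : 𝕄 => (w.2, m)))
  have h4 : ∀ᵐ z ∂((volume : Measure Plane).prod ν), ∀ w ∈ φ, ∀ u ∈ φ,
      dist z.1 w.1 ≠ dist w.1 u.1 :=
    (ae_ball_iff φ.countable_toSet).2 fun w _ => (ae_ball_iff φ.countable_toSet).2 fun u _ =>
      ae_dist_ne ν w.1 (f := fun _ => dist w.1 u.1) (by fun_prop)
  have h5 : ∀ᵐ z ∂((volume : Measure Plane).prod ν), ∀ w ∈ φ, ∀ u ∈ φ, w ≠ u →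
      dist z.1 w.1 ≠ dist z.1 u.1 :=
    (ae_ball_iff φ.countable_toSet).2 fun w hw => (ae_ball_iff φ.countable_toSet).2 fun u hu => by
      by_cases h : w = u
      · exact Eventually.of_forall fun z h' => (h' h).elim
      · filter_upwards [ae_dist_ne_dist ν (hφ.fst_ne w hw u hu h)] with z hz _ using hz
  filter_upwards [h1, h2, h3, h4, h5] with z h1 h2 h3 h4 h5
  refine ⟨fun hz => h1 z hz (dist_self _), ⟨?_, ?_, ?_⟩⟩
  · rintro a (rfl | ha) b (rfl | hb) hab
    · exact (hab rfl).elim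
    · exact fun h => h1 b hb (by rw [h, dist_self])
    · exact fun h => h1 a ha (by rw [h, dist_self])
    · exact hφ.fst_ne a ha b hb hab
  · rintro a (rfl | ha) b (rfl | hb) hab k
    · exact (hab rfl).elim
    · exact h2 b hb k
    · rw [dist_comm]
      exact h3 a ha k
    · exact hφ.dist_ne a ha b hb hab k
  · rintro a (rfl | ha) b (rfl | hb) d (rfl | hd) hab had hbd
    · exact (hab rfl).elim
    · exact (hab rfl).elim
    · exact (had rfl).elim
    · exact h5 b hb d hd hbd
    · exact (hbd rfl).elim
    · rw [dist_comm a.1 b.1]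
      exact h4 a ha d hd
    · rw [dist_comm a.1 d.1]
      exact (h4 a ha b hb).symm
    · exact hφ.no_tie a ha b hb d hd hab had hbd

end Generic

/-! ### Increments, births, deaths and tame models -/

namespace Model

variable {𝕄 : Type} [MeasurableSpace 𝕄] {ι : Type} [Fintype ι] (X : Model 𝕄 ι)

/-- The increment `v(z | φ)` of the statistics when the point `z` is added to `φ`. -/
def incr (φ : Finset (Plane × 𝕄)) (z : Plane × 𝕄) (j : ι) : ℝ :=
  X.stat (insert z φ) j - X.stat φ j

lemma incr_of_mem {φ : Finset (Plane × 𝕄)} {z : Plane × 𝕄} (h : z ∈ φ) : X.incr φ z = 0 := by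
  funext j
  simp [incr, Finset.insert_eq_of_mem h]

/-- The Papangelou intensity `exp (-V(z | φ; θ))`. -/
def papangelou (θ : ι → ℝ) (φ : Finset (Plane × 𝕄)) (z : Plane × 𝕄) : ℝ :=
  if (insert z (φ : Set (Plane × 𝕄))) ∈ X.hardCore then Real.exp (-∑ j, θ j * X.incr φ z j) else 0

lemma papangelou_nonneg (θ : ι → ℝ) (φ : Finset (Plane × 𝕄)) (z : Plane × 𝕄) :
    0 ≤ X.papangelou θ φ z := by
  unfold papangelou
  split_ifs
  · exact (Real.exp_pos _).le
  · exact le_rfl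

/-- The integrand `v(z | φ) exp (-V(z | φ; θ))` of the innovations. -/
def birth (θ : ι → ℝ) (φ : Finset (Plane × 𝕄)) (z : Plane × 𝕄) (j : ι) : ℝ :=
  X.incr φ z j * X.papangelou θ φ z

/-- The sum of the increments `v(x | φ \ x)` over the points `x` of `φ`. -/
def death (φ : Finset (Plane × 𝕄)) (j : ι) : ℝ := ∑ x ∈ φ, X.incr (φ.erase x) x j

/-- The difference between the gradients of the log-pseudolikelihood at `φ` and at the empty
configuration. -/
def innov (θ : ι → ℝ) (φ : Finset (Plane × 𝕄)) (j : ι) : ℝ :=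
  ∫ z, (X.birth θ φ z j - X.birth θ ∅ z j) ∂X.mu - X.death φ j

variable [TopologicalSpace 𝕄] {κ : Type}

/-- Regularity properties of a model with interaction range `D`, critical distances `c` and
parameters in `Θ`. -/
structure IsTame (c : κ → 𝕄 → 𝕄 → ℝ) (Θ : Set (ι → ℝ)) (D : ℝ) : Prop where
  range_pos : 0 < D
  continuous_crit : ∀ k, Continuous fun p : 𝕄 × 𝕄 => c k p.1 p.2
  incr_bound : ∀ j, ∃ (a : ℝ) (k : ℕ), 0 ≤ a ∧ ∀ φ z, |X.incr φ z j| ≤ a * (φ.card : ℝ) ^ k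
  incr_congr : ∀ φ φ' z, (∀ w : Plane × 𝕄, dist z.1 w.1 ≤ D → (w ∈ φ ↔ w ∈ φ')) →
    X.incr φ z = X.incr φ' z
  hardCore_singleton : ∀ z, {z} ∈ X.hardCore
  hardCore_iff : ∀ s, s ∈ X.hardCore ↔ ∀ z ∈ s, ∀ w ∈ s, dist z.1 w.1 ≤ D → {z, w} ∈ X.hardCore
  stable : ∃ K : ℝ, 0 ≤ K ∧ ∀ θ ∈ Θ, ∀ (φ : Finset (Plane × 𝕄)) (z : Plane × 𝕄),
    insert z (φ : Set (Plane × 𝕄)) ∈ X.hardCore → -K ≤ ∑ j, θ j * X.incr φ z j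
  measurableSet_hardCore : MeasurableSet {φ : Config 𝕄 | φ.pts ∈ X.hardCore}
  continuousOn_stat : ∀ n, ContinuousOn (fun x : Fin n → Plane × 𝕄 =>
    X.stat (Finset.univ.image x)) (genericTuples c n)
  hardCore_nhds : ∀ z w : Plane × 𝕄, z ≠ w → IsGeneric c {z, w} →
    ∀ᶠ p : (Plane × 𝕄) × (Plane × 𝕄) in 𝓝 (z, w),
      ({p.1, p.2} ∈ X.hardCore ↔ {z, w} ∈ X.hardCore)

namespace IsTame

variable {X} {c : κ → 𝕄 → 𝕄 → ℝ} {Θ : Set (ι → ℝ)} {D : ℝ} (hX : X.IsTame c Θ D)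

include hX

lemma hardCore_mono {s t : Set (Plane × 𝕄)} (ht : t ∈ X.hardCore) (h : s ⊆ t) :
    s ∈ X.hardCore := by
  rw [hX.hardCore_iff] at ht ⊢
  exact fun z hz w hw => ht z (h hz) w (h hw)

lemma empty_mem_hardCore : ∅ ∈ X.hardCore := by
  rw [hX.hardCore_iff]
  simp

lemma hardCore_union {s t : Set (Plane × 𝕄)} (hs : s ∈ X.hardCore) (ht : t ∈ X.hardCore)
    (h : ∀ z ∈ s, ∀ w ∈ t, D < dist z.1 w.1) : s ∪ t ∈ X.hardCore := by
  rw [hX.hardCore_iff] at hs ht ⊢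
  rintro z (hz | hz) w (hw | hw) hzw
  · exact hs z hz w hw hzw
  · exact (not_lt.2 hzw (h z hz w hw)).elim
  · exact (not_lt.2 hzw (dist_comm z.1 w.1 ▸ h w hw z hz)).elim
  · exact ht z hz w hw hzw

/-- Add the points of `ψ` one at a time: each increment only sees the points within `D`, so it stops
changing once the growing disc has radius `‖z.1‖ + D`. The limit in `localStat` is thus that of an
eventually constant sequence. -/
lemma tendsto_localStat (ψ : Finset (Plane × 𝕄)) (φ : Config 𝕄) :
    ∃ a : ι → ℝ, ∀ᶠ n : ℕ in atTop,
      (fun j => X.stat (ψ ∪ φ.inBall n) j - X.stat (φ.inBall n) j) = a := by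
  induction ψ using Finset.induction_on with
  | empty => exact ⟨0, Eventually.of_forall fun n => by funext j; simp⟩
  | insert z ψ hz ih =>
    obtain ⟨a, ha⟩ := ih
    obtain ⟨N, hN⟩ := exists_nat_ge (‖z.1‖ + D)
    refine ⟨X.incr (ψ ∪ φ.inBall N) z + a, ?_⟩
    filter_upwards [ha, eventually_ge_atTop N] with n hn hNn
    have : X.incr (ψ ∪ φ.inBall n) z = X.incr (ψ ∪ φ.inBall N) z := by
      refine hX.incr_congr _ _ _ fun w hw => ?_
      have h1 : ‖w.1‖ ≤ N := by
        have : ‖w.1‖ ≤ ‖z.1‖ + dist z.1 w.1 := by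
          rw [dist_eq_norm]
          have := norm_sub_le z.1 (z.1 - w.1)
          simpa using this
        linarith
      have h2 : ‖w.1‖ ≤ n := h1.trans (by exact_mod_cast hNn)
      simp [Config.inBall, h1, h2]
    rw [← this, ← hn]
    funext j
    simp [incr, Finset.insert_union]

/-- Since the sequence is eventually constant, a value taken infinitely often is its limit. -/
lemma localStat_eq {ψ : Finset (Plane × 𝕄)} {φ : Config 𝕄} {a : ι → ℝ}
    (h : ∃ᶠ n : ℕ in atTop, (fun j => X.stat (ψ ∪ φ.inBall n) j - X.stat (φ.inBall n) j) = a) :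
    X.localStat ψ φ = a := by
  obtain ⟨b, hb⟩ := hX.tendsto_localStat ψ φ
  obtain ⟨n, hn, hn'⟩ := (h.and_eventually hb).exists
  funext j
  have : Tendsto (fun n : ℕ => X.stat (ψ ∪ φ.inBall n) j - X.stat (φ.inBall n) j) atTop
      (𝓝 (a j)) := by
    refine tendsto_const_nhds.congr' ?_
    filter_upwards [hb] with m hm
    rw [← hn, hn', ← hm]
  exact this.limUnder_eq

lemma exists_localStat_eq (ψ : Finset (Plane × 𝕄)) (φ : Config 𝕄) :
    ∃ n : ℕ, ∀ j, X.localStat ψ φ j = X.stat (ψ ∪ φ.inBall n) j - X.stat (φ.inBall n) j := by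
  obtain ⟨b, hb⟩ := hX.tendsto_localStat ψ φ
  obtain ⟨n, hn⟩ := hb.exists
  refine ⟨n, fun j => ?_⟩
  rw [hX.localStat_eq hb.frequently, ← hn]

/-- The local statistic of a point is the increment with respect to any finite set which agrees
with the configuration near the point. -/
lemma localStat_singleton {φ : Config 𝕄} {ψ : Finset (Plane × 𝕄)} {z : Plane × 𝕄}
    (h : ∀ w : Plane × 𝕄, dist z.1 w.1 ≤ D → (w ∈ φ.pts ↔ w ∈ ψ)) :
    X.localStat {z} φ = X.incr ψ z := by
  refine hX.localStat_eq (Eventually.frequently ?_)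
  obtain ⟨N, hN⟩ := exists_nat_ge (‖z.1‖ + D)
  filter_upwards [eventually_ge_atTop N] with n hn
  have : X.incr (φ.inBall n) z = X.incr ψ z := by
    refine hX.incr_congr _ _ _ fun w hw => ?_
    have h1 : ‖w.1‖ ≤ n := by
      have : ‖w.1‖ ≤ ‖z.1‖ + dist z.1 w.1 := by
        rw [dist_eq_norm]
        have := norm_sub_le z.1 (z.1 - w.1)
        simpa using this
      have : (N : ℝ) ≤ n := by exact_mod_cast hn
      linarith
    rw [← h w hw]
    simp [Config.inBall, h1]
  rw [← this]
  funext j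
  simp only [incr, Finset.singleton_union]

/-- A finite set far from a configuration does not interact with it. -/
lemma localStat_of_far {φ : Config 𝕄} {ψ : Finset (Plane × 𝕄)}
    (h : ∀ z ∈ ψ, ∀ w ∈ φ.pts, D < dist z.1 w.1) (j : ι) :
    X.localStat ψ φ j = X.stat ψ j - X.stat ∅ j := by
  suffices ∀ n : ℕ, (fun j => X.stat (ψ ∪ φ.inBall n) j - X.stat (φ.inBall n) j)
      = fun j => X.stat ψ j - X.stat ∅ j by
    rw [hX.localStat_eq (Eventually.of_forall this).frequently]
  intro n
  induction ψ using Finset.induction_on with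
  | empty => simp
  | insert z ψ hz ih =>
    have ih := ih fun a ha => h a (Finset.mem_insert_of_mem ha)
    have : X.incr (ψ ∪ φ.inBall n) z = X.incr ψ z := by
      refine hX.incr_congr _ _ _ fun w hw => ?_
      have : w ∉ φ.pts := fun hw' => not_lt.2 hw (h z (Finset.mem_insert_self _ _) w hw')
      simp [Config.inBall, this]
    funext j
    have h1 := congrFun this j
    have h2 := congrFun ih j
    simp only [incr, Finset.insert_union] at h1 h2 ⊢
    linarith

/-- Stability is summed over the points of `ψ`, added one by one; parts of an allowed configuration
are allowed, so the bound `-K` applies at each step. -/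
lemma neg_card_mul_le_localStat {K : ℝ} {θ : ι → ℝ}
    (hK : ∀ (φ : Finset (Plane × 𝕄)) (z : Plane × 𝕄),
      insert z (φ : Set (Plane × 𝕄)) ∈ X.hardCore → -K ≤ ∑ j, θ j * X.incr φ z j)
    {ψ : Finset (Plane × 𝕄)} {φ : Config 𝕄} (h : (φ.addPts ψ).pts ∈ X.hardCore) :
    -(K * ψ.card) ≤ ∑ j, θ j * X.localStat ψ φ j := by
  obtain ⟨n, hn⟩ := hX.exists_localStat_eq ψ φ
  simp only [hn]
  have h' : (↑(ψ ∪ φ.inBall n) : Set (Plane × 𝕄)) ∈ X.hardCore := by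
    refine hX.hardCore_mono h ?_
    intro w hw
    simp only [Finset.coe_union, Config.inBall, Finite.coe_toFinset, mem_union] at hw
    exact hw.imp id fun h => h.1
  clear hn h
  induction ψ using Finset.induction_on with
  | empty => simp
  | insert z ψ hz ih =>
    have ih := ih (hX.hardCore_mono h' (by
      simp only [Finset.insert_union, Finset.coe_insert]
      exact subset_insert _ _))
    have := hK (ψ ∪ φ.inBall n) z (by simpa [Finset.insert_union] using h')
    rw [Finset.card_insert_of_notMem hz]
    push_cast
    have e : ∑ j, θ j * (X.stat (insert z ψ ∪ φ.inBall n) j - X.stat (φ.inBall n) j)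
        = ∑ j, θ j * X.incr (ψ ∪ φ.inBall n) z j
          + ∑ j, θ j * (X.stat (ψ ∪ φ.inBall n) j - X.stat (φ.inBall n) j) := by
      rw [← Finset.sum_add_distrib]
      refine Finset.sum_congr rfl fun j _ => ?_
      simp only [incr, Finset.insert_union]
      ring
    rw [e]
    linarith

omit hX in
lemma weight_of_mem (θ : ι → ℝ) {ψ : Finset (Plane × 𝕄)} {φ : Config 𝕄}
    (h : (φ.addPts ψ).pts ∈ X.hardCore) :
    X.weight θ ψ φ = ENNReal.ofReal (Real.exp (-∑ j, θ j * X.localStat ψ φ j)) := by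
  rw [weight, localEnergy, if_pos h, ← EReal.coe_neg, EReal.exp_coe]

omit hX in
lemma weight_of_notMem (θ : ι → ℝ) {ψ : Finset (Plane × 𝕄)} {φ : Config 𝕄}
    (h : (φ.addPts ψ).pts ∉ X.hardCore) : X.weight θ ψ φ = 0 := by
  rw [weight, localEnergy, if_neg h]
  simp

lemma weight_le {K : ℝ} {θ : ι → ℝ}
    (hK : ∀ (φ : Finset (Plane × 𝕄)) (z : Plane × 𝕄),
      insert z (φ : Set (Plane × 𝕄)) ∈ X.hardCore → -K ≤ ∑ j, θ j * X.incr φ z j)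
    (ψ : Finset (Plane × 𝕄)) (φ : Config 𝕄) :
    X.weight θ ψ φ ≤ ENNReal.ofReal (Real.exp (K * ψ.card)) := by
  by_cases h : (φ.addPts ψ).pts ∈ X.hardCore
  · rw [weight_of_mem θ h]
    have := hX.neg_card_mul_le_localStat hK h
    exact ENNReal.ofReal_le_ofReal (Real.exp_le_exp.2 (by linarith))
  · rw [weight_of_notMem θ h]
    exact zero_le

end IsTame

end Model

end MarkedGibbs

namespace MarkedGibbs

open scoped Classical

namespace Model

variable {𝕄 : Type} [MeasurableSpace 𝕄] {ι : Type} [Fintype ι] {X : Model 𝕄 ι}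

/-! ### The intensity measure and the Poisson integral -/

section Mu

variable (X) [IsProbabilityMeasure X.markLaw]

instance : SigmaFinite X.mu := by unfold mu; infer_instance

lemma mu_prod_univ (Λ : Set Plane) : X.mu (Λ ×ˢ univ) = volume Λ := by
  simp [mu]

lemma mu_lt_top {Λ : Set Plane} (h : Bornology.IsBounded Λ) : X.mu (Λ ×ˢ univ) < ∞ := by
  rw [mu_prod_univ]
  exact h.measure_lt_top

instance [TopologicalSpace 𝕄] [X.markLaw.IsOpenPosMeasure] : X.mu.IsOpenPosMeasure := by
  unfold mu; infer_instance

lemma poissonIntegral_mono (Λ : Set Plane) {f g : Finset (Plane × 𝕄) → ℝ≥0∞} (h : ∀ ψ, f ψ ≤ g ψ) :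
    X.poissonIntegral Λ f ≤ X.poissonIntegral Λ g := by
  unfold poissonIntegral
  gcongr
  exact h _

lemma exp_neg_mu_pos {Λ : Set Plane} (h : Bornology.IsBounded Λ) :
    0 < EReal.exp (-(X.mu (Λ ×ˢ univ) : EReal)) := by
  rw [pos_iff_ne_zero, Ne, EReal.exp_eq_zero_iff, EReal.neg_eq_bot_iff]
  simpa using (X.mu_lt_top h).ne

lemma le_poissonIntegral (Λ : Set Plane) (f : Finset (Plane × 𝕄) → ℝ≥0∞) :
    EReal.exp (-(X.mu (Λ ×ˢ univ) : EReal)) * f ∅ ≤ X.poissonIntegral Λ f := by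
  unfold poissonIntegral
  gcongr
  refine le_trans ?_ (ENNReal.le_tsum 0)
  simp

/-- With the empty window the partition function is the weight of adding no point, so that its
positivity detects the hard core. -/
lemma poissonIntegral_empty (f : Finset (Plane × 𝕄) → ℝ≥0∞) :
    X.poissonIntegral ∅ f = f ∅ := by
  unfold poissonIntegral
  rw [tsum_eq_single 0]
  · simp
  · intro n hn
    have : (Measure.pi fun _ : Fin n => X.mu.restrict ((∅ : Set Plane) ×ˢ univ)) = 0 := by
      have : NeZero n := ⟨hn⟩
      rw [← Measure.measure_univ_eq_zero, Measure.pi_univ]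
      exact Finset.prod_eq_zero (Finset.mem_univ (0 : Fin n)) (by simp)
    rw [this, lintegral_zero_measure, mul_zero]

/-- The term with `n` points is at most `(exp K * μ(Λ × 𝕄)) ^ n / n!`: the series is dominated by
that of an exponential. -/
lemma poissonIntegral_lt_top {Λ : Set Plane} (h : Bornology.IsBounded Λ)
    {f : Finset (Plane × 𝕄) → ℝ≥0∞} {K : ℝ} (hK : 0 ≤ K)
    (hf : ∀ ψ, f ψ ≤ ENNReal.ofReal (Real.exp (K * ψ.card))) :
    X.poissonIntegral Λ f < ∞ := by
  have hμ := X.mu_lt_top h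
  set a : ℝ≥0∞ := ENNReal.ofReal (Real.exp K) * X.mu (Λ ×ˢ univ) with ha
  have ha' : a ≠ ∞ := ENNReal.mul_ne_top ENNReal.ofReal_ne_top hμ.ne
  have key : ∑' n : ℕ, ((n.factorial : ℝ≥0∞))⁻¹ *
      ∫⁻ x : Fin n → Plane × 𝕄, f (Finset.univ.image x)
        ∂(Measure.pi fun _ => X.mu.restrict (Λ ×ˢ univ))
      ≤ ∑' n : ℕ, ((n.factorial : ℝ≥0∞))⁻¹ * a ^ n := by
    refine ENNReal.tsum_le_tsum fun n => ?_
    gcongr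
    calc ∫⁻ x : Fin n → Plane × 𝕄, f (Finset.univ.image x)
          ∂(Measure.pi fun _ => X.mu.restrict (Λ ×ˢ univ))
        ≤ ∫⁻ _ : Fin n → Plane × 𝕄, ENNReal.ofReal (Real.exp K) ^ n
          ∂(Measure.pi fun _ => X.mu.restrict (Λ ×ˢ univ)) := by
          refine lintegral_mono fun x => (hf _).trans ?_
          rw [← ENNReal.ofReal_pow (Real.exp_pos _).le, ← Real.exp_nat_mul, mul_comm]
          refine ENNReal.ofReal_le_ofReal (Real.exp_le_exp.2 ?_)
          gcongr
          -- The image has fewer than `n` points when coordinates coincide; the bound survives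
          -- because `0 ≤ K`.
          have : (Finset.univ.image x).card ≤ n := by
            simpa using Finset.card_image_le (s := Finset.univ) (f := x)
          exact_mod_cast this
      _ = a ^ n := by
          rw [lintegral_const, Measure.pi_univ]
          simp [ha, mul_pow]
  have h2 : ∑' n : ℕ, ((n.factorial : ℝ≥0∞))⁻¹ * a ^ n < ∞ := by
    clear_value a
    clear key
    lift a to NNReal using ha'
    have e : ∀ n : ℕ, ((n.factorial : ℝ≥0∞))⁻¹ * (a : ℝ≥0∞) ^ n
        = ((a ^ n / n.factorial : NNReal) : ℝ≥0∞) := by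
      intro n
      rw [ENNReal.coe_div (by exact_mod_cast n.factorial_ne_zero), ENNReal.div_eq_inv_mul]
      simp
    simp only [e]
    rw [lt_top_iff_ne_top, ENNReal.tsum_coe_ne_top_iff_summable, ← NNReal.summable_coe]
    simpa using Real.summable_pow_div_factorial (a : ℝ)
  unfold poissonIntegral
  refine ENNReal.mul_lt_top ?_ (key.trans_lt h2)
  rw [lt_top_iff_ne_top, Ne, EReal.exp_eq_top_iff, EReal.neg_eq_top_iff]
  exact EReal.coe_ennreal_ne_bot _

end Mu

/-! ### Admissible configurations and the DLR equations -/

namespace IsTame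

variable [TopologicalSpace 𝕄] {κ : Type}
variable {c : κ → 𝕄 → 𝕄 → ℝ} {Θ : Set (ι → ℝ)} {D : ℝ} (hX : X.IsTame c Θ D)

include hX

lemma hardCore_iff_pairwise {s : Set (Plane × 𝕄)} :
    s ∈ X.hardCore ↔ ∀ z ∈ s, ∀ w ∈ s, z ≠ w → {z, w} ∈ X.hardCore := by
  constructor
  · exact fun h z hz w hw _ => hX.hardCore_mono h (by rintro _ (rfl | rfl) <;> assumption)
  · intro h
    rw [hX.hardCore_iff]
    intro z hz w hw _
    by_cases e : z = w
    · subst e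
      simpa using hX.hardCore_singleton z
    · exact h z hz w hw e

/-- The hard core of a tuple is a finite conjunction of conditions on pairs, each of which is
locally constant near a generic pair. -/
lemma eventually_hardCore_iff {n : ℕ} {x : Fin n → Plane × 𝕄} (hx : x ∈ genericTuples c n) :
    ∀ᶠ y in 𝓝 x, (range y ∈ X.hardCore ↔ range x ∈ X.hardCore) := by
  have h1 : ∀ᶠ y in 𝓝 x, ∀ i j, i ≠ j →
      ({y i, y j} ∈ X.hardCore ↔ {x i, x j} ∈ X.hardCore) := by
    rw [eventually_all]
    intro i
    rw [eventually_all]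
    intro j
    by_cases h : i = j
    · exact Eventually.of_forall fun y h' => (h' h).elim
    have h2 := hX.hardCore_nhds (x i) (x j) (hx.1.ne h) (hx.2.mono (by
      rintro _ (rfl | rfl) <;> exact mem_range_self _))
    have h3 : Tendsto (fun y : Fin n → Plane × 𝕄 => (y i, y j)) (𝓝 x) (𝓝 (x i, x j)) :=
      Continuous.tendsto (by fun_prop) x
    filter_upwards [h3.eventually h2] with y hy _ using hy
  have h4 : ∀ y : Fin n → Plane × 𝕄, range y ∈ X.hardCore ↔
      ∀ i j, i ≠ j → {y i, y j} ∈ X.hardCore := by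
    intro y
    rw [hX.hardCore_iff_pairwise]
    constructor
    · intro h i j _
      by_cases e : y i = y j
      · rw [e]
        simpa using hX.hardCore_singleton (y j)
      · exact h _ (mem_range_self i) _ (mem_range_self j) e
    · rintro h _ ⟨i, rfl⟩ _ ⟨j, rfl⟩ hij
      exact h i j fun e => hij (by rw [e])
  filter_upwards [h1] with y hy
  rw [h4, h4]
  exact forall_congr' fun i => forall_congr' fun j => forall_congr' fun h => hy i j h

variable [IsProbabilityMeasure X.markLaw]

/-- Positivity comes from the term without points in `Λ`, finiteness from stability. -/
lemma mem_goodSet {θ : ι → ℝ} (hθ : θ ∈ Θ) {Λ : Set Plane} (hΛ : Bornology.IsBounded Λ)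
    {φ : Config 𝕄} (hφ : φ.pts ∈ X.hardCore) : φ ∈ X.goodSet θ Λ := by
  obtain ⟨K, hK0, hK⟩ := hX.stable
  refine ⟨?_, X.poissonIntegral_lt_top hΛ hK0 fun ψ => hX.weight_le (hK θ hθ) ψ _⟩
  refine lt_of_lt_of_le ?_ (X.le_poissonIntegral Λ _)
  refine ENNReal.mul_pos (X.exp_neg_mu_pos hΛ).ne' ?_
  have : ((φ.restrict Λᶜ).addPts ∅).pts ∈ X.hardCore :=
    hX.hardCore_mono hφ (by
      rintro z (hz | hz)
      · simp at hz
      · exact hz.1)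
  rw [weight_of_mem θ this, Ne, ENNReal.ofReal_eq_zero, not_le]
  exact Real.exp_pos _

/-- The hard core is recovered from admissibility by looking at the empty window, whose partition
function vanishes when the hard core is violated. -/
lemma mem_admissible_iff {θ : ι → ℝ} (hθ : θ ∈ Θ) {φ : Config 𝕄} :
    φ ∈ X.admissible θ ↔ φ.pts ∈ X.hardCore := by
  refine ⟨fun h => ?_, fun h Λ _ hΛ => hX.mem_goodSet hθ hΛ h⟩
  have h := (h ∅ MeasurableSet.empty Bornology.isBounded_empty).1
  rw [partition, poissonIntegral_empty] at h
  by_contra h'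
  rw [weight_of_notMem] at h
  · exact lt_irrefl _ h
  · convert h'
    simp [Config.addPts, Config.restrict]

/-- For the empty window and the sure event the DLR equation equates `1` with a specification which
is zero unless the partition function of the empty window is positive. -/
lemma ae_hardCore {θ : ι → ℝ} {P : Measure (Config 𝕄)} (hP : X.IsStationaryGibbs θ P) :
    ∀ᵐ φ ∂P, φ.pts ∈ X.hardCore := by
  have := hP.isProbabilityMeasure
  have h := hP.dlr ∅ MeasurableSet.empty Bornology.isBounded_empty univ MeasurableSet.univ
  have e : (fun φ : Config 𝕄 => φ.restrict ∅ᶜ) = id := by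
    funext φ
    ext z
    simp [Config.restrict]
  rw [e, indicator_univ, MeasurableSpace.comap_id, condExp_const le_rfl] at h
  filter_upwards [h] with φ hφ
  have hg : φ ∈ X.goodSet θ ∅ := by
    by_contra hg
    rw [spec, if_neg hg] at hφ
    simp at hφ
  have h := hg.1
  rw [partition, poissonIntegral_empty] at h
  by_contra h'
  rw [weight_of_notMem] at h
  · exact lt_irrefl _ h
  · convert h'
    simp [Config.addPts, Config.restrict]

/-- The conditional probability of a null event vanishes almost surely, and it is almost surely
equal to the specification. -/
lemma exists_spec_eq_zero {θ : ι → ℝ} {P : Measure (Config 𝕄)} (hP : X.IsStationaryGibbs θ P)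
    {Λ : Set Plane} (hΛ : MeasurableSet Λ) (hΛ' : Bornology.IsBounded Λ)
    {F : Set (Config 𝕄)} (hF : MeasurableSet F) (h0 : P F = 0) :
    ∃ φ : Config 𝕄, φ.pts ∈ X.hardCore ∧ (X.spec θ Λ φ F).toReal = 0 := by
  have := hP.isProbabilityMeasure
  have h1 : F.indicator (fun _ => (1 : ℝ)) =ᵐ[P] 0 := by
    filter_upwards [measure_eq_zero_iff_ae_notMem.1 h0] with φ hφ
    simp [hφ]
  have h2 := (condExp_congr_ae (m := MeasurableSpace.comap
    (fun φ : Config 𝕄 => φ.restrict Λᶜ) inferInstance) h1).symm.trans (hP.dlr Λ hΛ hΛ' F hF)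
  rw [condExp_zero] at h2
  obtain ⟨φ, h, h'⟩ := ((hX.ae_hardCore hP).and h2).exists
  exact ⟨φ, h, h'.symm⟩

end IsTame

end Model

end MarkedGibbs

/-! ### Patterns of positive probability -/

namespace MarkedGibbs

open scoped Classical

lemma measurableSet_encard_eq {𝕄 : Type} [MeasurableSpace 𝕄] {F : Set (Plane × 𝕄)}
    (hF : MeasurableSet F) (hb : Bornology.IsBounded (Prod.fst '' F)) (n : ℕ) :
    MeasurableSet {φ : Config 𝕄 | (φ.pts ∩ F).encard = n} :=
  MeasurableSpace.measurableSet_generateFrom ⟨F, hF, hb, n, rfl⟩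

namespace Model.IsTame

variable {𝕄 : Type} [MeasurableSpace 𝕄] {ι : Type} [Fintype ι] {X : Model 𝕄 ι}
variable [TopologicalSpace 𝕄] [T2Space 𝕄] [BorelSpace 𝕄] [SecondCountableTopology 𝕄]
variable [IsProbabilityMeasure X.markLaw] [X.markLaw.IsOpenPosMeasure]
variable {κ : Type} [Finite κ]
variable {c : κ → 𝕄 → 𝕄 → ℝ} {Θ : Set (ι → ℝ)} {D : ℝ} (hX : X.IsTame c Θ D)

include hX

/-- In the Poisson integral keep only the term with `n` points, and in it only the box of the `U i`,
which has positive measure and on which the integrand is at least `a`. -/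
lemma spec_toReal_pos {θ : ι → ℝ} (hθ : θ ∈ Θ) {Λ : Set Plane} (hΛ : Bornology.IsBounded Λ)
    {φ : Config 𝕄} (hφ : φ.pts ∈ X.hardCore) {F : Set (Config 𝕄)} {n : ℕ}
    {U : Fin n → Set (Plane × 𝕄)} (hU : ∀ i, IsOpen (U i)) (hUne : ∀ i, (U i).Nonempty)
    (hUΛ : ∀ i, U i ⊆ Λ ×ˢ univ) {a : ℝ≥0∞} (ha : a ≠ 0)
    (h : ∀ y : Fin n → Plane × 𝕄, (∀ i, y i ∈ U i) →
      a ≤ X.weight θ (Finset.univ.image y) (φ.restrict Λᶜ) ∧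
      (φ.restrict Λᶜ).addPts (Finset.univ.image y) ∈ F) :
    0 < (X.spec θ Λ φ F).toReal := by
  have hg := hX.mem_goodSet hθ hΛ hφ
  rw [spec, if_pos hg, ENNReal.toReal_pos_iff]
  constructor
  · refine ENNReal.mul_pos (ENNReal.inv_ne_zero.2 hg.2.ne) ?_
    unfold poissonIntegral
    refine (ENNReal.mul_pos (X.exp_neg_mu_pos hΛ).ne' ?_).ne'
    refine (lt_of_lt_of_le ?_ (ENNReal.le_tsum n)).ne'
    refine ENNReal.mul_pos (by simp) ?_
    have hm : MeasurableSet (Set.pi univ U) := MeasurableSet.univ_pi fun i => (hU i).measurableSet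
    refine (lt_of_lt_of_le ?_ (lintegral_mono (f := (Set.pi univ U).indicator fun _ => a) ?_)).ne'
    · rw [lintegral_indicator_const hm, Measure.pi_pi]
      refine ENNReal.mul_pos ha (Finset.prod_ne_zero_iff.2 fun i _ => ?_)
      rw [Measure.restrict_apply (hU i).measurableSet, inter_eq_left.2 (hUΛ i)]
      exact ((hU i).measure_pos _ (hUne i)).ne'
    · intro y
      by_cases hy : y ∈ Set.pi univ U
      · obtain ⟨h1, h2⟩ := h y fun i => hy i (mem_univ i)
        simpa [indicator_of_mem hy, indicator_of_mem h2] using h1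
      · simp [indicator_of_notMem hy]
  -- Finiteness has to be checked as well, since `toReal` sends `∞` to zero: the specification is at
  -- most `1`.
  · refine lt_of_le_of_lt (b := 1) ?_ ENNReal.one_lt_top
    refine le_trans ?_ (ENNReal.inv_mul_le_one (X.partition θ Λ φ))
    refine mul_le_mul_right (X.poissonIntegral_mono Λ fun ψ => ?_) _
    by_cases h2 : (φ.restrict Λᶜ).addPts ψ ∈ F
    · simp [indicator_of_mem h2]
    · simp [indicator_of_notMem h2]

/-- Under a stationary Gibbs measure, the configurations which have in `Λ` only points close to
those of a given generic configuration far from the boundary form an event of positive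
probability. -/
theorem exists_event {θ : ι → ℝ} (hθ : θ ∈ Θ) {P : Measure (Config 𝕄)}
    (hP : X.IsStationaryGibbs θ P) {Λ : Set Plane} (hΛ : MeasurableSet Λ)
    (hΛ' : Bornology.IsBounded Λ) {n : ℕ} {x : Fin n → Plane × 𝕄} (hx : x ∈ genericTuples c n)
    (hxc : range x ∈ X.hardCore) {D' : ℝ} (hD' : D < D')
    (hxΛ : ∀ i u, dist u (x i).1 ≤ D' → u ∈ Λ) {W : Set (Fin n → Plane × 𝕄)} (hW : W ∈ 𝓝 x) :
    ∃ A : Set (Config 𝕄), MeasurableSet A ∧ A ⊆ X.admissible θ ∧ 0 < P A ∧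
      ∀ φ ∈ A, φ.pts ∈ X.hardCore ∧ ∃ y ∈ W, y ∈ genericTuples c n ∧ range y ∈ X.hardCore ∧
        {z ∈ φ.pts | z.1 ∈ Λ} = range y := by
  -- `E` is the energy of the pattern alone. It stays below `E x + 1` near `x`, which bounds the
  -- weights from below.
  set E : (Fin n → Plane × 𝕄) → ℝ :=
    fun y => ∑ j, θ j * (X.stat (Finset.univ.image y) j - X.stat ∅ j) with hE
  have hopen := isOpen_genericTuples hX.continuous_crit n
  have hEc : ContinuousAt E x := by
    have h := (hX.continuousOn_stat n).continuousAt (hopen.mem_nhds hx)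
    have h' : ∀ j, ContinuousAt (fun y : Fin n → Plane × 𝕄 => X.stat (Finset.univ.image y) j) x :=
      fun j => (continuous_apply j).continuousAt.comp h
    exact tendsto_finsetSum _ fun j _ => ((h' j).sub continuousAt_const).const_mul _
  have hnear : ∀ᶠ y in 𝓝 x, y ∈ W ∧ y ∈ genericTuples c n ∧ range y ∈ X.hardCore ∧
      E y < E x + 1 := by
    filter_upwards [hW, hopen.mem_nhds hx, hX.eventually_hardCore_iff hx,
      hEc.eventually_lt continuousAt_const (lt_add_one (E x))] with y h1 h2 h3 h4
    exact ⟨h1, h2, h3.2 hxc, h4⟩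
  rw [Filter.Eventually, nhds_pi, Filter.mem_pi'] at hnear
  obtain ⟨I, t, ht, htW⟩ := hnear
  obtain ⟨V, hV, hVd⟩ := (finite_range x).t2_separation
  -- Disjoint neighbourhoods of the points, within `D' - D` of them, so that they remain farther
  -- than `D` from the complement of `Λ`.
  have hU' : ∀ i, ∃ U : Set (Plane × 𝕄), U ⊆ t i ∩ V (x i) ∩ (Metric.ball (x i).1 (D' - D)) ×ˢ univ ∧
      IsOpen U ∧ x i ∈ U := fun i => mem_nhds_iff.1 (inter_mem (inter_mem (ht i)
        ((hV (x i)).2.mem_nhds (hV (x i)).1)) (prod_mem_nhds (Metric.ball_mem_nhds _ (by linarith))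
          univ_mem))
  choose U hUsub hUo hUx using hU'
  have hUt : ∀ y : Fin n → Plane × 𝕄, (∀ i, y i ∈ U i) → y ∈ W ∧ y ∈ genericTuples c n ∧
      range y ∈ X.hardCore ∧ E y < E x + 1 := fun y hy => htW fun i _ => (hUsub i (hy i)).1.1
  have hUd : ∀ i j, i ≠ j → Disjoint (U i) (U j) := fun i j hij =>
    (hVd ⟨i, rfl⟩ ⟨j, rfl⟩ (hx.1.ne hij)).mono (fun z hz => (hUsub i hz).1.2)
      fun z hz => (hUsub j hz).1.2
  have hUfar : ∀ i, ∀ z ∈ U i, ∀ u, dist z.1 u ≤ D → u ∈ Λ := by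
    intro i z hz u hu
    refine hxΛ i u ?_
    have := (hUsub i hz).2.1
    rw [Metric.mem_ball] at this
    have := dist_triangle u z.1 (x i).1
    rw [dist_comm u z.1] at this
    linarith
  have hUΛ : ∀ i, U i ⊆ Λ ×ˢ univ := fun i z hz =>
    ⟨hUfar i z hz z.1 (by simpa using hX.range_pos.le), mem_univ _⟩
  -- Apart from the hard core, the event only involves counts: `n` points above `Λ`, one of them in
  -- each of the `n` disjoint `U i`, hence no other point above `Λ`.
  set A : Set (Config 𝕄) := {φ | φ.pts ∈ X.hardCore} ∩ ({φ | (φ.pts ∩ Λ ×ˢ univ).encard = n} ∩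
    ⋂ i, {φ | (φ.pts ∩ U i).encard = (1 : ℕ)}) with hA
  have hAm : MeasurableSet A := by
    refine hX.measurableSet_hardCore.inter ((measurableSet_encard_eq (hΛ.prod MeasurableSet.univ)
      (hΛ'.subset (fst_image_prod_subset _ _)) n).inter
      (MeasurableSet.iInter fun i => measurableSet_encard_eq (hUo i).measurableSet
        (hΛ'.subset ((image_mono (hUΛ i)).trans (fst_image_prod_subset _ _))) 1))
  refine ⟨A, hAm, fun φ hφ => (hX.mem_admissible_iff hθ).2 hφ.1, ?_, ?_⟩
  -- If `A` were null, its specification would vanish at some allowed `φ`. But whatever `φ` is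
  -- outside `Λ`, it does not interact with the pattern, whose weight is therefore at least `exp
  -- (-(E x + 1))`.
  · rw [pos_iff_ne_zero]
    intro h0
    obtain ⟨φ, hφ, hs⟩ := hX.exists_spec_eq_zero hP hΛ hΛ' hAm h0
    refine hs.not_gt (hX.spec_toReal_pos hθ hΛ' hφ hUo (fun i => ⟨_, hUx i⟩) hUΛ
      (a := ENNReal.ofReal (Real.exp (-(E x + 1)))) ?_ fun y hy => ?_)
    · rw [Ne, ENNReal.ofReal_eq_zero, not_le]
      exact Real.exp_pos _
    obtain ⟨-, hyg, hyc, hyE⟩ := hUt y hy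
    have hfar : ∀ z ∈ Finset.univ.image y, ∀ w ∈ (φ.restrict Λᶜ).pts, D < dist z.1 w.1 := by
      intro z hz w hw
      obtain ⟨i, -, rfl⟩ := Finset.mem_image.1 hz
      by_contra h
      exact hw.2 (hUfar i _ (hy i) _ (not_lt.1 h))
    have hcoe : ((Finset.univ.image y : Finset (Plane × 𝕄)) : Set (Plane × 𝕄)) = range y := by simp
    have hhc : ((φ.restrict Λᶜ).addPts (Finset.univ.image y)).pts ∈ X.hardCore := by
      refine hX.hardCore_union (by rwa [hcoe]) (hX.hardCore_mono hφ fun z hz => hz.1) ?_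
      exact fun z hz => hfar z hz
    constructor
    · rw [weight_of_mem θ hhc]
      refine ENNReal.ofReal_le_ofReal (Real.exp_le_exp.2 ?_)
      simp only [hX.localStat_of_far hfar]
      linarith
    · have hpts : ((φ.restrict Λᶜ).addPts (Finset.univ.image y)).pts =
          range y ∪ {z ∈ φ.pts | z.1 ∈ Λᶜ} := by
        rw [← hcoe]
        rfl
      refine ⟨hhc, ?_, mem_iInter.2 fun i => ?_⟩
      · have : (range y ∪ {z ∈ φ.pts | z.1 ∈ Λᶜ}) ∩ Λ ×ˢ univ = range y := by
          ext z
          constructor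
          · rintro ⟨h | h, h'⟩
            · exact h
            · exact (h.2 h'.1).elim
          · rintro ⟨i, rfl⟩
            exact ⟨Or.inl ⟨i, rfl⟩, hUΛ i (hy i)⟩
        change Set.encard (_ ∩ _) = _
        rw [hpts, this, ← image_univ, hyg.1.encard_image, encard_univ]
        simp
      · have : (range y ∪ {z ∈ φ.pts | z.1 ∈ Λᶜ}) ∩ U i = {y i} := by
          ext z
          constructor
          · rintro ⟨⟨j, rfl⟩ | h, h'⟩
            · by_cases hij : i = j
              · rw [hij]; rfl
              · exact (disjoint_left.1 (hUd i j hij) h' (hy j)).elim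
            · exact (h.2 (hUΛ i h').1).elim
          · rintro rfl
            exact ⟨Or.inl ⟨i, rfl⟩, hy i⟩
        change Set.encard (_ ∩ _) = _
        rw [hpts, this]
        simp
  · rintro φ ⟨h1, h2, h3⟩
    refine ⟨h1, ?_⟩
    have h4 : ∀ i, ∃ z, φ.pts ∩ U i = {z} := fun i => encard_eq_one.1 (by
      simpa using mem_iInter.1 h3 i)
    choose y hy using h4
    have hyU : ∀ i, y i ∈ φ.pts ∩ U i := fun i => by rw [hy i]; rfl
    obtain ⟨h5, h6, h7, -⟩ := hUt y fun i => (hyU i).2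
    refine ⟨y, h5, h6, h7, ?_⟩
    have hsub : range y ⊆ φ.pts ∩ Λ ×ˢ univ := by
      rintro _ ⟨i, rfl⟩
      exact ⟨(hyU i).1, hUΛ i (hyU i).2⟩
    have hcard : (φ.pts ∩ Λ ×ˢ univ).encard ≤ (range y).encard := by
      rw [← image_univ, h6.1.encard_image, encard_univ]
      refine (le_of_eq h2).trans ?_
      simp
    have := (finite_range y).eq_of_subset_of_encard_le hsub hcard
    rw [this]
    ext z
    simp

end Model.IsTame

end MarkedGibbs

/-! ### Continuity of births, deaths and innovations -/

namespace MarkedGibbs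

open scoped Classical

lemma image_cons {α : Type} [DecidableEq α] {n : ℕ} (z : α) (x : Fin n → α) :
    Finset.univ.image (Fin.cons z x : Fin (n + 1) → α) = insert z (Finset.univ.image x) := by
  ext w
  simp [Fin.exists_fin_succ, eq_comm]

lemma image_succAbove {α : Type} [DecidableEq α] {n : ℕ} {y : Fin (n + 1) → α} (hy : Function.Injective y)
    (i : Fin (n + 1)) :
    Finset.univ.image (fun k => y (i.succAbove k)) = (Finset.univ.image y).erase (y i) := by
  ext w
  simp only [Finset.mem_image, Finset.mem_univ, true_and, Finset.mem_erase]
  constructor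
  · rintro ⟨k, rfl⟩
    exact ⟨hy.ne (Fin.succAbove_ne i k), _, rfl⟩
  · rintro ⟨h, k, rfl⟩
    obtain ⟨l, rfl⟩ := Fin.exists_succAbove_eq (x := k) (y := i) fun e => h (by rw [e])
    exact ⟨l, rfl⟩

lemma exists_tuple {𝕄 : Type} (φ : Finset (Plane × 𝕄)) :
    ∃ x : Fin φ.card → Plane × 𝕄, Function.Injective x ∧ range x = φ ∧
      Finset.univ.image x = φ := by
  have h : range (fun i => (φ.equivFin.symm i : Plane × 𝕄)) = φ := by
    have := φ.equivFin.symm.surjective.range_comp (Subtype.val : φ → Plane × 𝕄)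
    simpa [Function.comp_def] using this
  exact ⟨_, Subtype.val_injective.comp φ.equivFin.symm.injective, h, by
    rw [← Finset.coe_inj]; simpa using h⟩

namespace Model.IsTame

variable {𝕄 : Type} [MeasurableSpace 𝕄] {ι : Type} [Fintype ι] {X : Model 𝕄 ι}
variable [TopologicalSpace 𝕄] {κ : Type}
variable {c : κ → 𝕄 → 𝕄 → ℝ} {Θ : Set (ι → ℝ)} {D : ℝ} (hX : X.IsTame c Θ D)

include hX

lemma hardCore_insert_congr {s t : Set (Plane × 𝕄)} {z : Plane × 𝕄} (hs : s ∈ X.hardCore)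
    (ht : t ∈ X.hardCore) (h : ∀ w : Plane × 𝕄, dist z.1 w.1 ≤ D → (w ∈ s ↔ w ∈ t)) :
    insert z s ∈ X.hardCore ↔ insert z t ∈ X.hardCore := by
  have key : ∀ s t : Set (Plane × 𝕄), t ∈ X.hardCore →
      (∀ w : Plane × 𝕄, dist z.1 w.1 ≤ D → (w ∈ s ↔ w ∈ t)) →
      insert z s ∈ X.hardCore → insert z t ∈ X.hardCore := by
    intro s t ht h hz
    rw [hX.hardCore_iff] at hz ht ⊢
    rintro a (rfl | ha) b (rfl | hb) hab
    · exact hz _ (Or.inl rfl) _ (Or.inl rfl) hab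
    · exact hz _ (Or.inl rfl) _ (Or.inr ((h b hab).2 hb)) hab
    · exact hz _ (Or.inr ((h a (by rwa [dist_comm])).2 ha)) _ (Or.inl rfl) hab
    · exact ht a ha b hb hab
  exact ⟨key s t ht h, key t s hs fun w hw => (h w hw).symm⟩

lemma papangelou_congr (θ : ι → ℝ) {φ φ' : Finset (Plane × 𝕄)} {z : Plane × 𝕄}
    (hφ : (φ : Set (Plane × 𝕄)) ∈ X.hardCore) (hφ' : (φ' : Set (Plane × 𝕄)) ∈ X.hardCore)
    (h : ∀ w : Plane × 𝕄, dist z.1 w.1 ≤ D → (w ∈ φ ↔ w ∈ φ')) :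
    X.papangelou θ φ z = X.papangelou θ φ' z := by
  unfold papangelou
  rw [hX.incr_congr φ φ' z h]
  exact if_congr (hX.hardCore_insert_congr hφ hφ' h) rfl rfl

lemma birth_congr (θ : ι → ℝ) {φ φ' : Finset (Plane × 𝕄)} {z : Plane × 𝕄}
    (hφ : (φ : Set (Plane × 𝕄)) ∈ X.hardCore) (hφ' : (φ' : Set (Plane × 𝕄)) ∈ X.hardCore)
    (h : ∀ w : Plane × 𝕄, dist z.1 w.1 ≤ D → (w ∈ φ ↔ w ∈ φ')) (j : ι) :
    X.birth θ φ z j = X.birth θ φ' z j := by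
  unfold birth
  rw [hX.papangelou_congr θ hφ hφ' h, hX.incr_congr φ φ' z h]

/-- Far from `φ` the integrand of the innovations is the one of the empty configuration. -/
lemma birth_of_far (θ : ι → ℝ) {φ : Finset (Plane × 𝕄)} {z : Plane × 𝕄}
    (hφ : (φ : Set (Plane × 𝕄)) ∈ X.hardCore) (h : ∀ w ∈ φ, D < dist z.1 w.1) (j : ι) :
    X.birth θ φ z j = X.birth θ ∅ z j :=
  hX.birth_congr θ hφ (by simpa using hX.empty_mem_hardCore) (fun w hw => by
    simp only [Finset.notMem_empty, iff_false]
    exact fun hw' => not_lt.2 hw (h w hw')) j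

lemma exists_papangelou_le : ∃ T : ℝ, 0 < T ∧ ∀ θ ∈ Θ, ∀ φ z, X.papangelou θ φ z ≤ T := by
  obtain ⟨K, -, hK⟩ := hX.stable
  refine ⟨Real.exp K, Real.exp_pos _, fun θ hθ φ z => ?_⟩
  unfold papangelou
  split_ifs with h
  · have := hK θ hθ φ z h
    exact Real.exp_le_exp.2 (by linarith)
  · exact (Real.exp_pos _).le

/-- The Papangelou intensity is bounded by stability and the increment is bounded by a power of the
number of points. -/
lemma exists_birth_le (j : ι) (n : ℕ) : ∃ C : ℝ, 0 ≤ C ∧ ∀ θ ∈ Θ, ∀ (φ : Finset (Plane × 𝕄)) (z : Plane × 𝕄),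
    φ.card ≤ n → |X.birth θ φ z j| ≤ C := by
  obtain ⟨T, hT, h⟩ := hX.exists_papangelou_le
  obtain ⟨a, k, ha, hb⟩ := hX.incr_bound j
  refine ⟨a * ((n : ℝ) + 1) ^ k * T, by positivity, fun θ hθ φ z hn => ?_⟩
  rw [birth, abs_mul, abs_of_nonneg (X.papangelou_nonneg θ φ z)]
  refine mul_le_mul ((hb φ z).trans ?_) (h θ hθ φ z) (X.papangelou_nonneg θ φ z) (by positivity)
  gcongr
  have : (φ.card : ℝ) ≤ n := by exact_mod_cast hn
  linarith

variable [T2Space 𝕄] [BorelSpace 𝕄] [SecondCountableTopology 𝕄] [Finite κ]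

lemma continuousAt_stat {n : ℕ} {x : Fin n → Plane × 𝕄} (hx : x ∈ genericTuples c n) (j : ι) :
    ContinuousAt (fun y : Fin n → Plane × 𝕄 => X.stat (Finset.univ.image y) j) x := by
  have hopen := isOpen_genericTuples hX.continuous_crit n
  have h := (hX.continuousOn_stat n).continuousAt (hopen.mem_nhds hx)
  exact (continuous_apply j).continuousAt.comp h

omit [MeasurableSpace 𝕄] [T2Space 𝕄] [BorelSpace 𝕄] [SecondCountableTopology 𝕄] [Finite κ] hX in
lemma genericTuples_comp {n m : ℕ} {x : Fin n → Plane × 𝕄} (hx : x ∈ genericTuples c n)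
    {e : Fin m → Fin n} (he : Function.Injective e) : (fun k => x (e k)) ∈ genericTuples c m :=
  ⟨hx.1.comp he, hx.2.mono (by rintro _ ⟨k, rfl⟩; exact ⟨e k, rfl⟩)⟩

/-- The added point is entry `0` of the tuple: the increment is the difference between the
statistics of a generic tuple and of its tail, and the hard core indicator is locally constant. -/
lemma continuousAt_birth_tuple (θ : ι → ℝ) {n : ℕ} {u : Fin (n + 1) → Plane × 𝕄}
    (hu : u ∈ genericTuples c (n + 1)) (j : ι) :
    ContinuousAt (fun v : Fin (n + 1) → Plane × 𝕄 =>
      X.birth θ (Finset.univ.image (Fin.tail v)) (v 0) j) u := by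
  have h1 : ∀ j, ContinuousAt (fun v : Fin (n + 1) → Plane × 𝕄 =>
      X.incr (Finset.univ.image (Fin.tail v)) (v 0) j) u := by
    intro j
    have e : (fun v : Fin (n + 1) → Plane × 𝕄 => X.incr (Finset.univ.image (Fin.tail v)) (v 0) j)
        = fun v => X.stat (Finset.univ.image v) j - X.stat (Finset.univ.image (Fin.tail v)) j := by
      funext v
      rw [incr, ← image_cons, Fin.cons_self_tail]
    rw [e]
    refine (hX.continuousAt_stat hu j).sub ?_
    exact ContinuousAt.comp (f := fun v : Fin (n + 1) → Plane × 𝕄 => Fin.tail v)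
      (hX.continuousAt_stat (genericTuples_comp hu (Fin.succ_injective n)) j)
      (Continuous.continuousAt (by unfold Fin.tail; fun_prop))
  have h2 : ContinuousAt (fun v : Fin (n + 1) → Plane × 𝕄 =>
      X.papangelou θ (Finset.univ.image (Fin.tail v)) (v 0)) u := by
    have hr : ∀ v : Fin (n + 1) → Plane × 𝕄,
        insert (v 0) ((Finset.univ.image (Fin.tail v) : Finset (Plane × 𝕄)) : Set (Plane × 𝕄))
          = range v := by
      intro v
      rw [← Finset.coe_insert, ← image_cons, Fin.cons_self_tail]
      simp
    by_cases hc : range u ∈ X.hardCore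
    · have : ContinuousAt (fun v : Fin (n + 1) → Plane × 𝕄 =>
          Real.exp (-∑ j, θ j * X.incr (Finset.univ.image (Fin.tail v)) (v 0) j)) u :=
        Real.continuous_exp.continuousAt.comp
          (tendsto_finsetSum _ fun j _ => (h1 j).const_mul _).neg
      refine this.congr ?_
      filter_upwards [hX.eventually_hardCore_iff hu] with v hv
      rw [papangelou, hr, if_pos (hv.2 hc)]
    · refine (continuousAt_const (y := (0 : ℝ))).congr ?_
      filter_upwards [hX.eventually_hardCore_iff hu] with v hv
      rw [papangelou, hr, if_neg fun h => hc (hv.1 h)]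
  exact (h1 j).mul h2

lemma ae_cons_mem [IsProbabilityMeasure X.markLaw] {n : ℕ} {x : Fin n → Plane × 𝕄}
    (hx : x ∈ genericTuples c n) :
    ∀ᵐ z ∂X.mu, (Fin.cons z x : Fin (n + 1) → Plane × 𝕄) ∈ genericTuples c (n + 1) := by
  have hr : ((Finset.univ.image x : Finset (Plane × 𝕄)) : Set (Plane × 𝕄)) = range x := by simp
  have h := IsGeneric.ae_insert hX.continuous_crit X.markLaw (φ := Finset.univ.image x)
    (by rw [hr]; exact hx.2)
  filter_upwards [h] with z hz
  refine ⟨Fin.cons_injective_iff.2 ⟨?_, hx.1⟩, ?_⟩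
  · simpa using hz.1
  · rw [Fin.range_cons, ← hr]
    exact hz.2

variable [IsProbabilityMeasure X.markLaw]

/-- The integrand is continuous on the open set of the points which keep the configuration generic,
a set of full measure. -/
lemma aestronglyMeasurable_birth (θ : ι → ℝ) {φ : Finset (Plane × 𝕄)}
    (hφ : IsGeneric c (φ : Set (Plane × 𝕄))) (j : ι) :
    AEStronglyMeasurable (fun z => X.birth θ φ z j) X.mu := by
  obtain ⟨x, hx, hxr, hxi⟩ := exists_tuple φ
  have hxg : x ∈ genericTuples c φ.card := ⟨hx, by rwa [hxr]⟩
  set O := {z : Plane × 𝕄 | (Fin.cons z x : Fin (φ.card + 1) → Plane × 𝕄) ∈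
    genericTuples c (φ.card + 1)} with hO
  have hcons : Continuous fun z : Plane × 𝕄 => (Fin.cons z x : Fin (φ.card + 1) → Plane × 𝕄) := by
    refine continuous_pi fun i => ?_
    cases i using Fin.cases
    · simp only [Fin.cons_zero]
      fun_prop
    · simp only [Fin.cons_succ]
      fun_prop
  have hOo : IsOpen O := (isOpen_genericTuples hX.continuous_crit _).preimage hcons
  have hc : ContinuousOn (fun z => X.birth θ φ z j) O := by
    intro z hz
    refine ContinuousAt.continuousWithinAt ?_
    have := ContinuousAt.comp (f := fun z : Plane × 𝕄 =>
      (Fin.cons z x : Fin (φ.card + 1) → Plane × 𝕄)) (hX.continuousAt_birth_tuple θ hz j)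
      hcons.continuousAt
    simpa [Function.comp_def, hxi] using this
  have := hc.aestronglyMeasurable (μ := X.mu) hOo.measurableSet
  rwa [Measure.restrict_eq_self_of_ae_mem (s := O) (hX.ae_cons_mem hxg)] at this

lemma integrableOn_birth {θ : ι → ℝ} (hθ : θ ∈ Θ) {φ : Finset (Plane × 𝕄)}
    (hφ : IsGeneric c (φ : Set (Plane × 𝕄))) (j : ι) {Λ : Set Plane}
    (hΛ : Bornology.IsBounded Λ) :
    IntegrableOn (fun z => X.birth θ φ z j) (Λ ×ˢ univ) X.mu := by
  obtain ⟨C, -, hC⟩ := hX.exists_birth_le j φ.card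
  exact IntegrableOn.of_bound (X.mu_lt_top hΛ) (hX.aestronglyMeasurable_birth θ hφ j).restrict C
    (Eventually.of_forall fun z => hC θ hθ φ z le_rfl)

/-- Deleting the point `i` of an injective tuple is precomposition with `i.succAbove`, so the deaths
are a finite sum of statistics of generic tuples. -/
lemma continuousAt_death {n : ℕ} {x : Fin n → Plane × 𝕄} (hx : x ∈ genericTuples c n) (j : ι) :
    ContinuousAt (fun y : Fin n → Plane × 𝕄 => X.death (Finset.univ.image y) j) x := by
  rcases n with _ | n
  · exact continuousAt_const.congr (Eventually.of_forall fun y => by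
      rw [Subsingleton.elim y x])
  have h : ContinuousAt (fun y : Fin (n + 1) → Plane × 𝕄 => ∑ i : Fin (n + 1), (X.stat (Finset.univ.image y) j -
      X.stat (Finset.univ.image fun k => y (Fin.succAbove i k)) j)) x := by
    refine tendsto_finsetSum _ fun i _ => (hX.continuousAt_stat hx j).sub ?_
    exact ContinuousAt.comp (f := fun (y : Fin (n + 1) → Plane × 𝕄) k => y (i.succAbove k))
      (hX.continuousAt_stat (genericTuples_comp hx Fin.succAbove_right_injective) j)
      (Continuous.continuousAt (by fun_prop))
  refine h.congr ?_
  filter_upwards [(isOpen_genericTuples hX.continuous_crit _).mem_nhds hx] with y hy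
  rw [death, Finset.sum_image hy.1.injOn]
  refine Finset.sum_congr rfl fun i _ => ?_
  rw [image_succAbove hy.1, incr, Finset.insert_erase (Finset.mem_image_of_mem _
    (Finset.mem_univ i))]

/-- Dominated convergence: births are continuous in the tuple for almost every added point, they
cancel against those of the empty configuration beyond distance `D` of the tuple, and they are
bounded on a disc which serves for all nearby tuples. -/
lemma continuousAt_innov {θ : ι → ℝ} (hθ : θ ∈ Θ) {n : ℕ} {x : Fin n → Plane × 𝕄}
    (hx : x ∈ genericTuples c n) (hxc : range x ∈ X.hardCore) (j : ι) :
    ContinuousAt (fun y : Fin n → Plane × 𝕄 => X.innov θ (Finset.univ.image y) j) x := by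
  refine ContinuousAt.sub ?_ (hX.continuousAt_death hx j)
  obtain ⟨C, hC0, hC⟩ := hX.exists_birth_le j n
  obtain ⟨r, hr⟩ := (finite_range fun i => ‖(x i).1‖).bddAbove
  have hr : ∀ i, ‖(x i).1‖ ≤ r := fun i => hr ⟨i, rfl⟩
  have hg : ∀ᶠ y in 𝓝 x, y ∈ genericTuples c n :=
    (isOpen_genericTuples hX.continuous_crit _).mem_nhds hx
  have hnear : ∀ᶠ y in 𝓝 x, ∀ i, ‖(y i).1‖ < r + 1 := by
    rw [eventually_all]
    exact fun i => ContinuousAt.eventually_lt (f := fun y : Fin n → Plane × 𝕄 => ‖(y i).1‖)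
      (Continuous.continuousAt (by fun_prop)) continuousAt_const (by have := hr i; linarith)
  set B : Set (Plane × 𝕄) := Metric.closedBall (0 : Plane) (r + 1 + D) ×ˢ univ with hB
  have hBm : MeasurableSet B := Metric.isClosed_closedBall.measurableSet.prod MeasurableSet.univ
  refine continuousAt_of_dominated (bound := B.indicator fun _ => C + C) ?_ ?_ ?_ ?_
  · filter_upwards [hg] with y hy
    refine (hX.aestronglyMeasurable_birth θ (by simpa using hy.2) j).sub ?_
    exact hX.aestronglyMeasurable_birth θ (by simpa using isGeneric_empty c) j
  · filter_upwards [hnear, hX.eventually_hardCore_iff hx] with y hy hyc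
    refine Eventually.of_forall fun z => ?_
    by_cases hz : z ∈ B
    · rw [indicator_of_mem hz, Real.norm_eq_abs]
      refine (abs_sub _ _).trans (add_le_add (hC θ hθ _ z ?_) (hC θ hθ _ z (by simp)))
      simpa using Finset.card_image_le (s := Finset.univ) (f := y)
    · rw [indicator_of_notMem hz, hX.birth_of_far θ (by simpa using hyc.2 hxc), sub_self, norm_zero]
      intro w hw
      obtain ⟨i, -, rfl⟩ := Finset.mem_image.1 hw
      by_contra h
      refine hz ⟨?_, mem_univ _⟩
      rw [Metric.mem_closedBall, dist_zero_right]
      have h1 := hy i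
      have h2 : ‖z.1‖ ≤ dist z.1 (y i).1 + ‖(y i).1‖ := by
        rw [dist_eq_norm]
        simpa using norm_add_le (z.1 - (y i).1) (y i).1
      linarith [not_lt.1 h]
  · rw [integrable_indicator_iff hBm]
    exact integrableOn_const (X.mu_lt_top Metric.isBounded_closedBall).ne
  · filter_upwards [hX.ae_cons_mem hx] with z hz
    refine ContinuousAt.sub ?_ continuousAt_const
    have hcons : Continuous fun y : Fin n → Plane × 𝕄 =>
        (Fin.cons z y : Fin (n + 1) → Plane × 𝕄) := by
      refine continuous_pi fun i => ?_
      cases i using Fin.cases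
      · simp only [Fin.cons_zero]
        fun_prop
      · simp only [Fin.cons_succ]
        fun_prop
    have := ContinuousAt.comp (f := fun y : Fin n → Plane × 𝕄 =>
      (Fin.cons z y : Fin (n + 1) → Plane × 𝕄)) (hX.continuousAt_birth_tuple θ hz j)
      hcons.continuousAt
    simpa [Function.comp_def] using this

end Model.IsTame

end MarkedGibbs

/-! ### Linear independence as an open condition; unions of squares -/

namespace MarkedGibbs

open scoped Classical

section LinearAlgebra

variable {ι : Type} [Fintype ι]

/-- The rows span the whole space, so the difference of two vectors with the same image is
orthogonal to everything, itself included. -/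
lemma mulVec_injective_of_linearIndependent {f : Fin (Fintype.card ι) → ι → ℝ}
    (hf : LinearIndependent ℝ f) : Function.Injective (Matrix.of f).mulVec := by
  have hs : Submodule.span ℝ (range f) = ⊤ :=
    hf.span_eq_top_of_card_eq_finrank' (by simp)
  intro u v huv
  have h : ∀ w : ι → ℝ, w ⬝ᵥ (u - v) = 0 := by
    intro w
    have hw : w ∈ Submodule.span ℝ (range f) := hs ▸ Submodule.mem_top
    induction hw using Submodule.span_induction with
    | mem w hw =>
      obtain ⟨i, rfl⟩ := hw
      have := congrFun huv i
      simp only [Matrix.mulVec, Matrix.of_apply] at this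
      rw [dotProduct_sub, sub_eq_zero]
      exact this
    | zero => simp
    | add a b _ _ ha hb => rw [add_dotProduct, ha, hb, add_zero]
    | smul r a _ ha => rw [smul_dotProduct, ha, smul_zero]
  exact sub_eq_zero.1 (dotProduct_self_eq_zero.1 (h _))

/-- From functions whose values at given points have no common annihilator one can choose a family
which is linearly independent at all nearby points. -/
lemma exists_nhds_linearIndependent {α : Type} {Y : α → Type} [∀ a, TopologicalSpace (Y a)]
    (f : ∀ a, Y a → ι → ℝ) (y : ∀ a, Y a) (hf : ∀ a, ContinuousAt (f a) (y a))
    (hspan : ∀ v : ι → ℝ, (∀ a, ∑ j, v j * f a (y a) j = 0) → v = 0) :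
    ∃ (s : Fin (Fintype.card ι) → α) (W : ∀ i, Set (Y (s i))), (∀ i, W i ∈ 𝓝 (y (s i))) ∧
      ∀ w : ∀ i, Y (s i), (∀ i, w i ∈ W i) → LinearIndependent ℝ fun i => f (s i) (w i) := by
  -- A proper subspace is contained in the kernel of a nonzero linear form, whose coordinates are a
  -- common annihilator.
  have htop : Submodule.span ℝ (range fun a => f a (y a)) = ⊤ := by
    by_contra h
    obtain ⟨g, hg, hle⟩ := Submodule.exists_le_ker_of_lt_top _ (lt_top_iff_ne_top.2 h)
    have hgv : ∀ u : ι → ℝ, g u = ∑ j, g (Pi.single j 1) * u j := by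
      intro u
      conv_lhs => rw [pi_eq_sum_univ' u]
      rw [map_sum]
      refine Finset.sum_congr rfl fun j _ => ?_
      rw [map_smul, smul_eq_mul, mul_comm]
    refine hg (LinearMap.ext fun u => ?_)
    have := hspan (fun j => g (Pi.single j 1)) fun a => by
      rw [← hgv]
      exact hle (Submodule.subset_span ⟨a, rfl⟩)
    rw [hgv]
    simp [funext_iff] at this
    simp [this]
  -- Extract a basis from the spanning values, then use that independent families form an open set.
  obtain ⟨β, a, -, ha, hli⟩ := exists_linearIndependent' ℝ fun a => f a (y a)
  rw [htop] at ha
  let b : Module.Basis β ℝ (ι → ℝ) := Module.Basis.mk hli ha.ge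
  have : Fintype β := FiniteDimensional.fintypeBasisIndex b
  have hcard : Fintype.card (Fin (Fintype.card ι)) = Fintype.card β := by
    rw [← Module.finrank_eq_card_basis b]
    simp
  let e : Fin (Fintype.card ι) ≃ β := Fintype.equivOfCardEq hcard
  have hli' : LinearIndependent ℝ fun i => f (a (e i)) (y (a (e i))) := hli.comp e e.injective
  have hopen : IsOpen {g : Fin (Fintype.card ι) → ι → ℝ | LinearIndependent ℝ g} :=
    isOpen_setOfPred_linearIndependent
  have hc : ContinuousAt (fun (w : ∀ i, Y (a (e i))) i => f (a (e i)) (w i))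
      fun i => y (a (e i)) := by
    refine continuousAt_pi.2 fun i => ?_
    exact ContinuousAt.comp (f := fun w : ∀ i, Y (a (e i)) => w i) (hf (a (e i)))
      (continuous_apply i).continuousAt
  have h := hc.preimage_mem_nhds (hopen.mem_nhds hli')
  rw [nhds_pi, Filter.mem_pi'] at h
  obtain ⟨I, t, ht, htW⟩ := h
  exact ⟨fun i => a (e i), t, ht, fun w hw => htW fun i _ => hw i⟩

end LinearAlgebra

lemma mem_cells_iff {d : ℝ} (hd : 0 < d) (ρ : ℕ) (u : Plane) :
    u ∈ cells d ρ ↔ ∀ j, |u j| ≤ d * (ρ + 1 / 2) := by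
  simp only [cells, mem_iUnion, cell, exists_prop]
  constructor
  · rintro ⟨i, hi, hu⟩ j
    obtain ⟨h1, h2⟩ := hu j
    obtain ⟨h3, h4⟩ := abs_le.1 (hi j)
    have h3' : -(ρ : ℝ) ≤ i j := by exact_mod_cast h3
    have h4' : (i j : ℝ) ≤ ρ := by exact_mod_cast h4
    rw [abs_le]
    constructor
    · nlinarith
    · nlinarith
  · intro h
    have key : ∀ j, ∃ i : ℤ, |i| ≤ (ρ : ℤ) ∧ d * ((i : ℝ) - 1 / 2) ≤ u j ∧
        u j ≤ d * ((i : ℝ) + 1 / 2) := by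
      intro j
      obtain ⟨h1, h2⟩ := abs_le.1 (h j)
      -- On this edge the floor used below would give `ρ + 1`, a square outside the range.
      by_cases hc : u j = d * (ρ + 1 / 2)
      · refine ⟨ρ, by simp, ?_, ?_⟩
        · rw [hc]
          push_cast
          nlinarith
        · rw [hc]
          push_cast
          exact le_rfl
      have h2' : u j < d * (ρ + 1 / 2) := lt_of_le_of_ne h2 hc
      have e : d * (u j / d) = u j := by field_simp
      have f1 := Int.floor_le (u j / d + 1 / 2)
      have f2 := Int.lt_floor_add_one (u j / d + 1 / 2)
      refine ⟨⌊u j / d + 1 / 2⌋, abs_le.2 ⟨?_, ?_⟩, ?_, ?_⟩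
      · refine Int.le_floor.2 ?_
        push_cast
        have : -(ρ + 1 / 2) ≤ u j / d := by
          rw [le_div_iff₀ hd]
          linarith
        linarith
      · refine Int.lt_add_one_iff.1 (Int.floor_lt.2 ?_)
        push_cast
        have : u j / d < ρ + 1 / 2 := by
          rw [div_lt_iff₀ hd]
          linarith
        linarith
      · refine le_of_le_of_eq ?_ e
        exact mul_le_mul_of_nonneg_left (by linarith) hd.le
      · refine le_of_eq_of_le e.symm ?_
        exact mul_le_mul_of_nonneg_left (by linarith) hd.le
    choose i hi hu using key
    exact ⟨i, hi, hu⟩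

lemma isBounded_cells {d : ℝ} (hd : 0 < d) (ρ : ℕ) : Bornology.IsBounded (cells d ρ) := by
  refine (Metric.isBounded_closedBall (x := (0 : Plane)) (r := 2 * (d * (ρ + 1 / 2)))).subset ?_
  intro u hu
  rw [mem_cells_iff hd] at hu
  rw [mem_closedBall_zero_iff, EuclideanSpace.norm_eq, Fin.sum_univ_two]
  have h0 := hu 0
  have h1 := hu 1
  refine Real.sqrt_le_iff.2 ⟨by positivity, ?_⟩
  simp only [Real.norm_eq_abs]
  nlinarith [abs_nonneg (u 0), abs_nonneg (u 1)]

lemma measurableSet_cells {d : ℝ} (hd : 0 < d) (ρ : ℕ) : MeasurableSet (cells d ρ) := by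
  have : cells d ρ = {u : Plane | ∀ j, |u j| ≤ d * (ρ + 1 / 2)} := by
    ext u
    exact mem_cells_iff hd ρ u
  rw [this, ofPred_forall]
  exact MeasurableSet.iInter fun j =>
    (isClosed_le (by fun_prop) continuous_const).measurableSet

lemma abs_apply_le_norm (u : Plane) (j : Fin 2) : |u j| ≤ ‖u‖ := by
  simpa using PiLp.norm_apply_le u j

/-! ### [Mod], [Ident] and [SDP] for tame models -/

namespace Model.IsTame

variable {𝕄 : Type} [MeasurableSpace 𝕄] {ι : Type} [Fintype ι] {X : Model 𝕄 ι}
variable [TopologicalSpace 𝕄] {κ : Type}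
variable {c : κ → 𝕄 → 𝕄 → ℝ} {Θ : Set (ι → ℝ)} {D : ℝ} (hX : X.IsTame c Θ D)

include hX

theorem mod [IsProbabilityMeasure X.markLaw] : X.Mod Θ D := by
  have hb : ∀ (φ : Config 𝕄) (m : 𝕄) (w : Plane × 𝕄), dist (((0 : Plane), m) : Plane × 𝕄).1 w.1 ≤ D →
      (w ∈ φ.pts ↔ w ∈ φ.inBall D) := by
    intro φ m w hw
    simp only [dist_zero_left] at hw
    simp [Config.inBall, hw]
  refine ⟨hX.range_pos.le, ?_, ?_, ?_⟩
  · obtain ⟨K, hK0, hK⟩ := hX.stable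
    refine ⟨K, hK0, fun θ hθ m φ hφ => ?_⟩
    rw [localEnergy]
    split_ifs with h
    · rw [EReal.coe_le_coe_iff, hX.localStat_singleton (ψ := φ.inBall D) (hb φ m)]
      refine hK θ hθ _ _ (hX.hardCore_mono h ?_)
      rintro w (rfl | hw)
      · exact Or.inl (by simp)
      · simp only [Config.inBall, Finite.coe_toFinset] at hw
        exact Or.inr hw.1
    · exact le_top
  · intro θ hθ m φ hφ
    have hc := (hX.mem_admissible_iff hθ).1 hφ.2
    have hc' : (φ.restrict (Metric.closedBall 0 D)).pts ∈ X.hardCore :=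
      hX.hardCore_mono hc fun z hz => hz.1
    have hw : ∀ w : Plane × 𝕄, dist (((0 : Plane), m) : Plane × 𝕄).1 w.1 ≤ D →
        (w ∈ φ.pts ↔ w ∈ (φ.restrict (Metric.closedBall 0 D)).pts) := by
      intro w hw
      simp only [dist_zero_left] at hw
      simp [Config.restrict, hw]
    have := hX.hardCore_insert_congr (z := ((0 : Plane), m)) hc hc' hw
    rw [localEnergy, localEnergy, hX.localStat_singleton (ψ := φ.inBall D) (hb φ m),
      hX.localStat_singleton (ψ := φ.inBall D) (φ := φ.restrict (Metric.closedBall 0 D))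
        (fun w h => (hw w h).symm.trans (hb φ m w h))]
    refine if_congr ?_ rfl rfl
    simpa [Config.addPts] using this
  · intro j
    obtain ⟨a, k, ha, h⟩ := hX.incr_bound j
    refine ⟨a, k, ha, fun θ hθ m φ hφ => ?_⟩
    rw [hX.localStat_singleton (ψ := φ.inBall D) (hb φ m)]
    exact (le_abs_self _).trans (h _ _)

variable [T2Space 𝕄] [BorelSpace 𝕄] [SecondCountableTopology 𝕄] [Finite κ]
variable [IsProbabilityMeasure X.markLaw] [X.markLaw.IsOpenPosMeasure]

theorem ident {θ : ι → ℝ} (hθ : θ ∈ Θ) {P : Measure (Config 𝕄)} (hP : X.IsStationaryGibbs θ P)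
    (hspan : ∀ v : ι → ℝ, (∀ (m : 𝕄) (φ : Finset (Plane × 𝕄)), ((0 : Plane), m) ∉ φ →
      IsGeneric c (insert ((0 : Plane), m) (φ : Set (Plane × 𝕄))) →
      (φ : Set (Plane × 𝕄)) ∈ X.hardCore → ∑ j, v j * X.incr φ ((0 : Plane), m) j = 0) → v = 0) :
    X.Ident θ P := by
  have hPp := hP.isProbabilityMeasure
  -- The candidates for rows: a mark at the origin and a pattern around it, jointly generic. Only
  -- the pattern has to respect the hard core, because [Ident] involves the statistics and not the
  -- energy of the added point.
  let α := {q : Σ n, 𝕄 × (Fin n → Plane × 𝕄) //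
    (Fin.cons ((0 : Plane), q.2.1) q.2.2 : Fin (q.1 + 1) → Plane × 𝕄) ∈ genericTuples c (q.1 + 1) ∧
      range q.2.2 ∈ X.hardCore}
  let f : ∀ a : α, 𝕄 × (Fin a.1.1 → Plane × 𝕄) → ι → ℝ := fun a y =>
    X.incr (Finset.univ.image y.2) ((0 : Plane), y.1)
  have htail : ∀ a : α, a.1.2.2 ∈ genericTuples c a.1.1 := fun a =>
    genericTuples_comp (e := Fin.succ) a.2.1 (Fin.succ_injective _)
  have hf : ∀ a : α, ContinuousAt (f a) a.1.2 := by
    intro a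
    refine continuousAt_pi.2 fun j => ?_
    have hcons : Continuous fun y : 𝕄 × (Fin a.1.1 → Plane × 𝕄) =>
        (Fin.cons ((0 : Plane), y.1) y.2 : Fin (a.1.1 + 1) → Plane × 𝕄) := by
      refine continuous_pi fun i => ?_
      cases i using Fin.cases
      · simp only [Fin.cons_zero]
        fun_prop
      · simp only [Fin.cons_succ]
        fun_prop
    have h1 := ContinuousAt.comp (f := fun y : 𝕄 × (Fin a.1.1 → Plane × 𝕄) =>
      (Fin.cons ((0 : Plane), y.1) y.2 : Fin (a.1.1 + 1) → Plane × 𝕄)) (x := a.1.2)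
      (hX.continuousAt_stat a.2.1 j) hcons.continuousAt
    have h2 := ContinuousAt.comp (f := fun y : 𝕄 × (Fin a.1.1 → Plane × 𝕄) => y.2) (x := a.1.2)
      (hX.continuousAt_stat (htail a) j) continuous_snd.continuousAt
    refine (h1.sub h2).congr (Eventually.of_forall fun y => ?_)
    simp only [f, incr, ← image_cons]
    rfl
  obtain ⟨s, W, hW, hli⟩ := exists_nhds_linearIndependent f (fun a => a.1.2) hf (by
    intro v hv
    refine hspan v fun m φ hm hφ hc => ?_
    obtain ⟨x, hx, hxr, hxi⟩ := exists_tuple φ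
    have hcons : (Fin.cons ((0 : Plane), m) x : Fin (φ.card + 1) → Plane × 𝕄) ∈
        genericTuples c (φ.card + 1) :=
      ⟨Fin.cons_injective_iff.2 ⟨by rw [hxr]; simpa using hm, hx⟩, by rwa [Fin.range_cons, hxr]⟩
    have := hv ⟨⟨φ.card, m, x⟩, hcons, by rwa [hxr]⟩
    simpa only [f, hxi] using this)
  have hWp : ∀ i, ∃ (U : Set 𝕄) (V : Set (Fin (s i).1.1 → Plane × 𝕄)), IsOpen U ∧
      (s i).1.2.1 ∈ U ∧ V ∈ 𝓝 (s i).1.2.2 ∧ U ×ˢ V ⊆ W i := by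
    intro i
    obtain ⟨U, hU, V, hV, h⟩ := mem_nhds_prod_iff.1 (hW i)
    obtain ⟨U', hU', hUo, hUm⟩ := mem_nhds_iff.1 hU
    exact ⟨U', V, hUo, hUm, hV, (prod_mono_left hU').trans h⟩
  choose U V hUo hUm hV hUV using hWp
  have hA : ∀ i, ∃ A : Set (Config 𝕄), MeasurableSet A ∧ A ⊆ X.admissible θ ∧ 0 < P A ∧
      ∀ φ ∈ A, ∃ y ∈ V i, ∀ m, X.localStat {((0 : Plane), m)} φ = f (s i) (m, y) := by
    intro i
    obtain ⟨r, hr⟩ := (finite_range fun k => ‖((s i).1.2.2 k).1‖).bddAbove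
    have hr : ∀ k, ‖((s i).1.2.2 k).1‖ ≤ r := fun k => hr ⟨k, rfl⟩
    -- The radius leaves a margin `D + 1` around the pattern, and `max r 0` ensures that the disc
    -- contains everything within `D` of the origin.
    obtain ⟨A, h1, h2, h3, h4⟩ := hX.exists_event hθ hP
      (Λ := Metric.closedBall 0 (max r 0 + D + 1)) Metric.isClosed_closedBall.measurableSet
      Metric.isBounded_closedBall (htail (s i)) (s i).2.2 (D' := D + 1) (by linarith) (by
        intro k u hu
        rw [mem_closedBall_zero_iff]
        have h5 : ‖u‖ ≤ dist u ((s i).1.2.2 k).1 + ‖((s i).1.2.2 k).1‖ := by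
          rw [dist_eq_norm]
          simpa using norm_add_le (u - ((s i).1.2.2 k).1) ((s i).1.2.2 k).1
        linarith [hr k, le_max_left r 0]) (hV i)
    refine ⟨A, h1, h2, h3, fun φ hφ => ?_⟩
    obtain ⟨-, y, hyV, -, -, hy⟩ := h4 φ hφ
    refine ⟨y, hyV, fun m => hX.localStat_singleton fun w hw => ?_⟩
    have hwΛ : w.1 ∈ Metric.closedBall (0 : Plane) (max r 0 + D + 1) := by
      rw [mem_closedBall_zero_iff]
      simp only [dist_zero_left] at hw
      linarith [le_max_right r 0]
    have : w ∈ φ.pts ↔ w ∈ range y := by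
      rw [← hy]
      exact ⟨fun h => ⟨h, hwΛ⟩, fun h => h.1⟩
    simpa using this
  choose A hAm hAa hAp hAs using hA
  have hli2 : ∀ (m : Fin (Fintype.card ι) → 𝕄) (φ : Fin (Fintype.card ι) → Config 𝕄),
      (∀ i, m i ∈ U i ∧ φ i ∈ A i) →
      LinearIndependent ℝ fun i => X.localStat {((0 : Plane), m i)} (φ i) := by
    intro m φ h
    choose y hyV hy using fun i => hAs i (φ i) (h i).2
    have := hli (fun i => (m i, y i)) fun i => hUV i ⟨(h i).1, hyV i⟩
    simpa only [← hy] using this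
  refine ⟨Fintype.card ι, le_rfl, U, A, fun i => (hUo i).measurableSet,
    fun i => ⟨hAm i, hAa i⟩, ?_, ?_, ?_⟩
  -- Disjointness is free: a common element of two of the products would make two rows of an
  -- independent family equal.
  · intro i i' hii'
    rw [disjoint_left]
    rintro ⟨m, φ⟩ ⟨h1, h2⟩ ⟨h3, h4⟩
    have hne : ∀ k, (A k).Nonempty := fun k => nonempty_of_measure_ne_zero (hAp k).ne'
    choose φ' hφ' using hne
    have h := hli2 (fun k => if k = i ∨ k = i' then m else (s k).1.2.1)
      (fun k => if k = i ∨ k = i' then φ else φ' k) (by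
        intro k
        split_ifs with h
        · rcases h with rfl | rfl
          · exact ⟨h1, h2⟩
          · exact ⟨h3, h4⟩
        · exact ⟨hUm k, hφ' k⟩)
    exact hii' (h.injective (by simp))
  · intro i
    rw [Measure.prod_prod]
    exact ENNReal.mul_pos ((hUo i).measure_pos _ ⟨_, hUm i⟩).ne' (hAp i).ne'
  · intro m φ h
    exact mulVec_injective_of_linearIndependent (hli2 m φ h)

/-- `Λ` contains the `D`-neighbourhood of `S`, so that the gradient on `S` depends only on the
pattern seen in `Λ`. -/
lemma gradLPL_eq (θ : ι → ℝ) {φ : Config 𝕄} (hφ : φ.pts ∈ X.hardCore) {n : ℕ}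
    {y : Fin n → Plane × 𝕄} (hyc : range y ∈ X.hardCore) {S Λ : Set Plane}
    (hS : MeasurableSet S) (hSΛ : ∀ u ∈ S, ∀ v, dist u v ≤ D → v ∈ Λ) (hyS : ∀ i, (y i).1 ∈ S)
    (hy : {z ∈ φ.pts | z.1 ∈ Λ} = range y) (j : ι) :
    X.gradLPL θ S φ j =
      ∫ z in S ×ˢ univ, X.birth θ (Finset.univ.image y) z j ∂X.mu
        - X.death (Finset.univ.image y) j := by
  have hagree : ∀ u ∈ S, ∀ w : Plane × 𝕄, dist u w.1 ≤ D →
      (w ∈ φ.pts ↔ w ∈ Finset.univ.image y) := by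
    intro u hu w hw
    have : w ∈ φ.pts ↔ w ∈ range y := by
      rw [← hy]
      exact ⟨fun h => ⟨h, hSΛ u hu _ hw⟩, fun h => h.1⟩
    simpa using this
  have hsub : (φ.restrict S).pts = ((Finset.univ.image y : Finset (Plane × 𝕄)) : Set (Plane × 𝕄)) := by
    ext w
    constructor
    · intro h
      exact (hagree w.1 h.2 w (by simpa using hX.range_pos.le)).1 h.1
    · intro h
      have h' : w ∈ range y := by simpa using h
      refine ⟨?_, ?_⟩
      · rw [← hy] at h'
        exact h'.1
      · obtain ⟨i, rfl⟩ := h'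
        exact hyS i
  rw [gradLPL]
  congr 1
  · refine setIntegral_congr_fun (hS.prod MeasurableSet.univ) ?_
    intro z hz
    have h1 := hX.localStat_singleton (hagree z.1 hz.1)
    have hyc' : ((Finset.univ.image y : Finset (Plane × 𝕄)) : Set (Plane × 𝕄)) ∈ X.hardCore := by
      simpa using hyc
    have h2 : (X.weight θ {z} φ).toReal = X.papangelou θ (Finset.univ.image y) z := by
      have h3 := hX.hardCore_insert_congr hφ hyc' (hagree z.1 hz.1)
      have h4 : (φ.addPts {z}).pts = insert z φ.pts := by simp [Config.addPts]
      rw [papangelou]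
      split_ifs with h
      · rw [weight_of_mem θ (by rw [h4]; exact h3.2 h), h1,
          ENNReal.toReal_ofReal (Real.exp_pos _).le]
      · rw [weight_of_notMem θ (by rw [h4]; exact fun h' => h (h3.1 h'))]
        simp
    simp only [h2, h1, birth]
  · rw [hsub, finsum_mem_coe_finset]
    refine Finset.sum_congr rfl fun x hx => ?_
    have hxS : x.1 ∈ S := by
      have : x ∈ (φ.restrict S).pts := by rw [hsub]; exact hx
      exact this.2
    rw [hX.localStat_singleton (ψ := (Finset.univ.image y).erase x)]
    intro w hw
    rw [Finset.mem_erase, ← hagree x.1 hxS w hw]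
    simp [Config.erase, and_comm]

/-- The reference event consists of configurations with no point in a large square, the others of
configurations with only a small central pattern there. The difference of the gradients is then
exactly the innovation of the pattern. -/
theorem sdp {θ : ι → ℝ} (hθ : θ ∈ Θ) {P : Measure (Config 𝕄)} (hP : X.IsStationaryGibbs θ P)
    (hspan : ∀ v : ι → ℝ, (∀ φ : Finset (Plane × 𝕄), IsGeneric c (φ : Set (Plane × 𝕄)) →
      (φ : Set (Plane × 𝕄)) ∈ X.hardCore → ∑ j, v j * X.innov θ φ j = 0) → v = 0) :
    X.SDP θ P D := by
  have hD := hX.range_pos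
  let α := {q : Σ n, Fin n → Plane × 𝕄 // q.2 ∈ genericTuples c q.1 ∧ range q.2 ∈ X.hardCore}
  let f : ∀ a : α, (Fin a.1.1 → Plane × 𝕄) → ι → ℝ := fun a y =>
    X.innov θ (Finset.univ.image y)
  obtain ⟨s, W, hW, hli⟩ := exists_nhds_linearIndependent f (fun a => a.1.2)
    (fun a => continuousAt_pi.2 fun j => hX.continuousAt_innov hθ a.2.1 a.2.2 j) (by
      intro v hv
      refine hspan v fun φ hφ hc => ?_
      obtain ⟨x, hx, hxr, hxi⟩ := exists_tuple φ
      have := hv ⟨⟨φ.card, x⟩, ⟨hx, by rwa [hxr]⟩, by rwa [hxr]⟩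
      simpa only [f, hxi] using this)
  obtain ⟨r, hr⟩ := (finite_range fun p : Σ i, Fin (s i).1.1 => ‖((s p.1).1.2 p.2).1‖).bddAbove
  have hr : ∀ i k, ‖((s i).1.2 k).1‖ ≤ r := fun i k => hr ⟨⟨i, k⟩, rfl⟩
  -- The side is large enough for the chosen patterns and their small perturbations to lie in the
  -- open central square `T`; `max r 0` keeps it positive when there are no points.
  set d : ℝ := 2 * max r 0 + 2 with hd
  have hd0 : 0 < d := by
    have := le_max_right r 0
    linarith
  set ρ : ℕ := ⌈D / d⌉₊ with hρ
  have hρD : D ≤ ρ * d := by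
    have := Nat.le_ceil (D / d)
    rwa [div_le_iff₀ hd0] at this
  -- Its half side exceeds that of the central square by `2 * ρ * d ≥ 2 * D`, and that of `cells d
  -- ρ` by `ρ * d ≥ D`.
  set Λ := cells d (2 * ρ) with hΛ
  set T : Set Plane := {u | ∀ j, |u j| < d / 2} with hT
  have hTnhds : ∀ i, {y : Fin (s i).1.1 → Plane × 𝕄 | ∀ k, (y k).1 ∈ T} ∈ 𝓝 (s i).1.2 := by
    intro i
    have : ∀ᶠ y in 𝓝 (s i).1.2, ∀ k, ∀ j, |(y k).1 j| < d / 2 := by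
      rw [eventually_all]
      intro k
      rw [eventually_all]
      intro j
      refine ContinuousAt.eventually_lt (f := fun y : Fin (s i).1.1 → Plane × 𝕄 => |(y k).1 j|)
        (Continuous.continuousAt (by fun_prop)) continuousAt_const ?_
      have h1 := abs_apply_le_norm ((s i).1.2 k).1 j
      have h2 := hr i k
      have h3 := le_max_left r 0
      linarith
    exact this
  have hTΛ : ∀ t ∈ T, ∀ u, dist u t ≤ 2 * D → u ∈ Λ := by
    intro t ht u hu
    rw [hΛ, mem_cells_iff hd0]
    intro j
    have h1 := abs_apply_le_norm (u - t) j
    rw [← dist_eq_norm] at h1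
    have h2 : |u j| ≤ |(u - t) j| + |t j| := by
      have : u j = (u - t) j + t j := by simp
      rw [this]
      exact abs_add_le _ _
    have h3 := ht j
    push_cast
    linarith
  have hcΛ : ∀ t ∈ cells d ρ, ∀ u, dist t u ≤ D → u ∈ Λ := by
    intro t ht u hu
    rw [hΛ, mem_cells_iff hd0]
    rw [mem_cells_iff hd0] at ht
    intro j
    have h1 := abs_apply_le_norm (u - t) j
    rw [← dist_eq_norm, dist_comm] at h1
    have h2 : |u j| ≤ |(u - t) j| + |t j| := by
      have : u j = (u - t) j + t j := by simp
      rw [this]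
      exact abs_add_le _ _
    have h3 := ht j
    push_cast
    linarith
  have hTc : ∀ t ∈ T, t ∈ cells d ρ := by
    intro t ht
    rw [mem_cells_iff hd0]
    intro j
    have := ht j
    have : 0 ≤ d * (ρ : ℝ) := by positivity
    linarith
  -- The coordinates of the points of the pattern are less than `d / 2` in absolute value, so the
  -- only square which can contain one of them is that with index `0`.
  have hempty : ∀ {n : ℕ} {y : Fin n → Plane × 𝕄} {φ : Config 𝕄}, (∀ k, (y k).1 ∈ T) →
      {z ∈ φ.pts | z.1 ∈ Λ} = range y → ∀ i : Fin 2 → ℤ, i ≠ 0 →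
      (∀ j, |i j| ≤ ((2 * ρ : ℕ) : ℤ)) → (φ.restrict (cell d i)).pts = ∅ := by
    intro n y φ hyT hy i hi hiρ
    rw [eq_empty_iff_forall_notMem]
    rintro z ⟨hz, hzc⟩
    have hzΛ : z.1 ∈ Λ := mem_biUnion (show i ∈ {i : Fin 2 → ℤ | ∀ j, |i j| ≤ ((2 * ρ : ℕ) : ℤ)}
      from hiρ) hzc
    have : z ∈ range y := by
      rw [← hy]
      exact ⟨hz, hzΛ⟩
    obtain ⟨k, rfl⟩ := this
    refine hi (funext fun j => ?_)
    have h1 := hyT k j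
    obtain ⟨h2, h3⟩ := hzc j
    obtain ⟨h4, h5⟩ := abs_lt.1 h1
    have h6 : (i j : ℝ) < 1 := by
      by_contra h
      nlinarith [not_lt.1 h]
    have h7 : -1 < (i j : ℝ) := by
      by_contra h
      nlinarith [not_lt.1 h]
    have h6' : i j < 1 := by exact_mod_cast h6
    have h7' : -1 < i j := by exact_mod_cast h7
    simp only [Pi.zero_apply]
    omega
  have hA : ∀ i, ∃ A : Set (Config 𝕄), MeasurableSet A ∧ A ⊆ X.surroundedByVoid θ D d ∧ 0 < P A ∧
      ∀ φ ∈ A, φ.pts ∈ X.hardCore ∧ ∃ y ∈ W i, (∀ k, (y k).1 ∈ T) ∧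
        y ∈ genericTuples c (s i).1.1 ∧ range y ∈ X.hardCore ∧
        {z ∈ φ.pts | z.1 ∈ Λ} = range y := by
    intro i
    obtain ⟨A, h1, h2, h3, h4⟩ := hX.exists_event hθ hP (measurableSet_cells hd0 (2 * ρ))
      (isBounded_cells hd0 (2 * ρ)) (s i).2.1 (s i).2.2 (D' := 2 * D) (by linarith)
      (fun k u hu => hTΛ _ (mem_of_mem_nhds (hTnhds i) k) u hu) (inter_mem (hW i) (hTnhds i))
    refine ⟨A, h1, fun φ hφ => ⟨h2 hφ, ?_⟩, h3, fun φ hφ => ?_⟩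
    · obtain ⟨-, y, ⟨-, hyT⟩, -, -, hy⟩ := h4 φ hφ
      exact hempty hyT hy
    · obtain ⟨h5, y, ⟨hyW, hyT⟩, h6, h7, hy⟩ := h4 φ hφ
      exact ⟨h5, y, hyW, hyT, h6, h7, hy⟩
  choose A hAm hAa hAp hAs using hA
  -- The reference event is given by the empty pattern.
  have h0g : (Fin.elim0 : Fin 0 → Plane × 𝕄) ∈ genericTuples c 0 :=
    ⟨fun i => i.elim0, by simpa using isGeneric_empty c⟩
  obtain ⟨B, hBm, hBa, hBp, hBs⟩ := hX.exists_event hθ hP (measurableSet_cells hd0 (2 * ρ))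
    (isBounded_cells hd0 (2 * ρ)) h0g (by simpa using hX.empty_mem_hardCore) (D' := 2 * D)
    (by linarith) (fun k => k.elim0) univ_mem
  have hBv : B ⊆ X.surroundedByVoid θ D d := by
    intro φ hφ
    obtain ⟨-, y, -, -, -, hy⟩ := hBs φ hφ
    exact ⟨hBa hφ, hempty (fun k => k.elim0) hy⟩
  have hrow : ∀ i, ∀ φ ∈ A i, ∃ y ∈ W i, ∀ φ₀ ∈ B, ∀ j,
      X.gradLPL θ (cells d ρ) φ j - X.gradLPL θ (cells d ρ) φ₀ j = f (s i) y j := by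
    intro i φ hφ
    obtain ⟨hc, y, hyW, hyT, hyg, hyc, hy⟩ := hAs i φ hφ
    refine ⟨y, hyW, fun φ₀ hφ₀ j => ?_⟩
    obtain ⟨hc₀, y₀, -, -, hyc₀, hy₀⟩ := hBs φ₀ hφ₀
    have hS := measurableSet_cells hd0 ρ
    have hSb := isBounded_cells hd0 ρ
    rw [hX.gradLPL_eq θ hc hyc hS hcΛ (fun k => hTc _ (hyT k)) hy j,
      hX.gradLPL_eq θ hc₀ hyc₀ hS hcΛ (fun k => k.elim0) hy₀ j]
    have e0 : Finset.univ.image y₀ = ∅ := by simp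
    have ed : X.death ∅ j = 0 := by simp [death]
    rw [e0, ed, sub_zero, sub_right_comm, ← integral_sub
      (hX.integrableOn_birth hθ (by simpa using hyg.2) j hSb)
      (hX.integrableOn_birth hθ (by simpa using isGeneric_empty c) j hSb)]
    simp only [f, innov]
    congr 1
    -- Outside `cells d ρ` the points are farther than `D` from the pattern, so the births cancel
    -- and the integral extends to the whole space.
    refine setIntegral_eq_integral_of_forall_compl_eq_zero fun z hz => ?_
    rw [hX.birth_of_far θ (by simpa using hyc), sub_self]
    intro w hw
    obtain ⟨k, -, rfl⟩ := Finset.mem_image.1 hw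
    by_contra h
    refine hz ⟨?_, mem_univ _⟩
    rw [mem_cells_iff hd0]
    intro j
    have h1 := abs_apply_le_norm (z.1 - (y k).1) j
    rw [← dist_eq_norm] at h1
    have h2 : |z.1 j| ≤ |(z.1 - (y k).1) j| + |(y k).1 j| := by
      have : z.1 j = (z.1 - (y k).1) j + (y k).1 j := by simp
      rw [this]
      exact abs_add_le _ _
    have h3 := hyT k j
    linarith [not_lt.1 h]
  have hli2 : ∀ (φ : Fin (Fintype.card ι) → Config 𝕄), (∀ i, φ i ∈ A i) → ∀ φ₀ ∈ B,
      LinearIndependent ℝ fun i => (fun j => X.gradLPL θ (cells d ρ) (φ i) j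
        - X.gradLPL θ (cells d ρ) φ₀ j) := by
    intro φ h φ₀ h₀
    choose y hyW hy using fun i => hrow i (φ i) (h i)
    have := hli y hyW
    have e : (fun i => f (s i) (y i)) = fun i => (fun j => X.gradLPL θ (cells d ρ) (φ i) j
        - X.gradLPL θ (cells d ρ) φ₀ j) := by
      funext i j
      rw [hy i φ₀ h₀ j]
    rwa [e] at this
  have hne : ∀ k, (A k).Nonempty := fun k => nonempty_of_measure_ne_zero (hAp k).ne'
  obtain ⟨φ₁, hφ₁⟩ : B.Nonempty := nonempty_of_measure_ne_zero hBp.ne'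
  choose φ' hφ' using hne
  -- A common configuration would give a zero row.
  have hd1 : ∀ i, Disjoint B (A i) := by
    intro i
    rw [disjoint_left]
    intro φ h0 h1
    have h := hli2 (fun k => if k = i then φ else φ' k) (by
      intro k
      split_ifs with h
      · rw [h]; exact h1
      · exact hφ' k) φ h0
    refine h.ne_zero i ?_
    funext j
    simp
  have hd2 : ∀ i i', i ≠ i' → Disjoint (A i) (A i') := by
    intro i i' hii'
    rw [disjoint_left]
    intro φ h1 h2
    have h := hli2 (fun k => if k = i ∨ k = i' then φ else φ' k) (by
      intro k
      split_ifs with h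
      · rcases h with rfl | rfl
        · exact h1
        · exact h2
      · exact hφ' k) φ₁ hφ₁
    exact hii' (h.injective (by simp))
  refine ⟨d, hd0, Fintype.card ι, le_rfl, Fin.cons B A, ?_, ?_, ?_, ?_⟩
  · intro i
    cases i using Fin.cases
    · exact ⟨hBm, hBv⟩
    · exact ⟨hAm _, hAa _⟩
  · intro i i' hii'
    cases i using Fin.cases <;> cases i' using Fin.cases
    · exact (hii' rfl).elim
    · exact hd1 _
    · exact (hd1 _).symm
    · exact hd2 _ _ fun e => hii' (congrArg Fin.succ e)
  · intro i
    cases i using Fin.cases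
    · exact hBp
    · exact hAp _
  · intro φ hφ
    exact mulVec_injective_of_linearIndependent
      (hli2 (fun i => φ i.succ) (fun i => hφ i.succ) (φ 0) (hφ 0))

end Model.IsTame

end MarkedGibbs

/-! ### Growth of a statistic along an annihilating direction -/

namespace MarkedGibbs

open scoped Classical

/-- Harmonic sums are `o(n)`, as Cesàro sums of a sequence tending to zero; the constant takes care
of the first indices. -/
lemma exists_sum_one_div_le {ε : ℝ} (hε : 0 < ε) :
    ∃ C : ℝ, ∀ n : ℕ, ∑ i ∈ Finset.range n, (1 : ℝ) / (i + 1) ≤ ε * n + C := by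
  have h := (tendsto_one_div_add_atTop_nhds_zero_nat (𝕜 := ℝ)).cesaro
  obtain ⟨N, hN⟩ := eventually_atTop.1 (h.eventually (gt_mem_nhds hε))
  have hmono : ∀ {n m : ℕ}, n ≤ m → ∑ i ∈ Finset.range n, (1 : ℝ) / (i + 1)
      ≤ ∑ i ∈ Finset.range m, (1 : ℝ) / (i + 1) := fun h =>
    Finset.sum_le_sum_of_subset_of_nonneg (Finset.range_mono h) fun _ _ _ => by positivity
  refine ⟨∑ i ∈ Finset.range N, (1 : ℝ) / (i + 1), fun n => ?_⟩
  have h0 : 0 ≤ ∑ i ∈ Finset.range N, (1 : ℝ) / (i + 1) :=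
    Finset.sum_nonneg fun _ _ => by positivity
  rcases le_total n N with hn | hn
  · have := hmono hn
    have : 0 ≤ ε * n := by positivity
    linarith
  · rcases Nat.eq_zero_or_pos n with rfl | hpos
    · simpa using h0
    have h1 := hN n hn
    have hn' : (0 : ℝ) < n := by exact_mod_cast hpos
    rw [inv_mul_lt_iff₀ hn'] at h1
    linarith

namespace Model.IsTame

variable {𝕄 : Type} [MeasurableSpace 𝕄] {ι : Type} [Fintype ι] {X : Model 𝕄 ι}
variable [TopologicalSpace 𝕄] {κ : Type}
variable {c : κ → 𝕄 → 𝕄 → ℝ} {Θ : Set (ι → ℝ)} {D : ℝ} (hX : X.IsTame c Θ D)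
variable [T2Space 𝕄] [BorelSpace 𝕄] [SecondCountableTopology 𝕄] [Finite κ]
variable [IsProbabilityMeasure X.markLaw]

include hX

/-- Points are added one at a time: almost every point keeps the tuple generic, and a nonempty open
set has positive measure. -/
lemma exists_generic_fin [X.markLaw.IsOpenPosMeasure] {n : ℕ} {U : Fin n → Set (Plane × 𝕄)}
    (hU : ∀ i, IsOpen (U i)) (hne : ∀ i, (U i).Nonempty) :
    ∃ x ∈ genericTuples c n, ∀ i, x i ∈ U i := by
  induction n with
  | zero => exact ⟨Fin.elim0, ⟨fun i => i.elim0, by simpa using isGeneric_empty c⟩, fun i => i.elim0⟩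
  | succ n ih =>
    obtain ⟨x, hx, hxU⟩ := ih (U := fun i => U i.succ) (fun i => hU _) fun i => hne _
    have h1 : ∃ᵐ z ∂X.mu, z ∈ U 0 := by
      rw [frequently_ae_mem_iff]
      exact ((hU 0).measure_pos _ (hne 0)).ne'
    obtain ⟨z, hz, hzx⟩ := (h1.and_eventually (hX.ae_cons_mem hx)).exists
    refine ⟨Fin.cons z x, hzx, fun i => ?_⟩
    cases i using Fin.cases
    · exact hz
    · exact hxU _

/-- There are generic configurations close to any given one. -/
lemma exists_generic [X.markLaw.IsOpenPosMeasure] {α : Type} [Fintype α] {U : α → Set (Plane × 𝕄)}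
    (hU : ∀ i, IsOpen (U i)) (hne : ∀ i, (U i).Nonempty) :
    ∃ x : α → Plane × 𝕄, Function.Injective x ∧ IsGeneric c (range x) ∧ ∀ i, x i ∈ U i := by
  let e := Fintype.equivFin α
  obtain ⟨x, hx, hxU⟩ := hX.exists_generic_fin (U := fun i => U (e.symm i)) (fun i => hU _)
    fun i => hne _
  refine ⟨fun i => x (e i), hx.1.comp e.injective, ?_, fun i => by simpa using hxU (e i)⟩
  have : range (fun i => x (e i)) = range x := e.surjective.range_comp x
  rw [this]
  exact hx.2

lemma integrable_birth_sub {θ : ι → ℝ} (hθ : θ ∈ Θ) {φ : Finset (Plane × 𝕄)}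
    (hφ : IsGeneric c (φ : Set (Plane × 𝕄))) (hc : (φ : Set (Plane × 𝕄)) ∈ X.hardCore) (j : ι) :
    Integrable (fun z => X.birth θ φ z j - X.birth θ ∅ z j) X.mu := by
  obtain ⟨r, hr⟩ := (φ.finite_toSet.image fun w => ‖w.1‖).bddAbove
  have hr : ∀ w ∈ φ, ‖w.1‖ ≤ r := fun w hw => hr ⟨w, hw, rfl⟩
  have hb : Bornology.IsBounded (Metric.closedBall (0 : Plane) (r + D)) :=
    Metric.isBounded_closedBall
  have h := (hX.integrableOn_birth hθ hφ j hb).sub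
    (hX.integrableOn_birth hθ (φ := ∅) (by simpa using isGeneric_empty c) j hb)
  refine h.integrable_of_forall_notMem_eq_zero fun z hz => ?_
  simp only [Pi.sub_apply]
  rw [hX.birth_of_far θ hc, sub_self]
  intro w hw
  by_contra h
  refine hz ⟨?_, mem_univ _⟩
  rw [mem_closedBall_zero_iff]
  have h2 : ‖z.1‖ ≤ dist z.1 w.1 + ‖w.1‖ := by
    rw [dist_eq_norm]
    simpa using norm_add_le (z.1 - w.1) w.1
  linarith [not_lt.1 h, hr w hw]

/-- The balance equation on which every verification of [SDP] rests. -/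
lemma sum_death_eq {θ : ι → ℝ} (hθ : θ ∈ Θ) {φ : Finset (Plane × 𝕄)}
    (hφ : IsGeneric c (φ : Set (Plane × 𝕄))) (hc : (φ : Set (Plane × 𝕄)) ∈ X.hardCore) {v : ι → ℝ}
    (hv : ∑ j, v j * X.innov θ φ j = 0) :
    ∑ j, v j * X.death φ j =
      ∫ z, (∑ j, v j * X.birth θ φ z j - ∑ j, v j * X.birth θ ∅ z j) ∂X.mu := by
  have h1 : ∀ z, ∑ j, v j * X.birth θ φ z j - ∑ j, v j * X.birth θ ∅ z j
      = ∑ j, v j * (X.birth θ φ z j - X.birth θ ∅ z j) := by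
    intro z
    rw [← Finset.sum_sub_distrib]
    exact Finset.sum_congr rfl fun j _ => by ring
  simp only [h1]
  rw [integral_finsetSum _ fun j _ => (hX.integrable_birth_sub hθ hφ hc j).const_mul _]
  simp only [integral_const_mul]
  simp only [innov, mul_sub, Finset.sum_sub_distrib] at hv
  linarith

lemma sum_birth_of_far (θ : ι → ℝ) {φ : Finset (Plane × 𝕄)}
    (hc : (φ : Set (Plane × 𝕄)) ∈ X.hardCore) (v : ι → ℝ) {r : ℝ} (hr : ∀ w ∈ φ, ‖w.1‖ ≤ r)
    {z : Plane × 𝕄} (hz : z ∉ Metric.closedBall (0 : Plane) (r + D) ×ˢ (univ : Set 𝕄)) :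
    ∑ j, v j * X.birth θ φ z j - ∑ j, v j * X.birth θ ∅ z j = 0 := by
  rw [sub_eq_zero]
  refine Finset.sum_congr rfl fun j _ => ?_
  rw [hX.birth_of_far θ hc]
  intro w hw
  by_contra h
  refine hz ⟨?_, mem_univ _⟩
  rw [mem_closedBall_zero_iff]
  have h2 : ‖z.1‖ ≤ dist z.1 w.1 + ‖w.1‖ := by
    rw [dist_eq_norm]
    simpa using norm_add_le (z.1 - w.1) w.1
  linarith [not_lt.1 h, hr w hw]

/-- In the balance equation the excess births vanish beyond distance `D` of the configuration, so a
bound on births costs only the area of a disc. -/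
lemma abs_sum_death_le {θ : ι → ℝ} (hθ : θ ∈ Θ) {φ : Finset (Plane × 𝕄)}
    (hφ : IsGeneric c (φ : Set (Plane × 𝕄))) (hc : (φ : Set (Plane × 𝕄)) ∈ X.hardCore) {v : ι → ℝ}
    (hv : ∑ j, v j * X.innov θ φ j = 0) {r : ℝ} (hr : ∀ w ∈ φ, ‖w.1‖ ≤ r) {C C₀ : ℝ}
    (hC : ∀ z, |∑ j, v j * X.birth θ φ z j| ≤ C) (hC₀ : ∀ z, |∑ j, v j * X.birth θ ∅ z j| ≤ C₀) :
    |∑ j, v j * X.death φ j| ≤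
      (C + C₀) * (volume (Metric.closedBall (0 : Plane) (r + D))).toReal := by
  rw [hX.sum_death_eq hθ hφ hc hv,
    ← setIntegral_eq_integral_of_forall_compl_eq_zero fun z hz => hX.sum_birth_of_far θ hc v hr hz,
    ← Real.norm_eq_abs]
  refine (norm_setIntegral_le_of_norm_le_const (X.mu_lt_top Metric.isBounded_closedBall)
    (C := C + C₀) fun z _ => ?_).trans (le_of_eq ?_)
  · rw [Real.norm_eq_abs]
    exact (abs_sub _ _).trans (add_le_add (hC z) (hC₀ z))
  · rw [measureReal_def, mu_prod_univ]

omit [TopologicalSpace 𝕄] [T2Space 𝕄] [BorelSpace 𝕄] [SecondCountableTopology 𝕄] [Finite κ]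
  [IsProbabilityMeasure X.markLaw] hX in
lemma sum_mul_death (v : ι → ℝ) (φ : Finset (Plane × 𝕄)) :
    ∑ j, v j * X.death φ j = ∑ x ∈ φ, (∑ j, v j * X.stat φ j - ∑ j, v j * X.stat (φ.erase x) j) := by
  simp only [death, Finset.mul_sum]
  rw [Finset.sum_comm]
  refine Finset.sum_congr rfl fun x hx => ?_
  rw [← Finset.sum_sub_distrib]
  refine Finset.sum_congr rfl fun j _ => ?_
  rw [incr, Finset.insert_erase hx, mul_sub]

/-- If the innovations have no component along `v` and the increments of the statistic along `v`
have bounded weights then this statistic grows at most logarithmically. -/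
lemma exists_stat_le {θ : ι → ℝ} (hθ : θ ∈ Θ) {v : ι → ℝ}
    (hv : ∀ φ : Finset (Plane × 𝕄), IsGeneric c (φ : Set (Plane × 𝕄)) →
      (φ : Set (Plane × 𝕄)) ∈ X.hardCore → ∑ j, v j * X.innov θ φ j = 0) {C : ℝ}
    (hC : ∀ φ : Finset (Plane × 𝕄), IsGeneric c (φ : Set (Plane × 𝕄)) →
      (φ : Set (Plane × 𝕄)) ∈ X.hardCore → ∀ z, |∑ j, v j * X.birth θ φ z j| ≤ C) (r : ℝ) :
    ∃ C' : ℝ, 0 ≤ C' ∧ ∀ φ : Finset (Plane × 𝕄), IsGeneric c (φ : Set (Plane × 𝕄)) →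
      (φ : Set (Plane × 𝕄)) ∈ X.hardCore → (∀ w ∈ φ, ‖w.1‖ ≤ r) →
      ∑ j, v j * X.stat φ j ≤ ∑ j, v j * X.stat ∅ j +
        C' * ∑ i ∈ Finset.range φ.card, (1 : ℝ) / (i + 1) := by
  have h0 := hC ∅ (by simpa using isGeneric_empty c) (by simpa using hX.empty_mem_hardCore)
  set C' := (C + C) * (volume (Metric.closedBall (0 : Plane) (r + D))).toReal with hC'
  have key : ∀ n : ℕ, ∀ φ : Finset (Plane × 𝕄), φ.card = n → IsGeneric c (φ : Set (Plane × 𝕄)) →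
      (φ : Set (Plane × 𝕄)) ∈ X.hardCore → (∀ w ∈ φ, ‖w.1‖ ≤ r) →
      ∑ j, v j * X.stat φ j ≤ ∑ j, v j * X.stat ∅ j +
        C' * ∑ i ∈ Finset.range n, (1 : ℝ) / (i + 1) := by
    intro n
    induction n with
    | zero =>
      intro φ h _ _ _
      rw [Finset.card_eq_zero] at h
      simp [h]
    | succ n ih =>
      intro φ hn hφ hc hr
      have h1 := (le_abs_self _).trans
        (hX.abs_sum_death_le hθ hφ hc (hv φ hφ hc) hr (hC φ hφ hc) h0)
      rw [sum_mul_death, ← hC'] at h1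
      have hne : φ.Nonempty := by
        rw [← Finset.card_pos]
        omega
      -- The `n + 1` decrements have a sum at most `C'`, so one of them is at most the average.
      -- Removing that point and iterating produces the harmonic sum.
      have h2 : ∃ x ∈ φ, ∑ j, v j * X.stat φ j - ∑ j, v j * X.stat (φ.erase x) j
          ≤ C' * (1 / ((n : ℝ) + 1)) := by
        by_contra! h
        have := Finset.sum_lt_sum_of_nonempty hne h
        rw [Finset.sum_const, hn, nsmul_eq_mul] at this
        push_cast at this
        have e : ((n : ℝ) + 1) * (C' * (1 / ((n : ℝ) + 1))) = C' := by field_simp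
        linarith
      obtain ⟨x, hx, hxC⟩ := h2
      have hs : ((φ.erase x : Finset (Plane × 𝕄)) : Set (Plane × 𝕄)) ⊆ φ :=
        Finset.coe_subset.2 (Finset.erase_subset x φ)
      have := ih (φ.erase x) (by rw [Finset.card_erase_of_mem hx, hn]; rfl) (hφ.mono hs)
        (hX.hardCore_mono hc hs) fun w hw => hr w (hs hw)
      rw [Finset.sum_range_succ, mul_add]
      linarith
  -- That `C` is nonnegative needs a point at which to read the bound; there is one because the
  -- space of marks carries a probability and cannot be empty.
  exact ⟨C', mul_nonneg (by linarith [(abs_nonneg _).trans (h0 (Classical.choice (by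
      by_contra h
      rw [not_nonempty_iff] at h
      have : IsEmpty 𝕄 := ⟨fun m => h.elim ((0 : Plane), m)⟩
      exact (IsProbabilityMeasure.ne_zero X.markLaw) (Measure.eq_zero_of_isEmpty _))))])
    ENNReal.toReal_nonneg, fun φ hφ hc hr => key _ φ rfl hφ hc hr⟩

/-- Under the same hypotheses, a statistic which grows linearly along a family of configurations
has a nonpositive slope. -/
lemma slope_nonpos {θ : ι → ℝ} (hθ : θ ∈ Θ) {v : ι → ℝ}
    (hv : ∀ φ : Finset (Plane × 𝕄), IsGeneric c (φ : Set (Plane × 𝕄)) →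
      (φ : Set (Plane × 𝕄)) ∈ X.hardCore → ∑ j, v j * X.innov θ φ j = 0) {C : ℝ}
    (hC : ∀ φ : Finset (Plane × 𝕄), IsGeneric c (φ : Set (Plane × 𝕄)) →
      (φ : Set (Plane × 𝕄)) ∈ X.hardCore → ∀ z, |∑ j, v j * X.birth θ φ z j| ≤ C) {a b r : ℝ} {B : ℕ}
    (h : ∀ n : ℕ, ∃ φ : Finset (Plane × 𝕄), IsGeneric c (φ : Set (Plane × 𝕄)) ∧
      (φ : Set (Plane × 𝕄)) ∈ X.hardCore ∧ (∀ w ∈ φ, ‖w.1‖ ≤ r) ∧ φ.card ≤ B * n ∧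
      a * n ≤ ∑ j, v j * X.stat φ j + b) : a ≤ 0 := by
  obtain ⟨C', hC'0, hC'⟩ := hX.exists_stat_le hθ hv hC r
  by_contra! ha
  -- Chosen so that the bound on the harmonic sum uses at most half of the slope `a`.
  set ε : ℝ := a / (2 * (C' + 1) * (B + 1)) with hε
  have hε0 : 0 < ε := by positivity
  obtain ⟨E, hE⟩ := exists_sum_one_div_le hε0
  have hεB : C' * (ε * B) ≤ a / 2 := by
    have h1 : (C' + 1) * (ε * (B + 1)) = a / 2 := by
      rw [hε]
      field_simp
    have h2 : C' * (ε * B) ≤ (C' + 1) * (ε * (B + 1)) := by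
      gcongr <;> linarith
    linarith
  set F := ∑ j, v j * X.stat ∅ j + b + C' * E with hF
  obtain ⟨n, hn⟩ := exists_nat_gt (F / (a / 2))
  rw [div_lt_iff₀ (by positivity)] at hn
  obtain ⟨φ, h1, h2, h3, h4, h5⟩ := h n
  have h6 := hC' φ h1 h2 h3
  have h7 : ∑ i ∈ Finset.range φ.card, (1 : ℝ) / (i + 1) ≤ ε * (B * n) + E := by
    refine (hE φ.card).trans ?_
    have : (φ.card : ℝ) ≤ B * n := by exact_mod_cast h4
    gcongr
  have h8 := mul_le_mul_of_nonneg_left h7 hC'0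
  have h9 : C' * (ε * (B * n)) ≤ a / 2 * n := by
    have := mul_le_mul_of_nonneg_right hεB (Nat.cast_nonneg (α := ℝ) n)
    linarith
  linarith

/-- A maximum principle: if the innovations have no component along `v`, the statistic along `v`
cannot be bounded on bounded regions and take values of the order of the area. -/
lemma false_of_stat_ge {θ : ι → ℝ} (hθ : θ ∈ Θ) {v : ι → ℝ}
    (hv : ∀ φ : Finset (Plane × 𝕄), IsGeneric c (φ : Set (Plane × 𝕄)) →
      (φ : Set (Plane × 𝕄)) ∈ X.hardCore → ∑ j, v j * X.innov θ φ j = 0) {C : ℝ}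
    (hC : ∀ φ : Finset (Plane × 𝕄), IsGeneric c (φ : Set (Plane × 𝕄)) →
      (φ : Set (Plane × 𝕄)) ∈ X.hardCore → ∀ z, |∑ j, v j * X.birth θ φ z j| ≤ C)
    (hfin : ∀ L : ℝ, {t : ℝ | ∃ φ : Finset (Plane × 𝕄), IsGeneric c (φ : Set (Plane × 𝕄)) ∧
      (φ : Set (Plane × 𝕄)) ∈ X.hardCore ∧ (∀ w ∈ φ, ‖w.1‖ ≤ L) ∧
      ∑ j, v j * X.stat φ j = t}.Finite) {δ : ℝ} (hδ : 0 < δ)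
    (hgap : ∀ φ z, 0 < ∑ j, v j * X.incr φ z j → δ ≤ ∑ j, v j * X.incr φ z j) {C₁ b : ℝ}
    (hC₁ : ∀ φ : Finset (Plane × 𝕄), ∑ j, v j * X.stat φ j ≤ C₁ * φ.card)
    (hκ : ∀ L : ℝ, 0 ≤ ∫ z in Metric.closedBall (0 : Plane) L ×ˢ univ,
      ∑ j, v j * X.birth θ ∅ z j ∂X.mu) {s a : ℝ} (hs : 0 < s) (ha : 0 < a)
    (h : ∀ n : ℕ, ∃ φ : Finset (Plane × 𝕄), IsGeneric c (φ : Set (Plane × 𝕄)) ∧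
      (φ : Set (Plane × 𝕄)) ∈ X.hardCore ∧ (∀ w ∈ φ, ‖w.1‖ ≤ s * (n + 1)) ∧
      a * n ^ 2 ≤ ∑ j, v j * X.stat φ j + b) : False := by
  have hD := hX.range_pos
  have h0 := hC ∅ (by simpa using isGeneric_empty c) (by simpa using hX.empty_mem_hardCore)
  set V₁ := (volume (Metric.ball (0 : Plane) 1)).toReal with hV₁
  have hV₁0 : 0 ≤ V₁ := ENNReal.toReal_nonneg
  have hvol : ∀ L : ℝ, 0 ≤ L →
      (volume (Metric.closedBall (0 : Plane) L)).toReal = L ^ 2 * V₁ := by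
    intro L hL
    rw [Measure.addHaar_closedBall _ _ hL, ENNReal.toReal_mul, ENNReal.toReal_ofReal (by positivity)]
    simp [hV₁]
  -- The left side bounds from below the maximum of `H` on a disc of radius `L`; the right side
  -- bounds it from above through the number of points of a maximizer, itself controlled by the area
  -- of an annulus of width `D`, which is linear in `n`.
  have key : ∀ n : ℕ, a * n ^ 2 - b ≤
      |C₁| * ((C + C) * (((s * (n + 1) + D) ^ 2 - (s * (n + 1)) ^ 2) * V₁) / δ) := by
    intro n
    set L := s * ((n : ℝ) + 1) with hL
    have hL0 : 0 ≤ L := by positivity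
    let S : Set (Finset (Plane × 𝕄)) := {φ | IsGeneric c (φ : Set (Plane × 𝕄)) ∧
      (φ : Set (Plane × 𝕄)) ∈ X.hardCore ∧ ∀ w ∈ φ, ‖w.1‖ ≤ L}
    let H : Finset (Plane × 𝕄) → ℝ := fun φ => ∑ j, v j * X.stat φ j
    obtain ⟨φ₀, hφ₀1, hφ₀2, hφ₀3, hφ₀4⟩ := h n
    have hmax : ∃ φ ∈ S, ∀ ψ ∈ S, H ψ ≤ H φ := by
      have hf : (H '' S).Finite := (hfin L).subset (by
        rintro _ ⟨φ, ⟨h1, h2, h3⟩, rfl⟩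
        exact ⟨φ, h1, h2, h3, rfl⟩)
      obtain ⟨_, ⟨φ, hφ, rfl⟩, hm⟩ := hf.exists_maximal ⟨_, φ₀, ⟨hφ₀1, hφ₀2, hφ₀3⟩, rfl⟩
      refine ⟨φ, hφ, fun ψ hψ => ?_⟩
      by_contra! h
      exact (hm ⟨ψ, hψ, rfl⟩ h.le).not_gt h
    -- A maximizer with as few points as possible: removing any of its points strictly decreases
    -- `H`, hence decreases it by at least `δ`.
    obtain ⟨φ, ⟨hφS, hφm⟩, hmin⟩ := exists_minimal_of_wellFoundedLT
      (α := ℕ) (fun k => ∃ φ, (φ ∈ S ∧ ∀ ψ ∈ S, H ψ ≤ H φ) ∧ φ.card = k) (by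
        obtain ⟨φ, h1, h2⟩ := hmax
        exact ⟨_, φ, ⟨h1, h2⟩, rfl⟩) |>.elim (fun k hk => by
          obtain ⟨φ, h1, h2⟩ := hk.1
          exact (⟨φ, h1, fun ψ hψ => by
            by_contra! hlt
            have := hk.2 ⟨ψ, hψ, rfl⟩ (by omega)
            omega⟩ : ∃ φ, (φ ∈ S ∧ ∀ ψ ∈ S, H ψ ≤ H φ) ∧
              ∀ ψ, (ψ ∈ S ∧ ∀ χ ∈ S, H χ ≤ H ψ) → φ.card ≤ ψ.card))
    have hsum := hX.sum_death_eq hθ hφS.1 hφS.2.1 (hv φ hφS.1 hφS.2.1)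
    rw [sum_mul_death] at hsum
    have hlow : δ * φ.card ≤ ∑ x ∈ φ, (H φ - H (φ.erase x)) := by
      rw [mul_comm, ← nsmul_eq_mul, ← Finset.sum_const]
      refine Finset.sum_le_sum fun x hx => ?_
      have hsub : ((φ.erase x : Finset (Plane × 𝕄)) : Set (Plane × 𝕄)) ⊆ φ :=
        Finset.coe_subset.2 (Finset.erase_subset x φ)
      have hxS : φ.erase x ∈ S := ⟨hφS.1.mono hsub, hX.hardCore_mono hφS.2.1 hsub,
        fun w hw => hφS.2.2 w (hsub hw)⟩
      have e : H φ - H (φ.erase x) = ∑ j, v j * X.incr (φ.erase x) x j := by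
        simp only [H, incr, Finset.insert_erase hx, mul_sub, Finset.sum_sub_distrib]
      rw [e]
      refine hgap _ _ ?_
      rw [← e, sub_pos]
      refine lt_of_le_of_ne (hφm _ hxS) fun he => ?_
      have := hmin (φ.erase x) ⟨hxS, fun χ hχ => by rw [he]; exact hφm χ hχ⟩
      rw [Finset.card_erase_of_mem hx] at this
      have : 0 < φ.card := Finset.card_pos.2 ⟨x, hx⟩
      omega
    set g : Plane × 𝕄 → ℝ := fun z =>
      ∑ j, v j * X.birth θ φ z j - ∑ j, v j * X.birth θ ∅ z j with hg
    set B₁ : Set (Plane × 𝕄) := Metric.closedBall (0 : Plane) L ×ˢ univ with hB₁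
    set B₂ : Set (Plane × 𝕄) := Metric.closedBall (0 : Plane) (L + D) ×ˢ univ with hB₂
    have hB₁m : MeasurableSet B₁ := Metric.isClosed_closedBall.measurableSet.prod MeasurableSet.univ
    have hB₂m : MeasurableSet B₂ := Metric.isClosed_closedBall.measurableSet.prod MeasurableSet.univ
    have hB₁₂ : B₁ ⊆ B₂ := prod_mono_left (Metric.closedBall_subset_closedBall (by linarith))
    have hgi : Integrable g X.mu := by
      have : g = fun z => ∑ j, v j * (X.birth θ φ z j - X.birth θ ∅ z j) := by
        funext z
        simp only [hg, mul_sub, Finset.sum_sub_distrib]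
      rw [this]
      exact integrable_finsetSum _ fun j _ => (hX.integrable_birth_sub hθ hφS.1 hφS.2.1 j).const_mul _
    have hint : ∀ ψ : Finset (Plane × 𝕄), IsGeneric c (ψ : Set (Plane × 𝕄)) →
        IntegrableOn (fun z => ∑ j, v j * X.birth θ ψ z j) B₁ X.mu := fun ψ hψ =>
      integrable_finsetSum _ fun j _ =>
        (hX.integrableOn_birth hθ hψ j Metric.isBounded_closedBall).const_mul _
    -- In the disc, adding an allowed point to the maximizer cannot increase `H`, so its births are
    -- nonpositive almost everywhere, while `hκ` gives the sign of those of the empty configuration.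
    have h1 : ∫ z in B₁, g z ∂X.mu ≤ 0 := by
      rw [hg, integral_sub (hint φ hφS.1) (hint ∅ (by simpa using isGeneric_empty c))]
      have h2 : ∫ z in B₁, ∑ j, v j * X.birth θ φ z j ∂X.mu ≤ 0 := by
        refine integral_nonpos_of_ae ?_
        rw [EventuallyLE, ae_restrict_iff' hB₁m]
        have := hφS.1.ae_insert hX.continuous_crit X.markLaw
        filter_upwards [this] with z hz hzB
        have e : ∑ j, v j * X.birth θ φ z j = (H (insert z φ) - H φ) * X.papangelou θ φ z := by
          simp only [H, birth, incr, ← Finset.sum_sub_distrib, Finset.sum_mul]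
          exact Finset.sum_congr rfl fun j _ => by ring
        simp only [Pi.zero_apply]
        rw [e]
        by_cases hcz : insert z (φ : Set (Plane × 𝕄)) ∈ X.hardCore
        · refine mul_nonpos_of_nonpos_of_nonneg ?_ (X.papangelou_nonneg _ _ _)
          rw [sub_nonpos]
          refine hφm _ ⟨by simpa using hz.2, by simpa using hcz, ?_⟩
          intro w hw
          rcases Finset.mem_insert.1 hw with rfl | hw
          · simpa using hzB.1
          · exact hφS.2.2 w hw
        · rw [papangelou, if_neg hcz, mul_zero]
      linarith [hκ L]
    -- In the annulus a new point need not compete with the maximizer; births are merely bounded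
    -- there.
    have h2 : ∫ z in B₂ \ B₁, g z ∂X.mu ≤ (C + C) * (((L + D) ^ 2 - L ^ 2) * V₁) := by
      have hμ : X.mu.real (B₂ \ B₁) = ((L + D) ^ 2 - L ^ 2) * V₁ := by
        rw [measureReal_sdiff hB₁₂ hB₁m (X.mu_lt_top Metric.isBounded_closedBall).ne,
          measureReal_def, measureReal_def, hB₁, hB₂, mu_prod_univ, mu_prod_univ,
          hvol _ hL0, hvol _ (by linarith)]
        ring
      refine (le_abs_self _).trans ?_
      rw [← Real.norm_eq_abs, ← hμ]
      refine norm_setIntegral_le_of_norm_le_const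
        ((measure_mono sdiff_subset).trans_lt (X.mu_lt_top Metric.isBounded_closedBall)) fun z _ => ?_
      rw [Real.norm_eq_abs]
      exact (abs_sub _ _).trans (add_le_add (hC φ hφS.1 hφS.2.1 z) (h0 z))
    have h3 : ∫ z, g z ∂X.mu = ∫ z in B₁, g z ∂X.mu + ∫ z in B₂ \ B₁, g z ∂X.mu := by
      rw [← setIntegral_union disjoint_sdiff_right (hB₂m.diff hB₁m) hgi.integrableOn
        hgi.integrableOn, union_sdiff_cancel hB₁₂]
      exact (setIntegral_eq_integral_of_forall_compl_eq_zero fun z hz =>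
        hX.sum_birth_of_far θ hφS.2.1 v hφS.2.2 hz).symm
    have h4 : (φ.card : ℝ) ≤ (C + C) * (((L + D) ^ 2 - L ^ 2) * V₁) / δ := by
      rw [le_div_iff₀ hδ, mul_comm]
      refine hlow.trans ?_
      change ∑ x ∈ φ, (H φ - H (φ.erase x)) = ∫ z, g z ∂X.mu at hsum
      linarith
    have h5 : H φ₀ ≤ |C₁| * φ.card := by
      refine (hφm φ₀ ⟨hφ₀1, hφ₀2, hφ₀3⟩).trans ((hC₁ φ).trans ?_)
      exact mul_le_mul_of_nonneg_right (le_abs_self _) (Nat.cast_nonneg _)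
    have h6 := mul_le_mul_of_nonneg_left h4 (abs_nonneg C₁)
    have h7 : a * (n : ℝ) ^ 2 ≤ H φ₀ + b := hφ₀4
    linarith
  set A : ℝ := |C₁| * ((C + C) * V₁ / δ) with hA
  have key' : ∀ n : ℕ, a * n ^ 2 ≤ b + A * (2 * s * D * (n + 1) + D ^ 2) := by
    intro n
    have := key n
    have e : |C₁| * ((C + C) * (((s * (n + 1) + D) ^ 2 - (s * (n + 1)) ^ 2) * V₁) / δ)
        = A * (2 * s * D * (n + 1) + D ^ 2) := by
      rw [hA]
      ring
    linarith
  -- `G * n` dominates the right side of `key'`, so `a * n ^ 2 ≤ G * n`, which fails once `n > G /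
  -- a`.
  set G : ℝ := |b| + |A| * (4 * s * D + D ^ 2) + 1 with hG
  have hG1 : 1 ≤ G := by
    have : 0 ≤ |A| * (4 * s * D + D ^ 2) := by positivity
    linarith [abs_nonneg b]
  obtain ⟨n, hn⟩ := exists_nat_gt (max 1 (G / a))
  have hn1 : (1 : ℝ) < n := (le_max_left _ _).trans_lt hn
  have hn2 : G < n * a := (div_lt_iff₀ ha).1 ((le_max_right _ _).trans_lt hn)
  have h1 := key' n
  have h2 : A * (2 * s * D * (n + 1) + D ^ 2) ≤ |A| * (4 * s * D + D ^ 2) * n := by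
    have h3 : 2 * s * D * ((n : ℝ) + 1) + D ^ 2 ≤ (4 * s * D + D ^ 2) * n := by
      have h4 : 0 < s * D := by positivity
      have h5 : 0 ≤ D ^ 2 := by positivity
      nlinarith
    calc A * (2 * s * D * (n + 1) + D ^ 2) ≤ |A| * (2 * s * D * (n + 1) + D ^ 2) :=
          mul_le_mul_of_nonneg_right (le_abs_self _) (by positivity)
      _ ≤ |A| * ((4 * s * D + D ^ 2) * n) := mul_le_mul_of_nonneg_left h3 (abs_nonneg _)
      _ = _ := by ring
  have h3 : b ≤ |b| * n := by
    have := le_abs_self b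
    nlinarith [abs_nonneg b]
  have h4 : a * (n : ℝ) ^ 2 ≤ G * n := by
    rw [hG]
    nlinarith
  nlinarith

end Model.IsTame

end MarkedGibbs

/-! ### Sums over subsets; reduction to annihilators -/

namespace MarkedGibbs

open scoped Classical

section Powerset

variable {α β M : Type} [DecidableEq α] [DecidableEq β] [AddCommMonoid M]

lemma sum_powersetCard_succ_insert (f : Finset α → M) {s : Finset α} {a : α} (ha : a ∉ s) (n : ℕ) :
    ∑ t ∈ (insert a s).powersetCard (n + 1), f t =
      ∑ t ∈ s.powersetCard (n + 1), f t + ∑ t ∈ s.powersetCard n, f (insert a t) := by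
  have hn : ∀ {k : ℕ} {t : Finset α}, t ∈ s.powersetCard k → a ∉ t := fun ht h =>
    ha ((Finset.mem_powersetCard.1 ht).1 h)
  rw [Finset.powersetCard_succ_insert ha, Finset.sum_union, Finset.sum_image]
  · intro t ht t' ht' h
    rw [← Finset.erase_insert (hn ht), ← Finset.erase_insert (hn ht')]
    exact congrArg (fun u => Finset.erase u a) h
  · rw [Finset.disjoint_left]
    intro t ht ht'
    obtain ⟨u, -, rfl⟩ := Finset.mem_image.1 ht'
    exact hn ht (Finset.mem_insert_self a u)

lemma sum_powersetCard_two_insert (f : Finset α → M) {s : Finset α} {a : α} (ha : a ∉ s) :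
    ∑ t ∈ (insert a s).powersetCard 2, f t =
      ∑ t ∈ s.powersetCard 2, f t + ∑ w ∈ s, f {a, w} := by
  rw [sum_powersetCard_succ_insert f ha 1, Finset.powersetCard_one, Finset.sum_map]
  rfl

lemma sum_powersetCard_image (f : Finset β → M) {s : Finset α} {e : α → β}
    (he : InjOn e s) (n : ℕ) :
    ∑ t ∈ (s.image e).powersetCard n, f t = ∑ t ∈ s.powersetCard n, f (t.image e) := by
  symm
  have hcard : ∀ t ⊆ s, (t.image e).card = t.card := fun t ht =>
    Finset.card_image_of_injOn (he.mono (Finset.coe_subset.2 ht))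
  refine Finset.sum_nbij (fun t => t.image e) (fun t ht => ?_) (fun t ht t' ht' h => ?_)
    (fun t ht => ?_) fun _ _ => rfl
  · obtain ⟨h1, h2⟩ := Finset.mem_powersetCard.1 ht
    exact Finset.mem_powersetCard.2 ⟨Finset.image_subset_image h1, (hcard t h1).trans h2⟩
  · have h1 := (Finset.mem_powersetCard.1 ht).1
    have h2 := (Finset.mem_powersetCard.1 ht').1
    have h := congrArg (fun u : Finset β => (u : Set β)) h
    simp only [Finset.coe_image] at h
    exact Finset.coe_injective ((he.image_eq_image_iff (Finset.coe_subset.2 h1)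
      (Finset.coe_subset.2 h2)).1 h)
  · obtain ⟨h1, h2⟩ := Finset.mem_powersetCard.1 ht
    obtain ⟨t', ht', rfl⟩ := Finset.subset_image_iff.1 h1
    exact ⟨t', Finset.mem_powersetCard.2 ⟨ht', (hcard t' ht').symm.trans h2⟩, rfl⟩

end Powerset

lemma exists_abs_le {ι : Type} [Fintype ι] {Θ : Set (ι → ℝ)} (hΘ : IsCompact Θ) :
    ∃ B : ℝ, 0 ≤ B ∧ ∀ θ ∈ Θ, ∀ j, |θ j| ≤ B := by
  obtain ⟨B, hB⟩ := hΘ.isBounded.exists_norm_le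
  refine ⟨max B 0, le_max_right _ _, fun θ hθ j => ?_⟩
  exact (norm_le_pi_norm θ j).trans ((hB θ hθ).trans (le_max_left _ _))

lemma IsGeneric.translate {𝕄 κ : Type} {c : κ → 𝕄 → 𝕄 → ℝ} {s : Set (Plane × 𝕄)}
    (hs : IsGeneric c s) (x : Plane) :
    IsGeneric c ((fun z : Plane × 𝕄 => (z.1 + x, z.2)) '' s) := by
  refine ⟨?_, ?_, ?_⟩
  · rintro _ ⟨z, hz, rfl⟩ _ ⟨w, hw, rfl⟩ h
    simpa using hs.fst_ne z hz w hw (fun e => h (by rw [e]))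
  · rintro _ ⟨z, hz, rfl⟩ _ ⟨w, hw, rfl⟩ h k
    simpa using hs.dist_ne z hz w hw (fun e => h (by rw [e])) k
  · rintro _ ⟨z, hz, rfl⟩ _ ⟨w, hw, rfl⟩ _ ⟨u, hu, rfl⟩ h h' h''
    simpa using hs.no_tie z hz w hw u hu (fun e => h (by rw [e])) (fun e => h' (by rw [e]))
      (fun e => h'' (by rw [e]))

/-- Sums over the subsets of size `k` depend continuously on the points. -/
lemma continuousOn_sum_powersetCard {𝕄 κ : Type} [TopologicalSpace 𝕄] {c : κ → 𝕄 → 𝕄 → ℝ} {n : ℕ}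
    (f : Finset (Plane × 𝕄) → ℝ) (k : ℕ)
    (hf : ∀ S : Finset (Fin n), S.card = k →
      ContinuousOn (fun x : Fin n → Plane × 𝕄 => f (S.image x)) (genericTuples c n)) :
    ContinuousOn (fun x : Fin n → Plane × 𝕄 =>
      ∑ t ∈ (Finset.univ.image x).powersetCard k, f t) (genericTuples c n) := by
  have h : ContinuousOn (fun x : Fin n → Plane × 𝕄 =>
      ∑ S ∈ (Finset.univ : Finset (Fin n)).powersetCard k, f (S.image x)) (genericTuples c n) :=
    continuousOn_finsetSum _ fun S hS => hf S (Finset.mem_powersetCard.1 hS).2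
  exact h.congr fun x hx => sum_powersetCard_image f hx.1.injOn k

lemma continuousOn_card_image {𝕄 κ : Type} [TopologicalSpace 𝕄] {c : κ → 𝕄 → 𝕄 → ℝ} {n : ℕ} :
    ContinuousOn (fun x : Fin n → Plane × 𝕄 => ((Finset.univ.image x).card : ℝ))
      (genericTuples c n) := by
  refine (continuousOn_const (c := (n : ℝ))).congr fun x hx => ?_
  simp [Finset.card_image_of_injective _ hx.1]

/-- A sum of values of `f` at pairs of points is continuous on generic tuples if `f` is continuous
at generic pairs. -/
lemma continuousOn_sum_pairs {𝕄 κ : Type} [TopologicalSpace 𝕄] {c : κ → 𝕄 → 𝕄 → ℝ} {n : ℕ}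
    (f : Finset (Plane × 𝕄) → ℝ)
    (hf : ∀ z w : Plane × 𝕄, z ≠ w → IsGeneric c {z, w} →
      ContinuousAt (fun p : (Plane × 𝕄) × (Plane × 𝕄) => f {p.1, p.2}) (z, w)) :
    ContinuousOn (fun x : Fin n → Plane × 𝕄 =>
      ∑ t ∈ (Finset.univ.image x).powersetCard 2, f t) (genericTuples c n) := by
  refine continuousOn_sum_powersetCard f 2 fun S hS x hx => ContinuousAt.continuousWithinAt ?_
  obtain ⟨i, j, hij, rfl⟩ := Finset.card_eq_two.1 hS
  have h := hf (x i) (x j) (hx.1.ne hij) (hx.2.mono (by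
    rintro _ (rfl | rfl) <;> exact mem_range_self _))
  have h2 : ContinuousAt (fun y : Fin n → Plane × 𝕄 => (y i, y j)) x := by fun_prop
  have := ContinuousAt.comp (f := fun y : Fin n → Plane × 𝕄 => (y i, y j)) h h2
  refine this.congr (Eventually.of_forall fun y => ?_)
  simp [Finset.image_insert]

lemma isGeneric_singleton {𝕄 κ : Type} (c : κ → 𝕄 → 𝕄 → ℝ) (z : Plane × 𝕄) :
    IsGeneric c {z} where
  fst_ne _ h _ h' hne := absurd (h.trans h'.symm) hne
  dist_ne _ h _ h' hne := absurd (h.trans h'.symm) hne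
  no_tie _ h _ h' _ _ hne := absurd (h.trans h'.symm) hne

namespace Model

variable {𝕄 : Type} [MeasurableSpace 𝕄] {ι : Type} [Fintype ι] {X : Model 𝕄 ι}
variable [TopologicalSpace 𝕄] {κ : Type}
variable {c : κ → 𝕄 → 𝕄 → ℝ}

lemma IsTame.of_univ {Θ : Set (ι → ℝ)} {D : ℝ} (hX : X.hardCore = univ) (hD : 0 < D)
    (hc : ∀ k, Continuous fun p : 𝕄 × 𝕄 => c k p.1 p.2)
    (hb : ∀ j, ∃ (a : ℝ) (k : ℕ), 0 ≤ a ∧ ∀ φ z, |X.incr φ z j| ≤ a * (φ.card : ℝ) ^ k)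
    (hl : ∀ (φ φ' : Finset (Plane × 𝕄)) (z : Plane × 𝕄),
      (∀ w, dist z.1 w.1 ≤ D → (w ∈ φ ↔ w ∈ φ')) → X.incr φ z = X.incr φ' z)
    (hs : ∃ K : ℝ, 0 ≤ K ∧ ∀ θ ∈ Θ, ∀ φ z, -K ≤ ∑ j, θ j * X.incr φ z j)
    (hst : ∀ n, ContinuousOn (fun x : Fin n → Plane × 𝕄 => X.stat (Finset.univ.image x))
      (genericTuples c n)) : X.IsTame c Θ D where
  range_pos := hD
  continuous_crit := hc
  incr_bound := hb
  incr_congr := hl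
  hardCore_singleton z := by simp [hX]
  hardCore_iff s := by simp [hX]
  stable := by
    obtain ⟨K, hK, h⟩ := hs
    exact ⟨K, hK, fun θ hθ φ z _ => h θ hθ φ z⟩
  measurableSet_hardCore := by simp [hX]
  continuousOn_stat := hst
  hardCore_nhds z w _ _ := by simp [hX]

variable [T2Space 𝕄] [BorelSpace 𝕄] [SecondCountableTopology 𝕄] [Finite κ]
variable [IsProbabilityMeasure X.markLaw] [X.markLaw.IsOpenPosMeasure]

/-- [Ident] looks at increments at the origin, whereas it is convenient to test an annihilator at
arbitrary points; translation invariance makes the two equivalent. -/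
theorem satisfiesAssumptions_of (hT : X.TranslationInvariant) {params : Set (ι → ℝ)}
    (h : ∀ Θ : Set (ι → ℝ), IsCompact Θ → Θ ⊆ params → ∃ D : ℝ, X.IsTame c Θ D ∧
      (∀ v : ι → ℝ, (∀ (φ : Finset (Plane × 𝕄)) (z : Plane × 𝕄), z ∉ φ →
        IsGeneric c (insert z (φ : Set (Plane × 𝕄))) → (φ : Set (Plane × 𝕄)) ∈ X.hardCore →
          ∑ j, v j * X.incr φ z j = 0) → v = 0) ∧
      ∀ θ ∈ Θ, ∀ v : ι → ℝ, (∀ φ : Finset (Plane × 𝕄), IsGeneric c (φ : Set (Plane × 𝕄)) →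
        (φ : Set (Plane × 𝕄)) ∈ X.hardCore → ∑ j, v j * X.innov θ φ j = 0) → v = 0) :
    X.SatisfiesAssumptions params := by
  refine ⟨hT, fun Θ hΘ hsub => ?_⟩
  obtain ⟨D, hX, hi, hs⟩ := h Θ hΘ hsub
  refine ⟨D, hX.mod, fun θ hθ P hP => ⟨hX.ident hθ hP fun v hv => hi v fun φ z hz hg hc => ?_,
    hX.sdp hθ hP (hs θ hθ)⟩⟩
  let τ : Plane × 𝕄 → Plane × 𝕄 := fun w => (w.1 + -z.1, w.2)
  have hτ : Function.Injective τ := fun a b hab => by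
    simp only [τ, Prod.mk.injEq, add_left_inj] at hab
    exact Prod.ext hab.1 hab.2
  have hτz : τ z = (0, z.2) := by simp [τ]
  have hcoe : ((φ.image τ : Finset (Plane × 𝕄)) : Set (Plane × 𝕄)) = τ '' φ := Finset.coe_image
  have h1 := hv z.2 (φ.image τ) (by
      rw [← hτz, Finset.mem_image]
      rintro ⟨w, hw, e⟩
      exact hz (hτ e ▸ hw)) (by
      rw [hcoe, ← hτz, ← image_insert_eq]
      exact hg.translate (-z.1)) (by
      rw [hcoe]
      exact (hT.2 (-z.1) ⟨φ, fun r => φ.finite_toSet.subset fun _ h => h.1⟩).2 hc)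
  have h2 : X.incr (φ.image τ) (0, z.2) = X.incr φ z := by
    funext j
    rw [incr, incr, ← hτz, ← Finset.image_insert, hT.1 (-z.1), hT.1 (-z.1)]
  rw [h2] at h1
  exact h1

end Model

end MarkedGibbs

/-! ### Pair interactions -/

namespace MarkedGibbs

open scoped Classical

lemma nonpos_of_forall_mul_le {t A : ℝ} {N : ℕ} (h : ∀ n : ℕ, N ≤ n → t * n ≤ A) : t ≤ 0 := by
  by_contra! ht
  obtain ⟨n, hn⟩ := exists_nat_gt (max (N : ℝ) (A / t))
  have h1 : A < n * t := (div_lt_iff₀ ht).1 ((le_max_right _ _).trans_lt hn)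
  have h2 := h n (by exact_mod_cast ((le_max_left _ _).trans_lt hn).le)
  linarith

/-- The model without hard core whose statistics are the number of points and the sum of the values
of `f` at the pairs of points. -/
def pairModel {𝕄 : Type} [MeasurableSpace 𝕄] (ν : Measure 𝕄) (f : Finset (Plane × 𝕄) → ℝ) :
    Model 𝕄 (Fin 2) where
  markLaw := ν
  stat φ := ![(φ.card : ℝ), ∑ s ∈ φ.powersetCard 2, f s]
  hardCore := univ

section PairModel

variable {𝕄 : Type} [MeasurableSpace 𝕄] (ν : Measure 𝕄) {f : Finset (Plane × 𝕄) → ℝ}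

lemma pairModel_incr {φ : Finset (Plane × 𝕄)} {z : Plane × 𝕄} (hz : z ∉ φ) :
    (pairModel ν f).incr φ z = ![1, ∑ w ∈ φ, f {z, w}] := by
  funext j
  fin_cases j
  · simp [Model.incr, pairModel, Finset.card_insert_of_notMem hz]
  · simp [Model.incr, pairModel, sum_powersetCard_two_insert f hz]

lemma pairModel_abs_incr_zero (φ : Finset (Plane × 𝕄)) (z : Plane × 𝕄) :
    |(pairModel ν f).incr φ z 0| ≤ 1 := by
  by_cases hz : z ∈ φ
  · simp [Model.incr_of_mem _ hz]
  · simp [pairModel_incr ν hz]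

variable {C : ℝ} (hf0 : ∀ s, 0 ≤ f s) (hfC : ∀ s, f s ≤ C)

include hf0 hfC in
lemma pairModel_abs_incr_one (φ : Finset (Plane × 𝕄)) (z : Plane × 𝕄) :
    |(pairModel ν f).incr φ z 1| ≤ C * φ.card := by
  have hC : 0 ≤ C := (hf0 ∅).trans (hfC ∅)
  by_cases hz : z ∈ φ
  · simp only [Model.incr_of_mem _ hz, Pi.zero_apply, abs_zero]
    positivity
  · simp only [pairModel_incr ν hz, Matrix.cons_val_one, Matrix.cons_val_fin_one]
    rw [abs_of_nonneg (Finset.sum_nonneg fun _ _ => hf0 _), mul_comm, ← nsmul_eq_mul,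
      ← Finset.sum_const]
    exact Finset.sum_le_sum fun _ _ => hfC _

variable {κ : Type} [TopologicalSpace 𝕄] {c : κ → 𝕄 → 𝕄 → ℝ}
  (hc : ∀ k, Continuous fun p : 𝕄 × 𝕄 => c k p.1 p.2) {D : ℝ} (hD : 0 < D)
  (hfD : ∀ z w, D < dist z.1 w.1 → f {z, w} = 0)
  (hcont : ∀ z w : Plane × 𝕄, z ≠ w → IsGeneric c {z, w} →
      ContinuousAt (fun p : (Plane × 𝕄) × (Plane × 𝕄) => f {p.1, p.2}) (z, w))

-- Stability: the pair term is nonnegative since `θ 1` and `f` are, so that only the bounded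
-- coefficient `θ 0` can lower the energy.
include hf0 hfC hc hD hfD hcont in
lemma pairModel_isTame {Θ : Set (Fin 2 → ℝ)} (hΘ : IsCompact Θ) (hsub : Θ ⊆ {θ | 0 ≤ θ 1}) :
    (pairModel ν f).IsTame c Θ D := by
  refine Model.IsTame.of_univ rfl hD hc ?_ ?_ ?_ ?_
  · intro j
    fin_cases j
    · exact ⟨1, 0, zero_le_one, fun φ z => by simpa using pairModel_abs_incr_zero ν φ z⟩
    · exact ⟨C, 1, (hf0 ∅).trans (hfC ∅), fun φ z => by
        simpa using pairModel_abs_incr_one ν hf0 hfC φ z⟩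
  · intro φ φ' z h
    have hz := h z (by simpa using hD.le)
    by_cases hzφ : z ∈ φ
    · rw [Model.incr_of_mem _ hzφ, Model.incr_of_mem _ (hz.1 hzφ)]
    rw [pairModel_incr ν hzφ, pairModel_incr ν (mt hz.2 hzφ)]
    have key : ∀ χ : Finset (Plane × 𝕄), ∑ w ∈ χ, f {z, w}
        = ∑ w ∈ χ.filter fun w => dist z.1 w.1 ≤ D, f {z, w} := fun χ =>
      (Finset.sum_filter_of_ne fun w _ hw => by
        by_contra hlt
        exact hw (hfD z w (not_le.1 hlt))).symm
    rw [key, key φ']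
    congr 3
    ext w
    simp only [Finset.mem_filter]
    exact and_congr_left fun hw => h w hw
  · obtain ⟨B, hB0, hB⟩ := exists_abs_le hΘ
    refine ⟨B, hB0, fun θ hθ φ z => ?_⟩
    by_cases hz : z ∈ φ
    · simpa [Model.incr_of_mem _ hz] using hB0
    rw [pairModel_incr ν hz, Fin.sum_univ_two]
    have h0 := abs_le.1 (hB θ hθ 0)
    have h1 : 0 ≤ θ 1 * ∑ w ∈ φ, f {z, w} :=
      mul_nonneg (hsub hθ) (Finset.sum_nonneg fun _ _ => hf0 _)
    simp only [Matrix.cons_val_zero, Matrix.cons_val_one, Matrix.cons_val_fin_one, mul_one]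
    linarith
  · intro n
    refine continuousOn_pi.2 fun j => ?_
    fin_cases j
    · exact continuousOn_card_image
    · exact continuousOn_sum_pairs f hcont

variable [T2Space 𝕄] [BorelSpace 𝕄] [SecondCountableTopology 𝕄] [Finite κ]
variable [IsProbabilityMeasure ν] [ν.IsOpenPosMeasure]

instance : IsProbabilityMeasure (pairModel ν f).markLaw := inferInstanceAs (IsProbabilityMeasure ν)
instance : (pairModel ν f).markLaw.IsOpenPosMeasure := inferInstanceAs ν.IsOpenPosMeasure

-- Put `n` generic points in `U`, where all pairs interact by at least `a`. The deaths of the pair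
-- statistic are of order `n ^ 2`, while births are of order `n` because the Papangelou intensity is
-- bounded; hence `v 1 = 0`. Births along `v` are then bounded, and the `n` deaths of the count give
-- `v 0 = 0`.
include hf0 hfC hc hD hfD hcont in
theorem pairModel_satisfiesAssumptions
    (hT : ∀ (x : Plane) (s : Finset (Plane × 𝕄)), f (s.image fun z => (z.1 + x, z.2)) = f s)
    {U : Set (Plane × 𝕄)} (hU : IsOpen U) (hne : U.Nonempty) {r : ℝ} (hr : ∀ z ∈ U, ‖z.1‖ ≤ r)
    {a : ℝ} (ha : 0 < a) (hfa : ∀ z ∈ U, ∀ w ∈ U, a ≤ f {z, w}) :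
    (pairModel ν f).SatisfiesAssumptions {θ | 0 ≤ θ 1} := by
  refine Model.satisfiesAssumptions_of (c := c) ⟨fun x φ => ?_, fun x φ => Iff.rfl⟩
    fun Θ hΘ hsub => ?_
  · have hinj : Function.Injective fun z : Plane × 𝕄 => (z.1 + x, z.2) := fun z w h => by
      simp only [Prod.mk.injEq, add_left_inj] at h
      exact Prod.ext h.1 h.2
    simp only [pairModel]
    rw [Finset.card_image_of_injective _ hinj, sum_powersetCard_image f hinj.injOn]
    simp only [hT]
  have hX := pairModel_isTame ν hf0 hfC hc hD hfD hcont hΘ hsub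
  refine ⟨D, hX, fun v hv => ?_, fun θ hθ v hv => ?_⟩
  · obtain ⟨x, hxi, hxg, hxU⟩ := hX.exists_generic (α := Fin 2) (U := fun _ => U) (fun _ => hU)
      fun _ => hne
    have h0 := hv ∅ (x 0) (by simp) (by simpa using isGeneric_singleton c (x 0)) trivial
    have hx01 : x 0 ∉ ({x 1} : Finset (Plane × 𝕄)) := by
      rw [Finset.mem_singleton]
      exact hxi.ne (by decide)
    have h1 := hv {x 1} (x 0) hx01 (hxg.mono (by
      rw [Finset.coe_singleton]
      rintro _ (rfl | rfl) <;> exact mem_range_self _)) trivial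
    rw [pairModel_incr ν (by simp), Fin.sum_univ_two] at h0
    rw [pairModel_incr ν hx01, Fin.sum_univ_two] at h1
    simp only [Matrix.cons_val_zero, Matrix.cons_val_one, Matrix.cons_val_fin_one, mul_one,
      Finset.sum_empty, mul_zero, add_zero, Finset.sum_singleton] at h0 h1
    rw [h0, zero_add] at h1
    have h2 := ha.trans_le (hfa _ (hxU 0) _ (hxU 1))
    have h3 := (mul_eq_zero.1 h1).resolve_right h2.ne'
    funext j
    fin_cases j
    · exact h0
    · exact h3
  · obtain ⟨T, hT0, hT⟩ := hX.exists_papangelou_le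
    have hC0 : 0 ≤ C := (hf0 ∅).trans (hfC ∅)
    set V := (volume (Metric.closedBall (0 : Plane) (r + D))).toReal with hV
    have hV0 : 0 ≤ V := ENNReal.toReal_nonneg
    have hb : ∀ φ z, |∑ j, v j * (pairModel ν f).birth θ φ z j|
        ≤ |v 0| * T + |v 1| * (C * φ.card * T) := by
      intro φ z
      have hp := (pairModel ν f).papangelou_nonneg θ φ z
      rw [Fin.sum_univ_two]
      refine (abs_add_le _ _).trans (add_le_add ?_ ?_)
      · rw [abs_mul, Model.birth, abs_mul, abs_of_nonneg hp]
        have := mul_le_mul (pairModel_abs_incr_zero ν (f := f) φ z) (hT θ hθ φ z) hp zero_le_one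
        rw [one_mul] at this
        gcongr
      · rw [abs_mul, Model.birth, abs_mul, abs_of_nonneg hp]
        gcongr
        exacts [pairModel_abs_incr_one ν hf0 hfC φ z, hT θ hθ φ z]
    have key : ∀ n : ℕ, ∃ d : ℝ, a * (n * (n - 1)) ≤ d ∧
        |v 0 * n + v 1 * d| ≤ (|v 0| * T + |v 1| * (C * n * T) + |v 0| * T) * V := by
      intro n
      obtain ⟨x, hxi, hxg, hxU⟩ := hX.exists_generic (α := Fin n) (U := fun _ => U) (fun _ => hU)
        fun _ => hne
      set φ := Finset.univ.image x with hφ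
      have hφc : φ.card = n := by simp [hφ, Finset.card_image_of_injective _ hxi]
      have hφU : ∀ w ∈ φ, w ∈ U := by
        intro w hw
        obtain ⟨i, -, rfl⟩ := Finset.mem_image.1 hw
        exact hxU i
      have hφg : IsGeneric c (φ : Set (Plane × 𝕄)) := by simpa [hφ] using hxg
      have h1 := hX.abs_sum_death_le hθ hφg trivial (hv φ hφg trivial)
        (fun w hw => hr w (hφU w hw)) (hb φ) (hb ∅)
      rw [hφc, Finset.card_empty, Fin.sum_univ_two] at h1
      have hd0 : (pairModel ν f).death φ 0 = n := by
        rw [Model.death, Finset.sum_congr rfl fun y hy => by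
          rw [pairModel_incr ν (Finset.notMem_erase y φ)]]
        simp [hφc]
      refine ⟨(pairModel ν f).death φ 1, ?_, ?_⟩
      · rw [Model.death, Finset.sum_congr rfl fun y hy => by
          rw [pairModel_incr ν (Finset.notMem_erase y φ)]]
        have h2 : ∀ y ∈ φ, a * ((n : ℝ) - 1) ≤ ∑ w ∈ φ.erase y, f {y, w} := by
          intro y hy
          have h3 := Finset.card_nsmul_le_sum (φ.erase y) (fun w => f {y, w}) a fun w hw =>
            hfa y (hφU y hy) w (hφU w (Finset.mem_of_mem_erase hw))
          rw [nsmul_eq_mul, Finset.cast_card_erase_of_mem hy, hφc] at h3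
          linarith
        have h4 := Finset.card_nsmul_le_sum φ _ _ h2
        rw [nsmul_eq_mul, hφc] at h4
        simp only [Matrix.cons_val_one, Matrix.cons_val_fin_one]
        linarith
      · rw [hd0] at h1
        simpa only [Nat.cast_zero, mul_zero, zero_mul, add_zero] using h1
    -- The bound of `key` is divided by `n`; the factor `a / 2` comes from `n - 1 ≥ n / 2` for `n ≥
    -- 2`.
    have hv1 : v 1 = 0 := by
      rw [← abs_nonpos_iff]
      have : |v 1| * (a / 2) ≤ 0 := by
        refine nonpos_of_forall_mul_le (N := 2)
          (A := |v 0| + (|v 0| * T + |v 1| * (C * T) + |v 0| * T) * V) fun n hn => ?_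
        obtain ⟨d, hd, h⟩ := key n
        have hn' : (2 : ℝ) ≤ n := by exact_mod_cast hn
        have hd0 : a * (n * (n / 2)) ≤ d := by
          refine le_trans ?_ hd
          gcongr
          linarith
        have h2 : |v 1| * d ≤ |v 0| * n + |v 0 * n + v 1 * d| := by
          have h3 : |v 1 * d| = |v 1| * d := by
            rw [abs_mul, abs_of_nonneg (le_trans (by positivity) hd0)]
          have h4 : |v 0 * (n : ℝ)| = |v 0| * n := by rw [abs_mul, Nat.abs_cast]
          have h5 := abs_sub (v 0 * n + v 1 * d) (v 0 * n)
          rw [add_sub_cancel_left, h3, h4] at h5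
          linarith
        have h3 : |v 1| * (a * (n * (n / 2))) ≤ |v 1| * d := by gcongr
        have h4 : (|v 0| * T + |v 1| * (C * n * T) + |v 0| * T) * V
            ≤ n * ((|v 0| * T + |v 1| * (C * T) + |v 0| * T) * V) := by
          have h5 : |v 0| * T ≤ n * (|v 0| * T) :=
            le_mul_of_one_le_left (by positivity) (by linarith)
          calc _ ≤ (n * (|v 0| * T) + |v 1| * (C * n * T) + n * (|v 0| * T)) * V := by gcongr
            _ = _ := by ring
        refine le_of_mul_le_mul_left (a := (n : ℝ)) ?_ (by linarith)
        linarith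
      nlinarith
    have hv0 : v 0 = 0 := by
      rw [← abs_nonpos_iff]
      refine nonpos_of_forall_mul_le (N := 0) (A := (|v 0| * T + |v 0| * T) * V) fun n _ => ?_
      obtain ⟨d, hd, h⟩ := key n
      rw [hv1] at h
      simpa [abs_mul] using h
    funext j
    fin_cases j
    exacts [hv0, hv1]

end PairModel

end MarkedGibbs

/-! ### Continuity of areas; overlap area -/

namespace MarkedGibbs

open scoped Classical

/-- Off the circle, which is null, membership is decided by a strict inequality and so is stable
under small moves of the centre. -/
lemma ae_eventually_mem_closedBall_iff {R : ℝ} (hR : 0 < R) (x : Plane) :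
    ∀ᵐ u : Plane, ∀ᶠ y in 𝓝 x, (u ∈ Metric.closedBall y R ↔ u ∈ Metric.closedBall x R) := by
  have h : ∀ᵐ u : Plane, u ∉ Metric.sphere x R := by
    rw [← measure_eq_zero_iff_ae_notMem]
    exact Measure.addHaar_sphere_of_ne_zero _ _ hR.ne'
  filter_upwards [h] with u hu
  have hcont : ContinuousAt (fun y : Plane => dist u y) x := by fun_prop
  simp only [Metric.mem_closedBall]
  rcases lt_or_gt_of_ne (show dist u x ≠ R from hu) with h1 | h1
  · filter_upwards [hcont.eventually (gt_mem_nhds h1)] with y hy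
    exact iff_of_true hy.le h1.le
  · filter_upwards [hcont.eventually (lt_mem_nhds h1)] with y hy
    exact iff_of_false (not_le.2 hy) (not_le.2 h1)

/-- Dominated convergence for indicators, the dominating set being a fixed disc. -/
lemma continuousAt_volume_toReal {α : Type} [TopologicalSpace α] {x : α} [(𝓝 x).IsCountablyGenerated]
    {A : α → Set Plane} (hA : ∀ y, MeasurableSet (A y)) {r : ℝ}
    (hr : ∀ᶠ y in 𝓝 x, A y ⊆ Metric.closedBall 0 r)
    (h : ∀ᵐ u : Plane, ∀ᶠ y in 𝓝 x, (u ∈ A y ↔ u ∈ A x)) :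
    ContinuousAt (fun y => (volume (A y)).toReal) x := by
  have h1 := tendsto_measure_of_ae_tendsto_indicator (𝓝 x) (hA x) hA
    Metric.isClosed_closedBall.measurableSet measure_closedBall_lt_top.ne hr h
  refine (ENNReal.tendsto_toReal ?_).comp h1
  exact ((measure_mono hr.self_of_nhds).trans_lt measure_closedBall_lt_top).ne

section OverlapArea

variable {𝕄 : Type} {R : ℝ}

/-- The area of the intersection of the discs of radius `R / 2` centred at the points of `s`. -/
def overlap (R : ℝ) (s : Finset (Plane × 𝕄)) : ℝ :=
  (volume (⋂ z ∈ s, Metric.closedBall z.1 (R / 2))).toReal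

lemma overlapArea_eq : overlapArea R = pairModel (Measure.dirac ()) (overlap R) := rfl

lemma overlap_le (s : Finset (Plane × 𝕄)) :
    overlap R s ≤ (volume (Metric.closedBall (0 : Plane) (R / 2))).toReal := by
  rcases s.eq_empty_or_nonempty with rfl | ⟨z, hz⟩
  · exact le_of_eq_of_le (by simp [overlap]) ENNReal.toReal_nonneg
  · refine ENNReal.toReal_mono measure_closedBall_lt_top.ne ?_
    rw [Measure.addHaar_closedBall_center volume (0 : Plane),
      ← Measure.addHaar_closedBall_center volume z.1]
    exact measure_mono (biInter_subset_of_mem hz)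

lemma overlap_pair (z w : Plane × 𝕄) : overlap R {z, w} =
    (volume (Metric.closedBall z.1 (R / 2) ∩ Metric.closedBall w.1 (R / 2))).toReal := by
  simp [overlap]

lemma overlap_translate (x : Plane) (s : Finset (Plane × 𝕄)) :
    overlap R (s.image fun z => (z.1 + x, z.2)) = overlap R s := by
  have h : (⋂ z ∈ s.image (fun z : Plane × 𝕄 => (z.1 + x, z.2)), Metric.closedBall z.1 (R / 2))
      = (fun u : Plane => u + -x) ⁻¹' ⋂ z ∈ s, Metric.closedBall z.1 (R / 2) := by
    ext u
    simp only [Finset.mem_image, mem_iInter, mem_preimage, Metric.mem_closedBall, dist_eq_norm,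
      forall_exists_index, and_imp]
    refine ⟨fun h z hz => ?_, ?_⟩
    · have := h _ z hz rfl
      rwa [← sub_sub, sub_right_comm, sub_eq_add_neg u x] at this
    · rintro h _ z hz rfl
      have := h z hz
      rwa [← sub_sub, sub_right_comm, sub_eq_add_neg u x]
  rw [overlap, h, measure_preimage_add_right, overlap]

instance {α : Type} [TopologicalSpace α] [Subsingleton α] [MeasurableSpace α] (a : α) :
    (Measure.dirac a).IsOpenPosMeasure where
  open_pos U _ hne := by
    obtain ⟨b, hb⟩ := hne
    rw [Subsingleton.elim b a] at hb
    simp [hb]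

/-- Overlaps are continuous, so there is no critical distance (`κ = Empty`). When two centres are
within `R / 4` of the origin, the disc of radius `R / 4` about the origin lies in both discs of
radius `R / 2`, whence `a`. -/
theorem overlapArea_satisfiesAssumptions (hR : 0 < R) :
    (overlapArea R).SatisfiesAssumptions {θ | 0 ≤ θ 1} := by
  rw [overlapArea_eq]
  refine pairModel_satisfiesAssumptions (κ := Empty) (c := fun k => k.elim)
    (Measure.dirac ()) (f := overlap R) (D := R) (fun _ => ENNReal.toReal_nonneg) overlap_le (fun k => k.elim) hR ?_ ?_
    overlap_translate
    (U := Metric.ball (0 : Plane) (R / 4) ×ˢ (univ : Set Unit))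
    (Metric.isOpen_ball.prod isOpen_univ)
    ⟨(0, ()), by simpa using hR, mem_univ _⟩ (r := R / 4) ?_
    (a := (volume (Metric.closedBall (0 : Plane) (R / 4))).toReal) ?_ ?_
  · intro z w h
    have : Metric.closedBall z.1 (R / 2) ∩ Metric.closedBall w.1 (R / 2) = ∅ :=
      disjoint_iff_inter_eq_empty.1 (Metric.closedBall_disjoint_closedBall (by linarith))
    rw [overlap_pair, this]
    simp
  · intro z w _ _
    simp only [overlap_pair]
    refine continuousAt_volume_toReal (r := ‖z.1‖ + 1 + R / 2)
      (fun p => (Metric.isClosed_closedBall.inter Metric.isClosed_closedBall).measurableSet) ?_ ?_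
    · have h1 : ContinuousAt (fun p : (Plane × Unit) × (Plane × Unit) => ‖p.1.1‖) (z, w) := by
        fun_prop
      filter_upwards [h1.eventually (gt_mem_nhds (lt_add_one _))] with p hp u hu
      have h2 := hu.1
      rw [Metric.mem_closedBall, dist_eq_norm] at h2
      rw [mem_closedBall_zero_iff]
      have := norm_add_le (u - p.1.1) p.1.1
      rw [sub_add_cancel] at this
      linarith
    · filter_upwards [ae_eventually_mem_closedBall_iff (half_pos hR) z.1,
        ae_eventually_mem_closedBall_iff (half_pos hR) w.1] with u h1 h2
      have hc1 : ContinuousAt (fun p : (Plane × Unit) × (Plane × Unit) => p.1.1) (z, w) := by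
        fun_prop
      have hc2 : ContinuousAt (fun p : (Plane × Unit) × (Plane × Unit) => p.2.1) (z, w) := by
        fun_prop
      filter_upwards [hc1.eventually h1, hc2.eventually h2] with p hp1 hp2
      exact and_congr hp1 hp2
  · intro z hz
    simpa using (mem_ball_zero_iff.1 hz.1).le
  · exact ENNReal.toReal_pos (Metric.measure_closedBall_pos _ _ (by positivity)).ne'
      measure_closedBall_lt_top.ne
  · intro z hz w hw
    rw [overlap_pair]
    refine ENNReal.toReal_mono ((measure_mono inter_subset_left).trans_lt
      measure_closedBall_lt_top).ne (measure_mono (subset_inter ?_ ?_)) <;>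
    · refine Metric.closedBall_subset_closedBall' ?_
      first
      | have := Metric.mem_ball'.1 hz.1
        linarith
      | have := Metric.mem_ball'.1 hw.1
        linarith

end OverlapArea

/-! ### Strauss discs -/

section StraussDisc

variable {M : ℝ}

lemma isProbabilityMeasure_Icc (hM : 0 < M) : IsProbabilityMeasure
    ((ENNReal.ofReal M)⁻¹ • Measure.comap (Subtype.val : Icc (0 : ℝ) M → ℝ) volume) where
  measure_univ := by
    rw [Measure.smul_apply, comap_subtype_coe_apply measurableSet_Icc, image_univ,
      Subtype.range_coe, Real.volume_Icc, sub_zero, smul_eq_mul]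
    exact ENNReal.inv_mul_cancel (by simpa using hM) ENNReal.ofReal_ne_top

/-- A nonempty relatively open subset of `[0, M]` meets the open interval, by density, and there it
contains a nonempty open set of reals. -/
lemma isOpenPosMeasure_Icc (hM : 0 < M) : Measure.IsOpenPosMeasure
    ((ENNReal.ofReal M)⁻¹ • Measure.comap (Subtype.val : Icc (0 : ℝ) M → ℝ) volume) where
  open_pos U hU hne := by
    obtain ⟨O, hO, rfl⟩ := isOpen_induced_iff.1 hU
    obtain ⟨x, hx⟩ := hne
    have h1 : (O ∩ Ioo 0 M).Nonempty :=
      mem_closure_iff.1 (by rw [closure_Ioo hM.ne]; exact x.2) O hO hx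
    have h2 := (hO.inter isOpen_Ioo).measure_pos volume h1
    rw [Measure.smul_apply, comap_subtype_coe_apply measurableSet_Icc, smul_eq_mul]
    refine mul_ne_zero (by simp) (h2.trans_le (measure_mono ?_)).ne'
    rintro y ⟨hy, hy'⟩
    exact ⟨⟨y, Ioo_subset_Icc_self hy'⟩, hy, rfl⟩

/-- The indicator that the discs with the marks as radii meet. -/
def discsMeet {𝕄 : Type} (ρ : 𝕄 → ℝ) (s : Finset (Plane × 𝕄)) : ℝ :=
  if ∀ z₁ ∈ s, ∀ z₂ ∈ s, z₁ ≠ z₂ → dist z₁.1 z₂.1 ≤ ρ z₁.2 + ρ z₂.2 then 1 else 0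

lemma straussDisc_eq : straussDisc M = pairModel
    ((ENNReal.ofReal M)⁻¹ • Measure.comap Subtype.val (volume : Measure ℝ)) (discsMeet fun m : Icc (0 : ℝ) M => (m : ℝ)) := by
  simp only [straussDisc, pairModel, discsMeet]
  congr 1
  funext φ
  rw [Finset.natCast_card_filter]
  congr!

lemma discsMeet_pair {𝕄 : Type} {ρ : 𝕄 → ℝ} (hρ : ∀ m, 0 ≤ ρ m) (z w : Plane × 𝕄) :
    discsMeet ρ {z, w} = if dist z.1 w.1 ≤ ρ z.2 + ρ w.2 then 1 else 0 := by
  rw [discsMeet]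
  congr 1
  simp only [Finset.mem_insert, Finset.mem_singleton, forall_eq_or_imp, forall_eq, ne_eq,
    not_true_eq_false, false_imp_iff, true_and, and_true, eq_iff_iff]
  rw [dist_comm w.1 z.1, add_comm (ρ w.2)]
  refine ⟨fun h => ?_, fun h => ⟨fun _ => h, fun _ => h⟩⟩
  by_cases e : z = w
  · subst e
    rw [dist_self]
    exact add_nonneg (hρ _) (hρ _)
  · exact h.1 e

/-- The only critical distance is the sum of the two marks. With positions within `M / 2` of the
origin and marks above `M / 2`, all the discs meet. -/
theorem straussDisc_satisfiesAssumptions (hM : 0 < M) :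
    (straussDisc M).SatisfiesAssumptions {θ | 0 ≤ θ 1} := by
  rw [straussDisc_eq]
  have := isProbabilityMeasure_Icc hM
  have := isOpenPosMeasure_Icc hM
  have hρ : ∀ m : Icc (0 : ℝ) M, 0 ≤ (m : ℝ) := fun m => m.2.1
  refine pairModel_satisfiesAssumptions (κ := Unit) (c := fun _ m m' => (m : ℝ) + (m' : ℝ)) _
    (f := discsMeet fun m : Icc (0 : ℝ) M => (m : ℝ)) (C := 1) (D := 2 * M) (fun s => ?_) (fun s => ?_) (fun _ => by fun_prop)
    (by positivity) ?_ ?_ ?_ 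
    (U := Metric.ball (0 : Plane) (M / 2) ×ˢ {m : Icc (0 : ℝ) M | M / 2 < (m : ℝ)})
    (Metric.isOpen_ball.prod (isOpen_lt continuous_const continuous_subtype_val))
    ⟨(0, ⟨M, hM.le, le_rfl⟩), by simpa using hM, by simpa using hM⟩ (r := M / 2) ?_
    (a := 1) one_pos ?_
  · unfold discsMeet
    split_ifs <;> simp
  · unfold discsMeet
    split_ifs <;> simp
  · intro z w h
    rw [discsMeet_pair hρ, if_neg]
    linarith [z.2.2.2, w.2.2.2]
  · intro z w hne hg
    have h0 : dist z.1 w.1 ≠ (z.2 : ℝ) + (w.2 : ℝ) :=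
      hg.dist_ne z (mem_insert _ _) w (mem_insert_of_mem _ rfl) hne ()
    simp only [discsMeet_pair hρ]
    have h1 : ContinuousAt (fun p : (Plane × Icc (0 : ℝ) M) × (Plane × Icc (0 : ℝ) M) =>
      dist p.1.1 p.2.1 - ((p.1.2 : ℝ) + (p.2.2 : ℝ))) (z, w) := by fun_prop
    refine ContinuousAt.congr (f := fun _ =>
      if dist z.1 w.1 ≤ (z.2 : ℝ) + (w.2 : ℝ) then (1 : ℝ) else 0) continuousAt_const ?_
    rcases lt_or_gt_of_ne h0 with h | h
    · filter_upwards [h1.eventually (gt_mem_nhds (sub_neg.2 h))] with p hp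
      rw [if_pos h.le, if_pos (sub_neg.1 hp).le]
    · filter_upwards [h1.eventually (lt_mem_nhds (sub_pos.2 h))] with p hp
      rw [if_neg h.not_ge, if_neg (sub_pos.1 hp).not_ge]
  · intro x s
    have hinj : Function.Injective fun z : Plane × Icc (0 : ℝ) M => (z.1 + x, z.2) :=
      fun z w h => by
        simp only [Prod.mk.injEq, add_left_inj] at h
        exact Prod.ext h.1 h.2
    unfold discsMeet
    congr 1
    rw [eq_iff_iff]
    simp only [Finset.forall_mem_image, hinj.ne_iff, dist_add_right]
  · intro z hz
    exact (mem_ball_zero_iff.1 hz.1).le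
  · intro z hz w hw
    rw [discsMeet_pair hρ, if_pos]
    have h1 := mem_ball_zero_iff.1 hz.1
    have h2 := mem_ball_zero_iff.1 hw.1
    have h3 : M / 2 < (z.2 : ℝ) := hz.2
    have h4 : M / 2 < (w.2 : ℝ) := hw.2
    have := norm_sub_le z.1 w.1
    rw [dist_eq_norm]
    linarith

end StraussDisc

end MarkedGibbs

/-! ### Limits of deaths along degenerating configurations -/

namespace MarkedGibbs

open scoped Classical

namespace Model.IsTame

variable {𝕄 : Type} [MeasurableSpace 𝕄] {ι : Type} [Fintype ι] {X : Model 𝕄 ι}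
variable [TopologicalSpace 𝕄] {κ : Type}
variable {c : κ → 𝕄 → 𝕄 → ℝ} {Θ : Set (ι → ℝ)} {D : ℝ} (hX : X.IsTame c Θ D)
variable [T2Space 𝕄] [BorelSpace 𝕄] [SecondCountableTopology 𝕄] [Finite κ]
variable [IsProbabilityMeasure X.markLaw]

include hX

/-- The balance equation passes to the limit by dominated convergence. Only the births have to
converge; the configurations may approach one that is not generic, where the deaths may be
discontinuous. -/
lemma tendsto_sum_death {θ : ι → ℝ} (hθ : θ ∈ Θ) {v : ι → ℝ}
    (hv : ∀ φ : Finset (Plane × 𝕄), IsGeneric c (φ : Set (Plane × 𝕄)) →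
      (φ : Set (Plane × 𝕄)) ∈ X.hardCore → ∑ j, v j * X.innov θ φ j = 0)
    {φ : ℕ → Finset (Plane × 𝕄)} (hφ : ∀ n, IsGeneric c (φ n : Set (Plane × 𝕄)))
    (hc : ∀ n, (φ n : Set (Plane × 𝕄)) ∈ X.hardCore) {r : ℝ} (hr : ∀ n, ∀ w ∈ φ n, ‖w.1‖ ≤ r)
    {C : ℝ} (hC : ∀ n z, |∑ j, v j * X.birth θ (φ n) z j - ∑ j, v j * X.birth θ ∅ z j| ≤ C)
    {G : Plane × 𝕄 → ℝ}
    (hG : ∀ᵐ z ∂X.mu, Tendsto (fun n => ∑ j, v j * X.birth θ (φ n) z j) atTop (𝓝 (G z))) :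
    Tendsto (fun n => ∑ j, v j * X.death (φ n) j) atTop
      (𝓝 (∫ z, (G z - ∑ j, v j * X.birth θ ∅ z j) ∂X.mu)) := by
  have h1 : ∀ n, ∑ j, v j * X.death (φ n) j = _ := fun n =>
    hX.sum_death_eq hθ (hφ n) (hc n) (hv _ (hφ n) (hc n))
  simp only [h1]
  set S : Set (Plane × 𝕄) := Metric.closedBall (0 : Plane) (r + D) ×ˢ univ with hS
  have hSm : MeasurableSet S := Metric.isClosed_closedBall.measurableSet.prod MeasurableSet.univ
  refine tendsto_integral_of_dominated_convergence (S.indicator fun _ => C) (fun n => ?_) ?_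
    (fun n => Eventually.of_forall fun z => ?_) ?_
  · have : (fun z => ∑ j, v j * X.birth θ (φ n) z j - ∑ j, v j * X.birth θ ∅ z j)
        = fun z => ∑ j, v j * (X.birth θ (φ n) z j - X.birth θ ∅ z j) := by
      funext z
      simp only [mul_sub, Finset.sum_sub_distrib]
    rw [this]
    exact (integrable_finsetSum _ fun j _ =>
      (hX.integrable_birth_sub hθ (hφ n) (hc n) j).const_mul _).aestronglyMeasurable
  · exact (integrable_indicator_iff hSm).2
      (integrableOn_const (X.mu_lt_top Metric.isBounded_closedBall).ne)
  · by_cases hz : z ∈ S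
    · rw [indicator_of_mem hz, Real.norm_eq_abs]
      exact hC n z
    · rw [indicator_of_notMem hz, hX.sum_birth_of_far θ (hc n) v (hr n) hz, norm_zero]
  · filter_upwards [hG] with z hz
    exact hz.sub_const _

end Model.IsTame

/-! ### Area interaction -/

section Area

variable {𝕄 : Type} {R : ℝ}

/-- The union of the discs of radius `R` centred at the points of `φ`. -/
def discUnion (R : ℝ) (φ : Finset (Plane × 𝕄)) : Set Plane := ⋃ z ∈ φ, Metric.closedBall z.1 R

lemma mem_discUnion {φ : Finset (Plane × 𝕄)} {u : Plane} :
    u ∈ discUnion R φ ↔ ∃ z ∈ φ, u ∈ Metric.closedBall z.1 R := by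
  simp [discUnion]

lemma measurableSet_discUnion (φ : Finset (Plane × 𝕄)) : MeasurableSet (discUnion R φ) :=
  Finset.measurableSet_biUnion _ fun _ _ => Metric.isClosed_closedBall.measurableSet

lemma discUnion_subset {φ : Finset (Plane × 𝕄)} {r : ℝ} (h : ∀ z ∈ φ, ‖z.1‖ ≤ r) :
    discUnion R φ ⊆ Metric.closedBall 0 (r + R) := by
  intro u hu
  obtain ⟨z, hz, hu⟩ := mem_discUnion.1 hu
  rw [Metric.mem_closedBall, dist_eq_norm] at hu
  rw [mem_closedBall_zero_iff]
  have h1 := norm_add_le (u - z.1) z.1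
  rw [sub_add_cancel] at h1
  linarith [h z hz]

lemma volume_discUnion_ne_top (φ : Finset (Plane × 𝕄)) : volume (discUnion R φ) ≠ ∞ := by
  obtain ⟨r, hr⟩ := (φ.finite_toSet.image fun w => ‖w.1‖).bddAbove
  exact ((measure_mono (discUnion_subset fun w hw => hr ⟨w, hw, rfl⟩)).trans_lt
    measure_closedBall_lt_top).ne

lemma discUnion_insert (φ : Finset (Plane × 𝕄)) (z : Plane × 𝕄) :
    discUnion R (insert z φ) = Metric.closedBall z.1 R ∪ discUnion R φ := by
  simp [discUnion]

lemma volume_closedBall_diff_le (x : Plane) (A : Set Plane) :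
    (volume (Metric.closedBall x R \ A)).toReal
      ≤ (volume (Metric.closedBall (0 : Plane) R)).toReal := by
  refine ENNReal.toReal_mono measure_closedBall_lt_top.ne ?_
  rw [Measure.addHaar_closedBall_center volume (0 : Plane),
    ← Measure.addHaar_closedBall_center volume x]
  exact measure_mono sdiff_subset

variable [MeasurableSpace 𝕄] (ν : Measure 𝕄)

/-- The model whose statistics are the number of points and the area of the union of the discs of
radius `R` centred at them. -/
def areaModel (ν : Measure 𝕄) (R : ℝ) : Model 𝕄 (Fin 2) where
  markLaw := ν
  stat φ := ![(φ.card : ℝ), (volume (discUnion R φ)).toReal]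
  hardCore := univ

lemma areaModel_incr_one (φ : Finset (Plane × 𝕄)) (z : Plane × 𝕄) :
    (areaModel ν R).incr φ z 1 = (volume (Metric.closedBall z.1 R \ discUnion R φ)).toReal := by
  simp only [Model.incr, areaModel, Matrix.cons_val_one, Matrix.cons_val_fin_one]
  rw [discUnion_insert, ← sdiff_union_self, measure_union disjoint_sdiff_left
    (measurableSet_discUnion φ), ENNReal.toReal_add _ (volume_discUnion_ne_top φ),
    add_sub_cancel_right]
  exact ((measure_mono sdiff_subset).trans_lt measure_closedBall_lt_top).ne

lemma areaModel_incr_zero {φ : Finset (Plane × 𝕄)} {z : Plane × 𝕄} (hz : z ∉ φ) :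
    (areaModel ν R).incr φ z 0 = 1 := by
  simp [Model.incr, areaModel, Finset.card_insert_of_notMem hz]

lemma areaModel_abs_incr (φ : Finset (Plane × 𝕄)) (z : Plane × 𝕄) (j : Fin 2) :
    |(areaModel ν R).incr φ z j| ≤ 1 + (volume (Metric.closedBall (0 : Plane) R)).toReal := by
  have h0 : 0 ≤ (volume (Metric.closedBall (0 : Plane) R)).toReal := ENNReal.toReal_nonneg
  fin_cases j
  · by_cases hz : z ∈ φ
    · simp only [Model.incr_of_mem _ hz, Pi.zero_apply, abs_zero]
      linarith
    · change |(areaModel ν R).incr φ z 0| ≤ _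
      rw [areaModel_incr_zero ν hz, abs_one]
      linarith
  · change |(areaModel ν R).incr φ z 1| ≤ _
    rw [areaModel_incr_one, abs_of_nonneg ENNReal.toReal_nonneg]
    linarith [volume_closedBall_diff_le (R := R) z.1 (discUnion R φ)]

variable [TopologicalSpace 𝕄] {κ : Type} {c : κ → 𝕄 → 𝕄 → ℝ}
  (hc : ∀ k, Continuous fun p : 𝕄 × 𝕄 => c k p.1 p.2) (hR : 0 < R)
variable [SecondCountableTopology 𝕄]

include hR in
lemma continuousAt_volume_discUnion {n : ℕ} (x : Fin n → Plane × 𝕄) :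
    ContinuousAt (fun y : Fin n → Plane × 𝕄 =>
      (volume (discUnion R (Finset.univ.image y))).toReal) x := by
  have hmem : ∀ (y : Fin n → Plane × 𝕄) (u : Plane), u ∈ discUnion R (Finset.univ.image y) ↔
      ∃ i, u ∈ Metric.closedBall (y i).1 R := fun y u => by simp [discUnion]
  have hfst : ∀ i, ContinuousAt (fun y : Fin n → Plane × 𝕄 => (y i).1) x := fun i =>
    (continuous_fst.comp (continuous_apply i)).continuousAt
  obtain ⟨r, hr⟩ := (Set.finite_range fun i => ‖(x i).1‖).bddAbove
  refine continuousAt_volume_toReal (r := r + 1 + R) (fun y => measurableSet_discUnion _) ?_ ?_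
  · have h1 : ∀ᶠ y in 𝓝 x, ∀ i, ‖(y i).1‖ < r + 1 := eventually_all.2 fun i =>
      (hfst i).norm.eventually (gt_mem_nhds (by linarith [hr ⟨i, rfl⟩]))
    filter_upwards [h1] with y hy
    refine discUnion_subset fun z hz => ?_
    obtain ⟨i, -, rfl⟩ := Finset.mem_image.1 hz
    exact (hy i).le
  · have h1 : ∀ᵐ u : Plane, ∀ i, ∀ᶠ y in 𝓝 (x i).1,
        (u ∈ Metric.closedBall y R ↔ u ∈ Metric.closedBall (x i).1 R) :=
      ae_all_iff.2 fun i => ae_eventually_mem_closedBall_iff hR _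
    filter_upwards [h1] with u hu
    have h2 : ∀ᶠ y in 𝓝 x, ∀ i,
        (u ∈ Metric.closedBall (y i).1 R ↔ u ∈ Metric.closedBall (x i).1 R) :=
      eventually_all.2 fun i => (hfst i).eventually (hu i)
    filter_upwards [h2] with y hy
    rw [hmem, hmem]
    exact exists_congr hy

-- Both increments are bounded, so stability requires no sign condition on the parameters. The range
-- is `2 * R` because discs of radius `R` whose centres are farther apart are disjoint.
include hc hR in
lemma areaModel_isTame {Θ : Set (Fin 2 → ℝ)} (hΘ : IsCompact Θ) :
    (areaModel ν R).IsTame c Θ (2 * R) := by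
  set W := (volume (Metric.closedBall (0 : Plane) R)).toReal
  have hW : 0 ≤ W := ENNReal.toReal_nonneg
  refine Model.IsTame.of_univ rfl (by positivity) hc ?_ ?_ ?_ ?_
  · exact fun j => ⟨1 + W, 0, by positivity, fun φ z => by
      simpa only [pow_zero, mul_one] using areaModel_abs_incr ν φ z j⟩
  · intro φ φ' z h
    have hz := h z (by simpa using hR.le)
    by_cases hzφ : z ∈ φ
    · rw [Model.incr_of_mem _ hzφ, Model.incr_of_mem _ (hz.1 hzφ)]
    funext j
    fin_cases j
    · exact (areaModel_incr_zero ν hzφ).trans (areaModel_incr_zero ν (mt hz.2 hzφ)).symm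
    · change (areaModel ν R).incr φ z 1 = (areaModel ν R).incr φ' z 1
      rw [areaModel_incr_one, areaModel_incr_one]
      congr 2
      ext u
      simp only [Set.mem_sdiff, mem_discUnion, and_congr_right_iff]
      intro hu
      refine not_congr (exists_congr fun w => ?_)
      refine and_congr_left fun hw => h w ?_
      have h1 := Metric.mem_closedBall'.1 hu
      have h2 := Metric.mem_closedBall.1 hw
      linarith [dist_triangle z.1 u w.1]
  · obtain ⟨B, hB0, hB⟩ := exists_abs_le hΘ
    refine ⟨∑ j : Fin 2, B * (1 + W), by positivity, fun θ hθ φ z => ?_⟩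
    rw [← Finset.sum_neg_distrib]
    refine Finset.sum_le_sum fun j _ => (abs_le.1 ?_).1
    rw [abs_mul]
    exact mul_le_mul (hB θ hθ j) (areaModel_abs_incr ν φ z j) (abs_nonneg _) hB0
  · intro n
    refine continuousOn_pi.2 fun j => ?_
    fin_cases j
    · exact continuousOn_card_image
    · exact fun x _ => (continuousAt_volume_discUnion hR x).continuousWithinAt

lemma continuousAt_volume_diff (hR : 0 < R) (A : Set Plane) (hA : MeasurableSet A) (x y : Plane) :
    ContinuousAt (fun y => (volume (Metric.closedBall x R \ (A ∪ Metric.closedBall y R))).toReal) y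
    ∧ ContinuousAt (fun y => (volume (Metric.closedBall y R \ A)).toReal) y := by
  constructor
  · refine continuousAt_volume_toReal (r := ‖x‖ + R) (fun y => Metric.isClosed_closedBall.measurableSet.diff
      (hA.union Metric.isClosed_closedBall.measurableSet)) (Eventually.of_forall fun y => ?_) ?_
    · exact sdiff_subset.trans (Metric.closedBall_subset_closedBall' (by simp [add_comm]))
    · filter_upwards [ae_eventually_mem_closedBall_iff hR y] with u hu
      filter_upwards [hu] with y' hy'
      simp only [Set.mem_sdiff, mem_union, hy']
  · refine continuousAt_volume_toReal (r := R + (‖y‖ + 1))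
      (fun y => Metric.isClosed_closedBall.measurableSet.diff hA) ?_ ?_
    · filter_upwards [(continuousAt_id (x := y)).norm.eventually (gt_mem_nhds (lt_add_one ‖y‖))]
        with y' hy'
      exact sdiff_subset.trans (Metric.closedBall_subset_closedBall' (by
        rw [dist_zero_right]
        exact add_le_add_right hy'.le R))
    · filter_upwards [ae_eventually_mem_closedBall_iff hR y] with u hu
      filter_upwards [hu] with y' hy'
      simp only [Set.mem_sdiff, hy']

lemma volume_discUnion_translate (x : Plane) (φ : Finset (Plane × 𝕄)) :
    volume (discUnion R (φ.image fun z => (z.1 + x, z.2))) = volume (discUnion R φ) := by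
  have h : discUnion R (φ.image fun z => (z.1 + x, z.2))
      = (fun u : Plane => u + -x) ⁻¹' discUnion R φ := by
    ext u
    simp only [mem_discUnion, Finset.mem_image, mem_preimage, Metric.mem_closedBall, dist_eq_norm]
    constructor
    · rintro ⟨_, ⟨z, hz, rfl⟩, h⟩
      refine ⟨z, hz, ?_⟩
      rwa [← sub_sub, sub_right_comm, sub_eq_add_neg u x] at h
    · rintro ⟨z, hz, h⟩
      refine ⟨_, ⟨z, hz, rfl⟩, ?_⟩
      rwa [← sub_sub, sub_right_comm, sub_eq_add_neg u x]
  rw [h, measure_preimage_add_right]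

lemma areaModel_translationInvariant : (areaModel ν R).TranslationInvariant := by
  refine ⟨fun x φ => ?_, fun x φ => Iff.rfl⟩
  have hinj : Function.Injective fun z : Plane × 𝕄 => (z.1 + x, z.2) := fun z w h => by
    simp only [Prod.mk.injEq, add_left_inj] at h
    exact Prod.ext h.1 h.2
  simp only [areaModel]
  rw [Finset.card_image_of_injective _ hinj, volume_discUnion_translate]

variable [T2Space 𝕄] [BorelSpace 𝕄] [Finite κ]
variable [IsProbabilityMeasure ν] [ν.IsOpenPosMeasure]

instance : IsProbabilityMeasure (areaModel ν R).markLaw := inferInstanceAs (IsProbabilityMeasure ν)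
instance : (areaModel ν R).markLaw.IsOpenPosMeasure := inferInstanceAs ν.IsOpenPosMeasure

-- The union of discs centred in a bounded region has bounded area, so the statistic along `v` has
-- slope `v 0` in the number of points; `slope_nonpos` for `v` and `-v` gives `v 0 = 0`. Then let
-- two points merge. The births tend to those of a single point, but the deaths of the area tend to
-- zero since each disc ends up covered by the other, whereas the death of a single point is the
-- area `W` of a disc. Hence `v 1 * W = 0`.
include hR in
theorem areaModel_satisfiesAssumptions : (areaModel ν R).SatisfiesAssumptions univ := by
  refine Model.satisfiesAssumptions_of (κ := Empty) (c := fun k => k.elim)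
    (areaModel_translationInvariant ν) fun Θ hΘ _ => ?_
  have hX := areaModel_isTame (κ := Empty) (c := fun k => k.elim) ν (fun k => k.elim) hR hΘ
  refine ⟨2 * R, hX, ?_⟩
  set W := (volume (Metric.closedBall (0 : Plane) R)).toReal with hWdef
  have hW : 0 < W := ENNReal.toReal_pos (Metric.measure_closedBall_pos _ _ hR).ne'
      measure_closedBall_lt_top.ne
  have hball : ∀ x : Plane, (volume (Metric.closedBall x R)).toReal = W := fun x => by
    rw [hWdef, Measure.addHaar_closedBall_center volume x]
  obtain ⟨m⟩ : Nonempty 𝕄 := by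
    by_contra h
    rw [not_nonempty_iff] at h
    exact IsProbabilityMeasure.ne_zero ν (Measure.eq_zero_of_isEmpty _)
  have hpair : ∀ {x y : Plane}, x ≠ y →
      IsGeneric (fun k : Empty => k.elim) (({(x, m), (y, m)} : Finset (Plane × 𝕄)) : Set (Plane × 𝕄)) := by
    intro x y hxy
    simp only [Finset.coe_insert, Finset.coe_singleton]
    refine ⟨?_, fun _ _ _ _ _ k => k.elim, ?_⟩
    · rintro _ (rfl | rfl) _ (rfl | rfl) h
      exacts [absurd rfl h, hxy, hxy.symm, absurd rfl h]
    · rintro _ (rfl | rfl) _ (rfl | rfl) _ (rfl | rfl) h h' h'' <;>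
      first
      | exact absurd rfl h
      | exact absurd rfl h'
      | exact absurd rfl h''
  let e : ℕ → Plane := fun n => EuclideanSpace.single 0 (R / (n + 1))
  have he_norm : ∀ n, ‖e n‖ = R / (n + 1) := fun n => by
    simp only [e, PiLp.norm_single, Real.norm_eq_abs]
    exact abs_of_pos (by positivity)
  have he_ne : ∀ n, (0 : Plane) ≠ e n := fun n h => by
    have h1 := he_norm n
    rw [← h, norm_zero] at h1
    have : 0 < R / ((n : ℝ) + 1) := by positivity
    linarith
  have he : Tendsto e atTop (𝓝 0) := by
    rw [tendsto_zero_iff_norm_tendsto_zero]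
    simp only [he_norm]
    exact tendsto_const_div_atTop_nhds_zero_nat R |>.comp (tendsto_add_atTop_nat 1) |>.congr
      fun n => by simp
  have hne : ∀ n, ((0 : Plane), m) ≠ (e n, m) := fun n h => he_ne n (Prod.mk.inj h).1
  have hU : ∀ x : Plane × 𝕄, discUnion R {x} = Metric.closedBall x.1 R := fun x => by
    simp [discUnion]
  refine ⟨fun v hv => ?_, fun θ hθ v hv => ?_⟩
  · have h0 := hv ∅ (0, m) (by simp) (by simpa using isGeneric_singleton _ _) trivial
    have h1 := hv {(e 0, m)} (0, m) (by simpa using he_ne 0) (by simpa using hpair (he_ne 0)) trivial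
    rw [Fin.sum_univ_two, areaModel_incr_one, areaModel_incr_zero ν (by simp)] at h0
    rw [Fin.sum_univ_two, areaModel_incr_one, areaModel_incr_zero ν (by simpa using he_ne 0),
      hU] at h1
    have h2 : discUnion R (∅ : Finset (Plane × 𝕄)) = ∅ := by simp [discUnion]
    rw [h2, sdiff_empty, hball] at h0
    have h3 : (volume (Metric.closedBall (0 : Plane) R \ Metric.closedBall (e 0) R)).toReal
        = W - (volume (Metric.closedBall (0 : Plane) R ∩ Metric.closedBall (e 0) R)).toReal := by
      rw [← hball 0, ← measure_inter_add_sdiff (Metric.closedBall (0 : Plane) R)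
        (Metric.isClosed_closedBall (x := e 0) (ε := R)).measurableSet, ENNReal.toReal_add]
      · ring
      · exact ((measure_mono inter_subset_left).trans_lt measure_closedBall_lt_top).ne
      · exact ((measure_mono sdiff_subset).trans_lt measure_closedBall_lt_top).ne
    -- The intersection contains the disc of radius `R / 2` about the midpoint of the two centres.
    have h4 : 0 < (volume (Metric.closedBall (0 : Plane) R ∩ Metric.closedBall (e 0) R)).toReal := by
      refine ENNReal.toReal_pos (ne_of_gt ?_)
        ((measure_mono inter_subset_left).trans_lt measure_closedBall_lt_top).ne
      refine (Metric.measure_closedBall_pos volume ((1 / 2 : ℝ) • e 0) (half_pos hR)).trans_le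
        (measure_mono (subset_inter ?_ ?_)) <;>
      · refine Metric.closedBall_subset_closedBall' ?_
        have h5 : ‖(1 / 2 : ℝ) • e 0‖ = R / 2 := by
          rw [norm_smul, he_norm]
          norm_num
          ring
        first
        | rw [dist_zero_right, h5]; linarith
        | rw [dist_eq_norm, show (1 / 2 : ℝ) • e 0 - e 0 = -((1 / 2 : ℝ) • e 0) by module,
            norm_neg, h5]
          linarith
    rw [h3] at h1
    have h5 : v 1 = 0 := by
      have : v 1 * (volume (Metric.closedBall (0 : Plane) R ∩ Metric.closedBall (e 0) R)).toReal
        = 0 := by linarith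
      exact (mul_eq_zero.1 this).resolve_right h4.ne'
    have h6 : v 0 = 0 := by
      rw [h5] at h0
      linarith
    funext j
    fin_cases j
    exacts [h6, h5]
  · obtain ⟨T, hT0, hT⟩ := hX.exists_papangelou_le
    have hC : ∀ v : Fin 2 → ℝ, ∀ φ z, |∑ j, v j * (areaModel ν R).birth θ φ z j|
        ≤ ∑ j, |v j| * ((1 + W) * T) := by
      intro v φ z
      have hp := (areaModel ν R).papangelou_nonneg θ φ z
      refine (Finset.abs_sum_le_sum_abs _ _).trans (Finset.sum_le_sum fun j _ => ?_)
      rw [abs_mul, Model.birth, abs_mul, abs_of_nonneg hp]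
      have := mul_le_mul (areaModel_abs_incr ν (R := R) φ z j) (hT θ hθ φ z) hp (by positivity)
      gcongr
    have hv0 : ∀ v : Fin 2 → ℝ, (∀ φ : Finset (Plane × 𝕄),
        IsGeneric (fun k : Empty => k.elim) (φ : Set (Plane × 𝕄)) →
        (φ : Set (Plane × 𝕄)) ∈ (areaModel ν R).hardCore →
          ∑ j, v j * (areaModel ν R).innov θ φ j = 0) → v 0 ≤ 0 := by
      intro v hv
      refine hX.slope_nonpos hθ hv (fun φ _ _ => hC v φ) (r := 1) (B := 1)
        (b := |v 1| * (volume (Metric.closedBall (0 : Plane) (1 + R))).toReal) fun n => ?_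
      obtain ⟨x, hxi, hxg, hxU⟩ := hX.exists_generic (α := Fin n)
        (U := fun _ => Metric.ball (0 : Plane) 1 ×ˢ (univ : Set 𝕄))
        (fun _ => Metric.isOpen_ball.prod isOpen_univ) fun _ => ⟨(0, m), by simp⟩
      have hr : ∀ w ∈ Finset.univ.image x, ‖w.1‖ ≤ 1 := by
        intro w hw
        obtain ⟨i, -, rfl⟩ := Finset.mem_image.1 hw
        exact (mem_ball_zero_iff.1 (hxU i).1).le
      have hcard : (Finset.univ.image x).card = n := by simp [Finset.card_image_of_injective _ hxi]
      refine ⟨Finset.univ.image x, by simpa using hxg, trivial, hr, by rw [hcard, one_mul], ?_⟩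
      have h1 : |v 1 * (volume (discUnion R (Finset.univ.image x))).toReal|
          ≤ |v 1| * (volume (Metric.closedBall (0 : Plane) (1 + R))).toReal := by
        rw [abs_mul, abs_of_nonneg ENNReal.toReal_nonneg]
        have := ENNReal.toReal_mono measure_closedBall_lt_top.ne
          (measure_mono (μ := (volume : Measure Plane)) (discUnion_subset (R := R) hr))
        gcongr
      rw [Fin.sum_univ_two]
      simp only [areaModel, Matrix.cons_val_zero, Matrix.cons_val_one, Matrix.cons_val_fin_one,
        hcard]
      linarith [(abs_le.1 h1).1]
    have hv0' : v 0 = 0 := by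
      refine le_antisymm (hv0 v hv) ?_
      have := hv0 (-v) fun φ h1 h2 => by
        simp only [Pi.neg_apply, neg_mul, Finset.sum_neg_distrib, hv φ h1 h2, neg_zero]
      simpa using this
    have hsum : ∀ f : Fin 2 → ℝ, ∑ j, v j * f j = v 1 * f 1 := fun f => by
      rw [Fin.sum_univ_two, hv0', zero_mul, zero_add]
    have hlim := hX.tendsto_sum_death hθ hv (φ := fun n => {(0, m), (e n, m)})
      (fun n => hpair (he_ne n)) (fun _ => trivial) (r := R) (fun n w hw => ?_)
      (fun n z => (abs_sub _ _).trans (add_le_add (hC v _ z) (hC v _ z)))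
      (G := fun z => ∑ j, v j * (areaModel ν R).birth θ {(0, m)} z j) ?_
    -- By the balance equation at the single point, the limit of the deaths of the pair has to be
    -- the death of that point.
    · rw [← hX.sum_death_eq hθ (by simpa using isGeneric_singleton _ _) trivial
        (hv _ (by simpa using isGeneric_singleton _ _) trivial)] at hlim
      simp only [hsum] at hlim
      have h1 : (areaModel ν R).death {(0, m)} 1 = W := by
        rw [Model.death, Finset.sum_singleton, areaModel_incr_one]
        simp [discUnion, hWdef]
      have h2 : ∀ n, (areaModel ν R).death {(0, m), (e n, m)} 1 =
          (volume (Metric.closedBall 0 R \ (∅ ∪ Metric.closedBall (e n) R))).toReal +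
          (volume (Metric.closedBall (e n) R \ Metric.closedBall 0 R)).toReal := by
        intro n
        rw [Model.death, Finset.sum_pair (hne n), areaModel_incr_one, areaModel_incr_one,
          Finset.erase_insert (by simpa using he_ne n), Finset.pair_comm,
          Finset.erase_insert (by simpa using (he_ne n).symm), hU, hU, empty_union]
      simp only [h1, h2] at hlim
      have h3 := ((continuousAt_volume_diff hR ∅ MeasurableSet.empty 0 0).1.tendsto.comp he).add
        ((continuousAt_volume_diff hR _ (Metric.isClosed_closedBall (x := (0 : Plane))
          (ε := R)).measurableSet 0 0).2.tendsto.comp he)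
      simp only [empty_union, Set.sdiff_self, measure_empty, ENNReal.toReal_zero,
        add_zero] at h3
      have h4 := tendsto_nhds_unique hlim ((h3.const_mul (v 1)).congr fun n => by simp)
      rw [mul_zero] at h4
      have h5 := (mul_eq_zero.1 h4).resolve_right hW.ne'
      funext j
      fin_cases j
      exacts [hv0', h5]
    · rcases Finset.mem_insert.1 hw with rfl | hw
      · simpa using hR.le
      · rw [Finset.mem_singleton.1 hw, he_norm]
        exact div_le_self hR.le (by linarith [Nat.cast_nonneg (α := ℝ) n])
    · have h0 : ∀ᵐ z ∂(areaModel ν R).mu, dist z.1 0 ≠ 0 :=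
        ae_dist_ne ν (0 : Plane) (f := fun _ => 0) (by fun_prop)
      filter_upwards [h0] with z hz
      have hz0 : z.1 ≠ 0 := fun h => hz (by rw [h, dist_self])
      have hzn : ∀ᶠ n in atTop, z ∉ ({(0, m), (e n, m)} : Finset (Plane × 𝕄)) := by
        filter_upwards [he.eventually_ne hz0.symm] with n hn
        rw [Finset.mem_insert, Finset.mem_singleton]
        rintro (h | h)
        · exact hz0 (by rw [h])
        · exact hn (by rw [h])
      have hi : ∀ j, Tendsto (fun n => (areaModel ν R).incr {(0, m), (e n, m)} z j) atTop
          (𝓝 ((areaModel ν R).incr {(0, m)} z j)) := by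
        intro j
        fin_cases j
        · refine tendsto_const_nhds.congr' ?_
          filter_upwards [hzn] with n hn
          refine (areaModel_incr_zero ν ?_).trans (areaModel_incr_zero ν hn).symm
          exact fun h => hn (Finset.mem_insert.2 (Or.inl (Finset.mem_singleton.1 h)))
        · change Tendsto (fun n => (areaModel ν R).incr {(0, m), (e n, m)} z 1) atTop
            (𝓝 ((areaModel ν R).incr {(0, m)} z 1))
          simp only [areaModel_incr_one, discUnion_insert, hU]
          have := (continuousAt_volume_diff hR _ (Metric.isClosed_closedBall (x := (0 : Plane))
            (ε := R)).measurableSet z.1 0).1.tendsto.comp he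
          rw [union_self] at this
          exact this
      refine tendsto_finsetSum _ fun j _ => ((hi j).mul ?_).const_mul _
      have hp : ∀ φ, (areaModel ν R).papangelou θ φ z
          = Real.exp (-∑ j, θ j * (areaModel ν R).incr φ z j) := fun φ => if_pos trivial
      simp only [hp]
      exact (Real.continuous_exp.tendsto _).comp
        (tendsto_finsetSum _ fun j _ => (hi j).const_mul _).neg

include hR in
theorem areaInteraction_satisfiesAssumptions : (areaInteraction R).SatisfiesAssumptions univ :=
  areaModel_satisfiesAssumptions (Measure.dirac ()) hR

end Area

end MarkedGibbs

/-! ### Geyer's triplet process -/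

namespace MarkedGibbs

open scoped Classical

/-- A disc can be divided into finitely many cells of small diameter. -/
lemma exists_cells (r : ℝ) {ε : ℝ} (hε : 0 < ε) : ∃ (t : Finset Plane) (f : Plane → Plane),
    (∀ x, ‖x‖ ≤ r → f x ∈ t) ∧ ∀ x y, ‖x‖ ≤ r → ‖y‖ ≤ r → f x = f y → dist x y < ε := by
  obtain ⟨t, -, ht, hcov⟩ :=
    (isCompact_closedBall (0 : Plane) r).finite_cover_balls (half_pos hε)
  have h : ∀ x : Plane, ∃ y, ‖x‖ ≤ r → y ∈ t ∧ dist x y < ε / 2 := by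
    intro x
    by_cases hx : ‖x‖ ≤ r
    · obtain ⟨y, hy, hxy⟩ := mem_iUnion₂.1 (hcov (mem_closedBall_zero_iff.2 hx))
      exact ⟨y, fun _ => ⟨hy, hxy⟩⟩
    · exact ⟨0, fun h => absurd h hx⟩
  choose f hf using h
  refine ⟨ht.toFinset, f, fun x hx => ht.mem_toFinset.2 (hf x hx).1, fun x y hx hy hxy => ?_⟩
  have h1 := (hf x hx).2
  have h2 := (hf y hy).2
  rw [← hxy, dist_comm] at h2
  linarith [dist_triangle x (f x) y]

section Geyer

variable {𝕄 : Type}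

/-- The indicator that the points of `s` are at distances at most `R`. -/
def close (R : ℝ) (s : Finset (Plane × 𝕄)) : ℝ :=
  if ∀ z₁ ∈ s, ∀ z₂ ∈ s, dist z₁.1 z₂.1 ≤ R then 1 else 0

lemma close_nonneg (R : ℝ) (s : Finset (Plane × 𝕄)) : 0 ≤ close R s := by
  unfold close
  split_ifs <;> simp

lemma close_le_one (R : ℝ) (s : Finset (Plane × 𝕄)) : close R s ≤ 1 := by
  unfold close
  split_ifs <;> simp

/-- The model whose statistics are the numbers of points, of close pairs and of close triples. -/
def geyerModel [MeasurableSpace 𝕄] (ν : Measure 𝕄) (R : ℝ) : Model 𝕄 (Fin 3) where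
  markLaw := ν
  stat φ := ![(φ.card : ℝ), ∑ s ∈ φ.powersetCard 2, close R s, ∑ s ∈ φ.powersetCard 3, close R s]
  hardCore := univ

lemma geyerTriplet_eq (R : ℝ) : geyerTriplet R = geyerModel (Measure.dirac ()) R := by
  have h : ∀ n φ, (closeSubsets R n φ : ℝ) = ∑ s ∈ φ.powersetCard n, close R s := by
    intro n φ
    rw [closeSubsets, Finset.natCast_card_filter]
    congr!
  simp only [geyerTriplet, geyerModel, h]

variable {R : ℝ}

/-- The points of `φ` at a distance at most `R` of `z`. -/
def nearby (R : ℝ) (φ : Finset (Plane × 𝕄)) (z : Plane × 𝕄) : Finset (Plane × 𝕄) :=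
  φ.filter fun w => dist z.1 w.1 ≤ R

lemma sum_close_insert (hR : 0 < R) (φ : Finset (Plane × 𝕄)) (z : Plane × 𝕄) (n : ℕ) :
    ∑ t ∈ φ.powersetCard n, close R (insert z t)
      = ∑ t ∈ (nearby R φ z).powersetCard n, close R t := by
  have h : (nearby R φ z).powersetCard n
      = (φ.powersetCard n).filter fun t => ∀ w ∈ t, dist z.1 w.1 ≤ R := by
    ext t
    simp only [nearby, Finset.mem_powersetCard, Finset.mem_filter, Finset.subset_iff]
    grind
  rw [h, Finset.sum_filter]
  refine Finset.sum_congr rfl fun t _ => ?_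
  unfold close
  rw [← ite_and]
  congr 1
  simp only [Finset.forall_mem_insert, dist_self, eq_iff_iff]
  constructor
  · rintro ⟨⟨-, h1⟩, h2⟩
    exact ⟨h1, fun a ha => (h2 a ha).2⟩
  · rintro ⟨h1, h2⟩
    exact ⟨⟨hR.le, h1⟩, fun a ha => ⟨by rw [dist_comm]; exact h1 a ha, h2 a ha⟩⟩

variable [MeasurableSpace 𝕄] (ν : Measure 𝕄)

lemma geyerModel_incr (hR : 0 < R) {φ : Finset (Plane × 𝕄)} {z : Plane × 𝕄} (hz : z ∉ φ) :
    (geyerModel ν R).incr φ z =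
      ![1, ((nearby R φ z).card : ℝ), ∑ t ∈ (nearby R φ z).powersetCard 2, close R t] := by
  have h1 : ∑ t ∈ (nearby R φ z).powersetCard 1, close R t = ((nearby R φ z).card : ℝ) := by
    rw [Finset.powersetCard_one, Finset.sum_map]
    simp [close, hR.le]
  funext j
  fin_cases j
  · simp [Model.incr, geyerModel, Finset.card_insert_of_notMem hz]
  · simp [Model.incr, geyerModel, sum_powersetCard_succ_insert (close R) hz 1, sum_close_insert hR,
      h1]
  · simp [Model.incr, geyerModel, sum_powersetCard_succ_insert (close R) hz 2, sum_close_insert hR]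

lemma sum_close_le (φ : Finset (Plane × 𝕄)) :
    ∑ t ∈ φ.powersetCard 2, close R t ≤ (φ.card : ℝ) ^ 2 := by
  refine (Finset.sum_le_card_nsmul _ _ 1 fun t _ => close_le_one R t).trans ?_
  rw [Finset.card_powersetCard, nsmul_one]
  exact_mod_cast Nat.choose_le_pow _ _

lemma geyerModel_abs_incr (hR : 0 < R) (φ : Finset (Plane × 𝕄)) (z : Plane × 𝕄) (j : Fin 3) :
    |(geyerModel ν R).incr φ z j| ≤ (φ.card : ℝ) ^ (j : ℕ) := by
  by_cases hz : z ∈ φ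
  · simp only [Model.incr_of_mem _ hz, Pi.zero_apply, abs_zero]
    positivity
  have hc : ((nearby R φ z).card : ℝ) ≤ φ.card := by
    exact_mod_cast Finset.card_le_card (Finset.filter_subset _ _)
  rw [geyerModel_incr ν hR hz]
  fin_cases j
  · simp
  · simpa using hc
  · have h0 : 0 ≤ ∑ t ∈ (nearby R φ z).powersetCard 2, close R t :=
      Finset.sum_nonneg fun t _ => close_nonneg R t
    have := (sum_close_le (R := R) (nearby R φ z)).trans (pow_le_pow_left₀ (by positivity) hc 2)
    simpa [abs_of_nonneg h0] using this

/-- The number of close pairs among the points close to `z` dominates any multiple of the number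
of these points. -/
lemma exists_le_sum_close (hR : 0 < R) (A : ℝ) : ∃ Q : ℝ, 0 ≤ Q ∧
    ∀ (φ : Finset (Plane × 𝕄)) (z : Plane × 𝕄), A * (nearby R φ z).card - Q
      ≤ ∑ t ∈ (nearby R φ z).powersetCard 2, close R t := by
  -- Points in the same cell are close to one another, and the number of cells does not depend on
  -- the configuration.
  obtain ⟨T, f, hfT, hf⟩ := exists_cells R hR
  refine ⟨T.card * ((A + 1 / 2) ^ 2 / 2), by positivity, fun φ z => ?_⟩
  set N := nearby R φ z with hN
  have hNr : ∀ w ∈ N, ‖w.1 - z.1‖ ≤ R := fun w hw => by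
    rw [← dist_eq_norm, dist_comm]
    exact (Finset.mem_filter.1 hw).2
  let F : Plane → Finset (Plane × 𝕄) := fun c => N.filter fun w => f (w.1 - z.1) = c
  have h1 : (N.card : ℝ) = ∑ c ∈ T, ((F c).card : ℝ) := by
    have h := Finset.card_eq_sum_card_fiberwise (s := N) (t := T)
      (f := fun w : Plane × 𝕄 => f (w.1 - z.1)) fun w hw => hfT _ (hNr w hw)
    rw [h, Nat.cast_sum]
  have h2 : ∑ c ∈ T, (((F c).card.choose 2 : ℕ) : ℝ) ≤ ∑ t ∈ N.powersetCard 2, close R t := by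
    have h3 : (T.biUnion fun c => (F c).powersetCard 2).card = ∑ c ∈ T, (F c).card.choose 2 := by
      rw [Finset.card_biUnion]
      · simp only [Finset.card_powersetCard]
      · intro c _ c' _ hcc
        refine Finset.disjoint_left.2 fun t ht ht' => ?_
        rw [Finset.mem_powersetCard] at ht ht'
        obtain ⟨w, hw⟩ := Finset.card_pos.1 (by rw [ht.2]; norm_num : 0 < t.card)
        exact hcc ((Finset.mem_filter.1 (ht.1 hw)).2.symm.trans (Finset.mem_filter.1 (ht'.1 hw)).2)
    unfold close
    rw [← Finset.natCast_card_filter, ← Nat.cast_sum, ← h3]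
    refine Nat.cast_le.2 (Finset.card_le_card fun t ht => ?_)
    obtain ⟨c, -, hc⟩ := Finset.mem_biUnion.1 ht
    rw [Finset.mem_powersetCard] at hc
    refine Finset.mem_filter.2 ⟨Finset.mem_powersetCard.2
      ⟨hc.1.trans (Finset.filter_subset _ _), hc.2⟩, fun w hw u hu => ?_⟩
    have hw := Finset.mem_filter.1 (hc.1 hw)
    have hu := Finset.mem_filter.1 (hc.1 hu)
    have := hf _ _ (hNr w hw.1) (hNr u hu.1) (hw.2.trans hu.2.symm)
    rw [dist_sub_right] at this
    exact this.le
  refine le_trans ?_ h2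
  rw [h1, Finset.mul_sum, ← nsmul_eq_mul, ← Finset.sum_const, ← Finset.sum_sub_distrib]
  refine Finset.sum_le_sum fun c _ => ?_
  -- With `N` points in a cell, `N * (N - 1) / 2 - A * N + (A + 1 / 2) ^ 2 / 2` is half the square
  -- of `N - (A + 1 / 2)`; this explains `Q`.
  rw [Nat.cast_choose_two]
  nlinarith [sq_nonneg (((F c).card : ℝ) - (A + 1 / 2))]

variable [TopologicalSpace 𝕄]

/-- Stability with a possibly negative `θ 1`: by compactness `θ 2 ≥ ε > 0` on `Θ`, and the triangles
created by a new point are the close pairs of its neighbours, which dominate `B / ε` times the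
number of neighbours up to a constant. -/
lemma geyerModel_isTame (hR : 0 < R) {Θ : Set (Fin 3 → ℝ)} (hΘ : IsCompact Θ)
    (hsub : Θ ⊆ {θ | 0 < θ 2}) :
    (geyerModel ν R).IsTame (fun (_ : Unit) _ _ => R) Θ R := by
  refine Model.IsTame.of_univ rfl hR (fun _ => continuous_const) ?_ ?_ ?_ ?_
  · exact fun j => ⟨1, j, zero_le_one, fun φ z => by
      simpa only [one_mul] using geyerModel_abs_incr ν hR φ z j⟩
  · intro φ φ' z h
    have hz := h z (by simpa using hR.le)
    by_cases hzφ : z ∈ φ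
    · rw [Model.incr_of_mem _ hzφ, Model.incr_of_mem _ (hz.1 hzφ)]
    have : nearby R φ z = nearby R φ' z := by
      ext w
      simp only [nearby, Finset.mem_filter]
      exact and_congr_left fun hw => h w hw
    rw [geyerModel_incr ν hR hzφ, geyerModel_incr ν hR (mt hz.2 hzφ), this]
  · obtain ⟨B, hB0, hB⟩ := exists_abs_le hΘ
    obtain ⟨ε, hε0, hε⟩ : ∃ ε : ℝ, 0 < ε ∧ ∀ θ ∈ Θ, ε ≤ θ 2 := by
      rcases Θ.eq_empty_or_nonempty with rfl | hne
      · exact ⟨1, one_pos, fun _ h => h.elim⟩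
      · obtain ⟨θ₀, hθ₀, h⟩ := hΘ.exists_isMinOn hne
          (f := fun θ : Fin 3 → ℝ => θ 2) (by fun_prop)
        exact ⟨θ₀ 2, hsub hθ₀, fun θ hθ => h hθ⟩
    obtain ⟨Q, hQ0, hQ⟩ := exists_le_sum_close (𝕄 := 𝕄) hR (B / ε)
    refine ⟨B + ε * Q, by positivity, fun θ hθ φ z => ?_⟩
    by_cases hz : z ∈ φ
    · simp only [Model.incr_of_mem _ hz, Pi.zero_apply, mul_zero, Finset.sum_const_zero]
      have : 0 ≤ ε * Q := by positivity
      linarith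
    rw [geyerModel_incr ν hR hz, Fin.sum_univ_three]
    have h0 := abs_le.1 (hB θ hθ 0)
    have h1 := abs_le.1 (hB θ hθ 1)
    have h2 := hε θ hθ
    have h3 := hQ φ z
    set s : ℝ := ((nearby R φ z).card : ℝ) with hs
    set P := ∑ t ∈ (nearby R φ z).powersetCard 2, close R t with hP
    have hs0 : 0 ≤ s := by positivity
    have hP0 : 0 ≤ P := Finset.sum_nonneg fun t _ => close_nonneg R t
    have h4 : ε * P ≤ θ 2 * P := mul_le_mul_of_nonneg_right h2 hP0
    have h5 : ε * (B / ε * s - Q) ≤ ε * P := mul_le_mul_of_nonneg_left h3 hε0.le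
    have h6 : ε * (B / ε * s - Q) = B * s - ε * Q := by field_simp
    have h7 : -B * s ≤ θ 1 * s := mul_le_mul_of_nonneg_right h1.1 hs0
    simp only [Matrix.cons_val, mul_one]
    linarith
  · intro n
    have hcont : ∀ k, ContinuousOn (fun x : Fin n → Plane × 𝕄 =>
        ∑ t ∈ (Finset.univ.image x).powersetCard k, close R t)
        (genericTuples (fun (_ : Unit) _ _ => R) n) := by
      intro k
      refine continuousOn_sum_powersetCard _ k fun S _ x hx => ContinuousAt.continuousWithinAt ?_
      have hd : ∀ᶠ y in 𝓝 x, ∀ i j, (dist (y i).1 (y j).1 ≤ R ↔ dist (x i).1 (x j).1 ≤ R) := by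
        refine eventually_all.2 fun i => eventually_all.2 fun j => ?_
        have hc : ContinuousAt (fun y : Fin n → Plane × 𝕄 => dist (y i).1 (y j).1) x :=
          (((continuous_apply i).fst).dist ((continuous_apply j).fst)).continuousAt
        have hne : dist (x i).1 (x j).1 ≠ R := by
          by_cases hij : i = j
          · rw [hij, dist_self]
            exact hR.ne
          · exact (mem_genericTuples_iff.1 hx).2.1 i j hij ()
        rcases lt_or_gt_of_ne hne with h | h
        · filter_upwards [hc.eventually (gt_mem_nhds h)] with y hy
          exact iff_of_true hy.le h.le
        · filter_upwards [hc.eventually (lt_mem_nhds h)] with y hy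
          exact iff_of_false hy.not_ge h.not_ge
      refine (continuousAt_const (y := close R (S.image x))).congr ?_
      filter_upwards [hd] with y hy
      unfold close
      congr 1
      simp only [Finset.forall_mem_image, hy]
    refine continuousOn_pi.2 fun j => ?_
    fin_cases j
    · exact continuousOn_card_image
    · exact hcont 2
    · exact hcont 3

lemma geyerModel_translationInvariant : (geyerModel ν R).TranslationInvariant := by
  refine ⟨fun x φ => ?_, fun x φ => Iff.rfl⟩
  have hinj : Function.Injective fun z : Plane × 𝕄 => (z.1 + x, z.2) := fun z w h => by
    simp only [Prod.mk.injEq, add_left_inj] at h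
    exact Prod.ext h.1 h.2
  have h : ∀ s : Finset (Plane × 𝕄), close R (s.image fun z => (z.1 + x, z.2)) = close R s := by
    intro s
    unfold close
    congr 1
    rw [eq_iff_iff]
    simp only [Finset.forall_mem_image, dist_add_right]
  simp only [geyerModel]
  rw [Finset.card_image_of_injective _ hinj, sum_powersetCard_image _ hinj.injOn,
    sum_powersetCard_image _ hinj.injOn]
  simp only [h]

variable [T2Space 𝕄] [BorelSpace 𝕄] [SecondCountableTopology 𝕄]
variable [IsProbabilityMeasure ν] [ν.IsOpenPosMeasure]

instance : IsProbabilityMeasure (geyerModel ν R).markLaw := inferInstanceAs (IsProbabilityMeasure ν)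
instance : (geyerModel ν R).markLaw.IsOpenPosMeasure := inferInstanceAs ν.IsOpenPosMeasure

lemma geyerModel_incr_clique (hR : 0 < R) {φ : Finset (Plane × 𝕄)} {z : Plane × 𝕄} (hz : z ∉ φ)
    (h : ∀ w ∈ insert z φ, w.1 ∈ Metric.ball (0 : Plane) (R / 2)) :
    (geyerModel ν R).incr φ z = ![1, (φ.card : ℝ), (φ.card : ℝ) * (φ.card - 1) / 2] := by
  have hd : ∀ w ∈ insert z φ, ∀ u ∈ insert z φ, dist w.1 u.1 ≤ R := by
    intro w hw u hu
    have h1 := mem_ball_zero_iff.1 (h w hw)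
    have h2 := mem_ball_zero_iff.1 (h u hu)
    rw [dist_eq_norm]
    linarith [norm_sub_le w.1 u.1]
  have h1 : nearby R φ z = φ := Finset.filter_true_of_mem fun w hw =>
    hd z (Finset.mem_insert_self z φ) w (Finset.mem_insert_of_mem hw)
  have h2 : ∀ t ∈ φ.powersetCard 2, close R t = 1 := fun t ht =>
    if_pos fun w hw u hu => hd w (Finset.mem_insert_of_mem ((Finset.mem_powersetCard.1 ht).1 hw))
      u (Finset.mem_insert_of_mem ((Finset.mem_powersetCard.1 ht).1 hu))
  rw [geyerModel_incr ν hR hz, h1, Finset.sum_congr rfl h2, Finset.sum_const,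
    Finset.card_powersetCard, nsmul_one, Nat.cast_choose_two]

/-- Points in a disc of radius `R / 2` are all close to one another. For `n` of them the deaths of
the three statistics are polynomials in `n` of degrees 1, 2, 3, while the corresponding births are
bounded by powers one degree lower; so the coefficients vanish successively from the top. -/
theorem geyerModel_satisfiesAssumptions (hR : 0 < R) :
    (geyerModel ν R).SatisfiesAssumptions {θ | 0 < θ 2} := by
  refine Model.satisfiesAssumptions_of (κ := Unit) (c := fun _ _ _ => R)
    (geyerModel_translationInvariant ν) fun Θ hΘ hsub => ?_
  have hX := geyerModel_isTame ν hR hΘ hsub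
  obtain ⟨m⟩ : Nonempty 𝕄 := by
    by_contra h
    rw [not_nonempty_iff] at h
    exact IsProbabilityMeasure.ne_zero ν (Measure.eq_zero_of_isEmpty _)
  have hex : ∀ n : ℕ, ∃ φ : Finset (Plane × 𝕄), φ.card = n ∧
      (∀ w ∈ φ, w.1 ∈ Metric.ball (0 : Plane) (R / 2)) ∧
      IsGeneric (fun (_ : Unit) _ _ => R) (φ : Set (Plane × 𝕄)) := by
    intro n
    obtain ⟨x, hxi, hxg, hxU⟩ := hX.exists_generic (α := Fin n)
      (U := fun _ => Metric.ball (0 : Plane) (R / 2) ×ˢ (univ : Set 𝕄))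
      (fun _ => Metric.isOpen_ball.prod isOpen_univ) fun _ => ⟨(0, m), by simpa using hR⟩
    refine ⟨Finset.univ.image x, by simp [Finset.card_image_of_injective _ hxi], fun w hw => ?_,
      by simpa using hxg⟩
    obtain ⟨i, -, rfl⟩ := Finset.mem_image.1 hw
    exact (hxU i).1
  refine ⟨R, hX, fun v hv => ?_, fun θ hθ v hv => ?_⟩
  · have key : ∀ n : ℕ, v 0 + v 1 * n + v 2 * (n * (n - 1) / 2) = 0 := by
      intro n
      obtain ⟨φ, hc, hU, hg⟩ := hex (n + 1)
      obtain ⟨z, hz⟩ := Finset.card_pos.1 (by omega : 0 < φ.card)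
      have hc' : (φ.erase z).card = n := by rw [Finset.card_erase_of_mem hz, hc]; rfl
      have := hv (φ.erase z) z (Finset.notMem_erase z φ) (by
        rwa [← Finset.coe_insert, Finset.insert_erase hz]) trivial
      rw [geyerModel_incr_clique ν hR (Finset.notMem_erase z φ) (by
        rwa [Finset.insert_erase hz]), hc', Fin.sum_univ_three] at this
      simpa using this
    have h0 := key 0
    have h1 := key 1
    have h2 := key 2
    norm_num at h0 h1 h2
    have e1 : v 1 = 0 := by linarith
    have e2 : v 2 = 0 := by linarith
    funext j
    fin_cases j
    exacts [h0, e1, e2]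
  · obtain ⟨T, hT0, hT⟩ := hX.exists_papangelou_le
    set V := (volume (Metric.closedBall (0 : Plane) (R / 2 + R))).toReal with hV
    have hV0 : 0 ≤ V := ENNReal.toReal_nonneg
    have hb : ∀ φ z, |∑ j, v j * (geyerModel ν R).birth θ φ z j|
        ≤ ∑ j : Fin 3, |v j| * ((φ.card : ℝ) ^ (j : ℕ) * T) := by
      intro φ z
      have hp := (geyerModel ν R).papangelou_nonneg θ φ z
      refine (Finset.abs_sum_le_sum_abs _ _).trans (Finset.sum_le_sum fun j _ => ?_)
      rw [abs_mul, Model.birth, abs_mul, abs_of_nonneg hp]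
      have := mul_le_mul (geyerModel_abs_incr ν hR φ z j) (hT θ hθ φ z) hp (by positivity)
      gcongr
    have key : ∀ n : ℕ, |v 0 * n + v 1 * (n * (n - 1)) + v 2 * (n * ((n - 1) * (n - 2) / 2))|
        ≤ (|v 0| * T + |v 1| * (n * T) + |v 2| * (n ^ 2 * T) + |v 0| * T) * V := by
      intro n
      obtain ⟨φ, hc, hU, hg⟩ := hex n
      have h1 := hX.abs_sum_death_le hθ hg trivial (hv φ hg trivial)
        (fun w hw => (mem_ball_zero_iff.1 (hU w hw)).le) (hb φ) (hb ∅)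
      have hd : ∀ j, (geyerModel ν R).death φ j
          = n * ![1, ((n : ℝ) - 1), ((n : ℝ) - 1) * (n - 2) / 2] j := by
        intro j
        rw [Model.death, ← hc, ← nsmul_eq_mul, ← Finset.sum_const]
        refine Finset.sum_congr rfl fun x hx => ?_
        rw [geyerModel_incr_clique ν hR (Finset.notMem_erase x φ) (by
          rwa [Finset.insert_erase hx]), Finset.cast_card_erase_of_mem hx]
        congr 2
        ring_nf
      simp only [hd, hc, Fin.sum_univ_three, Finset.card_empty, Matrix.cons_val, ← hV] at h1
      clear_value V
      norm_num at h1
      exact h1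
    -- For `x ≥ 3` one has `(x - 1) * (x - 2) / 2 ≥ x ^ 2 / 9`. Dividing the bound of `key` by `x ^
    -- 2` leaves a linear function of `x` which is bounded.
    have hv2 : v 2 = 0 := by
      rw [← abs_nonpos_iff]
      have : |v 2| * (1 / 9) ≤ 0 := by
        refine nonpos_of_forall_mul_le (N := 3)
          (A := |v 0| + |v 1| + (|v 0| * T + |v 1| * T + |v 2| * T + |v 0| * T) * V) fun n hn => ?_
        have hn' : (3 : ℝ) ≤ n := by exact_mod_cast hn
        have h1 := key n
        set x : ℝ := (n : ℝ) with hx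
        have h2 : |v 2| * (1 / 9) * x * x ^ 2 ≤ |v 2 * (x * ((x - 1) * (x - 2) / 2))| := by
          have h3 : x ^ 2 / 9 ≤ (x - 1) * (x - 2) / 2 := by nlinarith
          rw [abs_mul, abs_mul, abs_of_nonneg (by positivity : 0 ≤ x),
            abs_of_nonneg (le_trans (by positivity) h3)]
          calc |v 2| * (1 / 9) * x * x ^ 2 = |v 2| * (x * (x ^ 2 / 9)) := by ring
            _ ≤ _ := by gcongr
        have h4 : |v 0 * x| ≤ |v 0| * x ^ 2 := by
          rw [abs_mul, abs_of_nonneg (by positivity : 0 ≤ x)]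
          gcongr
          nlinarith
        have h5 : |v 1 * (x * (x - 1))| ≤ |v 1| * x ^ 2 := by
          rw [abs_mul, abs_of_nonneg (by nlinarith : 0 ≤ x * (x - 1))]
          gcongr
          nlinarith
        have h6 : (|v 0| * T + |v 1| * (x * T) + |v 2| * (x ^ 2 * T) + |v 0| * T) * V
            ≤ (|v 0| * T + |v 1| * T + |v 2| * T + |v 0| * T) * V * x ^ 2 := by
          have h7 : |v 0| * T ≤ |v 0| * T * x ^ 2 :=
            le_mul_of_one_le_right (by positivity) (by nlinarith)
          have h8 : |v 1| * (x * T) ≤ |v 1| * T * x ^ 2 := by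
            have : |v 1| * T * x ≤ |v 1| * T * x ^ 2 := by
              gcongr
              nlinarith
            linarith
          calc _ ≤ (|v 0| * T * x ^ 2 + |v 1| * T * x ^ 2 + |v 2| * (x ^ 2 * T)
                + |v 0| * T * x ^ 2) * V := by gcongr
            _ = _ := by ring
        have h7 := abs_sub (v 0 * x + v 1 * (x * (x - 1)) + v 2 * (x * ((x - 1) * (x - 2) / 2)))
          (v 0 * x + v 1 * (x * (x - 1)))
        rw [add_sub_cancel_left] at h7
        have h8 := abs_add_le (v 0 * x) (v 1 * (x * (x - 1)))
        refine le_of_mul_le_mul_right (a := x ^ 2) ?_ (by positivity)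
        linarith
      linarith
    have hv1 : v 1 = 0 := by
      rw [← abs_nonpos_iff]
      have : |v 1| * (1 / 2) ≤ 0 := by
        refine nonpos_of_forall_mul_le (N := 2)
          (A := |v 0| + (|v 0| * T + |v 1| * T + |v 0| * T) * V) fun n hn => ?_
        have hn' : (2 : ℝ) ≤ n := by exact_mod_cast hn
        have h1 := key n
        set x : ℝ := (n : ℝ) with hx
        simp only [hv2, zero_mul, abs_zero, add_zero] at h1
        have h2 : |v 1| * (1 / 2) * x * x ≤ |v 1 * (x * (x - 1))| := by
          rw [abs_mul, abs_of_nonneg (by nlinarith : 0 ≤ x * (x - 1))]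
          calc |v 1| * (1 / 2) * x * x = |v 1| * (x * (x / 2)) := by ring
            _ ≤ _ := by
              gcongr
              linarith
        have h4 : |v 0 * x| = |v 0| * x := by
          rw [abs_mul, abs_of_nonneg (by positivity : 0 ≤ x)]
        have h6 : (|v 0| * T + |v 1| * (x * T) + |v 0| * T) * V
            ≤ (|v 0| * T + |v 1| * T + |v 0| * T) * V * x := by
          have h7 : |v 0| * T ≤ |v 0| * T * x := le_mul_of_one_le_right (by positivity) (by linarith)
          calc _ ≤ (|v 0| * T * x + |v 1| * (x * T) + |v 0| * T * x) * V := by gcongr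
            _ = _ := by ring
        have h7 := abs_sub (v 0 * x + v 1 * (x * (x - 1))) (v 0 * x)
        rw [add_sub_cancel_left] at h7
        refine le_of_mul_le_mul_right (a := x) ?_ (by positivity)
        linarith
      linarith
    have hv0 : v 0 = 0 := by
      rw [← abs_nonpos_iff]
      refine nonpos_of_forall_mul_le (N := 0) (A := (|v 0| * T + |v 0| * T) * V) fun n _ => ?_
      have := key n
      rw [hv1, hv2] at this
      simpa [abs_mul] using this
    funext j
    fin_cases j
    exacts [hv0, hv1, hv2]

theorem geyerTriplet_satisfiesAssumptions (hR : 0 < R) :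
    (geyerTriplet R).SatisfiesAssumptions {θ | 0 < θ 2} := by
  rw [geyerTriplet_eq]
  exact geyerModel_satisfiesAssumptions (Measure.dirac ()) hR

end Geyer

end MarkedGibbs

/-! ### Bands of distances for unordered pairs of marks -/

namespace MarkedGibbs

open scoped Classical

/-- Bands of distances `[lo q, hi q]`, attached to unordered pairs of marks, with disjoint
interiors, lying beyond the core radius of the pair of marks. -/
structure BandData (𝕄 Q : Type) where
  typ : Q → Sym2 𝕄
  lo : Q → ℝ
  hi : Q → ℝ
  core : Sym2 𝕄 → ℝ
  core_nonneg : ∀ s, 0 ≤ core s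
  core_le_lo : ∀ q, core (typ q) ≤ lo q
  lo_lt_hi : ∀ q, lo q < hi q
  disjoint : ∀ q q', typ q = typ q' → q ≠ q' → hi q ≤ lo q' ∨ hi q' ≤ lo q

namespace BandData

variable {𝕄 Q : Type} (d : BandData 𝕄 Q)

/-- The pair `z, w` is in the band `q`. -/
def link (q : Q) (z w : Plane × 𝕄) : Prop :=
  s(z.2, w.2) = d.typ q ∧ dist z.1 w.1 ∈ Icc (d.lo q) (d.hi q)

lemma link_comm {q : Q} {z w : Plane × 𝕄} : d.link q z w ↔ d.link q w z := by
  rw [link, link, Sym2.eq_swap, dist_comm]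

lemma lo_nonneg (q : Q) : 0 ≤ d.lo q := (d.core_nonneg _).trans (d.core_le_lo q)

lemma hi_pos (q : Q) : 0 < d.hi q := (d.lo_nonneg q).trans_lt (d.lo_lt_hi q)

lemma link_iff_of_mem_Ioo {q q' : Q} {z w : Plane × 𝕄} (ht : s(z.2, w.2) = d.typ q)
    (hr : dist z.1 w.1 ∈ Ioo (d.lo q) (d.hi q)) : d.link q' z w ↔ q' = q := by
  constructor
  · rintro ⟨h1, h2⟩
    by_contra hne
    rcases d.disjoint q' q (h1.symm.trans ht) hne with h | h
    · linarith [h2.2, hr.1]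
    · linarith [h2.1, hr.2]
  · rintro rfl
    exact ⟨ht, Ioo_subset_Icc_self hr⟩

/-- The set of pairs which are edges in the band `q`. -/
def IsEdge (E : Plane × 𝕄 → Plane × 𝕄 → Prop) (q : Q) (s : Finset (Plane × 𝕄)) : Prop :=
  ∃ z w : Plane × 𝕄, s = {z, w} ∧ d.link q z w ∧ E z w

lemma isEdge_pair {E : Plane × 𝕄 → Plane × 𝕄 → Prop} (hE : ∀ z w, E z w → E w z) {q : Q}
    {z w : Plane × 𝕄} : d.IsEdge E q {z, w} ↔ d.link q z w ∧ E z w := by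
  refine ⟨?_, fun h => ⟨z, w, rfl, h⟩⟩
  rintro ⟨x, y, h, hl, he⟩
  have h' := congrArg (fun t : Finset (Plane × 𝕄) => (t : Set (Plane × 𝕄))) h
  simp only [Finset.coe_insert, Finset.coe_singleton] at h'
  rcases Set.pair_eq_pair_iff.1 h' with ⟨rfl, rfl⟩ | ⟨rfl, rfl⟩
  · exact ⟨hl, he⟩
  · exact ⟨d.link_comm.1 hl, hE _ _ he⟩

/-- The numbers of points with each mark and of edges in each band. -/
def stat (E : Finset (Plane × 𝕄) → Plane × 𝕄 → Plane × 𝕄 → Prop) (φ : Finset (Plane × 𝕄)) :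
    𝕄 ⊕ Q → ℝ
  | Sum.inl m => ((φ.filter fun z => z.2 = m).card : ℝ)
  | Sum.inr q => (((φ.powersetCard 2).filter fun s => d.IsEdge (E φ) q s).card : ℝ)

/-- The configurations which respect the hard core. -/
def hardCore : Set (Set (Plane × 𝕄)) :=
  {φ | ∀ z ∈ φ, ∀ w ∈ φ, z ≠ w → d.core s(z.2, w.2) ≤ dist z.1 w.1}

/-- The model on the complete graph. -/
def fullModel [MeasurableSpace 𝕄] (ν : Measure 𝕄) : Model 𝕄 (𝕄 ⊕ Q) where
  markLaw := ν
  stat := d.stat fun _ _ _ => True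
  hardCore := d.hardCore

/-- The model on the graph of the `k` nearest neighbours. -/
def knnModel [MeasurableSpace 𝕄] (ν : Measure 𝕄) (k : ℕ) : Model 𝕄 (𝕄 ⊕ Q) where
  markLaw := ν
  stat := d.stat fun φ z w => IsNeighbour k φ z w ∨ IsNeighbour k φ w z
  hardCore := univ

end BandData

section Bands

variable {M : ℕ} (b : Bands M)

/-- The hard core radius of an ordered pair of marks. -/
def Bands.coreRad (m m' : Fin M) : ℝ := b.rad m m' 0

/-- The band data of a multi-Strauss process. -/
def Bands.toBandData :
    BandData (Fin M) (Σ q : {q : Fin M × Fin M // q.1 ≤ q.2}, Fin (b.num q.1.1 q.1.2)) where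
  typ q := s(q.1.1.1, q.1.1.2)
  lo q := b.rad q.1.1.1 q.1.1.2 q.2.castSucc
  hi q := b.rad q.1.1.1 q.1.1.2 q.2.succ
  core s := b.coreRad s.inf s.sup
  core_nonneg s := b.nonneg _ _
  core_le_lo q := by
    obtain ⟨⟨⟨a, c⟩, h⟩, i⟩ := q
    simp only [Sym2.inf_mk, Sym2.sup_mk]
    have h : a ≤ c := h
    rw [inf_eq_left.2 h, sup_eq_right.2 h]
    exact (b.strictMono a c).monotone (Fin.zero_le _)
  lo_lt_hi q := b.strictMono _ _ (Fin.castSucc_lt_succ)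
  disjoint := by
    rintro ⟨⟨⟨a, c⟩, h⟩, i⟩ ⟨⟨⟨a', c'⟩, h'⟩, i'⟩ ht hne
    have h : a ≤ c := h
    have h' : a' ≤ c' := h'
    simp only [Sym2.eq_iff] at ht
    obtain ⟨rfl, rfl⟩ : a = a' ∧ c = c' := by
      rcases ht with ht | ⟨rfl, rfl⟩
      · exact ht
      · exact ⟨le_antisymm h h', le_antisymm h' h⟩
    have hi : i ≠ i' := fun e => hne (by rw [e])
    rcases lt_or_gt_of_ne hi with h | h
    · exact Or.inl ((b.strictMono a c).monotone (Fin.succ_le_castSucc_iff.2 h))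
    · exact Or.inr ((b.strictMono a c).monotone (Fin.succ_le_castSucc_iff.2 h))

/-- For a symmetric edge relation the condition on the ordered marks `m₁ ≤ m₂` can be stated for the
unordered pair, at the cost of exchanging the two points. -/
lemma multiStraussStat_eq
    {E : Finset (Plane × Fin M) → Plane × Fin M → Plane × Fin M → Prop}
    (hE : ∀ φ z w, E φ z w → E φ w z) : multiStraussStat b E = b.toBandData.stat E := by
  funext φ j
  rcases j with m | ⟨⟨⟨a, c⟩, h⟩, i⟩
  · simp only [multiStraussStat, BandData.stat]
    congr!
  · simp only [multiStraussStat, BandData.stat]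
    congr! with s
    constructor
    · rintro ⟨z, w, rfl, rfl, rfl, he, hd⟩
      refine ⟨z, w, ?_, ⟨rfl, hd⟩, he⟩
      congr!
    · rintro ⟨z, w, rfl, ⟨ht, hd⟩, he⟩
      rcases Sym2.eq_iff.1 ht with ⟨h1, h2⟩ | ⟨h1, h2⟩
      · refine ⟨z, w, ?_, h1, h2, he, hd⟩
        congr!
      · refine ⟨w, z, ?_, h2, h1, hE _ _ _ he, by rwa [dist_comm] at hd⟩
        ext u
        simp [or_comm]

lemma multiStrauss_eq : multiStrauss b =
    b.toBandData.fullModel (ProbabilityTheory.uniformOn univ) := by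
  have hc : {φ : Set (Plane × Fin M) | ∀ z₁ ∈ φ, ∀ z₂ ∈ φ, z₁ ≠ z₂ → z₁.2 ≤ z₂.2 →
      b.rad z₁.2 z₂.2 0 ≤ dist z₁.1 z₂.1} = b.toBandData.hardCore := by
    ext φ
    simp only [mem_ofPred_eq, BandData.hardCore, Bands.toBandData, Sym2.inf_mk, Sym2.sup_mk]
    constructor
    · intro h z hz w hw hne
      rcases le_total z.2 w.2 with hle | hle
      · rw [inf_eq_left.2 hle, sup_eq_right.2 hle]
        exact h z hz w hw hne hle
      · rw [inf_eq_right.2 hle, sup_eq_left.2 hle, dist_comm]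
        exact h w hw z hz hne.symm hle
    · intro h z hz w hw hne hle
      have := h z hz w hw hne
      rwa [inf_eq_left.2 hle, sup_eq_right.2 hle] at this
  rw [multiStrauss, BandData.fullModel, ← hc, multiStraussStat_eq b fun _ _ _ _ => trivial]

lemma knnMultiStrauss_eq (k : ℕ) : knnMultiStrauss k b =
    b.toBandData.knnModel (ProbabilityTheory.uniformOn univ) k := by
  rw [knnMultiStrauss, BandData.knnModel, multiStraussStat_eq b fun _ _ _ h => h.symm]

end Bands

/-- A packing bound. -/
lemma exists_card_le (r : ℝ) {ε : ℝ} (hε : 0 < ε) : ∃ P : ℕ,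
    ∀ {𝕄 : Type} (N : Finset (Plane × 𝕄)) (x : Plane), (∀ w ∈ N, dist x w.1 ≤ r) →
      (∀ w ∈ N, ∀ u ∈ N, w ≠ u → ε ≤ dist w.1 u.1) → N.card ≤ P := by
  obtain ⟨T, f, hfT, hf⟩ := exists_cells r hε
  refine ⟨T.card, fun N x hx hN => ?_⟩
  have hr : ∀ w ∈ N, ‖w.1 - x‖ ≤ r := fun w hw => by
    rw [← dist_eq_norm, dist_comm]
    exact hx w hw
  refine Finset.card_le_card_of_injOn (fun w => f (w.1 - x)) (fun w hw => hfT _ (hr w hw))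
    fun w hw u hu h => ?_
  by_contra hne
  have := hf _ _ (hr w hw) (hr u hu) h
  rw [dist_sub_right] at this
  linarith [hN w hw u hu hne]

lemma exists_gap {S : Set ℝ} (hS : S.Finite) : ∃ δ : ℝ, 0 < δ ∧ ∀ t ∈ S, 0 < t → δ ≤ t := by
  rcases (S ∩ Ioi 0).eq_empty_or_nonempty with h | h
  · exact ⟨1, one_pos, fun t ht h0 => ((h ▸ ⟨ht, h0⟩ : t ∈ (∅ : Set ℝ))).elim⟩
  · obtain ⟨δ, hδ⟩ := (hS.subset inter_subset_left : (S ∩ Ioi 0).Finite).exists_minimal h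
    refine ⟨δ, hδ.1.2, fun t ht h0 => ?_⟩
    by_contra! hlt
    exact (hδ.2 ⟨ht, h0⟩ hlt.le).not_gt hlt

/-- The configurations with a pair of points in an open set form an event. -/
lemma measurableSet_exists_pair {𝕄 : Type} [MeasurableSpace 𝕄] [TopologicalSpace 𝕄] [BorelSpace 𝕄]
    [SecondCountableTopology 𝕄] {O : Set ((Plane × 𝕄) × (Plane × 𝕄))} (hO : IsOpen O) :
    MeasurableSet {φ : Config 𝕄 | ∃ z ∈ φ.pts, ∃ w ∈ φ.pts, (z, w) ∈ O} := by
  have hne : ∀ F : Set (Plane × 𝕄), MeasurableSet F →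
      MeasurableSet {φ : Config 𝕄 | (φ.pts ∩ F).Nonempty} := by
    intro F hF
    have h1 : {φ : Config 𝕄 | (φ.pts ∩ F).Nonempty} = ⋃ n : ℕ,
        {φ : Config 𝕄 | (φ.pts ∩ (F ∩ Metric.ball (0 : Plane) n ×ˢ univ)).encard = (0 : ℕ)}ᶜ := by
      ext φ
      simp only [mem_ofPred_eq, mem_iUnion, mem_compl_iff, Nat.cast_zero, encard_eq_zero,
        ← nonempty_iff_ne_empty, ← ne_eq]
      constructor
      · rintro ⟨z, hz, hzF⟩
        obtain ⟨n, hn⟩ := exists_nat_gt ‖z.1‖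
        exact ⟨n, z, hz, hzF, mem_ball_zero_iff.2 hn, mem_univ _⟩
      · rintro ⟨n, z, hz, hzF, -⟩
        exact ⟨z, hz, hzF⟩
    rw [h1]
    refine MeasurableSet.iUnion fun n => (measurableSet_encard_eq
      (hF.inter (Metric.isOpen_ball.measurableSet.prod MeasurableSet.univ)) ?_ 0).compl
    refine Bornology.IsBounded.subset (Metric.isBounded_ball (x := (0 : Plane)) (r := n)) ?_
    rintro _ ⟨z, hz, rfl⟩
    exact hz.2.1
  let B := TopologicalSpace.countableBasis (Plane × 𝕄)
  have h2 : {φ : Config 𝕄 | ∃ z ∈ φ.pts, ∃ w ∈ φ.pts, (z, w) ∈ O} =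
      ⋃ p ∈ {p : Set (Plane × 𝕄) × Set (Plane × 𝕄) | (p.1 ∈ B ∧ p.2 ∈ B) ∧ p.1 ×ˢ p.2 ⊆ O},
        {φ : Config 𝕄 | (φ.pts ∩ p.1).Nonempty} ∩ {φ : Config 𝕄 | (φ.pts ∩ p.2).Nonempty} := by
    ext φ
    simp only [mem_ofPred_eq, mem_iUnion, mem_inter_iff]
    constructor
    · rintro ⟨z, hz, w, hw, hzw⟩
      obtain ⟨U, ⟨F, hF, F', hF', rfl⟩, hU, hUO⟩ :=
        ((TopologicalSpace.isBasis_countableBasis _).prod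
          (TopologicalSpace.isBasis_countableBasis _)).mem_nhds_iff.1 (hO.mem_nhds hzw)
      exact ⟨(F, F'), ⟨⟨hF, hF'⟩, hUO⟩, ⟨z, hz, hU.1⟩, ⟨w, hw, hU.2⟩⟩
    · rintro ⟨⟨F, F'⟩, ⟨-, hO'⟩, ⟨z, hz, hzF⟩, ⟨w, hw, hwF⟩⟩
      exact ⟨z, hz, w, hw, hO' ⟨hzF, hwF⟩⟩
  rw [h2]
  refine MeasurableSet.biUnion ?_ fun p hp =>
    (hne _ (TopologicalSpace.isOpen_of_mem_countableBasis hp.1.1).measurableSet).inter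
      (hne _ (TopologicalSpace.isOpen_of_mem_countableBasis hp.1.2).measurableSet)
  exact ((TopologicalSpace.countable_countableBasis _).prod
    (TopologicalSpace.countable_countableBasis _)).mono fun p hp => hp.1

end MarkedGibbs

/-! ### The multi-Strauss model is tame -/

namespace MarkedGibbs

open scoped Classical

lemma eventually_le_iff {α : Type} [TopologicalSpace α] {f : α → ℝ} {x : α}
    (hf : ContinuousAt f x) {a : ℝ} (h : f x ≠ a) :
    ∀ᶠ y in 𝓝 x, (f y ≤ a ↔ f x ≤ a) ∧ (a ≤ f y ↔ a ≤ f x) := by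
  rcases lt_or_gt_of_ne h with h | h
  · filter_upwards [hf.eventually (gt_mem_nhds h)] with y hy
    exact ⟨iff_of_true hy.le h.le, iff_of_false hy.not_ge h.not_ge⟩
  · filter_upwards [hf.eventually (lt_mem_nhds h)] with y hy
    exact ⟨iff_of_false hy.not_ge h.not_ge, iff_of_true hy.le h.le⟩

/-- The points of the square lattice with mesh `s`. -/
def latticePoint (s : ℝ) (i j : ℕ) : Plane := !₂[s * i, s * j]

lemma norm_latticePoint_le {s : ℝ} (hs : 0 ≤ s) (i j : ℕ) :
    ‖latticePoint s i j‖ ≤ s * (i + j) := by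
  rw [latticePoint, EuclideanSpace.norm_eq, Fin.sum_univ_two]
  refine Real.sqrt_le_iff.2 ⟨by positivity, ?_⟩
  simp only [Real.norm_eq_abs, sq_abs, Matrix.cons_val_zero, Matrix.cons_val_one,
    Matrix.cons_val_fin_one]
  have : 0 ≤ s * i * (s * j) := by positivity
  nlinarith

lemma le_dist_latticePoint {s : ℝ} (hs : 0 ≤ s) {p q : ℕ × ℕ} (h : p ≠ q) :
    s ≤ dist (latticePoint s p.1 p.2) (latticePoint s q.1 q.2) := by
  have key : ∀ a b : ℕ, a ≠ b → s ≤ |s * a - s * b| := by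
    intro a b hab
    rw [← mul_sub, abs_mul, abs_of_nonneg hs]
    refine le_mul_of_one_le_right hs ?_
    have h1 : (1 : ℤ) ≤ |(a : ℤ) - b| := Int.one_le_abs (sub_ne_zero.2 (by exact_mod_cast hab))
    exact_mod_cast h1
  have hc : ∀ k, |latticePoint s p.1 p.2 k - latticePoint s q.1 q.2 k|
      ≤ dist (latticePoint s p.1 p.2) (latticePoint s q.1 q.2) := fun k => by
    rw [dist_eq_norm]
    simpa using abs_apply_le_norm (latticePoint s p.1 p.2 - latticePoint s q.1 q.2) k
  by_cases h1 : p.1 = q.1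
  · have h2 : p.2 ≠ q.2 := fun e => h (Prod.ext h1 e)
    exact (key _ _ h2).trans (by simpa [latticePoint] using hc 1)
  · exact (key _ _ h1).trans (by simpa [latticePoint] using hc 0)

lemma Model.abs_incr_inl_le {𝕄 Q : Type} [Fintype 𝕄] [Fintype Q] [MeasurableSpace 𝕄] {X : Model 𝕄 (𝕄 ⊕ Q)}
    (hX : ∀ φ m, X.stat φ (Sum.inl m) = ((φ.filter fun z => z.2 = m).card : ℝ))
    (φ : Finset (Plane × 𝕄)) (z : Plane × 𝕄) (m : 𝕄) : |X.incr φ z (Sum.inl m)| ≤ 1 := by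
  by_cases hz : z ∈ φ
  · rw [Model.incr_of_mem _ hz, Pi.zero_apply, abs_zero]
    exact zero_le_one
  · rw [Model.incr, hX, hX, Finset.natCast_card_filter, Finset.natCast_card_filter,
      Finset.sum_insert hz, add_sub_cancel_right]
    split_ifs
    · exact abs_one.le
    · exact abs_zero.trans_le zero_le_one

namespace BandData

variable {𝕄 Q : Type} [Fintype 𝕄] [Fintype Q] (d : BandData 𝕄 Q)

/-- The critical distances. -/
def crit : Q ⊕ Q ⊕ Sym2 𝕄 → 𝕄 → 𝕄 → ℝ
  | Sum.inl q, _, _ => d.lo q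
  | Sum.inr (Sum.inl q), _, _ => d.hi q
  | Sum.inr (Sum.inr s), _, _ => d.core s

lemma exists_range : ∃ D : ℝ, 0 < D ∧ (∀ q, d.hi q ≤ D) ∧ ∀ s, d.core s ≤ D := by
  obtain ⟨a, ha⟩ := (Set.finite_range d.hi).bddAbove
  obtain ⟨b, hb⟩ := (Set.finite_range d.core).bddAbove
  refine ⟨max 1 (max a b), by positivity, fun q => ?_, fun s => ?_⟩
  · exact (ha ⟨q, rfl⟩).trans ((le_max_left _ _).trans (le_max_right _ _))
  · exact (hb ⟨s, rfl⟩).trans ((le_max_right _ _).trans (le_max_right _ _))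

/-- The pair `z, w` respects the hard core. -/
def allowed (z w : Plane × 𝕄) : Prop := z ≠ w → d.core s(z.2, w.2) ≤ dist z.1 w.1

lemma allowed_comm {z w : Plane × 𝕄} : d.allowed z w ↔ d.allowed w z := by
  rw [allowed, allowed, Sym2.eq_swap, dist_comm, ne_comm]

lemma allowed_self (z : Plane × 𝕄) : d.allowed z z := fun h => absurd rfl h

lemma mem_hardCore {s : Set (Plane × 𝕄)} :
    s ∈ d.hardCore ↔ ∀ z ∈ s, ∀ w ∈ s, d.allowed z w := Iff.rfl

lemma pair_mem_hardCore {z w : Plane × 𝕄} : {z, w} ∈ d.hardCore ↔ d.allowed z w := by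
  rw [mem_hardCore]
  constructor
  · exact fun h => h z (Or.inl rfl) w (Or.inr rfl)
  · rintro h _ (rfl | rfl) _ (rfl | rfl)
    exacts [d.allowed_self _, h, d.allowed_comm.1 h, d.allowed_self _]

lemma triple_mem_hardCore {z x y : Plane × 𝕄} :
    insert z {x, y} ∈ d.hardCore ↔ d.allowed z x ∧ d.allowed z y ∧ d.allowed x y := by
  rw [mem_hardCore]
  constructor
  · exact fun h => ⟨h z (by simp) x (by simp), h z (by simp) y (by simp), h x (by simp) y (by simp)⟩
  · rintro ⟨h1, h2, h3⟩ _ (rfl | rfl | rfl) _ (rfl | rfl | rfl)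
    exacts [d.allowed_self _, h1, h2, d.allowed_comm.1 h1, d.allowed_self _, h3,
      d.allowed_comm.1 h2, d.allowed_comm.1 h3, d.allowed_self _]

lemma stat_insert_inl (E : Finset (Plane × 𝕄) → Plane × 𝕄 → Plane × 𝕄 → Prop)
    {φ : Finset (Plane × 𝕄)} {z : Plane × 𝕄} (hz : z ∉ φ) (m : 𝕄) :
    d.stat E (insert z φ) (Sum.inl m) - d.stat E φ (Sum.inl m) = if z.2 = m then 1 else 0 := by
  simp only [stat, Finset.natCast_card_filter, Finset.sum_insert hz, add_sub_cancel_right]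

lemma stat_translate (E : Finset (Plane × 𝕄) → Plane × 𝕄 → Plane × 𝕄 → Prop) (x : Plane)
    (φ : Finset (Plane × 𝕄))
    (hE : ∀ z w, E (φ.image fun z => (z.1 + x, z.2)) (z.1 + x, z.2) (w.1 + x, w.2) ↔ E φ z w) :
    d.stat E (φ.image fun z => (z.1 + x, z.2)) = d.stat E φ := by
  have hinj : Function.Injective fun z : Plane × 𝕄 => (z.1 + x, z.2) := fun z w h => by
    simp only [Prod.mk.injEq, add_left_inj] at h
    exact Prod.ext h.1 h.2
  have hsurj : ∀ z : Plane × 𝕄, ∃ w : Plane × 𝕄, z = (w.1 + x, w.2) := fun z =>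
    ⟨(z.1 - x, z.2), by simp⟩
  funext j
  rcases j with m | q
  · simp only [stat, Finset.natCast_card_filter]
    rw [Finset.sum_image hinj.injOn]
  · simp only [stat, Finset.natCast_card_filter]
    rw [sum_powersetCard_image _ hinj.injOn]
    refine Finset.sum_congr rfl fun s _ => ?_
    congr 1
    rw [eq_iff_iff]
    constructor
    · rintro ⟨z, w, h, hl, he⟩
      obtain ⟨z, rfl⟩ := hsurj z
      obtain ⟨w, rfl⟩ := hsurj w
      refine ⟨z, w, Finset.image_injective hinj ?_, ?_, (hE z w).1 he⟩
      · rw [h, Finset.image_insert, Finset.image_singleton]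
      · simpa only [link, dist_add_right] using hl
    · rintro ⟨z, w, rfl, hl, he⟩
      refine ⟨(z.1 + x, z.2), (w.1 + x, w.2), ?_, ?_, (hE z w).2 he⟩
      · rw [Finset.image_insert, Finset.image_singleton]
      · simpa only [link, dist_add_right] using hl

variable [TopologicalSpace 𝕄] [DiscreteTopology 𝕄]

lemma eventually_marks (z w : Plane × 𝕄) :
    ∀ᶠ p : (Plane × 𝕄) × (Plane × 𝕄) in 𝓝 (z, w), p.1.2 = z.2 ∧ p.2.2 = w.2 := by
  have h1 : ContinuousAt (fun p : (Plane × 𝕄) × (Plane × 𝕄) => p.1.2) (z, w) := by fun_prop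
  have h2 : ContinuousAt (fun p : (Plane × 𝕄) × (Plane × 𝕄) => p.2.2) (z, w) := by fun_prop
  exact (h1.eventually_mem ((isOpen_discrete {z.2}).mem_nhds rfl)).and
    (h2.eventually_mem ((isOpen_discrete {w.2}).mem_nhds rfl))

lemma eventually_link_iff {q : Q} {z w : Plane × 𝕄} (h1 : dist z.1 w.1 ≠ d.lo q)
    (h2 : dist z.1 w.1 ≠ d.hi q) :
    ∀ᶠ p : (Plane × 𝕄) × (Plane × 𝕄) in 𝓝 (z, w), (d.link q p.1 p.2 ↔ d.link q z w) := by
  have hc : ContinuousAt (fun p : (Plane × 𝕄) × (Plane × 𝕄) => dist p.1.1 p.2.1) (z, w) := by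
    fun_prop
  filter_upwards [eventually_marks z w, eventually_le_iff hc h1, eventually_le_iff hc h2]
    with p hp h1 h2
  rw [link, link, hp.1, hp.2, mem_Icc, mem_Icc, h1.2, h2.1]

lemma eventually_allowed_iff {z w : Plane × 𝕄} (hne : z ≠ w)
    (h : dist z.1 w.1 ≠ d.core s(z.2, w.2)) :
    ∀ᶠ p : (Plane × 𝕄) × (Plane × 𝕄) in 𝓝 (z, w), (d.allowed p.1 p.2 ↔ d.allowed z w) := by
  have hc : ContinuousAt (fun p : (Plane × 𝕄) × (Plane × 𝕄) => dist p.1.1 p.2.1) (z, w) := by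
    fun_prop
  filter_upwards [eventually_marks z w, eventually_le_iff hc h,
    (isOpen_ne_fun continuous_fst continuous_snd).mem_nhds hne] with p hp h1 h2
  have h2 : p.1 ≠ p.2 := h2
  rw [allowed, allowed, hp.1, hp.2]
  simp only [ne_eq, h2, hne, not_false_eq_true, true_imp_iff, h1.2]

lemma continuousOn_stat_inl (E : Finset (Plane × 𝕄) → Plane × 𝕄 → Plane × 𝕄 → Prop) (m : 𝕄)
    (n : ℕ) : ContinuousOn (fun x : Fin n → Plane × 𝕄 =>
      d.stat E (Finset.univ.image x) (Sum.inl m)) (genericTuples d.crit n) := by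
  have h : ContinuousOn (fun x : Fin n → Plane × 𝕄 => ∑ i, if (x i).2 = m then (1 : ℝ) else 0)
      (genericTuples d.crit n) := by
    refine (continuous_finsetSum _ fun i _ => ?_).continuousOn
    exact (continuous_of_discreteTopology (f := fun m' : 𝕄 => if m' = m then (1 : ℝ) else 0)).comp
      ((continuous_apply i).snd)
  refine h.congr fun x hx => ?_
  simp only [stat, Finset.natCast_card_filter]
  rw [Finset.sum_image hx.1.injOn]

variable [MeasurableSpace 𝕄] (ν : Measure 𝕄)

section FullModel

lemma fullModel_stat_inr (φ : Finset (Plane × 𝕄)) (q : Q) : (d.fullModel ν).stat φ (Sum.inr q)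
    = ∑ s ∈ φ.powersetCard 2, if d.IsEdge (fun _ _ => True) q s then (1 : ℝ) else 0 :=
  Finset.natCast_card_filter _ _

lemma fullModel_incr_inl {φ : Finset (Plane × 𝕄)} {z : Plane × 𝕄} (hz : z ∉ φ) (m : 𝕄) :
    (d.fullModel ν).incr φ z (Sum.inl m) = if z.2 = m then 1 else 0 :=
  d.stat_insert_inl (fun _ _ _ => True) hz m

lemma fullModel_incr_inr {φ : Finset (Plane × 𝕄)} {z : Plane × 𝕄} (hz : z ∉ φ) (q : Q) :
    (d.fullModel ν).incr φ z (Sum.inr q) = ∑ w ∈ φ, if d.link q z w then (1 : ℝ) else 0 := by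
  rw [Model.incr, fullModel_stat_inr, fullModel_stat_inr, sum_powersetCard_two_insert _ hz,
    add_sub_cancel_left]
  refine Finset.sum_congr rfl fun w _ => ?_
  rw [d.isEdge_pair fun _ _ _ => trivial, and_true]

lemma fullModel_abs_incr_inr (φ : Finset (Plane × 𝕄)) (z : Plane × 𝕄) (q : Q) :
    |(d.fullModel ν).incr φ z (Sum.inr q)| ≤ φ.card := by
  by_cases hz : z ∈ φ
  · simp [Model.incr_of_mem _ hz]
  · rw [fullModel_incr_inr d ν hz, ← Finset.natCast_card_filter, Nat.abs_cast]
    exact_mod_cast Finset.card_le_card (Finset.filter_subset _ _)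

/-- The parameters of the multi-Strauss process. -/
def params : Set (𝕄 ⊕ Q → ℝ) := {θ | ∀ q, (d.core (d.typ q) = 0 ∨ ∃ m ∈ d.typ q,
  d.core s(m, m) = 0) → 0 ≤ θ (Sum.inr q)}

/-- Stability is checked band by band. If the coefficient may be negative, each mark of the band has
a positive core radius with itself, and packing bounds the number of partners of a new point;
otherwise the term is nonnegative. -/
lemma fullModel_isTame [BorelSpace 𝕄] {Θ : Set (𝕄 ⊕ Q → ℝ)} (hΘ : IsCompact Θ) (hsub : Θ ⊆ d.params)
    {D : ℝ} (hD : 0 < D) (hhi : ∀ q, d.hi q ≤ D) (hcore : ∀ s, d.core s ≤ D) :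
    (d.fullModel ν).IsTame d.crit Θ D where
  range_pos := hD
  continuous_crit k := by
    rcases k with q | q | s <;> exact continuous_const
  incr_bound j := by
    rcases j with m | q
    · exact ⟨1, 0, zero_le_one, fun φ z => by simpa using Model.abs_incr_inl_le (X := d.fullModel ν) (fun _ _ => rfl) φ z m⟩
    · exact ⟨1, 1, zero_le_one, fun φ z => by simpa using d.fullModel_abs_incr_inr ν φ z q⟩
  incr_congr φ φ' z h := by
    have hz := h z (by simpa using hD.le)
    by_cases hzφ : z ∈ φ
    · rw [Model.incr_of_mem _ hzφ, Model.incr_of_mem _ (hz.1 hzφ)]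
    have hzφ' := mt hz.2 hzφ
    funext j
    rcases j with m | q
    · rw [fullModel_incr_inl d ν hzφ, fullModel_incr_inl d ν hzφ']
    · rw [fullModel_incr_inr d ν hzφ, fullModel_incr_inr d ν hzφ', ← Finset.sum_filter,
        ← Finset.sum_filter]
      congr 1
      ext w
      simp only [Finset.mem_filter]
      exact and_congr_left fun hw => h w (hw.2.2.trans (hhi q))
  hardCore_singleton z := by
    rintro _ rfl _ rfl h
    exact absurd rfl h
  hardCore_iff s := by
    change s ∈ d.hardCore ↔ ∀ z ∈ s, ∀ w ∈ s, dist z.1 w.1 ≤ D → {z, w} ∈ d.hardCore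
    simp only [pair_mem_hardCore]
    rw [mem_hardCore]
    refine ⟨fun h z hz w hw _ => h z hz w hw, fun h z hz w hw hne => ?_⟩
    by_cases hd : dist z.1 w.1 ≤ D
    · exact h z hz w hw hd hne
    · exact (hcore _).trans (not_le.1 hd).le
  stable := by
    obtain ⟨B, hB0, hB⟩ := exists_abs_le hΘ
    have hpack : ∀ q, ∃ P : ℕ, ∀ θ ∈ Θ, ∀ (φ : Finset (Plane × 𝕄)) (z : Plane × 𝕄),
        insert z (φ : Set (Plane × 𝕄)) ∈ d.hardCore → z ∉ φ →
          -(B * P) ≤ θ (Sum.inr q) * (d.fullModel ν).incr φ z (Sum.inr q) := by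
      intro q
      by_cases hq : d.core (d.typ q) = 0 ∨ ∃ m ∈ d.typ q, d.core s(m, m) = 0
      · refine ⟨0, fun θ hθ φ z hc hz => ?_⟩
        rw [fullModel_incr_inr d ν hz, Nat.cast_zero, mul_zero, neg_zero]
        exact mul_nonneg (hsub hθ q hq) (Finset.sum_nonneg fun _ _ => by split_ifs <;> simp)
      · push Not at hq
        have hP : ∀ m : 𝕄, ∃ P : ℕ, m ∈ d.typ q → ∀ (N : Finset (Plane × 𝕄)) (x : Plane),
            (∀ w ∈ N, dist x w.1 ≤ D) → (∀ w ∈ N, w.2 = m) →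
            (∀ w ∈ N, ∀ u ∈ N, d.allowed w u) → N.card ≤ P := by
          intro m
          by_cases hm : m ∈ d.typ q
          · obtain ⟨P, hP⟩ := exists_card_le D
              (lt_of_le_of_ne (d.core_nonneg s(m, m)) (hq.2 m hm).symm)
            refine ⟨P, fun _ N x hx hNm hN => hP N x hx fun w hw u hu hne => ?_⟩
            have := hN w hw u hu hne
            rwa [hNm w hw, hNm u hu] at this
          · exact ⟨0, fun h => absurd h hm⟩
        choose P hP using hP
        refine ⟨∑ m, P m, fun θ hθ φ z hc hz => ?_⟩
        rw [fullModel_incr_inr d ν hz, ← Finset.natCast_card_filter]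
        have h1 : (φ.filter fun w => d.link q z w).card ≤ ∑ m, P m := by
          by_cases hzq : z.2 ∈ d.typ q
          -- All the partners of `z` carry the other mark of the pair, so the core of this mark with
          -- itself separates them.
          · have hNm : ∀ w, d.link q z w → w.2 = Sym2.Mem.other hzq := fun w hw => by
              have h2 : s(z.2, Sym2.Mem.other hzq) = s(z.2, w.2) :=
                (Sym2.other_spec hzq).trans hw.1.symm
              exact (Sym2.congr_right.1 h2).symm
            refine (hP (Sym2.Mem.other hzq) (Sym2.other_mem hzq) _ z.1 (fun w hw => ?_)
              (fun w hw => hNm w (Finset.mem_filter.1 hw).2) fun w hw u hu => ?_).trans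
              (Finset.single_le_sum (f := P) (fun _ _ => Nat.zero_le _) (Finset.mem_univ _))
            · exact (Finset.mem_filter.1 hw).2.2.2.trans (hhi q)
            · exact hc w (Or.inr (Finset.mem_filter.1 hw).1) u (Or.inr (Finset.mem_filter.1 hu).1)
          · rw [Finset.card_eq_zero.2]
            · exact Nat.zero_le _
            refine Finset.filter_eq_empty_iff.2 fun w _ hw => hzq ?_
            rw [← hw.1]
            exact Sym2.mem_mk_left _ _
        have h2 : ((φ.filter fun w => d.link q z w).card : ℝ) ≤ ((∑ m, P m : ℕ) : ℝ) := by
          exact_mod_cast h1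
        have h3 := (abs_le.1 (hB θ hθ (Sum.inr q))).1
        have h4 : B * ((φ.filter fun w => d.link q z w).card : ℝ) ≤ B * ((∑ m, P m : ℕ) : ℝ) := by
          gcongr
        have h5 : -B * ((φ.filter fun w => d.link q z w).card : ℝ)
            ≤ θ (Sum.inr q) * ((φ.filter fun w => d.link q z w).card : ℝ) :=
          mul_le_mul_of_nonneg_right h3 (Nat.cast_nonneg _)
        linarith
    choose P hP using hpack
    refine ⟨∑ m : 𝕄, B + ∑ q, B * P q, by positivity, fun θ hθ φ z hc => ?_⟩
    by_cases hz : z ∈ φ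
    · simp only [Model.incr_of_mem _ hz, Pi.zero_apply, mul_zero, Finset.sum_const_zero]
      have : 0 ≤ ∑ m : 𝕄, B + ∑ q, B * P q := by positivity
      linarith
    rw [Fintype.sum_sum_type, neg_add, ← Finset.sum_neg_distrib, ← Finset.sum_neg_distrib]
    refine add_le_add (Finset.sum_le_sum fun m _ => ?_)
      (Finset.sum_le_sum fun q _ => hP q θ hθ φ z hc hz)
    rw [fullModel_incr_inl d ν hz]
    have := abs_le.1 (hB θ hθ (Sum.inl m))
    split_ifs <;> linarith
  measurableSet_hardCore := by
    -- The hard core is violated exactly when some pair of points lies in this open set.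
    have hO : IsOpen {p : (Plane × 𝕄) × (Plane × 𝕄) |
        p.1 ≠ p.2 ∧ dist p.1.1 p.2.1 < d.core s(p.1.2, p.2.2)} := by
      refine (isOpen_ne_fun continuous_fst continuous_snd).inter (isOpen_lt
        (f := fun p : (Plane × 𝕄) × (Plane × 𝕄) => dist p.1.1 p.2.1)
        (g := fun p => d.core s(p.1.2, p.2.2)) (by fun_prop) ?_)
      exact (continuous_of_discreteTopology (f := fun p : 𝕄 × 𝕄 => d.core s(p.1, p.2))).comp
        (continuous_fst.snd.prodMk continuous_snd.snd)
    have h := (measurableSet_exists_pair hO).compl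
    convert h using 1
    ext φ
    simp only [mem_ofPred_eq, mem_compl_iff, fullModel, hardCore, not_exists, not_and, not_lt, ne_eq]
  continuousOn_stat n := by
    refine continuousOn_pi.2 fun j => ?_
    rcases j with m | q
    · exact d.continuousOn_stat_inl (fun _ _ _ => True) m n
    · simp only [fullModel_stat_inr]
      refine continuousOn_sum_pairs _ fun z w hne hg => ?_
      simp only [d.isEdge_pair (E := fun _ _ => True) fun _ _ _ => trivial, and_true]
      have hz : z ∈ ({z, w} : Set (Plane × 𝕄)) := Or.inl rfl
      have hw : w ∈ ({z, w} : Set (Plane × 𝕄)) := Or.inr rfl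
      refine (continuousAt_const (y := if d.link q z w then (1 : ℝ) else 0)).congr ?_
      filter_upwards [d.eventually_link_iff (hg.dist_ne z hz w hw hne (Sum.inl q))
        (hg.dist_ne z hz w hw hne (Sum.inr (Sum.inl q)))] with p hp
      simp only [hp]
  hardCore_nhds z w hne hg := by
    change ∀ᶠ p : (Plane × 𝕄) × (Plane × 𝕄) in 𝓝 (z, w), ({p.1, p.2} ∈ d.hardCore ↔ {z, w} ∈ d.hardCore)
    simp only [pair_mem_hardCore]
    exact d.eventually_allowed_iff hne
      (hg.dist_ne z (Or.inl rfl) w (Or.inr rfl) hne (Sum.inr (Sum.inr _)))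

end FullModel

end BandData

end MarkedGibbs

/-! ### Crossing the outer radius of a band -/

namespace MarkedGibbs

open scoped Classical

lemma isGeneric_pair {𝕄 κ : Type} {c : κ → 𝕄 → 𝕄 → ℝ} {z w : Plane × 𝕄} (hne : z.1 ≠ w.1)
    (h : ∀ k, dist z.1 w.1 ≠ c k z.2 w.2 ∧ dist z.1 w.1 ≠ c k w.2 z.2) : IsGeneric c {z, w} := by
  refine ⟨?_, ?_, ?_⟩
  · rintro _ (rfl | rfl) _ (rfl | rfl) h'
    exacts [absurd rfl h', hne, hne.symm, absurd rfl h']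
  · rintro _ (rfl | rfl) _ (rfl | rfl) h' k
    · exact absurd rfl h'
    · exact (h k).1
    · rw [dist_comm]
      exact (h k).2
    · exact absurd rfl h'
  · rintro _ (rfl | rfl) _ (rfl | rfl) _ (rfl | rfl) h h' h'' <;>
    first
    | exact absurd rfl h
    | exact absurd rfl h'
    | exact absurd rfl h''

namespace BandData

variable {𝕄 Q : Type} [Fintype 𝕄] [Fintype Q] (d : BandData 𝕄 Q)

/-- The point with mark `m` at abscissa `r` on the first axis. -/
def axisPoint (r : ℝ) (m : 𝕄) : Plane × 𝕄 := (EuclideanSpace.single 0 r, m)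

lemma dist_axisPoint (r s : ℝ) (m m' : 𝕄) :
    dist (axisPoint r m).1 (axisPoint s m').1 = |r - s| := by
  simp [axisPoint, Real.dist_eq]

lemma norm_axisPoint (r : ℝ) (m : 𝕄) : ‖(axisPoint r m).1‖ = |r| := by
  simp [axisPoint]

lemma axisPoint_ne {r s : ℝ} (h : r ≠ s) (m m' : 𝕄) : axisPoint r m ≠ axisPoint s m' := by
  intro e
  have h1 := dist_axisPoint r s m m'
  rw [e, dist_self] at h1
  exact h (sub_eq_zero.1 (abs_eq_zero.1 h1.symm))

/-- The pair of points with marks `a` and `b` at distance `r`. -/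
def axisPair (a b : 𝕄) (r : ℝ) : Finset (Plane × 𝕄) := {axisPoint 0 a, axisPoint r b}

lemma isGeneric_axisPair {a b : 𝕄} {r : ℝ} (hr : 0 < r) (hc : ∀ k m m', d.crit k m m' ≠ r) :
    IsGeneric d.crit (axisPair a b r : Set (Plane × 𝕄)) := by
  have hd : dist (axisPoint 0 a).1 (axisPoint r b).1 = r := by
    rw [dist_axisPoint, zero_sub, abs_neg, abs_of_pos hr]
  simp only [axisPair, Finset.coe_insert, Finset.coe_singleton]
  refine isGeneric_pair (fun e => hr.ne ?_) fun k => ?_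
  · rw [← hd, e, dist_self]
  · rw [hd]
    exact ⟨(hc _ _ _).symm, (hc _ _ _).symm⟩

lemma exists_isolated {ρ : ℝ} : ∃ δ : ℝ, 0 < δ ∧
    ∀ r, r ≠ ρ → |r - ρ| < δ → ∀ k m m', d.crit k m m' ≠ r := by
  have hfin : (⋃ k : Q ⊕ Q ⊕ Sym2 𝕄, ⋃ m : 𝕄, ⋃ m' : 𝕄, {d.crit k m m'} : Set ℝ).Finite :=
    Set.finite_iUnion fun k => Set.finite_iUnion fun m => Set.finite_iUnion fun m' =>
      Set.finite_singleton _
  set S : Set ℝ := (⋃ k : Q ⊕ Q ⊕ Sym2 𝕄, ⋃ m : 𝕄, ⋃ m' : 𝕄, {d.crit k m m'}) \ {ρ} with hS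
  have hSf : S.Finite := hfin.subset sdiff_subset
  have hmem : Sᶜ ∈ 𝓝 ρ := hSf.isClosed.isOpen_compl.mem_nhds fun h => h.2 rfl
  obtain ⟨δ, hδ, h⟩ := Metric.mem_nhds_iff.1 hmem
  refine ⟨δ, hδ, fun r hr hrδ k m m' e => ?_⟩
  refine h (Metric.mem_ball.2 (by rwa [Real.dist_eq])) ⟨?_, hr⟩
  simp only [mem_iUnion, mem_singleton_iff]
  exact ⟨k, m, m', e.symm⟩

variable [TopologicalSpace 𝕄] [DiscreteTopology 𝕄] [MeasurableSpace 𝕄] [BorelSpace 𝕄]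
variable (ν : Measure 𝕄)

lemma fullModel_incr_pair {x y z : Plane × 𝕄} (hxy : x ≠ y) (hzx : z ≠ x) (hzy : z ≠ y) :
    (d.fullModel ν).incr {x, y} z = Sum.elim (fun m => if z.2 = m then 1 else 0)
      fun q => (if d.link q z x then 1 else 0) + if d.link q z y then 1 else 0 := by
  have hz : z ∉ ({x, y} : Finset (Plane × 𝕄)) := by simp [hzx, hzy]
  funext j
  rcases j with m | q
  · exact d.fullModel_incr_inl ν hz m
  · rw [fullModel_incr_inr d ν hz, Finset.sum_pair hxy]
    rfl

/-- The births at a pair involve the relations of `z` with its two points but not the link between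
them, so for almost every `z` they do not notice that the distance of the pair crosses `ρ`. The
condition on the core keeps the pair itself allowed. -/
lemma fullModel_birth_eventually [SFinite ν] (θ : 𝕄 ⊕ Q → ℝ) (a b : 𝕄) {ρ : ℝ} (hρ : 0 < ρ)
    (hcore : d.core s(a, b) < ρ) : ∀ᵐ z ∂(d.fullModel ν).mu, ∀ᶠ r in 𝓝 ρ, ∀ j,
      (d.fullModel ν).birth θ (axisPair a b r) z j
        = (d.fullModel ν).birth θ (axisPair a b ρ) z j := by
  have h0 : ∀ᵐ z ∂(d.fullModel ν).mu, dist z.1 (axisPoint 0 a).1 ≠ 0 :=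
    ae_dist_ne ν _ (f := fun _ => 0) continuous_const
  have h1 : ∀ᵐ z ∂(d.fullModel ν).mu, dist z.1 (axisPoint ρ b).1 ≠ 0 :=
    ae_dist_ne ν _ (f := fun _ => 0) continuous_const
  have h2 : ∀ᵐ z ∂(d.fullModel ν).mu, ∀ q, dist z.1 (axisPoint ρ b).1 ≠ d.lo q :=
    ae_all_iff.2 fun q => ae_dist_ne ν _ (f := fun _ => d.lo q) continuous_const
  have h3 : ∀ᵐ z ∂(d.fullModel ν).mu, ∀ q, dist z.1 (axisPoint ρ b).1 ≠ d.hi q :=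
    ae_all_iff.2 fun q => ae_dist_ne ν _ (f := fun _ => d.hi q) continuous_const
  have h4 : ∀ᵐ z ∂(d.fullModel ν).mu, ∀ s, dist z.1 (axisPoint ρ b).1 ≠ d.core s :=
    ae_all_iff.2 fun s => ae_dist_ne ν _ (f := fun _ => d.core s) continuous_const
  filter_upwards [h0, h1, h2, h3, h4] with z h0 h1 h2 h3 h4
  have hzx : z ≠ axisPoint 0 a := fun e => h0 (by rw [e, dist_self])
  have hzy : z ≠ axisPoint ρ b := fun e => h1 (by rw [e, dist_self])
  have hy : Tendsto (fun r => (z, axisPoint r b)) (𝓝 ρ) (𝓝 (z, axisPoint ρ b)) := by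
    have : Continuous fun r : ℝ => (z, axisPoint r b) := by
      refine continuous_const.prodMk (Continuous.prodMk ?_ continuous_const)
      exact (Isometry.of_dist_eq fun r s => by simp).continuous
    exact this.tendsto ρ
  have e1 : ∀ᶠ r in 𝓝 ρ, z ≠ axisPoint r b :=
    hy.eventually ((isOpen_ne_fun continuous_fst continuous_snd).mem_nhds hzy)
  have e2 : ∀ᶠ r in 𝓝 ρ, ∀ q, (d.link q z (axisPoint r b) ↔ d.link q z (axisPoint ρ b)) :=
    eventually_all.2 fun q => hy.eventually (d.eventually_link_iff (h2 q) (h3 q))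
  have e3 : ∀ᶠ r in 𝓝 ρ, (d.allowed z (axisPoint r b) ↔ d.allowed z (axisPoint ρ b)) :=
    hy.eventually (d.eventually_allowed_iff hzy (h4 _))
  have hal : ∀ r, d.core s(a, b) < r → d.allowed (axisPoint 0 a) (axisPoint r b) := by
    intro r hr _
    rw [dist_axisPoint, zero_sub, abs_neg]
    exact hr.le.trans (le_abs_self r)
  filter_upwards [e1, e2, e3, lt_mem_nhds hρ, lt_mem_nhds hcore] with r e1 e2 e3 e4 e5 j
  have hi : (d.fullModel ν).incr (axisPair a b r) z = (d.fullModel ν).incr (axisPair a b ρ) z := by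
    rw [axisPair, axisPair, fullModel_incr_pair d ν (axisPoint_ne e4.ne _ _) hzx e1,
      fullModel_incr_pair d ν (axisPoint_ne hρ.ne _ _) hzx hzy]
    simp only [e2]
  have hh : (insert z (axisPair a b r : Set (Plane × 𝕄)) ∈ (d.fullModel ν).hardCore) ↔
      insert z (axisPair a b ρ : Set (Plane × 𝕄)) ∈ (d.fullModel ν).hardCore := by
    simp only [axisPair, Finset.coe_insert, Finset.coe_singleton]
    change _ ∈ d.hardCore ↔ _ ∈ d.hardCore
    rw [triple_mem_hardCore, triple_mem_hardCore, e3]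
    simp only [hal r e5, hal ρ hcore]
  simp only [Model.birth, Model.papangelou, hi, hh]

lemma fullModel_sum_death_pair (v : 𝕄 ⊕ Q → ℝ) {x y : Plane × 𝕄} (hxy : x ≠ y) :
    ∑ j, v j * (d.fullModel ν).death {x, y} j = v (Sum.inl x.2) + v (Sum.inl y.2)
      + 2 * ∑ q, v (Sum.inr q) * if d.link q x y then 1 else 0 := by
  have h : ∀ j, (d.fullModel ν).death {x, y} j =
      (d.fullModel ν).incr {y} x j + (d.fullModel ν).incr {x} y j := by
    intro j
    rw [Model.death, Finset.sum_pair hxy, Finset.erase_insert (by simpa using hxy),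
      Finset.pair_comm, Finset.erase_insert (by simpa using hxy.symm)]
  have hx : x ∉ ({y} : Finset (Plane × 𝕄)) := by simpa using hxy
  have hy : y ∉ ({x} : Finset (Plane × 𝕄)) := by simpa using hxy.symm
  simp only [h, Fintype.sum_sum_type, fullModel_incr_inl d ν hx, fullModel_incr_inl d ν hy,
    fullModel_incr_inr d ν hx, fullModel_incr_inr d ν hy, Finset.sum_singleton, mul_add,
    Finset.sum_add_distrib, d.link_comm (z := y) (w := x)]
  simp
  ring

variable [IsProbabilityMeasure ν]

instance : IsProbabilityMeasure (d.fullModel ν).markLaw := inferInstanceAs (IsProbabilityMeasure ν)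

/-- The band components of a direction without innovations vanish. -/
lemma fullModel_inr_eq_zero {Θ : Set (𝕄 ⊕ Q → ℝ)} {D : ℝ} (hX : (d.fullModel ν).IsTame d.crit Θ D)
    {θ : 𝕄 ⊕ Q → ℝ} (hθ : θ ∈ Θ) {v : 𝕄 ⊕ Q → ℝ}
    (hv : ∀ φ : Finset (Plane × 𝕄), IsGeneric d.crit (φ : Set (Plane × 𝕄)) →
      (φ : Set (Plane × 𝕄)) ∈ (d.fullModel ν).hardCore →
        ∑ j, v j * (d.fullModel ν).innov θ φ j = 0) (q : Q) : v (Sum.inr q) = 0 := by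
  by_contra hq0
  -- Among the bands with nonzero coefficient take one with the largest outer radius `ρ`: beyond `ρ`
  -- nothing is counted along `v`.
  obtain ⟨q, hq, hmax⟩ := Finset.exists_max_image
    (Finset.univ.filter fun q => v (Sum.inr q) ≠ 0) d.hi ⟨q, by simpa using hq0⟩
  have hq : v (Sum.inr q) ≠ 0 := (Finset.mem_filter.1 hq).2
  have hmax : ∀ q', v (Sum.inr q') ≠ 0 → d.hi q' ≤ d.hi q := fun q' h =>
    hmax q' (Finset.mem_filter.2 ⟨Finset.mem_univ _, h⟩)
  obtain ⟨⟨a, b⟩, hab⟩ := Quot.exists_rep (d.typ q)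
  have hab : s(a, b) = d.typ q := hab
  set ρ := d.hi q with hρ
  have hρ0 : 0 < ρ := d.hi_pos q
  obtain ⟨δ, hδ, hiso⟩ := d.exists_isolated (ρ := ρ)
  -- `lo q` is itself critical, so it is at least `δ` away from `ρ`.
  have hlo : d.lo q ≤ ρ - δ := by
    by_contra! h
    refine hiso (d.lo q) (d.lo_lt_hi q).ne ?_ (Sum.inl q) a a rfl
    rw [abs_lt]
    constructor <;> linarith [d.lo_lt_hi q]
  have hlo0 := d.lo_nonneg q
  have hcore : d.core s(a, b) ≤ d.lo q := hab ▸ d.core_le_lo q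
  choose C hC0 hC using fun j => hX.exists_birth_le j 2
  have hbd : ∀ φ : Finset (Plane × 𝕄), φ.card ≤ 2 → ∀ z,
      |∑ j, v j * (d.fullModel ν).birth θ φ z j| ≤ ∑ j, |v j| * C j := by
    intro φ hφ z
    refine (Finset.abs_sum_le_sum_abs _ _).trans (Finset.sum_le_sum fun j _ => ?_)
    rw [abs_mul]
    exact mul_le_mul_of_nonneg_left (hC j θ hθ φ z hφ) (abs_nonneg _)
  -- On either side of `ρ` the deaths of the pair along `v` are constant, and both constants equal
  -- the same integral of births. The sign `σ` selects the side.
  have key : ∀ σ : ℝ, |σ| = 1 → ∀ t : ℝ, (∀ r, |r - ρ| < δ → 0 < σ * (r - ρ) →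
      ∑ q', v (Sum.inr q') * (if d.link q' (axisPoint 0 a) (axisPoint r b) then (1 : ℝ) else 0) = t) →
      v (Sum.inl a) + v (Sum.inl b) + 2 * t =
        ∫ z, (∑ j, v j * (d.fullModel ν).birth θ (axisPair a b ρ) z j
          - ∑ j, v j * (d.fullModel ν).birth θ ∅ z j) ∂(d.fullModel ν).mu := by
    intro σ hσ t ht
    let r : ℕ → ℝ := fun n => ρ + σ * (δ / (n + 2))
    have hr1 : ∀ n, |r n - ρ| < δ := fun n => by
      simp only [r, add_sub_cancel_left, abs_mul, hσ, one_mul]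
      rw [abs_of_pos (by positivity)]
      exact div_lt_self hδ (by linarith [Nat.cast_nonneg (α := ℝ) n])
    have hr2 : ∀ n, 0 < σ * (r n - ρ) := fun n => by
      simp only [r, add_sub_cancel_left, ← mul_assoc]
      rw [← abs_mul_abs_self σ, hσ]
      positivity
    have hr3 : ∀ n, r n ≠ ρ := fun n h => by
      have := hr2 n
      rw [h] at this
      simp at this
    have hr4 : ∀ n, d.lo q < r n := fun n => by linarith [(abs_lt.1 (hr1 n)).1]
    have hr5 : Tendsto r atTop (𝓝 ρ) := by
      have h1 : Tendsto (fun n : ℕ => δ / ((n : ℝ) + 2)) atTop (𝓝 0) :=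
        (tendsto_const_div_atTop_nhds_zero_nat δ |>.comp (tendsto_add_atTop_nat 2)).congr
          fun n => by simp
      simpa using (h1.const_mul σ).const_add ρ
    have hlim := hX.tendsto_sum_death hθ hv (φ := fun n => axisPair a b (r n))
      (fun n => d.isGeneric_axisPair (hlo0.trans_lt (hr4 n)) (hiso _ (hr3 n) (hr1 n)))
      (fun n => ?_) (r := ρ + δ) (fun n w hw => ?_)
      (fun n z => (abs_sub _ _).trans (add_le_add (hbd _ Finset.card_le_two z) (hbd ∅ (by simp) z)))
      (G := fun z => ∑ j, v j * (d.fullModel ν).birth θ (axisPair a b ρ) z j) ?_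
    · refine tendsto_nhds_unique (tendsto_const_nhds.congr fun n => ?_) hlim
      rw [axisPair, fullModel_sum_death_pair d ν v
        (axisPoint_ne (hlo0.trans_lt (hr4 n)).ne _ _), ht _ (hr1 n) (hr2 n)]
      rfl
    · simp only [axisPair, Finset.coe_insert, Finset.coe_singleton]
      refine d.pair_mem_hardCore.2 fun _ => ?_
      rw [dist_axisPoint, zero_sub, abs_neg]
      exact hcore.trans ((hr4 n).le.trans (le_abs_self _))
    · have h1 := (abs_lt.1 (hr1 n)).2
      have h2 := hr4 n
      simp only [axisPair, Finset.mem_insert, Finset.mem_singleton] at hw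
      rcases hw with rfl | rfl
      · rw [norm_axisPoint, abs_zero]
        positivity
      · rw [norm_axisPoint, abs_of_pos (by linarith)]
        linarith
    · filter_upwards [d.fullModel_birth_eventually ν θ a b hρ0 (hcore.trans_lt (d.lo_lt_hi q))]
        with z hz
      refine tendsto_const_nhds.congr' ?_
      filter_upwards [hr5.eventually hz] with n hn
      simp only [hn]
  have hdist : ∀ r, |r - ρ| < δ → dist (axisPoint 0 a).1 (axisPoint r b).1 = r := fun r hr => by
    rw [dist_axisPoint, zero_sub, abs_neg, abs_of_pos]
    linarith [(abs_lt.1 hr).1]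
  -- Just below `ρ` the pair is in the band `q` and in no other, the bands of a pair of marks having
  -- disjoint interiors; just above, in no band with nonzero coefficient. The jump `2 * v q` is
  -- therefore zero.
  have k1 := key (-1) (by simp) (v (Sum.inr q)) fun r hr hσ => by
    have h1 := (abs_lt.1 hr).1
    simp only [d.link_iff_of_mem_Ioo (q := q) (z := axisPoint 0 a) (w := axisPoint r b) hab
      (by rw [hdist r hr]; constructor <;> linarith)]
    simp
  have k2 := key 1 (by simp) 0 fun r hr hσ => Finset.sum_eq_zero fun q' _ => by
    by_cases h0 : v (Sum.inr q') = 0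
    · rw [h0, zero_mul]
    · rw [if_neg, mul_zero]
      rintro ⟨-, h2⟩
      rw [hdist r hr] at h2
      linarith [hmax q' h0, h2.2]
  exact hq (by linarith)

end BandData

end MarkedGibbs

/-! ### Coefficients of the point counts; the multi-Strauss theorem -/

namespace MarkedGibbs

open scoped Classical

/-- There are generic configurations close to periodic ones. -/
lemma Model.IsTame.exists_lattice {𝕄 : Type} [MeasurableSpace 𝕄] {ι : Type} [Fintype ι]
    {X : Model 𝕄 ι} [TopologicalSpace 𝕄] [DiscreteTopology 𝕄] {κ : Type} {c : κ → 𝕄 → 𝕄 → ℝ}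
    {Θ : Set (ι → ℝ)} {D : ℝ} (hX : X.IsTame c Θ D) [BorelSpace 𝕄] [SecondCountableTopology 𝕄]
    [Finite κ] [IsProbabilityMeasure X.markLaw] [X.markLaw.IsOpenPosMeasure]
    {K : Type} [Fintype K] (o : K → Plane × 𝕄) (s : ℝ) {ε : ℝ} (hε : 0 < ε) (n : ℕ) :
    ∃ x : (Fin n × Fin n) × K → Plane × 𝕄, Function.Injective x ∧ IsGeneric c (range x) ∧
      ∀ p k, dist (x (p, k)).1 (latticePoint s p.1 p.2 + (o k).1) < ε ∧ (x (p, k)).2 = (o k).2 := by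
  obtain ⟨x, hxi, hxg, hxU⟩ := hX.exists_generic (α := (Fin n × Fin n) × K)
    (U := fun i => Metric.ball (latticePoint s i.1.1 i.1.2 + (o i.2).1) ε ×ˢ {(o i.2).2})
    (fun i => Metric.isOpen_ball.prod (isOpen_discrete _))
    fun i => ⟨(latticePoint s i.1.1 i.1.2 + (o i.2).1, (o i.2).2), by simpa using hε⟩
  exact ⟨x, hxi, hxg, fun p k => ⟨(hxU (p, k)).1, (hxU (p, k)).2⟩⟩

namespace Model

section PointCounts

variable {𝕄 Q : Type} [Fintype 𝕄] [Fintype Q] [MeasurableSpace 𝕄] {X : Model 𝕄 (𝕄 ⊕ Q)}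
  (hs : ∀ φ m, X.stat φ (Sum.inl m) = ((φ.filter fun z => z.2 = m).card : ℝ))
  {v : 𝕄 ⊕ Q → ℝ} (hq : ∀ q, v (Sum.inr q) = 0)

include hs hq

lemma sum_mul_stat_of_forall_mark {φ : Finset (Plane × 𝕄)} {a : 𝕄} (h : ∀ z ∈ φ, z.2 = a) :
    ∑ j, v j * X.stat φ j = v (Sum.inl a) * φ.card := by
  rw [Fintype.sum_sum_type]
  simp only [hq, zero_mul, Finset.sum_const_zero, add_zero, hs]
  rw [Finset.sum_eq_single a]
  · rw [Finset.filter_true_of_mem h]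
  · intro m _ hm
    rw [Finset.filter_false_of_mem fun z hz e => hm (e.symm.trans (h z hz))]
    simp
  · simp

variable [TopologicalSpace 𝕄] [DiscreteTopology 𝕄] [BorelSpace 𝕄] {κ : Type} [Finite κ]
  {c : κ → 𝕄 → 𝕄 → ℝ} {Θ : Set (𝕄 ⊕ Q → ℝ)} {D : ℝ} (hX : X.IsTame c Θ D)
  {θ : 𝕄 ⊕ Q → ℝ} (hθ : θ ∈ Θ)

include hX hθ

/-- With the band coefficients gone only increments of counts remain, and these are at most `1`;
this is the uniform bound required by `slope_nonpos` and `false_of_stat_ge`. -/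
lemma exists_abs_sum_mul_birth_le : ∃ C : ℝ, ∀ φ : Finset (Plane × 𝕄), ∀ z,
    |∑ j, v j * X.birth θ φ z j| ≤ C := by
  obtain ⟨T, hT0, hT⟩ := hX.exists_papangelou_le
  refine ⟨∑ j, |v j| * T, fun φ z => ?_⟩
  refine (Finset.abs_sum_le_sum_abs _ _).trans (Finset.sum_le_sum fun j _ => ?_)
  rcases j with m | q
  · have hp := X.papangelou_nonneg θ φ z
    rw [abs_mul, Model.birth, abs_mul, abs_of_nonneg hp]
    have := mul_le_mul (abs_incr_inl_le hs φ z m) (hT θ hθ φ z) hp zero_le_one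
    rw [one_mul] at this
    gcongr
  · simp [hq]

/-- The coefficient of the number of points with a mark is nonpositive if an arbitrary number of
points with this mark can be put in a disc. -/
lemma inl_nonpos [IsProbabilityMeasure X.markLaw] [X.markLaw.IsOpenPosMeasure]
    (hv : ∀ φ : Finset (Plane × 𝕄), IsGeneric c (φ : Set (Plane × 𝕄)) →
      (φ : Set (Plane × 𝕄)) ∈ X.hardCore → ∑ j, v j * X.innov θ φ j = 0) {a : 𝕄}
    (ha : ∀ φ : Finset (Plane × 𝕄), (∀ z ∈ φ, z.2 = a) → (φ : Set (Plane × 𝕄)) ∈ X.hardCore) :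
    v (Sum.inl a) ≤ 0 := by
  obtain ⟨C, hC⟩ := exists_abs_sum_mul_birth_le hs hq hX hθ
  refine hX.slope_nonpos hθ hv (fun φ _ _ => hC φ) (r := 1) (B := 1) (b := 0) fun n => ?_
  obtain ⟨x, hxi, hxg, hxU⟩ := hX.exists_generic (α := Fin n)
    (U := fun _ => Metric.ball (0 : Plane) 1 ×ˢ {a})
    (fun _ => Metric.isOpen_ball.prod (isOpen_discrete _)) fun _ => ⟨(0, a), by simp⟩
  have hmem : ∀ w ∈ Finset.univ.image x, ‖w.1‖ ≤ 1 ∧ w.2 = a := by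
    intro w hw
    obtain ⟨i, -, rfl⟩ := Finset.mem_image.1 hw
    exact ⟨(mem_ball_zero_iff.1 (hxU i).1).le, (hxU i).2⟩
  have hcard : (Finset.univ.image x).card = n := by simp [Finset.card_image_of_injective _ hxi]
  refine ⟨Finset.univ.image x, by simpa using hxg, ha _ fun w hw => (hmem w hw).2,
    fun w hw => (hmem w hw).1, by rw [hcard, one_mul], ?_⟩
  rw [sum_mul_stat_of_forall_mark hs hq fun z hz => (hmem z hz).2, hcard, add_zero]

end PointCounts

end Model

namespace BandData

variable {𝕄 Q : Type} [Fintype 𝕄] [Fintype Q] (d : BandData 𝕄 Q)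

lemma exists_regular (q : Q) : ∃ r ∈ Ioo (d.lo q) (d.hi q), ∀ k m m', d.crit k m m' ≠ r := by
  obtain ⟨δ, hδ, h⟩ := d.exists_isolated (ρ := d.hi q)
  set η := min (δ / 2) ((d.hi q - d.lo q) / 2) with hη
  have h0 := d.lo_lt_hi q
  have hη0 : 0 < η := lt_min (by positivity) (by linarith)
  have h1 : η ≤ δ / 2 := min_le_left _ _
  have h2 : η ≤ (d.hi q - d.lo q) / 2 := min_le_right _ _
  refine ⟨d.hi q - η, ⟨by linarith, by linarith⟩, h _ (by linarith) ?_⟩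
  rw [sub_sub_cancel_left, abs_neg, abs_of_pos hη0]
  linarith

variable [TopologicalSpace 𝕄] [DiscreteTopology 𝕄] [MeasurableSpace 𝕄] [BorelSpace 𝕄]
variable (ν : Measure 𝕄)

lemma fullModel_translationInvariant : (d.fullModel ν).TranslationInvariant := by
  refine ⟨fun x φ => d.stat_translate (fun _ _ _ => True) x φ fun _ _ => Iff.rfl, fun x φ => ?_⟩
  have hsurj : ∀ z w : Plane × 𝕄, d.allowed (z.1 + x, z.2) (w.1 + x, w.2) ↔ d.allowed z w := by
    intro z w
    simp only [allowed, dist_add_right, ne_eq, add_left_inj, Prod.ext_iff]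
  change (φ.translate x).pts ∈ d.hardCore ↔ φ.pts ∈ d.hardCore
  simp only [mem_hardCore, Config.translate, Set.forall_mem_image, hsurj]

lemma fullModel_incr_empty (z : Plane × 𝕄) :
    (d.fullModel ν).incr ∅ z = Sum.elim (fun m => if z.2 = m then 1 else 0) 0 := by
  funext j
  rcases j with m | q
  · exact d.fullModel_incr_inl ν (Finset.notMem_empty z) m
  · rw [fullModel_incr_inr d ν (Finset.notMem_empty z)]
    rfl

lemma fullModel_sum_birth_empty (θ v : 𝕄 ⊕ Q → ℝ) (z : Plane × 𝕄) :
    ∑ j, v j * (d.fullModel ν).birth θ ∅ z j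
      = v (Sum.inl z.2) * Real.exp (-θ (Sum.inl z.2)) := by
  have hp : (d.fullModel ν).papangelou θ ∅ z = Real.exp (-θ (Sum.inl z.2)) := by
    rw [Model.papangelou, if_pos]
    · rw [fullModel_incr_empty, Fintype.sum_sum_type]
      simp
    · rintro x hx y hy hne
      simp only [Finset.coe_empty, insert_empty_eq, mem_singleton_iff] at hx hy
      exact absurd (hx.trans hy.symm) hne
  simp only [Model.birth, hp, fullModel_incr_empty, Fintype.sum_sum_type]
  simp

variable [IsProbabilityMeasure ν]

lemma setIntegral_fullModel_birth_empty (θ v : 𝕄 ⊕ Q → ℝ) (L : ℝ) :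
    ∫ z in Metric.closedBall (0 : Plane) L ×ˢ univ, ∑ j, v j * (d.fullModel ν).birth θ ∅ z j
        ∂(d.fullModel ν).mu
      = volume.real (Metric.closedBall (0 : Plane) L) *
        ∑ m, ν.real {m} * (v (Sum.inl m) * Real.exp (-θ (Sum.inl m))) := by
  simp only [fullModel_sum_birth_empty]
  have h := setIntegral_prod_mul (μ := (volume : Measure Plane)) (ν := ν) (fun _ : Plane => (1 : ℝ))
    (fun m => v (Sum.inl m) * Real.exp (-θ (Sum.inl m))) (Metric.closedBall 0 L) univ
  simp only [one_mul] at h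
  refine h.trans ?_
  have h' : ∫ m in univ, v (Sum.inl m) * Real.exp (-θ (Sum.inl m)) ∂ν
      = ∑ m, ν.real {m} * (v (Sum.inl m) * Real.exp (-θ (Sum.inl m))) := by
    rw [setIntegral_univ, integral_fintype Integrable.of_finite]
    rfl
  rw [h']
  simp

section Annihilator

variable {ν} {Θ : Set (𝕄 ⊕ Q → ℝ)} {D : ℝ} (hX : (d.fullModel ν).IsTame d.crit Θ D)
  {θ : 𝕄 ⊕ Q → ℝ} (hθ : θ ∈ Θ) {v : 𝕄 ⊕ Q → ℝ}
  (hv : ∀ φ : Finset (Plane × 𝕄), IsGeneric d.crit (φ : Set (Plane × 𝕄)) →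
      (φ : Set (Plane × 𝕄)) ∈ (d.fullModel ν).hardCore →
        ∑ j, v j * (d.fullModel ν).innov θ φ j = 0)
  (hq : ∀ q, v (Sum.inr q) = 0)

include hq in
lemma fullModel_sum_stat (φ : Finset (Plane × 𝕄)) : ∑ j, v j * (d.fullModel ν).stat φ j
    = ∑ m, v (Sum.inl m) * ((φ.filter fun z => z.2 = m).card : ℝ) := by
  rw [Fintype.sum_sum_type]
  simp only [hq, zero_mul, Finset.sum_const_zero, add_zero]
  rfl

variable [ν.IsOpenPosMeasure]

instance : (d.fullModel ν).markLaw.IsOpenPosMeasure := inferInstanceAs ν.IsOpenPosMeasure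

-- The maximum principle for the count weighted by `v`. On a disc it takes finitely many values:
-- marks with a core are packed, and the others have coefficient zero by `h0`. If `v` were positive
-- at `a`, a sparse lattice of points with mark `a` would make it of the order of the area.
include hX hθ hv hq in
lemma fullModel_inl_nonpos_of_integral (hcore : ∀ s, d.core s ≤ D)
    (h0 : ∀ a, d.core s(a, a) = 0 → v (Sum.inl a) = 0)
    (hI : 0 ≤ ∑ m, ν.real {m} * (v (Sum.inl m) * Real.exp (-θ (Sum.inl m)))) (a : 𝕄) :
    v (Sum.inl a) ≤ 0 := by
  by_contra! ha
  have hD := hX.range_pos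
  obtain ⟨C, hC⟩ := Model.exists_abs_sum_mul_birth_le (X := d.fullModel ν) (fun _ _ => rfl) hq hX hθ
  obtain ⟨δ, hδ, hgap⟩ := exists_gap ((Set.finite_range fun m : 𝕄 => v (Sum.inl m)))
  refine hX.false_of_stat_ge hθ hv (fun φ _ _ => hC φ) (fun L => ?_) hδ (fun φ z h => ?_)
    (C₁ := ∑ m, |v (Sum.inl m)|) (b := 0) (fun φ => ?_) (fun L => ?_) (s := 2 * (D + 2) + 1)
    (a := v (Sum.inl a)) (by positivity) ha fun n => ?_
  · have hP : ∀ m : 𝕄, ∃ P : ℕ, d.core s(m, m) ≠ 0 → ∀ φ : Finset (Plane × 𝕄),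
        (φ : Set (Plane × 𝕄)) ∈ d.hardCore → (∀ w ∈ φ, ‖w.1‖ ≤ L) →
        (φ.filter fun z => z.2 = m).card ≤ P := by
      intro m
      by_cases hm : d.core s(m, m) = 0
      · exact ⟨0, fun h => absurd hm h⟩
      obtain ⟨P, hP⟩ := exists_card_le L (lt_of_le_of_ne (d.core_nonneg s(m, m)) (Ne.symm hm))
      refine ⟨P, fun _ φ hc hφ => hP _ 0 (fun w hw => ?_) fun w hw u hu hne => ?_⟩
      · rw [dist_zero_left]
        exact hφ w (Finset.mem_filter.1 hw).1
      · obtain ⟨hw, hw'⟩ := Finset.mem_filter.1 hw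
        obtain ⟨hu, hu'⟩ := Finset.mem_filter.1 hu
        have := hc w hw u hu hne
        rwa [hw', hu'] at this
    choose P hP using hP
    refine ((Set.finite_Icc (0 : 𝕄 → ℕ) P).image
      fun f => ∑ m, v (Sum.inl m) * (f m : ℝ)).subset ?_
    rintro _ ⟨φ, -, hc, hφ, rfl⟩
    -- The unbounded counts of the marks without core are replaced by zero, which does not change
    -- the sum.
    refine ⟨fun m => if d.core s(m, m) = 0 then 0 else (φ.filter fun z => z.2 = m).card,
      ⟨fun m => Nat.zero_le _, fun m => ?_⟩, ?_⟩
    · dsimp only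
      split_ifs with hm
      · exact Nat.zero_le _
      · exact hP m hm φ hc hφ
    · dsimp only
      rw [d.fullModel_sum_stat hq]
      refine Finset.sum_congr rfl fun m _ => ?_
      split_ifs with hm
      · rw [h0 m hm, zero_mul, zero_mul]
      · rfl
  · by_cases hz : z ∈ φ
    · simp [Model.incr_of_mem _ hz] at h
    have e : ∑ j, v j * (d.fullModel ν).incr φ z j = v (Sum.inl z.2) := by
      simp [Fintype.sum_sum_type, fullModel_incr_inl d ν hz, hq]
    rw [e] at h ⊢
    exact hgap _ ⟨z.2, rfl⟩ h
  · rw [d.fullModel_sum_stat hq, Finset.sum_mul]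
    refine Finset.sum_le_sum fun m _ => ?_
    have : ((φ.filter fun z => z.2 = m).card : ℝ) ≤ φ.card := by
      exact_mod_cast Finset.card_le_card (Finset.filter_subset _ _)
    exact mul_le_mul (le_abs_self _) this (Nat.cast_nonneg _) (abs_nonneg _)
  · rw [setIntegral_fullModel_birth_empty]
    exact mul_nonneg measureReal_nonneg hI
  -- With mesh `D + 2` and perturbations less than `1`, distances exceed all the core radii;
  -- positions have norm at most `2 * (D + 2) * n + 1`, which explains the scale `s`.
  · obtain ⟨x, hxi, hxg, hx⟩ := hX.exists_lattice (fun _ : Unit => ((0 : Plane), a)) (D + 2)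
      one_pos n
    simp only [add_zero] at hx
    have hcard : (Finset.univ.image x).card = n ^ 2 := by
      simp [Finset.card_image_of_injective _ hxi, sq]
    refine ⟨Finset.univ.image x, by simpa using hxg, ?_, ?_, ?_⟩
    · intro z hz w hw hne
      obtain ⟨⟨p, ⟨⟩⟩, -, rfl⟩ := Finset.mem_image.1 hz
      obtain ⟨⟨p', ⟨⟩⟩, -, rfl⟩ := Finset.mem_image.1 hw
      have hpp : ((p.1 : ℕ), (p.2 : ℕ)) ≠ ((p'.1 : ℕ), (p'.2 : ℕ)) := by
        intro e
        simp only [Prod.mk.injEq, Fin.val_inj] at e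
        exact hne (by rw [Prod.ext e.1 e.2])
      have h1 := le_dist_latticePoint (s := D + 2) (by positivity) hpp
      have h2 := (hx p ()).1
      have h3 := (hx p' ()).1
      have h4 := dist_triangle4 (latticePoint (D + 2) p.1 p.2) (x (p, ())).1 (x (p', ())).1
        (latticePoint (D + 2) p'.1 p'.2)
      rw [dist_comm] at h2
      dsimp only at h1
      linarith [hcore s((x (p, ())).2, (x (p', ())).2)]
    · intro w hw
      obtain ⟨⟨p, ⟨⟩⟩, -, rfl⟩ := Finset.mem_image.1 hw
      have h1 := norm_latticePoint_le (s := D + 2) (by positivity) p.1 p.2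
      have h2 := (hx p ()).1
      rw [dist_eq_norm] at h2
      have h3 := norm_add_le ((x (p, ())).1 - latticePoint (D + 2) p.1 p.2)
        (latticePoint (D + 2) p.1 p.2)
      rw [sub_add_cancel] at h3
      have h4 : ((p.1 : ℕ) : ℝ) ≤ n := by exact_mod_cast p.1.2.le
      have h5 : ((p.2 : ℕ) : ℝ) ≤ n := by exact_mod_cast p.2.2.le
      have h6 : (D + 2) * (((p.1 : ℕ) : ℝ) + (p.2 : ℕ)) ≤ (D + 2) * (n + n) := by gcongr
      nlinarith [Nat.cast_nonneg (α := ℝ) n]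
    · rw [Model.sum_mul_stat_of_forall_mark (X := d.fullModel ν) (fun _ _ => rfl) hq (a := a), hcard,
        add_zero]
      · push_cast
        exact le_rfl
      · intro w hw
        obtain ⟨⟨p, ⟨⟩⟩, -, rfl⟩ := Finset.mem_image.1 hw
        exact (hx p ()).2

end Annihilator

variable [ν.IsOpenPosMeasure]

/-- Once the band coefficients vanish, marks without core are settled by `inl_nonpos` for `v` and
`-v`. For the remaining marks, `v` or `-v` has a nonnegative mean birth at the empty configuration;
the maximum principle makes its coefficients nonpositive, and then every term of this mean vanishes.
-/
theorem fullModel_satisfiesAssumptions : (d.fullModel ν).SatisfiesAssumptions d.params := by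
  refine Model.satisfiesAssumptions_of (c := d.crit) (d.fullModel_translationInvariant ν)
    fun Θ hΘ hsub => ?_
  obtain ⟨D, hD, hhi, hcore⟩ := d.exists_range
  have hX := d.fullModel_isTame ν hΘ hsub hD hhi hcore
  refine ⟨D, hX, fun v hv => ?_, fun θ hθ v hv => ?_⟩
  · have h0 : ∀ m, v (Sum.inl m) = 0 := by
      intro m
      have := hv ∅ (0, m) (Finset.notMem_empty _) (by simpa using isGeneric_singleton _ _)
        (by simpa using hX.empty_mem_hardCore)
      rw [fullModel_incr_empty, Fintype.sum_sum_type] at this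
      simpa using this
    funext j
    rcases j with m | q
    · exact h0 m
    · obtain ⟨⟨a, b⟩, hab⟩ := Quot.exists_rep (d.typ q)
      have hab : s(a, b) = d.typ q := hab
      obtain ⟨r, hr, hreg⟩ := d.exists_regular q
      have hr0 : 0 < r := (d.lo_nonneg q).trans_lt hr.1
      have hne := axisPoint_ne hr0.ne a b
      have hz : axisPoint 0 a ∉ ({axisPoint r b} : Finset (Plane × 𝕄)) := by simpa using hne
      have h1 := hv {axisPoint r b} (axisPoint 0 a) hz (by
        simpa [axisPair] using d.isGeneric_axisPair (a := a) (b := b) hr0 hreg)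
        (by simpa using hX.hardCore_singleton (axisPoint r b))
      have hd : dist (axisPoint 0 a).1 (axisPoint r b).1 ∈ Ioo (d.lo q) (d.hi q) := by
        rwa [dist_axisPoint, zero_sub, abs_neg, abs_of_pos hr0]
      rw [Fintype.sum_sum_type] at h1
      simp only [fullModel_incr_inr d ν hz, h0, Finset.sum_singleton,
        d.link_iff_of_mem_Ioo (q := q) (z := axisPoint 0 a) (w := axisPoint r b) hab hd] at h1
      simpa using h1
  · have hcl : ∀ a, d.core s(a, a) = 0 → ∀ φ : Finset (Plane × 𝕄), (∀ z ∈ φ, z.2 = a) →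
        (φ : Set (Plane × 𝕄)) ∈ (d.fullModel ν).hardCore := fun a ha φ hφ z hz w hw _ => by
      rw [hφ z hz, hφ w hw, ha]
      exact dist_nonneg
    have hneg : ∀ φ : Finset (Plane × 𝕄), IsGeneric d.crit (φ : Set (Plane × 𝕄)) →
        (φ : Set (Plane × 𝕄)) ∈ (d.fullModel ν).hardCore →
          ∑ j, (-v) j * (d.fullModel ν).innov θ φ j = 0 := fun φ h1 h2 => by
      simp only [Pi.neg_apply, neg_mul, Finset.sum_neg_distrib, hv φ h1 h2, neg_zero]
    have hq := d.fullModel_inr_eq_zero ν hX hθ hv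
    have hq' : ∀ q, (-v) (Sum.inr q) = 0 := fun q => by simp [hq]
    have h0 : ∀ a, d.core s(a, a) = 0 → v (Sum.inl a) = 0 := fun a ha =>
      le_antisymm (Model.inl_nonpos (X := d.fullModel ν) (fun _ _ => rfl) hq hX hθ hv (hcl a ha))
        (neg_nonpos.1 (Model.inl_nonpos (X := d.fullModel ν) (fun _ _ => rfl) hq' hX hθ hneg
          (hcl a ha)))
    have key : ∀ v : 𝕄 ⊕ Q → ℝ, (∀ a, v (Sum.inl a) ≤ 0) →
        0 ≤ ∑ m, ν.real {m} * (v (Sum.inl m) * Real.exp (-θ (Sum.inl m))) →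
        ∀ a, v (Sum.inl a) = 0 := by
      intro v hle hI a
      have hterm : ∀ m ∈ Finset.univ, ν.real {m} * (v (Sum.inl m) * Real.exp (-θ (Sum.inl m))) ≤ 0 :=
        fun m _ => mul_nonpos_of_nonneg_of_nonpos measureReal_nonneg
          (mul_nonpos_of_nonpos_of_nonneg (hle m) (Real.exp_pos _).le)
      have h1 := (Finset.sum_eq_zero_iff_of_nonpos hterm).1
        (le_antisymm (Finset.sum_nonpos hterm) hI) a (Finset.mem_univ a)
      have h2 : 0 < ν.real {a} := ENNReal.toReal_pos
        ((isOpen_discrete {a}).measure_ne_zero ν (singleton_nonempty a)) (measure_ne_top _ _)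
      exact (mul_eq_zero.1 ((mul_eq_zero.1 h1).resolve_left h2.ne')).resolve_right
        (Real.exp_pos _).ne'
    have hm : ∀ a, v (Sum.inl a) = 0 := by
      rcases le_total 0 (∑ m, ν.real {m} * (v (Sum.inl m) * Real.exp (-θ (Sum.inl m)))) with h | h
      · exact key v (d.fullModel_inl_nonpos_of_integral hX hθ hv hq hcore h0 h) h
      · have h' : 0 ≤ ∑ m, ν.real {m} * ((-v) (Sum.inl m) * Real.exp (-θ (Sum.inl m))) := by
          simpa using h
        intro a
        have := key (-v) (d.fullModel_inl_nonpos_of_integral hX hθ hneg hq' hcore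
          (fun a ha => by simp [h0 a ha]) h') h' a
        simpa using this
    funext j
    rcases j with m | q
    exacts [hm m, hq q]

end BandData

lemma isOpenPosMeasure_uniformOn {α : Type} [MeasurableSpace α] [MeasurableSingletonClass α]
    [TopologicalSpace α] [Finite α] :
    (ProbabilityTheory.uniformOn (univ : Set α)).IsOpenPosMeasure where
  open_pos U _ hne h := by
    obtain ⟨x, hx⟩ := hne
    have h1 := measure_mono_null (singleton_subset_iff.2 hx) h
    rw [ProbabilityTheory.uniformOn_eq_zero_iff Set.finite_univ, univ_inter] at h1
    exact singleton_ne_empty x h1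

theorem multiStrauss_satisfiesAssumptions {M : ℕ} (hM : 1 ≤ M) (b : Bands M) :
    (multiStrauss b).SatisfiesAssumptions (multiStraussParams b) := by
  have : Nonempty (Fin M) := ⟨⟨0, hM⟩⟩
  have := ProbabilityTheory.isProbabilityMeasure_uniformOn (s := (univ : Set (Fin M)))
    Set.finite_univ univ_nonempty
  have := isOpenPosMeasure_uniformOn (α := Fin M)
  have hp₀ : ∀ a c : Fin M, a ≤ c → ((b.toBandData.core s(a, c) = 0 ∨ ∃ m ∈ s(a, c),
      b.toBandData.core s(m, m) = 0) ↔
        (b.rad a c 0 = 0 ∨ b.rad a a 0 = 0 ∨ b.rad c c 0 = 0)) := by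
    intro a c h
    have e : ∀ m m' : Fin M, m ≤ m' → b.toBandData.core s(m, m') = b.rad m m' 0 := by
      intro m m' h
      change b.coreRad (m ⊓ m') (m ⊔ m') = _
      rw [inf_eq_left.2 h, sup_eq_right.2 h, Bands.coreRad]
    simp only [Sym2.mem_iff, exists_eq_or_imp, exists_eq_left, e a c h, e _ _ le_rfl]
  have hp : multiStraussParams b = b.toBandData.params := by
    ext θ
    simp only [multiStraussParams, BandData.params, mem_ofPred_eq]
    constructor
    · rintro h ⟨q, i⟩ hq
      exact h q i ((hp₀ _ _ q.2).1 hq)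
    · intro h q i hq
      exact h ⟨q, i⟩ ((hp₀ _ _ q.2).2 hq)
  rw [multiStrauss_eq, hp]
  exact b.toBandData.fullModel_satisfiesAssumptions _

end MarkedGibbs

/-! ### Nearest neighbours -/

namespace MarkedGibbs

open scoped Classical

section Neighbours

variable {𝕄 : Type} {k : ℕ}

lemma IsNeighbour.anti {φ φ' : Finset (Plane × 𝕄)} (hφ : φ ⊆ φ') {z w : Plane × 𝕄}
    (h : IsNeighbour k φ' z w) : IsNeighbour k φ z w :=
  (Finset.card_le_card (Finset.filter_subset_filter _ hφ)).trans h

lemma isNeighbour_congr {φ φ' : Finset (Plane × 𝕄)} {z w : Plane × 𝕄}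
    (h : ∀ u : Plane × 𝕄, dist z.1 u.1 ≤ dist z.1 w.1 → (u ∈ φ ↔ u ∈ φ')) :
    IsNeighbour k φ z w ↔ IsNeighbour k φ' z w := by
  have : (φ.filter fun u => u ≠ z ∧ dist z.1 u.1 ≤ dist z.1 w.1)
      = φ'.filter fun u => u ≠ z ∧ dist z.1 u.1 ≤ dist z.1 w.1 := by
    ext u
    simp only [Finset.mem_filter]
    exact and_congr_left fun hu => h u hu.2
  rw [IsNeighbour, IsNeighbour, this]

lemma IsNeighbour.of_dist_le {φ : Finset (Plane × 𝕄)} {z w u : Plane × 𝕄}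
    (h : IsNeighbour k φ z w) (hu : dist z.1 u.1 ≤ dist z.1 w.1) : IsNeighbour k φ z u :=
  (Finset.card_le_card fun _ hv => by
    rw [Finset.mem_filter] at hv ⊢
    exact ⟨hv.1, hv.2.1, hv.2.2.trans hu⟩).trans h

lemma isNeighbour_of_card_le {φ : Finset (Plane × 𝕄)} {z w : Plane × 𝕄} (hz : z ∈ φ)
    (h : φ.card ≤ k + 1) : IsNeighbour k φ z w := by
  have h1 : (φ.filter fun u => u ≠ z ∧ dist z.1 u.1 ≤ dist z.1 w.1) ⊆ φ.erase z := fun u hu => by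
    rw [Finset.mem_filter] at hu
    exact Finset.mem_erase.2 ⟨hu.2.1, hu.1⟩
  have h2 := Finset.card_le_card h1
  rw [Finset.card_erase_of_mem hz] at h2
  rw [IsNeighbour]
  omega

/-- A new point which expels `w` from the neighbours of `z` is close to `z`. -/
lemma IsNeighbour.dist_le_of_insert {φ : Finset (Plane × 𝕄)} {x y z : Plane × 𝕄}
    (h : IsNeighbour k φ x y) (h' : ¬IsNeighbour k (insert z φ) x y) :
    dist x.1 z.1 ≤ dist x.1 y.1 := by
  by_contra! hlt
  refine h' ((isNeighbour_congr fun u hu => ?_).1 h)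
  rw [Finset.mem_insert, or_iff_right]
  rintro rfl
  exact hlt.not_ge hu

/-- All of them lie in the closed disc about `z` reaching the farthest one, and that disc has at
most `k` points besides `z`. -/
lemma card_isNeighbour_le (φ : Finset (Plane × 𝕄)) (z : Plane × 𝕄) :
    (φ.filter fun w => w ≠ z ∧ IsNeighbour k φ z w).card ≤ k := by
  rcases (φ.filter fun w => w ≠ z ∧ IsNeighbour k φ z w).eq_empty_or_nonempty with h | h
  · simp [h]
  obtain ⟨w, hw, hmax⟩ := Finset.exists_max_image _ (fun w => dist z.1 w.1) h
  refine (Finset.card_le_card fun u hu => ?_).trans (Finset.mem_filter.1 hw).2.2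
  have hu' := Finset.mem_filter.1 hu
  exact Finset.mem_filter.2 ⟨hu'.1, hu'.2.1, hmax u hu⟩

/-- A point is among the `k` nearest neighbours of a bounded number of points. -/
lemma exists_card_isNeighbour_le (𝕄 : Type) (k : ℕ) : ∃ N : ℕ,
    ∀ (φ : Finset (Plane × 𝕄)) (z : Plane × 𝕄), (φ.filter fun x => IsNeighbour k φ x z).card ≤ N := by
  -- Sort the points by their direction from `z` into finitely many cones. In a cone the point `x`
  -- farthest from `z` is at least as close to each other point of the cone as to `z`; if `z` is a
  -- neighbour of `x`, there are at most `k` of them.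
  obtain ⟨T, f, hfT, hf⟩ := exists_cells 1 one_pos
  refine ⟨(k + 1) * T.card, fun φ z => ?_⟩
  let e : Plane × 𝕄 → Plane := fun x => ‖x.1 - z.1‖⁻¹ • (x.1 - z.1)
  have he : ∀ x, ‖e x‖ ≤ 1 := fun x => by
    rw [norm_smul, norm_inv, norm_norm]
    exact inv_mul_le_one
  have hx : ∀ x, x.1 - z.1 = ‖x.1 - z.1‖ • e x := fun x => by
    rcases eq_or_ne (x.1 - z.1) 0 with h | h
    · simp [h]
    · rw [smul_smul, mul_inv_cancel₀ (norm_ne_zero_iff.2 h), one_smul]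
  refine Finset.card_le_mul_card_image_of_maps_to (f := fun x => f (e x))
    (fun x _ => hfT _ (he x)) (k + 1) fun b _ => ?_
  set S := (φ.filter fun x => IsNeighbour k φ x z).filter fun x => f (e x) = b with hS
  rcases S.eq_empty_or_nonempty with h | h
  · simp [h]
  obtain ⟨x, hxS, hmax⟩ := Finset.exists_max_image S (fun x => ‖x.1 - z.1‖) h
  have hxS' := Finset.mem_filter.1 hxS
  have hsub : S.erase x ⊆ φ.filter fun u => u ≠ x ∧ dist x.1 u.1 ≤ dist x.1 z.1 := by
    intro u hu
    obtain ⟨hux, hu⟩ := Finset.mem_erase.1 hu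
    have hu' := Finset.mem_filter.1 hu
    refine Finset.mem_filter.2 ⟨(Finset.mem_filter.1 hu'.1).1, hux, ?_⟩
    have h1 := hf _ _ (he x) (he u) (hxS'.2.trans hu'.2.symm)
    -- A radial part and a change of direction: since the unit vectors are at distance less than
    -- `1`, the norms add up to at most `‖x.1 - z.1‖`.
    have h2 : x.1 - u.1 = (‖x.1 - z.1‖ - ‖u.1 - z.1‖) • e x + ‖u.1 - z.1‖ • (e x - e u) := by
      rw [sub_smul, smul_sub, ← hx x, ← hx u]
      abel
    rw [dist_eq_norm, dist_eq_norm, h2]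
    have h3 := hmax u hu
    refine (norm_add_le _ _).trans ?_
    rw [norm_smul _ (e x), norm_smul _ (e x - e u), Real.norm_of_nonneg (sub_nonneg.2 h3), norm_norm,
      ← dist_eq_norm (e x)]
    have h4 := mul_le_mul_of_nonneg_left (he x) (sub_nonneg.2 h3)
    have h5 := mul_le_mul_of_nonneg_left h1.le (norm_nonneg (u.1 - z.1))
    linarith
  have h1 := (Finset.card_le_card hsub).trans (Finset.mem_filter.1 hxS'.1).2
  rw [Finset.card_erase_of_mem hxS] at h1
  omega

/-- One of the two points is among the `k` nearest neighbours of the other. -/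
def knnAdj (k : ℕ) (φ : Finset (Plane × 𝕄)) (z w : Plane × 𝕄) : Prop :=
  IsNeighbour k φ z w ∨ IsNeighbour k φ w z

lemma knnAdj_comm {φ : Finset (Plane × 𝕄)} (z w : Plane × 𝕄) (h : knnAdj k φ z w) :
    knnAdj k φ w z := h.symm

lemma knnAdj.anti {φ φ' : Finset (Plane × 𝕄)} (hφ : φ ⊆ φ') {z w : Plane × 𝕄}
    (h : knnAdj k φ' z w) : knnAdj k φ z w :=
  h.imp (fun h => h.anti hφ) fun h => h.anti hφ

lemma knnAdj_congr {φ φ' : Finset (Plane × 𝕄)} {z w : Plane × 𝕄}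
    (h : ∀ u : Plane × 𝕄, dist z.1 u.1 ≤ 2 * dist z.1 w.1 → (u ∈ φ ↔ u ∈ φ')) :
    knnAdj k φ z w ↔ knnAdj k φ' z w := by
  refine or_congr (isNeighbour_congr fun u hu => h u ?_) (isNeighbour_congr fun u hu => h u ?_)
  · linarith [dist_nonneg (x := z.1) (y := w.1)]
  · linarith [dist_triangle z.1 w.1 u.1, dist_comm z.1 w.1]

end Neighbours

namespace BandData

variable {𝕄 Q : Type} [Fintype 𝕄] [Fintype Q] (d : BandData 𝕄 Q)

lemma isEdge_knnAdj_pair {k : ℕ} {φ : Finset (Plane × 𝕄)} {q : Q} {z w : Plane × 𝕄} :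
    d.IsEdge (knnAdj k φ) q {z, w} ↔ d.link q z w ∧ knnAdj k φ z w :=
  d.isEdge_pair knnAdj_comm

lemma stat_inr (E : Finset (Plane × 𝕄) → Plane × 𝕄 → Plane × 𝕄 → Prop) (φ : Finset (Plane × 𝕄))
    (q : Q) : d.stat E φ (Sum.inr q)
      = ∑ s ∈ φ.powersetCard 2, if d.IsEdge (E φ) q s then (1 : ℝ) else 0 :=
  Finset.natCast_card_filter _ _

variable [MeasurableSpace 𝕄] (ν : Measure 𝕄) (k : ℕ)

lemma knnModel_stat : (d.knnModel ν k).stat = d.stat (knnAdj k) := rfl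

lemma knnModel_incr_inl {φ : Finset (Plane × 𝕄)} {z : Plane × 𝕄} (hz : z ∉ φ) (m : 𝕄) :
    (d.knnModel ν k).incr φ z (Sum.inl m) = if z.2 = m then 1 else 0 :=
  d.stat_insert_inl (knnAdj k) hz m

/-- The pair `s` is no longer an edge when the point `z` is added. -/
def Lost (φ : Finset (Plane × 𝕄)) (z : Plane × 𝕄) (q : Q) (s : Finset (Plane × 𝕄)) : Prop :=
  d.IsEdge (knnAdj k φ) q s ∧ ¬d.IsEdge (knnAdj k (insert z φ)) q s

/-- A new point can only expel neighbours, so every new edge ends at `z` and the other changes are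
losses. -/
lemma knnModel_incr_inr {φ : Finset (Plane × 𝕄)} {z : Plane × 𝕄} (hz : z ∉ φ) (q : Q) :
    (d.knnModel ν k).incr φ z (Sum.inr q)
      = (∑ w ∈ φ, if d.link q z w ∧ knnAdj k (insert z φ) z w then (1 : ℝ) else 0)
        - ∑ s ∈ φ.powersetCard 2, if d.Lost k φ z q s then (1 : ℝ) else 0 := by
  rw [Model.incr, knnModel_stat, stat_inr, stat_inr, sum_powersetCard_two_insert _ hz,
    add_sub_right_comm, ← Finset.sum_sub_distrib, add_comm, sub_eq_add_neg, ← Finset.sum_neg_distrib]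
  congr 1
  · exact Finset.sum_congr rfl fun w _ => if_congr d.isEdge_knnAdj_pair rfl rfl
  · refine Finset.sum_congr rfl fun s hs => ?_
    obtain ⟨x, y, -, rfl⟩ := Finset.card_eq_two.1 (Finset.mem_powersetCard.1 hs).2
    have h : d.IsEdge (knnAdj k (insert z φ)) q {x, y} → d.IsEdge (knnAdj k φ) q {x, y} := by
      rw [isEdge_knnAdj_pair, isEdge_knnAdj_pair]
      exact And.imp_right fun h => h.anti (Finset.subset_insert z φ)
    rw [Lost]
    by_cases h1 : d.IsEdge (knnAdj k φ) q {x, y} <;>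
      by_cases h2 : d.IsEdge (knnAdj k (insert z φ)) q {x, y} <;> simp_all

variable {k}

lemma Lost.exists {φ : Finset (Plane × 𝕄)} {z : Plane × 𝕄} {q : Q} {s : Finset (Plane × 𝕄)}
    (h : d.Lost k φ z q s) : ∃ x y, s = {x, y} ∧ d.link q x y ∧ IsNeighbour k φ x y ∧
      dist x.1 z.1 ≤ dist x.1 y.1 := by
  obtain ⟨⟨x, y, rfl, hl, he⟩, h'⟩ := h
  rw [isEdge_knnAdj_pair] at h'
  have h1 : ¬IsNeighbour k (insert z φ) x y := fun h => h' ⟨hl, Or.inl h⟩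
  have h2 : ¬IsNeighbour k (insert z φ) y x := fun h => h' ⟨hl, Or.inr h⟩
  rcases he with h | h
  · exact ⟨x, y, rfl, hl, h, h.dist_le_of_insert h1⟩
  · exact ⟨y, x, Finset.pair_comm _ _, d.link_comm.1 hl, h, h.dist_le_of_insert h2⟩

-- A new edge joins `z` to one of its `k` neighbours or to a point having `z` as a neighbour. A lost
-- edge starts from a point having `z` as a neighbour and ends at one of the `k` neighbours of that
-- point. All these numbers are bounded.
variable (k) in
lemma exists_abs_knnModel_incr_inr_le : ∃ N : ℕ, ∀ (φ : Finset (Plane × 𝕄)) (z : Plane × 𝕄) (q : Q),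
    |(d.knnModel ν k).incr φ z (Sum.inr q)| ≤ N := by
  obtain ⟨N, hN⟩ := exists_card_isNeighbour_le 𝕄 k
  refine ⟨(k + N) + N * k, fun φ z q => ?_⟩
  by_cases hz : z ∈ φ
  · rw [Model.incr_of_mem _ hz, Pi.zero_apply, abs_zero]
    exact Nat.cast_nonneg _
  rw [knnModel_incr_inr d ν k hz, ← Finset.natCast_card_filter, ← Finset.natCast_card_filter]
  refine (abs_sub _ _).trans ?_
  rw [Nat.abs_cast, Nat.abs_cast, Nat.cast_add]
  have h1 : (φ.filter fun w => d.link q z w ∧ knnAdj k (insert z φ) z w).card ≤ k + N := by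
    refine (Finset.card_le_card (t := ((insert z φ).filter fun w => w ≠ z ∧
      IsNeighbour k (insert z φ) z w) ∪ φ.filter fun x => IsNeighbour k φ x z) fun w hw => ?_).trans
      ((Finset.card_union_le _ _).trans (add_le_add (card_isNeighbour_le _ _) (hN φ z)))
    obtain ⟨hw, -, h | h⟩ := Finset.mem_filter.1 hw
    · exact Finset.mem_union_left _ (Finset.mem_filter.2 ⟨Finset.mem_insert_of_mem hw,
        fun e => hz (e ▸ hw), h⟩)
    · exact Finset.mem_union_right _ (Finset.mem_filter.2 ⟨hw, h.anti (Finset.subset_insert z φ)⟩)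
  have h2 : ((φ.powersetCard 2).filter fun s => d.Lost k φ z q s).card ≤ N * k := by
    refine (Finset.card_le_card (t := (φ.filter fun x => IsNeighbour k φ x z).biUnion fun x =>
      (φ.filter fun y => y ≠ x ∧ IsNeighbour k φ x y).image fun y => {x, y}) fun s hs => ?_).trans
      (Finset.card_biUnion_le.trans ?_)
    · obtain ⟨hs, hlost⟩ := Finset.mem_filter.1 hs
      obtain ⟨x, y, rfl, -, h, hd⟩ := Lost.exists d hlost
      obtain ⟨hsub, hcard⟩ := Finset.mem_powersetCard.1 hs
      have hne : y ≠ x := by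
        rintro rfl
        simp at hcard
      exact Finset.mem_biUnion.2 ⟨x, Finset.mem_filter.2 ⟨hsub (by simp), h.of_dist_le hd⟩,
        Finset.mem_image.2 ⟨y, Finset.mem_filter.2 ⟨hsub (by simp), hne, h⟩, rfl⟩⟩
    · refine (Finset.sum_le_card_nsmul _ _ k fun x _ =>
        Finset.card_image_le.trans (card_isNeighbour_le φ x)).trans ?_
      rw [smul_eq_mul]
      exact Nat.mul_le_mul_right _ (hN φ z)
  exact add_le_add (by exact_mod_cast h1) (by exact_mod_cast h2)

-- The range is `3 * D`: a lost edge has length at most `D` and an endpoint `x` within `D` of `z`,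
-- and adjacency of its endpoints is decided within `2 * D` of `x`.
variable (k) in
lemma knnModel_incr_congr {D : ℝ} (hhi : ∀ q, d.hi q ≤ D) {φ φ' : Finset (Plane × 𝕄)}
    {z : Plane × 𝕄} (h : ∀ w : Plane × 𝕄, dist z.1 w.1 ≤ 3 * D → (w ∈ φ ↔ w ∈ φ')) (hD : 0 ≤ D) :
    (d.knnModel ν k).incr φ z = (d.knnModel ν k).incr φ' z := by
  have hz := h z (by simpa using hD)
  by_cases hzφ : z ∈ φ
  · rw [Model.incr_of_mem _ hzφ, Model.incr_of_mem _ (hz.1 hzφ)]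
  have hzφ' := mt hz.2 hzφ
  have hins : ∀ w : Plane × 𝕄, dist z.1 w.1 ≤ 3 * D → (w ∈ insert z φ ↔ w ∈ insert z φ') :=
    fun w hw => by rw [Finset.mem_insert, Finset.mem_insert, h w hw]
  funext j
  rcases j with m | q
  · rw [knnModel_incr_inl d ν k hzφ, knnModel_incr_inl d ν k hzφ']
  rw [knnModel_incr_inr d ν k hzφ, knnModel_incr_inr d ν k hzφ']
  simp only [← Finset.sum_filter]
  have hlost : ∀ {φ φ' : Finset (Plane × 𝕄)}, (∀ w : Plane × 𝕄, dist z.1 w.1 ≤ 3 * D →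
      (w ∈ φ ↔ w ∈ φ')) → ∀ s ∈ φ.powersetCard 2, d.Lost k φ z q s →
        s ∈ φ'.powersetCard 2 ∧ d.Lost k φ' z q s := by
    intro φ φ' h s hs hlost
    obtain ⟨x, y, rfl, hl, -, hd⟩ := Lost.exists d hlost
    obtain ⟨hsub, hcard⟩ := Finset.mem_powersetCard.1 hs
    have hxy : dist x.1 y.1 ≤ D := hl.2.2.trans (hhi q)
    rw [dist_comm x.1 z.1] at hd
    have hx : x ∈ φ' := (h x (by linarith)).1 (hsub (by simp))
    have hy : y ∈ φ' := (h y (by linarith [dist_triangle z.1 x.1 y.1])).1 (hsub (by simp))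
    refine ⟨Finset.mem_powersetCard.2 ⟨?_, hcard⟩, ?_⟩
    · simp [Finset.insert_subset_iff, hx, hy]
    · have key : ∀ u : Plane × 𝕄, dist x.1 u.1 ≤ 2 * dist x.1 y.1 → dist z.1 u.1 ≤ 3 * D :=
        fun u hu => by linarith [dist_triangle z.1 x.1 u.1]
      rw [Lost, isEdge_knnAdj_pair, isEdge_knnAdj_pair] at hlost ⊢
      rwa [← knnAdj_congr fun u hu => h u (key u hu),
        ← knnAdj_congr (φ := insert z φ) (φ' := insert z φ') fun u hu => by
          rw [Finset.mem_insert, Finset.mem_insert, h u (key u hu)]]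
  congr 2
  · ext w
    simp only [Finset.mem_filter]
    have hl : d.link q z w → dist z.1 w.1 ≤ D := fun hl => hl.2.2.trans (hhi q)
    constructor
    · rintro ⟨h1, h2, h3⟩
      have := hl h2
      exact ⟨(h w (by linarith)).1 h1, h2, (knnAdj_congr fun u hu => hins u (by linarith)).1 h3⟩
    · rintro ⟨h1, h2, h3⟩
      have := hl h2
      exact ⟨(h w (by linarith)).2 h1, h2, (knnAdj_congr fun u hu => hins u (by linarith)).2 h3⟩
  · ext s
    simp only [Finset.mem_filter]
    exact ⟨fun hs => hlost h s hs.1 hs.2, fun hs => hlost (fun w hw => (h w hw).symm) s hs.1 hs.2⟩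

lemma knnAdj_translate (k : ℕ) (x : Plane) (φ : Finset (Plane × 𝕄)) (z w : Plane × 𝕄) :
    knnAdj k (φ.image fun z => (z.1 + x, z.2)) (z.1 + x, z.2) (w.1 + x, w.2) ↔ knnAdj k φ z w := by
  have hinj : Function.Injective fun z : Plane × 𝕄 => (z.1 + x, z.2) := fun z w h => by
    simp only [Prod.mk.injEq, add_left_inj] at h
    exact Prod.ext h.1 h.2
  have key : ∀ z w : Plane × 𝕄, IsNeighbour k (φ.image fun z => (z.1 + x, z.2)) (z.1 + x, z.2)
      (w.1 + x, w.2) ↔ IsNeighbour k φ z w := by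
    intro z w
    rw [IsNeighbour, IsNeighbour, Finset.filter_image, Finset.card_image_of_injective _ hinj]
    simp only [dist_add_right, ne_eq, add_left_inj, Prod.ext_iff]
  exact or_congr (key z w) (key w z)

lemma knnModel_translationInvariant : (d.knnModel ν k).TranslationInvariant :=
  ⟨fun x φ => d.stat_translate (knnAdj k) x φ (knnAdj_translate k x φ), fun _ _ => Iff.rfl⟩

end BandData

end MarkedGibbs

/-! ### Local constancy of the nearest-neighbour statistics -/

namespace MarkedGibbs

open scoped Classical

section LocallyConstant

variable {𝕄 α κ : Type} [TopologicalSpace 𝕄] {c : κ → 𝕄 → 𝕄 → ℝ} {A : Finset α}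
  {x : α → Plane × 𝕄} (hx : InjOn x A) (hg : IsGeneric c (x '' A))

include hx hg

lemma eventually_injOn_fst : ∀ᶠ y in 𝓝 x, InjOn (fun i => (y i).1) A := by
  have h : ∀ᶠ y in 𝓝 x, ∀ i ∈ A, ∀ j ∈ A, i ≠ j → (y i).1 ≠ (y j).1 := by
    refine (Finset.eventually_all A).2 fun i hi => (Finset.eventually_all A).2 fun j hj => ?_
    by_cases hij : i = j
    · exact Eventually.of_forall fun y h => absurd hij h
    · have hne := hg.fst_ne _ (mem_image_of_mem x hi) _ (mem_image_of_mem x hj) (hx.ne hi hj hij)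
      have hc : IsOpen {y : α → Plane × 𝕄 | (y i).1 ≠ (y j).1} :=
        isOpen_ne_fun (continuous_apply i).fst (continuous_apply j).fst
      filter_upwards [hc.mem_nhds hne] with y hy _ using hy
  filter_upwards [h] with y hy i hi j hj e
  by_contra hij
  exact hy i hi j hj hij e

lemma eventually_dist_le_iff : ∀ᶠ y in 𝓝 x, ∀ i ∈ A, ∀ j ∈ A, ∀ l ∈ A, i ≠ j → i ≠ l → j ≠ l →
    (dist (y i).1 (y j).1 ≤ dist (y i).1 (y l).1 ↔ dist (x i).1 (x j).1 ≤ dist (x i).1 (x l).1) ∧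
      dist (y i).1 (y j).1 ≠ dist (y i).1 (y l).1 := by
  refine (Finset.eventually_all A).2 fun i hi => (Finset.eventually_all A).2 fun j hj =>
    (Finset.eventually_all A).2 fun l hl => ?_
  by_cases h : i ≠ j ∧ i ≠ l ∧ j ≠ l
  · have hne := hg.no_tie _ (mem_image_of_mem x hi) _ (mem_image_of_mem x hj) _
      (mem_image_of_mem x hl) (hx.ne hi hj h.1) (hx.ne hi hl h.2.1) (hx.ne hj hl h.2.2)
    have hc : Continuous fun y : α → Plane × 𝕄 =>
        dist (y i).1 (y j).1 - dist (y i).1 (y l).1 :=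
      ((continuous_apply i).fst.dist (continuous_apply j).fst).sub
        ((continuous_apply i).fst.dist (continuous_apply l).fst)
    filter_upwards [eventually_le_iff hc.continuousAt (sub_ne_zero.2 hne)] with y hy _ _ _
    simp only [sub_nonpos, sub_nonneg] at hy
    refine ⟨hy.1, fun e => hne (le_antisymm (hy.1.1 e.le) (hy.2.1 e.ge))⟩
  · exact Eventually.of_forall fun y h1 h2 h3 => absurd ⟨h1, h2, h3⟩ h

omit hx hg in
lemma isNeighbour_image {k : ℕ} (hx : InjOn x A) {i : α} (hi : i ∈ A) (j : α) :
    IsNeighbour k (A.image x) (x i) (x j) ↔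
      (A.filter fun l => l ≠ i ∧ dist (x i).1 (x l).1 ≤ dist (x i).1 (x j).1).card ≤ k := by
  have : ((A.image x).filter fun u => u ≠ x i ∧ dist (x i).1 u.1 ≤ dist (x i).1 (x j).1)
      = (A.filter fun l => l ≠ i ∧ dist (x i).1 (x l).1 ≤ dist (x i).1 (x j).1).image x := by
    ext u
    simp only [Finset.mem_filter, Finset.mem_image]
    constructor
    · rintro ⟨⟨l, hl, rfl⟩, h1, h2⟩
      exact ⟨l, ⟨hl, fun e => h1 (by rw [e]), h2⟩, rfl⟩
    · rintro ⟨l, ⟨hl, h1, h2⟩, rfl⟩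
      exact ⟨⟨l, hl, rfl⟩, hx.ne hl hi h1, h2⟩
  rw [IsNeighbour, this, Finset.card_image_of_injOn (hx.mono (Finset.coe_subset.2
    (Finset.filter_subset _ _)))]

/-- Without ties, the comparisons of distances which define the graph are strict and survive small
moves. -/
lemma eventually_knnAdj_iff (k : ℕ) : ∀ᶠ y in 𝓝 x, ∀ i ∈ A, ∀ j ∈ A, i ≠ j →
    (knnAdj k (A.image y) (y i) (y j) ↔ knnAdj k (A.image x) (x i) (x j)) := by
  filter_upwards [eventually_injOn_fst hx hg, eventually_dist_le_iff hx hg] with y h1 h2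
  have hy : InjOn y A := fun i hi j hj e => h1 hi hj (congrArg Prod.fst e)
  have key : ∀ i ∈ A, ∀ j ∈ A, i ≠ j →
      (IsNeighbour k (A.image y) (y i) (y j) ↔ IsNeighbour k (A.image x) (x i) (x j)) := by
    intro i hi j hj hij
    rw [isNeighbour_image hy hi, isNeighbour_image hx hi]
    have : (A.filter fun l => l ≠ i ∧ dist (y i).1 (y l).1 ≤ dist (y i).1 (y j).1)
        = A.filter fun l => l ≠ i ∧ dist (x i).1 (x l).1 ≤ dist (x i).1 (x j).1 := by
      refine Finset.filter_congr fun l hl => and_congr_right fun hli => ?_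
      by_cases hlj : l = j
      · rw [hlj]
        simp only [le_refl]
      · exact (h2 i hi l hl j hj (Ne.symm hli) hij hlj).1
    rw [this]
  exact fun i hi j hj hij => or_congr (key i hi j hj hij) (key j hj i hi hij.symm)

end LocallyConstant

namespace BandData

variable {𝕄 Q : Type} [Fintype 𝕄] [Fintype Q] (d : BandData 𝕄 Q)

/-- The distances which are not critical. -/
def Regular (r : ℝ) : Prop := ∀ k m m', d.crit k m m' ≠ r

lemma isOpen_regular : IsOpen {r | d.Regular r} := by
  have : {r | d.Regular r} = ⋂ k, ⋂ m, ⋂ m', {r | r ≠ d.crit k m m'} := by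
    ext r
    simp only [Regular, mem_ofPred_eq, mem_iInter, ne_comm]
  rw [this]
  exact isOpen_iInter_of_finite fun k => isOpen_iInter_of_finite fun m =>
    isOpen_iInter_of_finite fun m' => isOpen_ne

variable [TopologicalSpace 𝕄] [DiscreteTopology 𝕄] {α κ : Type} {c : κ → 𝕄 → 𝕄 → ℝ}
  {A : Finset α} {x : α → Plane × 𝕄} (hx : InjOn x A) (hg : IsGeneric c (x '' A)) (k : ℕ)

lemma stat_image_inl (E : Finset (Plane × 𝕄) → Plane × 𝕄 → Plane × 𝕄 → Prop) (hx : InjOn x A)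
    (m : 𝕄) : d.stat E (A.image x) (Sum.inl m) = ∑ i ∈ A, if (x i).2 = m then (1 : ℝ) else 0 := by
  simp only [stat, Finset.natCast_card_filter]
  rw [Finset.sum_image hx]

lemma stat_image_inr (E : Finset (Plane × 𝕄) → Plane × 𝕄 → Plane × 𝕄 → Prop) (hx : InjOn x A)
    (q : Q) : d.stat E (A.image x) (Sum.inr q)
      = ∑ t ∈ A.powersetCard 2, if d.IsEdge (E (A.image x)) q (t.image x) then (1 : ℝ) else 0 := by
  rw [stat_inr, sum_powersetCard_image _ hx]

include hx hg

/-- Adjacency is locally constant and links can change only at critical distances, which is harmless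
for a pair that is not adjacent. -/
lemma eventually_isEdge_iff : ∀ᶠ y in 𝓝 x, InjOn y A ∧ (∀ i ∈ A, (y i).2 = (x i).2) ∧
    ∀ i ∈ A, ∀ j ∈ A, i ≠ j →
      d.Regular (dist (x i).1 (x j).1) ∨ ¬knnAdj k (A.image x) (x i) (x j) →
        ∀ q, (d.IsEdge (knnAdj k (A.image y)) q {y i, y j} ↔
          d.IsEdge (knnAdj k (A.image x)) q {x i, x j}) := by
  have hm : ∀ᶠ y in 𝓝 x, ∀ i ∈ A, (y i).2 = (x i).2 := (Finset.eventually_all A).2 fun i _ =>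
    (ContinuousAt.eventually_mem (f := fun y : α → Plane × 𝕄 => (y i).2)
      (continuous_apply i).snd.continuousAt ((isOpen_discrete {(x i).2}).mem_nhds rfl))
  have hl : ∀ᶠ y in 𝓝 x, ∀ i ∈ A, ∀ j ∈ A, d.Regular (dist (x i).1 (x j).1) →
      ∀ q, (d.link q (y i) (y j) ↔ d.link q (x i) (x j)) := by
    refine (Finset.eventually_all A).2 fun i _ => (Finset.eventually_all A).2 fun j _ => ?_
    by_cases hr : d.Regular (dist (x i).1 (x j).1)
    · have h : Tendsto (fun y : α → Plane × 𝕄 => (y i, y j)) (𝓝 x) (𝓝 (x i, x j)) :=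
        ((continuous_apply i).prodMk (continuous_apply j)).continuousAt
      have := eventually_all.2 fun q => h.eventually (d.eventually_link_iff (q := q)
        (hr (Sum.inl q) (x i).2 (x i).2).symm (hr (Sum.inr (Sum.inl q)) (x i).2 (x i).2).symm)
      filter_upwards [this] with y hy _ using hy
    · exact Eventually.of_forall fun y h => absurd h hr
  filter_upwards [hm, hl, eventually_injOn_fst hx hg, eventually_knnAdj_iff hx hg k]
    with y h1 h2 h3 h4
  refine ⟨fun i hi j hj e => h3 hi hj (congrArg Prod.fst e), h1, fun i hi j hj hij h q => ?_⟩
  rw [isEdge_knnAdj_pair, isEdge_knnAdj_pair, h4 i hi j hj hij]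
  rcases h with h | h
  · rw [h2 i hi j hj h q]
  · simp only [h, and_false]

/-- The statistics are locally constant at a configuration without ties in which the points at
critical distances are not neighbours. -/
lemma eventually_stat_eq (hc : ∀ i ∈ A, ∀ j ∈ A, i ≠ j →
      d.Regular (dist (x i).1 (x j).1) ∨ ¬knnAdj k (A.image x) (x i) (x j)) :
    ∀ᶠ y in 𝓝 x, InjOn y A ∧ d.stat (knnAdj k) (A.image y) = d.stat (knnAdj k) (A.image x) := by
  filter_upwards [d.eventually_isEdge_iff hx hg k] with y hy
  refine ⟨hy.1, ?_⟩
  funext j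
  rcases j with m | q
  · rw [stat_image_inl d _ hy.1, stat_image_inl d _ hx]
    exact Finset.sum_congr rfl fun i hi => by rw [hy.2.1 i hi]
  · rw [stat_image_inr d _ hy.1, stat_image_inr d _ hx]
    refine Finset.sum_congr rfl fun t ht => if_congr ?_ rfl rfl
    obtain ⟨i, j, hij, rfl⟩ := Finset.card_eq_two.1 (Finset.mem_powersetCard.1 ht).2
    have hsub := (Finset.mem_powersetCard.1 ht).1
    have hi : i ∈ A := hsub (by simp)
    have hj : j ∈ A := hsub (by simp)
    simp only [Finset.image_insert, Finset.image_singleton]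
    exact hy.2.2 i hi j hj hij (hc i hi j hj hij) q

/-- The variation of the statistics when the distance between two neighbours crosses a critical
value. -/
lemma eventually_stat_sub {i₀ j₀ : α} (hi₀ : i₀ ∈ A) (hj₀ : j₀ ∈ A) (hne : i₀ ≠ j₀)
    (hadj : knnAdj k (A.image x) (x i₀) (x j₀))
    (hc : ∀ i ∈ A, ∀ j ∈ A, i ≠ j → s(i, j) ≠ s(i₀, j₀) → d.Regular (dist (x i).1 (x j).1)) :
    ∀ᶠ y in 𝓝 x, ∀ v : 𝕄 ⊕ Q → ℝ, ∑ j, v j * d.stat (knnAdj k) (A.image y) j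
      - ∑ q, v (Sum.inr q) * (if d.link q (y i₀) (y j₀) then (1 : ℝ) else 0)
      = ∑ j, v j * d.stat (knnAdj k) (A.image x) j
      - ∑ q, v (Sum.inr q) * (if d.link q (x i₀) (x j₀) then (1 : ℝ) else 0) := by
  filter_upwards [d.eventually_isEdge_iff hx hg k, eventually_knnAdj_iff hx hg k] with y hy hy'
  intro v
  have h0 : {i₀, j₀} ∈ A.powersetCard 2 := Finset.mem_powersetCard.2
    ⟨by simp [Finset.insert_subset_iff, hi₀, hj₀], Finset.card_pair hne⟩
  have e1 : ∀ m, d.stat (knnAdj k) (A.image y) (Sum.inl m)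
      = d.stat (knnAdj k) (A.image x) (Sum.inl m) := fun m => by
    rw [stat_image_inl d _ hy.1, stat_image_inl d _ hx]
    exact Finset.sum_congr rfl fun i hi => by rw [hy.2.1 i hi]
  have e2 : ∀ q, d.stat (knnAdj k) (A.image y) (Sum.inr q)
      - (if d.link q (y i₀) (y j₀) then (1 : ℝ) else 0)
      = d.stat (knnAdj k) (A.image x) (Sum.inr q)
      - (if d.link q (x i₀) (x j₀) then (1 : ℝ) else 0) := fun q => by
    rw [stat_image_inr d _ hy.1, stat_image_inr d _ hx]
    have hl : ∀ z : α → Plane × 𝕄, knnAdj k (A.image z) (z i₀) (z j₀) →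
        (if d.link q (z i₀) (z j₀) then (1 : ℝ) else 0)
          = if d.IsEdge (knnAdj k (A.image z)) q (({i₀, j₀} : Finset α).image z) then 1 else 0 := by
      intro z hz
      refine if_congr ?_ rfl rfl
      rw [Finset.image_insert, Finset.image_singleton, isEdge_knnAdj_pair, and_iff_left hz]
    rw [hl x hadj, hl y ((hy' i₀ hi₀ j₀ hj₀ hne).2 hadj), ← Finset.sum_erase_eq_sub h0,
      ← Finset.sum_erase_eq_sub h0]
    refine Finset.sum_congr rfl fun t ht => if_congr ?_ rfl rfl
    obtain ⟨ht0, ht⟩ := Finset.mem_erase.1 ht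
    obtain ⟨i, j, hij, rfl⟩ := Finset.card_eq_two.1 (Finset.mem_powersetCard.1 ht).2
    have hsub := (Finset.mem_powersetCard.1 ht).1
    have hi : i ∈ A := hsub (by simp)
    have hj : j ∈ A := hsub (by simp)
    simp only [Finset.image_insert, Finset.image_singleton]
    refine hy.2.2 i hi j hj hij (Or.inl (hc i hi j hj hij fun e => ht0 ?_)) q
    rcases Sym2.eq_iff.1 e with ⟨rfl, rfl⟩ | ⟨rfl, rfl⟩
    · rfl
    · exact Finset.pair_comm _ _
  rw [Fintype.sum_sum_type, Fintype.sum_sum_type, add_sub_assoc, add_sub_assoc,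
    ← Finset.sum_sub_distrib, ← Finset.sum_sub_distrib]
  simp only [e1, ← mul_sub, e2]

omit hx hg

variable [MeasurableSpace 𝕄] [BorelSpace 𝕄] (ν : Measure 𝕄)

/-- Increments are bounded uniformly in the configuration, so every compact set of real parameters
is stable. -/
lemma knnModel_isTame {Θ : Set (𝕄 ⊕ Q → ℝ)} (hΘ : IsCompact Θ)
    {D : ℝ} (hD : 0 < D) (hhi : ∀ q, d.hi q ≤ D) : (d.knnModel ν k).IsTame d.crit Θ (3 * D) := by
  obtain ⟨N, hN⟩ := d.exists_abs_knnModel_incr_inr_le ν k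
  have hb : ∀ φ z j, |(d.knnModel ν k).incr φ z j| ≤ N + 1 := by
    intro φ z j
    rcases j with m | q
    · refine (Model.abs_incr_inl_le (X := d.knnModel ν k) (fun _ _ => rfl) φ z m).trans ?_
      linarith [Nat.cast_nonneg (α := ℝ) N]
    · exact (hN φ z q).trans (by linarith)
  refine Model.IsTame.of_univ rfl (by positivity) (fun i => ?_)
    (fun j => ⟨N + 1, 0, by positivity, fun φ z => by simpa using hb φ z j⟩)
    (fun φ φ' z h => d.knnModel_incr_congr ν k hhi h hD.le) ?_ fun n x hx => ?_
  · rcases i with q | q | s <;> exact continuous_const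
  · obtain ⟨B, hB0, hB⟩ := exists_abs_le hΘ
    refine ⟨∑ _j : 𝕄 ⊕ Q, B * (N + 1), by positivity, fun θ hθ φ z => ?_⟩
    rw [← Finset.sum_neg_distrib]
    refine Finset.sum_le_sum fun j _ => (abs_le.1 ?_).1
    rw [abs_mul]
    exact mul_le_mul (hB θ hθ j) (hb φ z j) (abs_nonneg _) hB0
  · refine ContinuousAt.continuousWithinAt
      ((continuousAt_const (y := (d.knnModel ν k).stat (Finset.univ.image x))).congr ?_)
    have hcoe : x '' (Finset.univ : Finset (Fin n)) = range x := by simp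
    have hreg : ∀ i j, i ≠ j → d.Regular (dist (x i).1 (x j).1) := by
      intro i j hij l m m'
      have := hx.2.dist_ne _ (mem_range_self i) _ (mem_range_self j) (hx.1.ne hij) l
      rcases l with q | q | s <;> exact this.symm
    filter_upwards [d.eventually_stat_eq (A := Finset.univ) hx.1.injOn
      (by rw [hcoe]; exact hx.2) k fun i _ j _ hij => Or.inl (hreg i j hij)] with y hy
    exact hy.2.symm

end BandData

end MarkedGibbs

/-! ### Configurations with a single critical pair -/

namespace MarkedGibbs

open scoped Classical

namespace BandData

variable {𝕄 Q : Type} [Fintype 𝕄] [Fintype Q] (d : BandData 𝕄 Q)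

/-- The configurations without ties in which only the points `x` and `y` may be at a critical
distance. -/
structure IsGenericExcept (x y : Plane × 𝕄) (ψ : Finset (Plane × 𝕄)) : Prop where
  generic : IsGeneric (fun (_ : Empty) _ _ => (0 : ℝ)) (ψ : Set (Plane × 𝕄))
  regular : ∀ z ∈ ψ, ∀ w ∈ ψ, z ≠ w → s(z, w) ≠ s(x, y) → d.Regular (dist z.1 w.1)

variable {d}

lemma IsGenericExcept.mono {x y : Plane × 𝕄} {ψ ψ' : Finset (Plane × 𝕄)}
    (h : d.IsGenericExcept x y ψ') (hs : ψ ⊆ ψ') : d.IsGenericExcept x y ψ where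
  generic := h.generic.mono (Finset.coe_subset.2 hs)
  regular z hz w hw := h.regular z (hs hz) w (hs hw)

variable [TopologicalSpace 𝕄] [DiscreteTopology 𝕄] [MeasurableSpace 𝕄] [BorelSpace 𝕄]
  (ν : Measure 𝕄) [IsProbabilityMeasure ν]

lemma IsGenericExcept.ae_insert {x y : Plane × 𝕄} {ψ : Finset (Plane × 𝕄)}
    (h : d.IsGenericExcept x y ψ) : ∀ᵐ z ∂((volume : Measure Plane).prod ν),
      z ∉ ψ ∧ d.IsGenericExcept x y (insert z ψ) := by
  have h1 : ∀ᵐ z ∂((volume : Measure Plane).prod ν), ∀ w ∈ ψ, d.Regular (dist z.1 w.1) := by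
    refine (ae_ball_iff ψ.countable_toSet).2 fun w _ => ae_all_iff.2 fun k => ae_all_iff.2 fun m =>
      ae_all_iff.2 fun m' => ?_
    filter_upwards [ae_dist_ne ν w.1 (f := fun _ => d.crit k m m') continuous_const] with z hz
    exact hz.symm
  filter_upwards [h1, h.generic.ae_insert (fun k => k.elim) ν] with z h1 h2
  refine ⟨h2.1, by simpa using h2.2, fun a ha b hb hab hs => ?_⟩
  rcases Finset.mem_insert.1 ha with rfl | ha' <;> rcases Finset.mem_insert.1 hb with rfl | hb'
  · exact absurd rfl hab
  · exact h1 b hb'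
  · rw [dist_comm]
    exact h1 a ha'
  · exact h.regular a ha' b hb' hab hs

lemma isGenericExcept_pair {x y : Plane × 𝕄} (h : x.1 ≠ y.1) : d.IsGenericExcept x y {x, y} where
  generic := by
    simpa using isGeneric_pair (c := fun (_ : Empty) _ _ => (0 : ℝ)) h fun k => k.elim
  regular z hz w hw hzw hs := by
    simp only [Finset.mem_insert, Finset.mem_singleton] at hz hw
    rcases hz with rfl | rfl <;> rcases hw with rfl | rfl
    exacts [absurd rfl hzw, absurd rfl hs, absurd Sym2.eq_swap hs, absurd rfl hzw]

/-- There are `k` points closer to two given points than these are to one another, without other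
critical distances. -/
lemma exists_isGenericExcept [ν.IsOpenPosMeasure] {x y : Plane × 𝕄} (h : x.1 ≠ y.1) (k : ℕ) :
    ∃ W : Finset (Plane × 𝕄), W.card = k ∧ x ∉ W ∧ y ∉ W ∧
      (∀ w ∈ W, dist x.1 w.1 < dist x.1 y.1 ∧ dist y.1 w.1 < dist x.1 y.1) ∧
      d.IsGenericExcept x y (insert x (insert y W)) := by
  induction k with
  | zero => exact ⟨∅, rfl, by simp, by simp, by simp, isGenericExcept_pair h⟩
  | succ k ih =>
    obtain ⟨W, hW, hxW, hyW, hd, hg⟩ := ih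
    set U : Set (Plane × 𝕄) :=
      {w | dist x.1 w.1 < dist x.1 y.1 ∧ dist y.1 w.1 < dist x.1 y.1} with hU
    have hUo : IsOpen U := (isOpen_lt (continuous_const.dist continuous_fst) continuous_const).inter
      (isOpen_lt (continuous_const.dist continuous_fst) continuous_const)
    have hUne : U.Nonempty := by
      have h0 := dist_pos.2 h
      refine ⟨(midpoint ℝ x.1 y.1, x.2), ?_, ?_⟩
      · rw [dist_left_midpoint, Real.norm_two]
        linarith
      · rw [dist_right_midpoint, Real.norm_two]
        linarith
    have h1 : ∃ᵐ z ∂((volume : Measure Plane).prod ν), z ∈ U := by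
      rw [frequently_ae_mem_iff]
      exact (hUo.measure_pos _ hUne).ne'
    obtain ⟨z, hz, hzψ, hzg⟩ := (h1.and_eventually (hg.ae_insert ν)).exists
    simp only [Finset.mem_insert, not_or] at hzψ
    refine ⟨insert z W, by rw [Finset.card_insert_of_notMem hzψ.2.2, hW], ?_, ?_, ?_, ?_⟩
    · simp [hxW, Ne.symm hzψ.1]
    · simp [hyW, Ne.symm hzψ.2.1]
    · intro w hw
      rcases Finset.mem_insert.1 hw with rfl | hw
      exacts [hz, hd w hw]
    · rwa [Finset.insert_comm y, Finset.insert_comm x]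

/-- The map which moves the point `y` to `y'`. -/
def move (y y' : Plane × 𝕄) : Plane × 𝕄 → Plane × 𝕄 := Function.update id y y'

lemma tendsto_move (b : 𝕄) (ρ : ℝ) :
    Tendsto (fun t => move (axisPoint ρ b) (axisPoint t b)) (𝓝 ρ) (𝓝 (id : Plane × 𝕄 → _)) := by
  refine tendsto_pi_nhds.2 fun z => ?_
  by_cases hz : z = axisPoint ρ b
  · subst hz
    simp only [move, Function.update_self]
    have : Continuous fun t : ℝ => axisPoint t b :=
      Continuous.prodMk (Isometry.of_dist_eq fun r s => by simp).continuous continuous_const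
    exact this.tendsto ρ
  · simp only [move, Function.update_of_ne hz]
    exact tendsto_const_nhds

variable {ν} {k : ℕ}

/-- The only pair that may be at a critical distance is not adjacent, so moving one of its points
does not affect the counts. -/
lemma IsGenericExcept.eventually_move {a b : 𝕄} {ρ : ℝ} {ψ : Finset (Plane × 𝕄)}
    (h : d.IsGenericExcept (axisPoint 0 a) (axisPoint ρ b) ψ)
    (hadj : ¬knnAdj k ψ (axisPoint 0 a) (axisPoint ρ b)) :
    ∀ᶠ t in 𝓝 ρ, InjOn (move (axisPoint ρ b) (axisPoint t b)) ψ ∧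
      d.stat (knnAdj k) (ψ.image (move (axisPoint ρ b) (axisPoint t b))) = d.stat (knnAdj k) ψ := by
  have := (tendsto_move b ρ).eventually (d.eventually_stat_eq (A := ψ) (injOn_id _)
    (by rw [image_id]; exact h.generic) k fun z hz w hw hzw => ?_)
  · simpa only [Finset.image_id] using this
  · by_cases hs : s(z, w) = s(axisPoint 0 a, axisPoint ρ b)
    · right
      simp only [Finset.image_id, id]
      rcases Sym2.eq_iff.1 hs with ⟨rfl, rfl⟩ | ⟨rfl, rfl⟩
      exacts [hadj, fun h => hadj h.symm]
    · exact Or.inl (h.regular z hz w hw hzw hs)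


/-- The disc about either point reaching the other contains `W` and that other point, which makes
more than `k` points. -/
lemma not_knnAdj_of_closer {x y : Plane × 𝕄} {W φ : Finset (Plane × 𝕄)} (hW : k ≤ W.card)
    (hx : x ∉ W) (hy : y ∉ W) (hxy : x ≠ y)
    (hd : ∀ w ∈ W, dist x.1 w.1 < dist x.1 y.1 ∧ dist y.1 w.1 < dist x.1 y.1)
    (hφ : insert x (insert y W) ⊆ φ) : ¬knnAdj k φ x y := by
  have key : ∀ {x y : Plane × 𝕄}, x ∉ W → y ∉ W → x ≠ y →
      (∀ w ∈ W, dist x.1 w.1 ≤ dist x.1 y.1) → insert y W ⊆ φ → ¬IsNeighbour k φ x y := by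
    intro x y hx hy hxy hd hφ h
    have h1 : insert y W ⊆ φ.filter fun u => u ≠ x ∧ dist x.1 u.1 ≤ dist x.1 y.1 := by
      intro u hu
      refine Finset.mem_filter.2 ⟨hφ hu, ?_⟩
      rcases Finset.mem_insert.1 hu with rfl | hu
      · exact ⟨hxy.symm, le_rfl⟩
      · exact ⟨fun e => hx (e ▸ hu), hd u hu⟩
    have h2 := (Finset.card_le_card h1).trans h
    rw [Finset.card_insert_of_notMem hy] at h2
    omega
  rintro (h | h)
  · exact key hx hy hxy (fun w hw => (hd w hw).1.le) (fun u hu => hφ (Finset.mem_insert_of_mem hu)) h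
  · refine key hy hx hxy.symm (fun w hw => ?_) (fun u hu => hφ ?_) h
    · rw [dist_comm y.1 x.1]
      exact (hd w hw).2.le
    · rw [Finset.insert_comm]
      exact Finset.mem_insert_of_mem hu

instance : IsProbabilityMeasure (d.knnModel ν k).markLaw := inferInstanceAs (IsProbabilityMeasure ν)

lemma knnModel_birth_congr {θ : 𝕄 ⊕ Q → ℝ} {φ φ' : Finset (Plane × 𝕄)} {z : Plane × 𝕄}
    (h : d.stat (knnAdj k) φ = d.stat (knnAdj k) φ')
    (h' : d.stat (knnAdj k) (insert z φ) = d.stat (knnAdj k) (insert z φ')) (j : 𝕄 ⊕ Q) :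
    (d.knnModel ν k).birth θ φ z j = (d.knnModel ν k).birth θ φ' z j := by
  have hi : (d.knnModel ν k).incr φ z = (d.knnModel ν k).incr φ' z := by
    funext j
    rw [Model.incr, Model.incr, knnModel_stat, h, h']
  have hc : ∀ s, s ∈ (d.knnModel ν k).hardCore := mem_univ
  rw [Model.birth, Model.birth, Model.papangelou, Model.papangelou, hi, if_pos (hc _),
    if_pos (hc _)]

/-- Critical values are isolated, so the moved pair becomes regular as soon as `t ≠ ρ`; the absence
of ties and the regularity of the other pairs are open conditions. -/
lemma IsGenericExcept.eventually_isGeneric {a b : 𝕄} {ρ : ℝ} (hρ : 0 < ρ) {ψ : Finset (Plane × 𝕄)}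
    (h : d.IsGenericExcept (axisPoint 0 a) (axisPoint ρ b) ψ) :
    ∀ᶠ t in 𝓝 ρ, t ≠ ρ → IsGeneric d.crit
      (ψ.image (move (axisPoint ρ b) (axisPoint t b)) : Set (Plane × 𝕄)) := by
  have hg : IsGeneric (fun (_ : Empty) (_ _ : 𝕄) => (0 : ℝ)) (id '' (ψ : Set (Plane × 𝕄))) := by
    rw [image_id]
    exact h.generic
  have hreg : ∀ᶠ y in 𝓝 (id : Plane × 𝕄 → Plane × 𝕄), ∀ z ∈ ψ, ∀ w ∈ ψ, z ≠ w →
      s(z, w) ≠ s(axisPoint 0 a, axisPoint ρ b) → d.Regular (dist (y z).1 (y w).1) := by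
    refine (Finset.eventually_all ψ).2 fun z hz => (Finset.eventually_all ψ).2 fun w hw => ?_
    by_cases hzw : z ≠ w ∧ s(z, w) ≠ s(axisPoint 0 a, axisPoint ρ b)
    · have hc : Continuous fun y : Plane × 𝕄 → Plane × 𝕄 => dist (y z).1 (y w).1 :=
        (continuous_apply z).fst.dist (continuous_apply w).fst
      filter_upwards [hc.continuousAt.eventually_mem
        (d.isOpen_regular.mem_nhds (h.regular z hz w hw hzw.1 hzw.2))] with y hy _ _ using hy
    · exact Eventually.of_forall fun y h1 h2 => absurd ⟨h1, h2⟩ hzw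
  obtain ⟨δ, hδ, hiso⟩ := d.exists_isolated (ρ := ρ)
  filter_upwards [(tendsto_move b ρ).eventually (eventually_injOn_fst (injOn_id _) hg),
    (tendsto_move b ρ).eventually (eventually_dist_le_iff (injOn_id _) hg),
    (tendsto_move b ρ).eventually hreg, Metric.ball_mem_nhds ρ hδ, lt_mem_nhds hρ]
    with t h1 h2 h3 h4 h0 ht
  set y := move (axisPoint ρ b) (axisPoint t b) with hy
  have hxy : dist (y (axisPoint 0 a)).1 (y (axisPoint ρ b)).1 = t := by
    rw [hy, move, Function.update_of_ne (axisPoint_ne hρ.ne _ _), Function.update_self, id,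
      dist_axisPoint, zero_sub, abs_neg, abs_of_pos h0]
  have hrt : d.Regular t := hiso t ht (by rwa [Metric.mem_ball, Real.dist_eq] at h4)
  have hreg : ∀ z ∈ ψ, ∀ w ∈ ψ, z ≠ w → d.Regular (dist (y z).1 (y w).1) := by
    intro z hz w hw hzw
    by_cases hs : s(z, w) = s(axisPoint 0 a, axisPoint ρ b)
    · rcases Sym2.eq_iff.1 hs with ⟨rfl, rfl⟩ | ⟨rfl, rfl⟩
      · rwa [hxy]
      · rwa [dist_comm, hxy]
    · exact h3 z hz w hw hzw hs
  rw [Finset.coe_image]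
  refine ⟨?_, ?_, ?_⟩
  · rintro _ ⟨z, hz, rfl⟩ _ ⟨w, hw, rfl⟩ hne e
    exact hne (by rw [h1 hz hw e])
  · rintro _ ⟨z, hz, rfl⟩ _ ⟨w, hw, rfl⟩ hne k e
    exact hreg z hz w hw (fun e => hne (by rw [e])) k _ _ e.symm
  · rintro _ ⟨z, hz, rfl⟩ _ ⟨w, hw, rfl⟩ _ ⟨u, hu, rfl⟩ hzw hzu hwu
    exact (h2 z hz w hw u hu (fun e => hzw (by rw [e])) (fun e => hzu (by rw [e]))
      fun e => hwu (by rw [e])).2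

end BandData

end MarkedGibbs

/-! ### The nearest-neighbour theorem -/

namespace MarkedGibbs

open scoped Classical

namespace BandData

variable {𝕄 Q : Type} [Fintype 𝕄] [Fintype Q] (d : BandData 𝕄 Q)
variable [TopologicalSpace 𝕄] [DiscreteTopology 𝕄] [MeasurableSpace 𝕄] [BorelSpace 𝕄]
  {ν : Measure 𝕄} [IsProbabilityMeasure ν] [ν.IsOpenPosMeasure] {k : ℕ}

instance : (d.knnModel ν k).markLaw.IsOpenPosMeasure := inferInstanceAs ν.IsOpenPosMeasure

/-- The variation of the sum of the deaths when the distance between two points crosses a critical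
value, in a configuration where they are not neighbours, but become so when another point is
removed. -/
lemma knnModel_eventually_sum_death (v : 𝕄 ⊕ Q → ℝ) {a b : 𝕄} {ρ : ℝ} {W : Finset (Plane × 𝕄)}
    (hρ : 0 < ρ) (hW : W.card = k) (hx : axisPoint 0 a ∉ W) (hy : axisPoint ρ b ∉ W)
    (hd : ∀ w ∈ W, dist (axisPoint 0 a).1 w.1 < dist (axisPoint 0 a).1 (axisPoint ρ b).1 ∧
      dist (axisPoint ρ b).1 w.1 < dist (axisPoint 0 a).1 (axisPoint ρ b).1)
    (hg : d.IsGenericExcept (axisPoint 0 a) (axisPoint ρ b)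
      (insert (axisPoint 0 a) (insert (axisPoint ρ b) W))) :
    ∃ c : ℝ, ∀ᶠ t in 𝓝 ρ, ∑ j, v j * (d.knnModel ν k).death
      ((insert (axisPoint 0 a) (insert (axisPoint ρ b) W)).image
        (move (axisPoint ρ b) (axisPoint t b))) j
      = c - k * ∑ q, v (Sum.inr q) *
        (if d.link q (axisPoint 0 a) (axisPoint t b) then (1 : ℝ) else 0) := by
  set x := axisPoint 0 a with hxdef
  set y := axisPoint ρ b with hydef
  have hxy : x ≠ y := axisPoint_ne hρ.ne a b
  set ψ := insert x (insert y W) with hψ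
  have hxψ : x ∈ ψ := by simp [hψ]
  have hyψ : y ∈ ψ := by simp [hψ]
  have hcard : ψ.card = k + 2 := by
    rw [hψ, Finset.card_insert_of_notMem (by simp [hxy, hx]), Finset.card_insert_of_notMem hy, hW]
  have hψE := hg.eventually_move (k := k) (not_knnAdj_of_closer hW.ge hx hy hxy hd le_rfl)
  -- Removing `x` or `y` removes the critical pair, so nothing jumps.
  have hfar : ∀ z, z = x ∨ z = y → ∀ᶠ t in 𝓝 ρ, d.stat (knnAdj k)
      ((ψ.erase z).image (move y (axisPoint t b))) = d.stat (knnAdj k) (ψ.erase z) := by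
    intro z hz
    have := (tendsto_move b ρ).eventually (d.eventually_stat_eq (A := ψ.erase z) (injOn_id _)
      (by rw [image_id]; exact (hg.mono (Finset.erase_subset _ _)).generic) k
      fun u hu w hw huw => Or.inl ((hg.mono (Finset.erase_subset z ψ)).regular u hu w hw huw ?_))
    · simpa only [Finset.image_id] using this.mono fun t ht => ht.2
    · intro hs
      have hu' := (Finset.mem_erase.1 hu).1
      have hw' := (Finset.mem_erase.1 hw).1
      rcases Sym2.eq_iff.1 hs with ⟨rfl, rfl⟩ | ⟨rfl, rfl⟩
      · exact hz.elim (fun e => hu' e.symm) fun e => hw' e.symm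
      · exact hz.elim (fun e => hw' e.symm) fun e => hu' e.symm
  -- Removing a point of `W` leaves `k + 1` points, all of them adjacent, so the link between `x`
  -- and the moved point is counted. Each of the `k` points contributes this term to the sum of the
  -- deaths.
  have hnear : ∀ w ∈ W, ∀ᶠ t in 𝓝 ρ, ∑ j, v j * d.stat (knnAdj k)
      ((ψ.erase w).image (move y (axisPoint t b))) j
      - ∑ q, v (Sum.inr q) * (if d.link q x (axisPoint t b) then (1 : ℝ) else 0)
      = ∑ j, v j * d.stat (knnAdj k) (ψ.erase w) j
      - ∑ q, v (Sum.inr q) * (if d.link q x y then (1 : ℝ) else 0) := by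
    intro w hw
    have hwx : x ≠ w := fun e => hx (e ▸ hw)
    have hwy : y ≠ w := fun e => hy (e ▸ hw)
    have hwψ : w ∈ ψ := by simp [hψ, hw]
    have hx' : x ∈ ψ.erase w := Finset.mem_erase.2 ⟨hwx, hxψ⟩
    have hadj : knnAdj k (ψ.erase w) x y := Or.inl (isNeighbour_of_card_le hx' (by
      rw [Finset.card_erase_of_mem hwψ, hcard]
      omega))
    have := (tendsto_move b ρ).eventually (d.eventually_stat_sub (A := ψ.erase w) (injOn_id _)
      (by rw [image_id]; exact (hg.mono (Finset.erase_subset _ _)).generic) k (i₀ := x) (j₀ := y)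
      hx' (Finset.mem_erase.2 ⟨hwy, hyψ⟩) hxy (by rw [Finset.image_id]; exact hadj)
      fun u hu w' hw' huw hs => (hg.mono (Finset.erase_subset w ψ)).regular u hu w' hw' huw hs)
    filter_upwards [this] with t ht
    have h1 := ht v
    rwa [Finset.image_id, id, id, move, Function.update_self, Function.update_of_ne hxy, id] at h1
  refine ⟨∑ z ∈ ψ, (∑ j, v j * d.stat (knnAdj k) ψ j - ∑ j, v j * d.stat (knnAdj k) (ψ.erase z) j)
    + k * ∑ q, v (Sum.inr q) * (if d.link q x y then (1 : ℝ) else 0), ?_⟩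
  filter_upwards [hψE, hfar x (Or.inl rfl), hfar y (Or.inr rfl), (Finset.eventually_all W).2 hnear]
    with t h1 h2 h3 h4
  set g := move y (axisPoint t b) with hgdef
  set S := fun p : Plane × 𝕄 =>
    ∑ q, v (Sum.inr q) * (if d.link q x p then (1 : ℝ) else 0) with hS
  have herase : ∀ z ∈ ψ, (ψ.image g).erase (g z) = (ψ.erase z).image g := by
    intro z hz
    ext u
    simp only [Finset.mem_erase, Finset.mem_image]
    constructor
    · rintro ⟨hne, w, hw, rfl⟩
      exact ⟨w, ⟨fun e => hne (by rw [e]), hw⟩, rfl⟩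
    · rintro ⟨w, ⟨hne, hw⟩, rfl⟩
      exact ⟨h1.1.ne hw hz hne, w, hw, rfl⟩
  rw [Model.IsTame.sum_mul_death, Finset.sum_image h1.1, knnModel_stat, h1.2]
  have hsum : ∀ f : Plane × 𝕄 → ℝ, ∑ z ∈ ψ, f z = f x + (f y + ∑ w ∈ W, f w) := fun f => by
    rw [hψ, Finset.sum_insert (by simp [hxy, hx]), Finset.sum_insert hy]
  have e4 : ∀ w ∈ W, ∑ j, v j * d.stat (knnAdj k) ψ j
      - ∑ j, v j * d.stat (knnAdj k) ((ψ.image g).erase (g w)) j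
      = (∑ j, v j * d.stat (knnAdj k) ψ j - ∑ j, v j * d.stat (knnAdj k) (ψ.erase w) j)
        + (S y - S (axisPoint t b)) := fun w hw => by
    have := h4 w hw
    rw [herase w (by simp [hψ, hw])]
    simp only [hS]
    linarith
  rw [hsum, hsum, herase x hxψ, herase y hyψ, h2, h3, Finset.sum_congr rfl e4,
    Finset.sum_add_distrib, Finset.sum_const, hW, nsmul_eq_mul]
  ring

variable {d}

/-- The band components of a direction without innovations vanish. -/
lemma knnModel_inr_eq_zero (hk : 1 ≤ k) {Θ : Set (𝕄 ⊕ Q → ℝ)} {D : ℝ}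
    (hX : (d.knnModel ν k).IsTame d.crit Θ D) {θ : 𝕄 ⊕ Q → ℝ} (hθ : θ ∈ Θ) {v : 𝕄 ⊕ Q → ℝ}
    (hv : ∀ φ : Finset (Plane × 𝕄), IsGeneric d.crit (φ : Set (Plane × 𝕄)) →
      (φ : Set (Plane × 𝕄)) ∈ (d.knnModel ν k).hardCore →
        ∑ j, v j * (d.knnModel ν k).innov θ φ j = 0) (q : Q) : v (Sum.inr q) = 0 := by
  by_contra hq0
  obtain ⟨q, hq, hmax⟩ := Finset.exists_max_image
    (Finset.univ.filter fun q => v (Sum.inr q) ≠ 0) d.hi ⟨q, by simpa using hq0⟩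
  have hq : v (Sum.inr q) ≠ 0 := (Finset.mem_filter.1 hq).2
  have hmax : ∀ q', v (Sum.inr q') ≠ 0 → d.hi q' ≤ d.hi q := fun q' h =>
    hmax q' (Finset.mem_filter.2 ⟨Finset.mem_univ _, h⟩)
  obtain ⟨⟨a, b⟩, hab⟩ := Quot.exists_rep (d.typ q)
  have hab : s(a, b) = d.typ q := hab
  set ρ := d.hi q with hρ
  have hρ0 : 0 < ρ := d.hi_pos q
  have hdist : ∀ r, 0 < r → dist (axisPoint 0 a).1 (axisPoint r b).1 = r := fun r hr => by
    rw [dist_axisPoint, zero_sub, abs_neg, abs_of_pos hr]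
  -- The `k` auxiliary points hide the pair: neither the statistics nor the births notice that its
  -- distance crosses `ρ`, but the deaths do.
  obtain ⟨W, hW, hxW, hyW, hd, hg⟩ := exists_isGenericExcept (d := d) ν (x := axisPoint 0 a)
    (y := axisPoint ρ b) (fun e => hρ0.ne (by rw [← hdist ρ hρ0, e, dist_self])) k
  set ψ := insert (axisPoint 0 a) (insert (axisPoint ρ b) W) with hψ
  have hxy : axisPoint 0 a ≠ axisPoint ρ b := axisPoint_ne hρ0.ne a b
  obtain ⟨c, hc⟩ := d.knnModel_eventually_sum_death (ν := ν) v hρ0 hW hxW hyW hd hg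
  obtain ⟨δ, hδ, hball⟩ := Metric.eventually_nhds_iff.1
    ((hc.and (hg.eventually_isGeneric hρ0)).and (lt_mem_nhds (d.lo_lt_hi q)))
  have hbd : ∀ j, ∃ C : ℝ, ∀ φ : Finset (Plane × 𝕄), φ.card ≤ ψ.card → ∀ z,
      |(d.knnModel ν k).birth θ φ z j| ≤ C := fun j => by
    obtain ⟨C, -, hC⟩ := hX.exists_birth_le j ψ.card
    exact ⟨C, fun φ hφ z => hC θ hθ φ z hφ⟩
  choose C hC using hbd
  have hbd : ∀ φ : Finset (Plane × 𝕄), φ.card ≤ ψ.card → ∀ z,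
      |∑ j, v j * (d.knnModel ν k).birth θ φ z j| ≤ ∑ j, |v j| * C j := by
    intro φ hφ z
    refine (Finset.abs_sum_le_sum_abs _ _).trans (Finset.sum_le_sum fun j _ => ?_)
    rw [abs_mul]
    exact mul_le_mul_of_nonneg_left (hC j φ hφ z) (abs_nonneg _)
  have key : ∀ σ : ℝ, |σ| = 1 → ∀ T : ℝ, (∀ r, d.lo q < r → 0 < σ * (r - ρ) →
      ∑ q', v (Sum.inr q') * (if d.link q' (axisPoint 0 a) (axisPoint r b) then (1 : ℝ) else 0) = T) →
      c - k * T = ∫ z, (∑ j, v j * (d.knnModel ν k).birth θ ψ z j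
          - ∑ j, v j * (d.knnModel ν k).birth θ ∅ z j) ∂(d.knnModel ν k).mu := by
    intro σ hσ T hT
    let r : ℕ → ℝ := fun n => ρ + σ * (δ / (n + 2))
    have hr1 : ∀ n, dist (r n) ρ < δ := fun n => by
      simp only [r, Real.dist_eq, add_sub_cancel_left, abs_mul, hσ, one_mul]
      rw [abs_of_pos (by positivity)]
      exact div_lt_self hδ (by linarith [Nat.cast_nonneg (α := ℝ) n])
    have hr2 : ∀ n, 0 < σ * (r n - ρ) := fun n => by
      simp only [r, add_sub_cancel_left, ← mul_assoc]
      rw [← abs_mul_abs_self σ, hσ]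
      positivity
    have hr3 : ∀ n, r n ≠ ρ := fun n h => by
      have := hr2 n
      rw [h] at this
      simp at this
    have hr5 : Tendsto r atTop (𝓝 ρ) := by
      have h1 : Tendsto (fun n : ℕ => δ / ((n : ℝ) + 2)) atTop (𝓝 0) :=
        (tendsto_const_div_atTop_nhds_zero_nat δ |>.comp (tendsto_add_atTop_nat 2)).congr
          fun n => by simp
      simpa using (h1.const_mul σ).const_add ρ
    have hlim := hX.tendsto_sum_death hθ hv
      (φ := fun n => ψ.image (move (axisPoint ρ b) (axisPoint (r n) b)))
      (fun n => (hball (hr1 n)).1.2 (hr3 n)) (fun n => mem_univ _) (r := ρ + δ)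
      (fun n w hw => ?_)
      (fun n z => (abs_sub _ _).trans (add_le_add (hbd _ Finset.card_image_le z)
        (hbd ∅ (by simp) z)))
      (G := fun z => ∑ j, v j * (d.knnModel ν k).birth θ ψ z j) ?_
    · refine tendsto_nhds_unique (tendsto_const_nhds.congr fun n => ?_) hlim
      rw [(hball (hr1 n)).1.1, hT _ (hball (hr1 n)).2 (hr2 n)]
    · obtain ⟨u, hu, rfl⟩ := Finset.mem_image.1 hw
      by_cases huy : u = axisPoint ρ b
      · rw [huy, move, Function.update_self, norm_axisPoint]
        have h1 := (d.lo_nonneg q).trans_lt (hball (hr1 n)).2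
        have h2 := (abs_lt.1 (hr1 n)).2
        rw [abs_of_pos h1]
        linarith
      · rw [move, Function.update_of_ne huy, id]
        have h0 : (axisPoint 0 a).1 = 0 := norm_eq_zero.1 (by rw [norm_axisPoint, abs_zero])
        rcases Finset.mem_insert.1 hu with rfl | hu
        · rw [h0, norm_zero]
          positivity
        · have h1 := (hd u ((Finset.mem_insert.1 hu).resolve_left huy)).1
          rw [hdist ρ hρ0, h0, dist_zero_left] at h1
          linarith
    · filter_upwards [hg.ae_insert ν] with z hz
      have hzy : z ≠ axisPoint ρ b := fun e => hz.1 (by simp [hψ, e])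
      have e1 := hg.eventually_move (k := k) (not_knnAdj_of_closer hW.ge hxW hyW hxy hd le_rfl)
      have e2 := hz.2.eventually_move (k := k) (not_knnAdj_of_closer hW.ge hxW hyW hxy hd
        (Finset.subset_insert z ψ))
      refine tendsto_const_nhds.congr' ?_
      filter_upwards [hr5.eventually e1, hr5.eventually e2] with n h1 h2
      have h3 := h2.2
      rw [Finset.image_insert, move, Function.update_of_ne hzy] at h3
      exact Finset.sum_congr rfl fun j _ => by
        rw [knnModel_birth_congr (ν := ν) (θ := θ) h1.2.symm h3.symm]
  have k1 := key (-1) (by simp) (v (Sum.inr q)) fun r hr hσ => by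
    simp only [d.link_iff_of_mem_Ioo (q := q) (z := axisPoint 0 a) (w := axisPoint r b) hab
      (by rw [hdist r ((d.lo_nonneg q).trans_lt hr)]; constructor <;> linarith)]
    simp
  have k2 := key 1 (by simp) 0 fun r hr hσ => Finset.sum_eq_zero fun q' _ => by
    by_cases h0 : v (Sum.inr q') = 0
    · rw [h0, zero_mul]
    · rw [if_neg, mul_zero]
      rintro ⟨-, h2⟩
      rw [hdist r ((d.lo_nonneg q).trans_lt hr)] at h2
      linarith [hmax q' h0, h2.2]
  -- The one-sided limits of the deaths differ by `k * v q`; here the number of neighbours must be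
  -- positive.
  have h1 : (k : ℝ) * v (Sum.inr q) = 0 := by linarith
  have h2 : (k : ℝ) ≠ 0 := Nat.cast_ne_zero.2 (by omega)
  exact hq ((mul_eq_zero.1 h1).resolve_left h2)

variable (d ν)

/-- After the band coefficients, the point counts are settled by `inl_nonpos` for `v` and `-v`,
since without hard core any number of points fits in a disc. -/
theorem knnModel_satisfiesAssumptions (hk : 1 ≤ k) :
    (d.knnModel ν k).SatisfiesAssumptions univ := by
  refine Model.satisfiesAssumptions_of (c := d.crit) (d.knnModel_translationInvariant ν)
    fun Θ hΘ _ => ?_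
  obtain ⟨D, hD, hhi, -⟩ := d.exists_range
  have hX := d.knnModel_isTame k ν hΘ hD hhi
  refine ⟨3 * D, hX, fun v hv => ?_, fun θ hθ v hv => ?_⟩
  · have h0 : ∀ m, v (Sum.inl m) = 0 := by
      intro m
      have := hv ∅ (0, m) (Finset.notMem_empty _) (by simpa using isGeneric_singleton _ _)
        (mem_univ _)
      have hpow : (∅ : Finset (Plane × 𝕄)).powersetCard 2 = ∅ :=
        Finset.powersetCard_eq_empty.2 (by simp)
      rw [Fintype.sum_sum_type] at this
      simpa [hpow, knnModel_incr_inl d ν k (Finset.notMem_empty _),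
        knnModel_incr_inr d ν k (Finset.notMem_empty _)] using this
    funext j
    rcases j with m | q
    · exact h0 m
    · obtain ⟨⟨a, b⟩, hab⟩ := Quot.exists_rep (d.typ q)
      have hab : s(a, b) = d.typ q := hab
      obtain ⟨r, hr, hreg⟩ := d.exists_regular q
      have hr0 : 0 < r := (d.lo_nonneg q).trans_lt hr.1
      have hne := axisPoint_ne hr0.ne a b
      have hz : axisPoint 0 a ∉ ({axisPoint r b} : Finset (Plane × 𝕄)) := by simpa using hne
      have h1 := hv {axisPoint r b} (axisPoint 0 a) hz (by
        simpa [axisPair] using d.isGeneric_axisPair (a := a) (b := b) hr0 hreg) (mem_univ _)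
      have hd : dist (axisPoint 0 a).1 (axisPoint r b).1 ∈ Ioo (d.lo q) (d.hi q) := by
        rwa [dist_axisPoint, zero_sub, abs_neg, abs_of_pos hr0]
      have hadj : knnAdj k (insert (axisPoint 0 a) {axisPoint r b}) (axisPoint 0 a)
          (axisPoint r b) := Or.inl (isNeighbour_of_card_le (Finset.mem_insert_self _ _)
            (Finset.card_le_two.trans (by omega)))
      have hpow : (({axisPoint r b} : Finset (Plane × 𝕄)).powersetCard 2) = ∅ :=
        Finset.powersetCard_eq_empty.2 (by simp)
      rw [Fintype.sum_sum_type] at h1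
      simp only [knnModel_incr_inr d ν k hz, h0, Finset.sum_singleton, hpow, Finset.sum_empty,
        sub_zero, hadj, and_true, d.link_iff_of_mem_Ioo (q := q) (z := axisPoint 0 a)
        (w := axisPoint r b) hab hd] at h1
      simpa using h1
  · have hneg : ∀ φ : Finset (Plane × 𝕄), IsGeneric d.crit (φ : Set (Plane × 𝕄)) →
        (φ : Set (Plane × 𝕄)) ∈ (d.knnModel ν k).hardCore →
          ∑ j, (-v) j * (d.knnModel ν k).innov θ φ j = 0 := fun φ h1 h2 => by
      simp only [Pi.neg_apply, neg_mul, Finset.sum_neg_distrib, hv φ h1 h2, neg_zero]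
    have hq := knnModel_inr_eq_zero hk hX hθ hv
    have hq' : ∀ q, (-v) (Sum.inr q) = 0 := fun q => by simp [hq]
    funext j
    rcases j with m | q
    · exact le_antisymm (Model.inl_nonpos (X := d.knnModel ν k) (fun _ _ => rfl) hq hX hθ hv
        fun _ _ => mem_univ _) (neg_nonpos.1 (Model.inl_nonpos (X := d.knnModel ν k)
          (fun _ _ => rfl) hq' hX hθ hneg fun _ _ => mem_univ _))
    · exact hq q

end BandData

theorem knnMultiStrauss_satisfiesAssumptions {M : ℕ} (hM : 1 ≤ M) {k : ℕ} (hk : 1 ≤ k)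
    (b : Bands M) : (knnMultiStrauss k b).SatisfiesAssumptions univ := by
  have : Nonempty (Fin M) := ⟨⟨0, hM⟩⟩
  have := ProbabilityTheory.isProbabilityMeasure_uniformOn (s := (univ : Set (Fin M)))
    Set.finite_univ univ_nonempty
  have := isOpenPosMeasure_uniformOn (α := Fin M)
  rw [knnMultiStrauss_eq]
  exact b.toBandData.knnModel_satisfiesAssumptions _ hk

end MarkedGibbs

end

open MarkedGibbs in
theorem mainTheorem3 :
    (∀ R : ℝ, 0 < R → (overlapArea R).SatisfiesAssumptions {θ | 0 ≤ θ 1}) ∧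
    (∀ M : ℕ, 1 ≤ M → ∀ b : Bands M,
      (multiStrauss b).SatisfiesAssumptions (multiStraussParams b)) ∧
    (∀ M : ℕ, 1 ≤ M → ∀ k : ℕ, 1 ≤ k → ∀ b : Bands M,
      (knnMultiStrauss k b).SatisfiesAssumptions Set.univ) ∧
    (∀ Mmax : ℝ, 0 < Mmax → (straussDisc Mmax).SatisfiesAssumptions {θ | 0 ≤ θ 1}) ∧
    (∀ R : ℝ, 0 < R → (geyerTriplet R).SatisfiesAssumptions {θ | 0 < θ 2}) ∧
    (∀ R : ℝ, 0 < R → (areaInteraction R).SatisfiesAssumptions Set.univ) := by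
  exact ⟨fun R hR => overlapArea_satisfiesAssumptions hR,
    fun M hM b => multiStrauss_satisfiesAssumptions hM b,
    fun M hM k hk b => knnMultiStrauss_satisfiesAssumptions hM hk b,
    fun M hM => straussDisc_satisfiesAssumptions hM,
    fun R hR => geyerTriplet_satisfiesAssumptions hR,
    fun R hR => areaInteraction_satisfiesAssumptions hR⟩
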